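/- \textbf{Setting.} Let $m>0$ and let $S$ be the two-particle S-matrix of a factorizing model in $1+1$ dimensions with one selfconjugate particle of mass $m$ and without bound states: $S$ is analytic and bounded on a neighbourhood $-\delta<\operatorname{Im}\zeta<\pi+\delta$ of the closed physical strip, $|S(\theta)|=1$ and $S(-\theta)=\overline{S(\theta)}$ for $\theta\in\mathbb R$, and $S(i\pi-\zeta)=S(\zeta)$ for $0\le\operatorname{Im}\zeta\le\pi$. Let $Z(\theta),Z^*(\theta)$ be the Zamolodchikov--Faddeev operators on the $S$-symmetric Fock space (wave functions with $\psi(\dots,\theta_i,\theta_{i+1},\dots)=S(\theta_{i+1}-\theta_i)\,\psi(\dots,\theta_{i+1},\theta_i,\dots)$), normalized with respect to the measure $d\theta/2\pi$: $$Z(\theta)Z(\theta')=S(\theta-\theta')Z(\theta')Z(\theta),\qquad Z(\theta)Z^*(\theta')=S(\theta-\theta')^{-1}Z^*(\theta')Z(\theta)+2\pi\,\delta(\theta-\theta').$$ Put $Z(\theta-i\pi)=Z^*(\theta)$ and let $C$ consist of the lines $\mathbb R$ and $\mathbb R-i\pi$. \textbf{Fields.} For functions $a_n(\zeta_1,\dots,\zeta_n)$,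 $n\ge0$, consider the series $$A(x)=\sum_n A_n(x),\qquad A_n(x)=\frac1{n!}\int_C\frac{d\theta_1}{2\pi}\cdots\int_C\frac{d\theta_n}{2\pi}\;e^{-iP(\theta_1,\dots,\theta_n)x}\,a_n(\theta_n,\dots,\theta_1)\,{:}Z(\theta_1)\cdots Z(\theta_n){:},$$ where $P=\sum_i p(\theta_i)$, $p(\theta)=m(\cosh\theta,\sinh\theta)$, and the values of $a_n$ on $C$ are boundary values from inside the strip $-\pi<\operatorname{Im}\theta<0$ (points of $\mathbb R$ are approached as $\theta-i0$, points of $\mathbb R-i\pi$ as $\theta-i\pi+i0$). For test functions $f,g\in C_c^\infty(\mathbb R^2)$ write $A_j(f)=\int f(x)A_j(x)\,d^2x$. All operators and products are understood through matrix elements between vectors of the domain $\mathcal D$ of finite particle vectors whose wave functions are $S$-symmetric, analytic in some strip $|\operatorname{Im}\theta_i|<\kappa$, and decrease there faster than $\exp(-c\sum_i\cosh\operatorname{Re}\theta_i)$ for every $c$. \textbf{Conditions on the coefficients.} For each $n$ there is $\delta_n>0$ such that on the $\delta_n$-neighbourhood $T_n=\{\zeta:\,-\delta_n<\operatorname{Im}(\zeta_i-\zeta_j)<\pi+\delta_n\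 \ (i<j)\}$ of the closed tube $\operatorname{Im}\zeta_1\ge\dots\ge\operatorname{Im}\zeta_n\ge\operatorname{Im}\zeta_1-\pi$ the function $a_n\prod_{i<j}\cosh\frac{\zeta_i-\zeta_j}{2}$ is analytic (so $a_n$ has at most simple poles, at differences $i\pi$) and bounded by $C_n\exp(r_n\sum_i|\operatorname{Re}\zeta_i|)$; and, wherever both sides are evaluated at points of $T_n$ off the poles, $$a_n(\dots,\zeta_i,\zeta_{i+1},\dots)=S(\zeta_i-\zeta_{i+1})\,a_n(\dots,\zeta_{i+1},\zeta_i,\dots),\qquad a_n(\zeta_1,\dots,\zeta_n)=a_n(\zeta_2,\dots,\zeta_n,\zeta_1-2\pi i).$$ Moreover, for all real $\vartheta$ and $\theta_1,\dots,\theta_n\neq\vartheta$, as $\varepsilon\to0$, $$a_{n+2}(\vartheta+i\pi+i\varepsilon,\vartheta,\theta_1,\dots,\theta_n)\simeq\frac1\varepsilon\Bigl[1-\prod_{i=1}^nS(\vartheta-\theta_i)\Bigr]a_n(\theta_1,\dots,\theta_n),$$ that is, $\varepsilon$ times the left side tends to $[1-\prod_iS(\vartheta-\theta_i)]\,a_n(\theta_1,\dots,\theta_n)$.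 \textbf{Theorem.} Let $A$ and $B$ be two such series whose coefficients $(a_n)$ and $(b_n)$ both satisfy these conditions. Then $A$ and $B$ are local, and local relative to each other, in the following sense. (1) For all $f,g\in C_c^\infty(\mathbb R^2)$, $\Phi,\Psi\in\mathcal D$ and $j,k\ge0$ the matrix elements $\langle\Phi,A_j(f)B_k(g)\Psi\rangle$ and $\langle\Phi,B_k(g)A_j(f)\Psi\rangle$ exist. (2) As formal series $A$ and $B$ commute at spacelike separation: if every point of $\operatorname{supp}f$ lies in the right wedge of every point of $\operatorname{supp}g$ (that is, $|x^0-y^0|<x^1-y^1$), then $\sum_j\langle\Phi,A_j(f)B_k(g)\Psi\rangle=\sum_j\langle\Phi,B_k(g)A_j(f)\Psi\rangle$ for every $k$; if every point of $\operatorname{supp}g$ lies in the right wedge of every point of $\operatorname{supp}f$, then $\sum_k\langle\Phi,A_j(f)B_k(g)\Psi\rangle=\sum_k\langle\Phi,B_k(g)A_j(f)\Psi\rangle$ for every $j$. Only finitely many terms of these sums are nonzero. (3) If for all $f,g\in C_c^\infty(\mathbb R^2)$ with spacelike separated supports and all $\Phi,\Psi\in\mathcal D$ the double series $\sum_{j,k}\langle\Phi,A_j(f)B_k(g)\Psi\rangle$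 and $\sum_{j,k}\langle\Phi,B_k(g)A_j(f)\Psi\rangle$ converge absolutely, then their sums agree for all such $f,g,\Phi,\Psi$: $A(x)B(y)=B(y)A(x)$ for $(x-y)^2<0$. -/

import Mathlib

noncomputable section

namespace ZF

open Filter Topology

/-! ### The two-particle S-matrix -/

/-- The S-matrix of a factorizing model with one selfconjugate particle and without bound states:
analytic and bounded on a neighbourhood of the closed physical strip `0 ≤ Im ζ ≤ π`, unitary and
hermitian analytic (hence `S (-θ) = (S θ)⁻¹` for real `θ`), and crossing symmetric. -/
structure IsScatteringFunction (S : ℂ → ℂ) : Prop where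
  regular : ∃ δ > 0, DifferentiableOn ℂ S {ζ | -δ < ζ.im ∧ ζ.im < Real.pi + δ} ∧
    ∃ C : ℝ, ∀ ζ : ℂ, -δ < ζ.im → ζ.im < Real.pi + δ → ‖S ζ‖ ≤ C
  unitary : ∀ θ : ℝ, ‖S θ‖ = 1
  hermitian : ∀ θ : ℝ, S (-θ) = (starRingEnd ℂ) (S θ)
  crossing : ∀ ζ : ℂ, 0 ≤ ζ.im → ζ.im ≤ Real.pi → S (Real.pi * Complex.I - ζ) = S ζ

/-! ### Fock space and the operators `Z`, `Z*`

A vector is the sequence of its `n`-particle wave functions in the rapidities. Rapidities are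
integrated with the measure `dθ / 2π`, and `Z` is normalized accordingly:
`Z(η) Z*(θ) = S(η-θ)⁻¹ Z*(θ) Z(η) + 2π δ(η-θ)`. Wave functions obey
`ψ(…, θ_i, θ_{i+1}, …) = S(θ_{i+1} - θ_i) ψ(…, θ_{i+1}, θ_i, …)`. -/

/-- Sequences of wave functions. -/
abbrev FockFn : Type := (n : ℕ) → (Fin n → ℝ) → ℂ

/-- The annihilation operator `Z(η)`. -/
def annihilate (η : ℝ) (ψ : FockFn) : FockFn :=
  fun n ν => (Real.sqrt (n + 1) : ℂ) * ψ (n + 1) (Fin.cons η ν)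

/-- `∫ dθ/2π Z*(θ) χ(θ)` for a family of vectors `χ(θ)`. The operator `Z*(θ)` adds a particle of
rapidity `θ` in front, followed by `S`-symmetrization. -/
def create (S : ℂ → ℂ) (χ : ℝ → FockFn) : FockFn
  | 0, _ => 0
  | n + 1, t => (Real.sqrt (n + 1) : ℂ)⁻¹ *
      ∑ k : Fin (n + 1), (∏ j ∈ Finset.univ.filter (· < k), S (t k - t j)) *
        χ (t k) n (fun i => t (k.succAbove i))

/-- `∫ dθ_1/2π ⋯ dθ_r/2π Z*(θ_1) ⋯ Z*(θ_r) χ(θ_1, …, θ_r)`. -/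
def createMany (S : ℂ → ℂ) : (r : ℕ) → ((Fin r → ℝ) → FockFn) → FockFn
  | 0, χ => χ Fin.elim0
  | r + 1, χ => create S fun θ => createMany S r fun t => χ (Fin.cons θ t)

/-- `Z(η_1) ⋯ Z(η_l) ψ`. -/
def annihilateMany : (l : ℕ) → (Fin l → ℝ) → FockFn → FockFn
  | 0, _, ψ => ψ
  | l + 1, η, ψ => annihilate (η 0) (annihilateMany l (Fin.tail η) ψ)

/-- `∫ (dθ/2π)^r (dη/2π)^l K(θ, η) Z*(θ_1) ⋯ Z*(θ_r) Z(η_1) ⋯ Z(η_l)` applied to `ψ`. -/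
def wickMonomial (S : ℂ → ℂ) (r l : ℕ) (K : (Fin r → ℝ) → (Fin l → ℝ) → ℂ) (ψ : FockFn) : FockFn :=
  createMany S r fun θ n ν =>
    (((2 * Real.pi) ^ l : ℝ) : ℂ)⁻¹ * ∫ η : Fin l → ℝ, K θ η * annihilateMany l η ψ n ν

/-- The scalar product, linear in the second argument. -/
def pairing (Φ χ : FockFn) : ℂ :=
  ∑' n : ℕ, (((2 * Real.pi) ^ n : ℝ) : ℂ)⁻¹ * ∫ t : Fin n → ℝ, (starRingEnd ℂ) (Φ n t) * χ n t

/-- The domain: finite particle vectors with `S`-symmetric wave functions that are analytic in some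
strip around the real rapidities and decrease there faster than every `exp (-c ∑ cosh θ_i)`. -/
structure IsTestVector (S : ℂ → ℂ) (ψ : FockFn) : Prop where
  finite : ∃ N : ℕ, ∀ n, N < n → ψ n = 0
  symm : ∀ (n : ℕ) (i j : Fin n), (j : ℕ) = i + 1 → ∀ t : Fin n → ℝ,
    ψ n t = S (t j - t i) * ψ n (t ∘ Equiv.swap i j)
  analytic : ∀ n : ℕ, ∃ κ > 0, ∃ F : (Fin n → ℂ) → ℂ,
    DifferentiableOn ℂ F {ζ | ∀ i, |(ζ i).im| < κ} ∧
    (∀ t : Fin n → ℝ, F (fun i => (t i : ℂ)) = ψ n t) ∧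
    ∀ c : ℝ, ∃ C : ℝ, ∀ ζ : Fin n → ℂ, (∀ i, |(ζ i).im| < κ) →
      ‖F ζ‖ ≤ C * Real.exp (-c * ∑ i, Real.cosh (ζ i).re)

/-! ### Coefficient functions -/

/-- Sequences of coefficient functions `a_n(ζ_1, …, ζ_n)`. -/
abbrev Coefficients : Type := (n : ℕ) → (Fin n → ℂ) → ℂ

/-- The `δ`-neighbourhood of the closed tube
`Im ζ_1 ≥ Im ζ_2 ≥ ⋯ ≥ Im ζ_n ≥ Im ζ_1 - π`. -/
def tube (n : ℕ) (δ : ℝ) : Set (Fin n → ℂ) :=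
  {ζ | ∀ i j, i < j → -δ < (ζ i - ζ j).im ∧ (ζ i - ζ j).im < Real.pi + δ}

/-- The product of the factors `cosh ((ζ_i - ζ_j)/2)`, `i < j`, each with a simple zero at
`ζ_i - ζ_j = iπ`. -/
def poleFactor (n : ℕ) (ζ : Fin n → ℂ) : ℂ :=
  ∏ i, ∏ j ∈ Finset.univ.filter (i < ·), Complex.cosh ((ζ i - ζ j) / 2)

/-- The points of the tube off the kinematic poles. -/
def regularTube (n : ℕ) (δ : ℝ) : Set (Fin n → ℂ) :=
  {ζ | ζ ∈ tube n δ ∧ poleFactor n ζ ≠ 0}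

/-- `a_n` is meromorphic on a neighbourhood of the closed tube, its only singularities there are at
most simple poles at rapidity differences `iπ` on the boundary, and apart from these it is bounded
by a power of the `exp |Re ζ_i|`. -/
def MeromorphicInTube (a : Coefficients) (δ : ℕ → ℝ) : Prop :=
  ∀ n : ℕ, ∃ G : (Fin n → ℂ) → ℂ, DifferentiableOn ℂ G (tube n (δ n)) ∧
    (∀ ζ ∈ regularTube n (δ n), a n ζ = G ζ / poleFactor n ζ) ∧
    ∃ C r : ℝ, ∀ ζ ∈ tube n (δ n), ‖G ζ‖ ≤ C * Real.exp (r * ∑ i, |(ζ i).re|)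

/-- The exchange relation
`a_n(…, ζ_i, ζ_{i+1}, …) = S(ζ_i - ζ_{i+1}) a_n(…, ζ_{i+1}, ζ_i, …)`. -/
def ExchangeRelation (S : ℂ → ℂ) (a : Coefficients) (δ : ℕ → ℝ) : Prop :=
  ∀ (n : ℕ) (i j : Fin n), (j : ℕ) = i + 1 → ∀ ζ ∈ regularTube n (δ n),
    ζ ∘ Equiv.swap i j ∈ regularTube n (δ n) →
      a n ζ = S (ζ i - ζ j) * a n (ζ ∘ Equiv.swap i j)

/-- `(ζ_1, …, ζ_n) ↦ (ζ_2, …, ζ_n, ζ_1 - 2πi)`. -/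
def cycle {n : ℕ} (ζ : Fin (n + 1) → ℂ) : Fin (n + 1) → ℂ :=
  Fin.snoc (α := fun _ => ℂ) (Fin.tail ζ) (ζ 0 - 2 * Real.pi * Complex.I)

/-- The cyclicity relation `a_n(ζ_1, …, ζ_n) = a_n(ζ_2, …, ζ_n, ζ_1 - 2πi)`. -/
def CyclicityRelation (a : Coefficients) (δ : ℕ → ℝ) : Prop :=
  ∀ (n : ℕ), ∀ ζ ∈ regularTube (n + 1) (δ (n + 1)), cycle ζ ∈ regularTube (n + 1) (δ (n + 1)) →
    a (n + 1) ζ = a (n + 1) (cycle ζ)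

/-- The kinematic pole relation
`a_{n+2}(ϑ + iπ + iε, ϑ, θ_1, …, θ_n) ≃ ε⁻¹ [1 - ∏ S(ϑ - θ_i)] a_n(θ_1, …, θ_n)`, `ε → 0`. -/
def KinematicPoleRelation (S : ℂ → ℂ) (a : Coefficients) : Prop :=
  ∀ (n : ℕ) (ϑ : ℝ) (θ : Fin n → ℝ), (∀ i, θ i ≠ ϑ) →
    Tendsto
      (fun ε : ℂ => ε * a (n + 2) (Fin.cons (ϑ + Real.pi * Complex.I + Complex.I * ε)
        (Fin.cons (ϑ : ℂ) fun i => (θ i : ℂ))))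
      (𝓝[≠] 0)
      (𝓝 ((1 - ∏ i, S (ϑ - θ i)) * a n fun i => (θ i : ℂ)))

/-- The conditions on the coefficients of a field. -/
def IsLocalCoefficients (S : ℂ → ℂ) (a : Coefficients) : Prop :=
  ∃ δ : ℕ → ℝ, (∀ n, 0 < δ n) ∧ MeromorphicInTube a δ ∧ ExchangeRelation S a δ ∧
    CyclicityRelation a δ ∧ KinematicPoleRelation S a

/-! ### The fields

Spacetime points are pairs (time, space) with `p · x = p⁰ x⁰ - p¹ x¹`. -/

/-- Test functions on two-dimensional spacetime. -/
def IsTestFunction (f : ℝ × ℝ → ℂ) : Prop :=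
  ContDiff ℝ (⊤ : ℕ∞) f ∧ HasCompactSupport f

/-- The supports are spacelike separated: `(x - y)² < 0`. -/
def SpacelikeSeparated (f g : ℝ × ℝ → ℂ) : Prop :=
  ∀ x ∈ tsupport f, ∀ y ∈ tsupport g, (x.1 - y.1) ^ 2 - (x.2 - y.2) ^ 2 < 0

/-- Every point of the support of `f` lies in the right wedge of every point of the support of
`g`; for points `x`, `y` spacelike separation means that one is to the right of the other. -/
def RightOf (f g : ℝ × ℝ → ℂ) : Prop :=
  ∀ x ∈ tsupport f, ∀ y ∈ tsupport g, |x.1 - y.1| < x.2 - y.2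

/-- The momentum `μ (cosh θ, sinh θ)` of a particle of mass `μ`. -/
def momentum (μ θ : ℝ) : ℝ × ℝ := (μ * Real.cosh θ, μ * Real.sinh θ)

/-- `∫ d²x f(x) exp (-i P · x)`. -/
def smear (f : ℝ × ℝ → ℂ) (P : ℝ × ℝ) : ℂ :=
  ∫ x : ℝ × ℝ, f x * Complex.exp (-Complex.I * ((P.1 * x.1 - P.2 * x.2 : ℝ) : ℂ))

/-- The points `θ_1 - iπ + iε, …, θ_r - iπ + iε, η_1 - iε, …, η_l - iε`: the first `r` approach the
lower rim of the contour `C = ℝ ∪ (ℝ - iπ)` and the others the upper rim, both from inside the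
strip. -/
def contourPoints (ε : ℝ) {r l : ℕ} (θ : Fin r → ℝ) (η : Fin l → ℝ) : Fin (r + l) → ℂ :=
  Fin.append (fun i => (θ i : ℂ) - Real.pi * Complex.I + ε * Complex.I)
    (fun i => (η i : ℂ) - ε * Complex.I)

/-- The term of order `n` of `A(f) = ∫ d²x f(x) A(x)`,
`(1/n!) ∫_C ∏ dθ_i/2π ∫ d²x f(x) exp (-i P x) a_n(θ_n, …, θ_1) :Z(θ_1) ⋯ Z(θ_n):`,
with the contour `C` replaced by the one at distance `ε` inside the strip. On the lower rim
`Z(θ - iπ) = Z*(θ)` and `p(θ - iπ) = -p(θ)`. By the exchange relations of the `Z` and of `a_n` the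
integrand does not depend on the order of the variables, so that the `n!/(r! l!)` choices of `r`
variables on the lower rim give equal contributions. -/
def fieldTerm (μ : ℝ) (S : ℂ → ℂ) (a : Coefficients) (n : ℕ) (f : ℝ × ℝ → ℂ) (ε : ℝ)
    (ψ : FockFn) : FockFn :=
  ∑ q ∈ Finset.HasAntidiagonal.antidiagonal n, ((q.1.factorial * q.2.factorial : ℕ) : ℂ)⁻¹ •
    wickMonomial S q.1 q.2
      (fun θ η => a (q.1 + q.2) (contourPoints ε θ η ∘ Fin.rev) *
        smear f (∑ i, momentum μ (η i) - ∑ i, momentum μ (θ i))) ψ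

/-- The matrix element `⟨Φ, A_j(f) B_k(g) Ψ⟩` of the product of the term of order `j` of `A` and the
term of order `k` of `B` has the value `z`: both contours tend, independently, to `C`. -/
def HasProductElement (μ : ℝ) (S : ℂ → ℂ) (a b : Coefficients) (f g : ℝ × ℝ → ℂ) (Φ Ψ : FockFn)
    (j k : ℕ) (z : ℂ) : Prop :=
  Tendsto
    (fun ε : ℝ × ℝ => pairing Φ (fieldTerm μ S a j f ε.1 (fieldTerm μ S b k g ε.2 Ψ)))
    (𝓝[>] 0 ×ˢ 𝓝[>] 0) (𝓝 z)

/-- The value of `⟨Φ, A_j(f) B_k(g) Ψ⟩`. -/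
def productElement (μ : ℝ) (S : ℂ → ℂ) (a b : Coefficients) (f g : ℝ × ℝ → ℂ) (Φ Ψ : FockFn)
    (j k : ℕ) : ℂ :=
  limUnder (𝓝[>] 0 ×ˢ 𝓝[>] 0)
    (fun ε : ℝ × ℝ => pairing Φ (fieldTerm μ S a j f ε.1 (fieldTerm μ S b k g ε.2 Ψ)))

end ZF

end

noncomputable section

namespace ZF

open Topology MeasureTheory Complex Finset.HasAntidiagonal
open Filter hiding map_map mem_map
open Set hiding mem_antidiagonal range mem_range
open Function (update update_of_ne update_self comp_def comp_apply update_eq_self update_idem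
  Injective Involutive)
open List (count_cons_of_ne ofFn length_ofFn ofFn_get map_ofFn get_mem ofFn_succ prod_ofFn
  cons_append map_append prod_append map_cons prod_cons map_nil prod_nil pairwise_cons length_cons
  length_eq_zero_iff pairwise_append mem_cons finite_toSet mem_append pairwise_map mem_ofFn finRange
  ofFn_eq_map sum_cons map_congr_left length_append mem_ofFn' prod_map_mul get_eq_getElem sum_ofFn
  length_map map_reverse mem_reverse reverse_perm append_nil nil_append replicate length_replicate
  append_assoc take_append_drop count_pos_iff count_erase_self count_eq_zero count_replicate
  count_erase singleton_append map_eq_nil_iff count_append reverse_nil prod_reverse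
  map_map mem_map)
open Finset (sum_add_distrib sum_ite_eq' prod_filter single_le_sum sum_congr mem_filter mul_sum
  sum_const card_range sum_sigma' sum_filter sum_nbij' mem_sigma mem_product sum_eq_zero sum_mul
  sum_comm range mem_range)
open Real (exp_le_exp cosh_pos cosh_abs cosh_eq abs_sinh pi_pos two_le_pi norm_eq_abs sqrt_eq_zero
  exp_pos)
open Nat (cast_nonneg factorial_succ cast_one)
open scoped ComplexConjugate Real

-- Wick expansion. A creator of `B` is either contracted with an annihilator of `A` or passes
-- through `A` towards `Φ`. Hence a matrix element of `A_j(f) B_k(g)` is a finite sum, over the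
-- numbers of variables in each role, of integrals of a single integrand `Model.W` divided by
-- factorials (`Model.pairing_eq`, `Model.pairing_eq_sum`). A contracted rapidity `z` enters twice:
-- as an annihilation argument `z - i0` of `a` and as a creation argument `z - iπ + i0` of `b`.
--
-- Contours. The wave functions are analytic in strips, so the variables may be moved to fixed
-- heights in units of a small `s`: creators to `2s`, annihilators to `-s`, contracted variables to
-- `s`. The integrands are then regular at `ε = 0` and the limit of the regularization is harmless
-- (`Model.T_shift`, `Model.tendsto_T`). If `f` is supported to the right of `g`, the contracted
-- momentum enters through `exp(-i p(z)(x - y))`, which does not grow for `0 ≤ Im z ≤ π`; this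
-- permits raising the contracted variables. Without such a condition they stay at height `0`, which
-- is enough for existence and for linearity in the test functions.
--
-- Exchange of levels. Raising a contracted variable from `s` to `3s` crosses the creators of `A` at
-- `2s`, and there `a` has its kinematic poles. The residue `[1 - ∏ S] a_n` has two terms. By the
-- exchange relations, unitarity and crossing they are exactly the integrands in which the rapidity
-- has become a creator of `B` standing to the left (`P`) or to the right (`Q`) of the creators of
-- `A` (`Model.residue`, `Model.wint_flip`). An Euler-type counting argument (`euler_exchange`) then
-- identifies the sum over configurations with contractions below (`L`) and creators at the right
-- (`Q`) with the sum over those with contractions above (`H`) and creators at the left (`P`)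
-- (`Model.sum_T_flip`). A residue removes two variables of `A` and none of `B`; this is why the sum
-- runs over `j` at fixed `k`.
--
-- Crossing. In the second form, cyclicity moves the arguments `x - iπ` of the creators of `A` from
-- the end of the list to `x + iπ` at its front. The contracted variables can now rise to `π - 3s`
-- without meeting a pole, and the substitution of `conj z + iπ` for `z` exhibits the result as the
-- complex conjugate of the same expression for the adjoint fields between `Ψ` and `Φ`
-- (`Model.T_eq_conj`). Undoing the exchange of levels for the adjoint fields gives the conjugate of
-- the matrix elements of `A* B*`, that is, those of `B A` (`Model.sum_T_cross`,
-- `Model.pairing_swap`).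
--
-- Preparation. Cyclicity moves one variable at a time and only inside the tube, so rotating several
-- of them needs an analytic continuation, carried out by contour shifts against Gaussians
-- (`AnalyticCyc.rotate_real`). The pole relation is given at real points only and is continued to
-- the tube as an identity between analytic functions (`KinIdentity.extend`).
--
-- For general spacelike separated supports, a partition of unity cuts the test functions into
-- pieces small enough that in every pair one piece lies to the right of the other. Absolute
-- convergence then allows the double series to be summed in whichever order the pair requires.

notation "𝟎" => ((0 : ℝ) : ℂ)

/-! ### Contour shifts -/

/-- Shift of the contour by a complex multiple of a direction `v`, for a family of functions
`g e z` standing for `F (e + z • v)`. -/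
theorem integral_shift {E : Type*} [NormedAddCommGroup E] [NormedSpace ℝ E] [MeasurableSpace E]
    [BorelSpace E] [SecondCountableTopology E] (ν : Measure E) [SFinite ν] [ν.IsAddRightInvariant]
    (v : E) (g : E → ℂ → ℂ) (hg : ∀ e (x : ℝ) z, g e (x + z) = g (e + x • v) z)
    (hd : ∀ e z, 0 ≤ z.im → z.im ≤ 1 → DifferentiableAt ℂ (g e) z)
    (hc : ContinuousOn (fun p : E × ℝ => g p.1 (p.2 * I)) (univ ×ˢ Icc 0 1))
    (w : E → ℝ) (hw : Integrable w ν) (K : ℝ)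
    (hK : ∀ e, ∀ x ∈ Icc (0:ℝ) 1, w (e + x • v) ≤ K * w e)
    (hb : ∀ e, ∀ y ∈ Icc (0:ℝ) 1, ‖g e (y * I)‖ ≤ w e) :
    ∫ e, g e 0 ∂ν = ∫ e, g e I ∂ν := by
  -- Cauchy's theorem on the unit square of the shift parameter. A real shift of the parameter is a
  -- translation of `e`, so after integration over `e` the two vertical sides cancel and the
  -- horizontal ones become independent of `x`.
  have key : ∀ e, (∫ x in (0:ℝ)..1, g e x) - (∫ x in (0:ℝ)..1, g e (x + I)) +
      I * (∫ y in (0:ℝ)..1, g e (1 + y * I)) - I * (∫ y in (0:ℝ)..1, g e (y * I)) = 0 := by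
    intro e; have h := integral_boundary_rect_eq_zero_of_differentiableOn (g e) 0 (1 + I) (by
      intro z hz
      simp only [mem_reProdIm, zero_re, add_re, one_re, I_re, add_zero, zero_im, add_im, one_im,
        I_im, zero_add, uIcc_of_le zero_le_one] at hz
      exact (hd e z hz.2.1 hz.2.2).differentiableWithinAt)
    simpa using h
  set P := ν.prod (volume.restrict (uIoc (0:ℝ) 1)); have hmem : ∀ᵐ p ∂P, p.2 ∈ Icc (0:ℝ) 1 := by
    have h : ∀ᵐ y ∂(volume.restrict (uIoc (0:ℝ) 1)), y ∈ Icc (0:ℝ) 1 := by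
      rw [uIoc_of_le zero_le_one]
      filter_upwards [ae_restrict_mem measurableSet_Ioc] with y hy using ⟨hy.1.le, hy.2⟩
    exact Measure.quasiMeasurePreserving_snd.ae h
  haveI : IsFiniteMeasure (volume.restrict (uIoc (0:ℝ) 1)) := by
    rw [uIoc_of_le zero_le_one]; infer_instance
  have hwI : ∀ k : ℝ, Integrable (fun p : E × ℝ => k * w p.1) P := fun k =>
    ((hw.comp_fst (volume.restrict (uIoc (0:ℝ) 1)))).const_mul k
  have hEm : P = (ν.prod volume).restrict (univ ×ˢ uIoc (0:ℝ) 1) := by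
    rw [← Measure.prod_restrict, Measure.restrict_univ]
  have meas : ∀ φ : E × ℝ → E × ℝ, Continuous φ → (∀ p, p.2 ∈ Icc (0:ℝ) 1 → (φ p).2 ∈ Icc (0:ℝ) 1) →
      AEStronglyMeasurable (fun p => g (φ p).1 ((φ p).2 * I)) P := by
    intro φ hφ hm
    have h1 : ContinuousOn (fun p => g (φ p).1 ((φ p).2 * I)) (univ ×ˢ uIoc (0:ℝ) 1) := by
      refine hc.comp hφ.continuousOn ?_; rintro p ⟨-, hp⟩; rw [uIoc_of_le zero_le_one] at hp
      exact ⟨mem_univ _, hm p ⟨hp.1.le, hp.2⟩⟩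
    rw [hEm]; exact h1.aestronglyMeasurable (MeasurableSet.univ.prod measurableSet_uIoc)
  have int : ∀ φ : E × ℝ → E × ℝ, Continuous φ → (∀ p, p.2 ∈ Icc (0:ℝ) 1 → (φ p).2 ∈ Icc (0:ℝ) 1) →
      (∀ p, p.2 ∈ Icc (0:ℝ) 1 → ∃ x ∈ Icc (0:ℝ) 1, (φ p).1 = p.1 + x • v) →
      Integrable (fun p => g (φ p).1 ((φ p).2 * I)) P := by
    intro φ hφ hm hx; refine (hwI K).mono' (meas φ hφ hm) ?_
    filter_upwards [hmem] with p hp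
    obtain ⟨x, hx1, hx2⟩ := hx p hp; refine (hb _ _ (hm p hp)).trans ?_; rw [hx2]; exact hK _ _ hx1
  have i1 : Integrable (fun p : E × ℝ => g p.1 p.2) P := by
    have := int (fun p => (p.1 + p.2 • v, 0)) (by fun_prop) (by simp) (fun p hp => ⟨p.2, hp, rfl⟩)
    refine this.congr (ae_of_all _ fun p => ?_)
    simpa using (hg p.1 p.2 0).symm
  have i2 : Integrable (fun p : E × ℝ => g p.1 (p.2 + I)) P := by
    have := int (fun p => (p.1 + p.2 • v, 1)) (by fun_prop) (by simp) (fun p hp => ⟨p.2, hp, rfl⟩)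
    refine this.congr (ae_of_all _ fun p => ?_)
    simpa using (hg p.1 p.2 I).symm
  have i3 : Integrable (fun p : E × ℝ => g p.1 (1 + p.2 * I)) P := by
    have := int (fun p => (p.1 + (1:ℝ) • v, p.2)) (by fun_prop) (by simp)
      (fun p hp => ⟨1, by simp, rfl⟩)
    refine this.congr (ae_of_all _ fun p => ?_)
    simpa using (hg p.1 1 (p.2 * I)).symm
  have i4 : Integrable (fun p : E × ℝ => g p.1 (p.2 * I)) P := by
    exact int (fun p => (p.1, p.2)) (by fun_prop) (by simp) (fun p hp => ⟨0, by simp, by simp⟩)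
  have sw : ∀ h : E × ℝ → ℂ, Integrable h P →
      ∫ e, (∫ y in (0:ℝ)..1, h (e, y)) ∂ν = ∫ y in (0:ℝ)..1, ∫ e, h (e, y) ∂ν := by
    intro h hh; rw [intervalIntegral_integral_swap]; exact hh.swap
  have io : ∀ h : E × ℝ → ℂ, Integrable h P →
      Integrable (fun e => ∫ y in (0:ℝ)..1, h (e, y)) ν := by
    intro h hh; have := hh.integral_prod_left; refine this.congr (ae_of_all _ fun e => ?_)
    simp only [intervalIntegral.integral_of_le zero_le_one, uIoc_of_le (zero_le_one (α := ℝ))]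
  have tr : ∀ (x : ℝ) (z : ℂ), ∫ e, g e (x + z) ∂ν = ∫ e, g e z ∂ν := by
    intro x z; simp_rw [hg]; exact integral_add_right_eq_self (fun e => g e z) (x • v)
  have e1 := sw _ i1; have e2 := sw _ i2; have e3 := sw _ i3; have e4 := sw _ i4
  have t1 : ∀ x : ℝ, ∫ e, g e x ∂ν = ∫ e, g e 0 ∂ν := fun x => by simpa using tr x 0
  have t3 : ∀ y : ℝ, ∫ e, g e (1 + y * I) ∂ν = ∫ e, g e (y * I) ∂ν := fun y => by
    simpa using tr 1 (y * I)
  simp only [t1, tr, t3] at e1 e2 e3 e4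
  simp only [intervalIntegral.integral_const, sub_zero, one_smul] at e1 e2
  have tot : ∫ e, ((∫ x in (0:ℝ)..1, g e x) - (∫ x in (0:ℝ)..1, g e (x + I)) +
      I * (∫ y in (0:ℝ)..1, g e (1 + y * I)) - I * (∫ y in (0:ℝ)..1, g e (y * I))) ∂ν = 0 := by
    simp only [key, integral_zero]
  have j1 := io _ i1; have j2 := io _ i2; have j3 := (io _ i3).const_mul I
  have j4 := (io _ i4).const_mul I; have s1 := integral_sub ((j1.sub j2).add j3) j4
  have s2 := integral_add (j1.sub j2) j3; have s3 := integral_sub j1 j2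
  simp only [Pi.add_apply, Pi.sub_apply] at s1 s2 s3
  rw [s1, s2, s3, integral_const_mul, integral_const_mul, e1, e2, e3, e4] at tot
  linear_combination tot

theorem integrable_exp_neg_abs : Integrable (fun x : ℝ => rexp (-|x|)) := by
  have h : ∀ s : Set ℝ, MeasurableSet s → ∀ c : ℝ, (∀ x ∈ s, -|x| = c * x) →
      IntegrableOn (fun x : ℝ => rexp (c * x)) s → IntegrableOn (fun x => rexp (-|x|)) s :=
    fun s hs c hc hi => hi.congr_fun (fun x hx => by simp only [hc x hx]) hs
  rw [← integrableOn_univ, ← Set.Iic_union_Ioi (a := (0:ℝ))]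
  refine IntegrableOn.union (h _ measurableSet_Iic 1 (fun x hx => ?_) ?_)
    (h _ measurableSet_Ioi (-1) (fun x hx => ?_) ?_)
  · rw [abs_of_nonpos hx]; ring
  · simpa using integrableOn_exp_Iic 0
  · rw [abs_of_pos hx]; ring
  · simpa using integrableOn_exp_neg_Ioi 0

/-- The weight `exp (-∑ |t_i|)`. -/
def weight {n : ℕ} (t : Fin n → ℝ) : ℝ := rexp (-∑ i, |t i|)

theorem weight_pos {n : ℕ} (t : Fin n → ℝ) : 0 < weight t := exp_pos _

theorem integrable_weight (n : ℕ) : Integrable (weight : (Fin n → ℝ) → ℝ) := by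
  have : (weight : (Fin n → ℝ) → ℝ) = fun t => ∏ i, rexp (-|t i|) := by
    funext t; rw [weight, ← Finset.sum_neg_distrib, Real.exp_sum]
  rw [this]; exact Integrable.fintype_prod (f := fun _ (x : ℝ) => rexp (-|x|))
    (fun _ => integrable_exp_neg_abs)

theorem weight_add_le {n : ℕ} (t v : Fin n → ℝ) (x : ℝ) (hx : x ∈ Icc (0:ℝ) 1) :
    weight (t + x • v) ≤ rexp (∑ i, |v i|) * weight t := by
  rw [weight, weight, ← Real.exp_add, exp_le_exp, ← sub_eq_add_neg, ← Finset.sum_sub_distrib,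
    ← Finset.sum_neg_distrib]
  refine Finset.sum_le_sum fun i _ => ?_
  have h1 : |t i| ≤ |(t + x • v) i| + |x * v i| := by
    have := abs_sub_abs_le_abs_sub (t i) (-(x * v i))
    simp only [Pi.add_apply, Pi.smul_apply, smul_eq_mul]; rw [abs_neg, sub_neg_eq_add] at this
    linarith
  have h2 : |x * v i| ≤ |v i| := by
    rw [abs_mul, abs_of_nonneg hx.1]; exact mul_le_of_le_one_left (abs_nonneg _) hx.2
  linarith

/-- Shift of the contour of an integral over `ℝ ^ n` from height `u` to height `u + v`. -/
theorem integral_pi_shift {n : ℕ} (F : (Fin n → ℂ) → ℂ) (u v : Fin n → ℝ)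
    (hd : ∀ (t : Fin n → ℝ) (z : ℂ), 0 ≤ z.im → z.im ≤ 1 →
      DifferentiableAt ℂ (fun z : ℂ => F fun i => t i + u i * I + z * v i) z)
    (hc : ContinuousOn (fun p : (Fin n → ℝ) × ℝ => F fun i => p.1 i + (u i + p.2 * v i : ℝ) * I)
      (univ ×ˢ Icc 0 1))
    (C : ℝ) (hb : ∀ (t : Fin n → ℝ), ∀ y ∈ Icc (0:ℝ) 1,
      ‖F fun i => t i + (u i + y * v i : ℝ) * I‖ ≤ C * weight t) :
    ∫ t : Fin n → ℝ, F (fun i => t i + u i * I) =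
      ∫ t : Fin n → ℝ, F (fun i => t i + (u i + v i : ℝ) * I) := by
  have hC : 0 ≤ C := by
    have := (norm_nonneg _).trans (hb 0 0 (by simp))
    exact nonneg_of_mul_nonneg_left this (weight_pos _)
  have h := integral_shift (volume : Measure (Fin n → ℝ)) v
    (fun t z => F fun i => t i + u i * I + z * v i) (fun e x z => by
      congr 1; funext i; simp; ring) hd (by
      convert hc using 3 with p
      funext i; push_cast; ring) (fun t => C * weight t) ((integrable_weight n).const_mul C)
    (rexp (∑ i, |v i|)) (fun t x hx => by
      have := mul_le_mul_of_nonneg_left (weight_add_le t v x hx) hC; linarith) (fun t y hy => by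
      convert hb t y hy using 3; funext i; push_cast; ring)
  convert h using 3 with t t
  · simp
  · congr 1; funext i; push_cast; ring

/-- One variable: shift of the contour between two heights. -/
theorem integral_line_shift (V : ℂ → ℂ) {l1 l2 : ℝ} (hl : l1 ≤ l2)
    (hd : ∀ z : ℂ, l1 ≤ z.im → z.im ≤ l2 → DifferentiableAt ℂ V z) (C K : ℝ)
    (hb : ∀ z : ℂ, l1 ≤ z.im → z.im ≤ l2 → K ≤ |z.re| → ‖V z‖ ≤ C * rexp (-|z.re|)) :
    ∫ x : ℝ, V (x + l1 * I) = ∫ x : ℝ, V (x + l2 * I) := by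
  have hco : ContinuousOn V (univ ×ℂ Icc l1 l2) := fun z hz =>
    (hd z hz.2.1 hz.2.2).continuousAt.continuousWithinAt
  obtain ⟨B, hB⟩ : ∃ B, ∀ z ∈ (Icc (-K) K ×ℂ Icc l1 l2), ‖V z‖ ≤ B :=
    (isCompact_Icc.reProdIm isCompact_Icc).exists_bound_of_continuousOn
      (hco.mono fun z hz => ⟨mem_univ _, hz.2⟩)
  -- Decay is assumed only for `|Re z| ≥ K`. On the remaining compact rectangle the bound `B` takes
  -- the same exponential form at the cost of a factor `exp |K|`.
  set C' := max C (B * rexp |K|) with hC'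
  have hb' : ∀ z : ℂ, l1 ≤ z.im → z.im ≤ l2 → ‖V z‖ ≤ |C'| * rexp (-|z.re|) := by
    intro z h1 h2; have hCC : C' * rexp (-|z.re|) ≤ |C'| * rexp (-|z.re|) :=
      mul_le_mul_of_nonneg_right (le_abs_self _) (exp_pos _).le
    by_cases hz : K ≤ |z.re|
    · exact ((hb z h1 h2 hz).trans
        (mul_le_mul_of_nonneg_right (le_max_left _ _) (exp_pos _).le)).trans hCC
    · push Not at hz
      have h3 := hB z ⟨⟨(abs_lt.1 hz).1.le, (abs_lt.1 hz).2.le⟩, h1, h2⟩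
      have hB0 : 0 ≤ B := (norm_nonneg _).trans h3
      have h4 : B ≤ B * rexp |K| * rexp (-|z.re|) := by
        rw [mul_assoc, ← Real.exp_add]; refine le_mul_of_one_le_right hB0 (Real.one_le_exp ?_)
        have := le_abs_self K; linarith
      exact ((h3.trans h4).trans
        (mul_le_mul_of_nonneg_right (le_max_right _ _) (exp_pos _).le)).trans hCC
  have hr : ∀ y ∈ Icc (0:ℝ) 1, l1 ≤ l1 + y * (l2 - l1) ∧ l1 + y * (l2 - l1) ≤ l2 := by
    intro y hy; constructor <;> nlinarith [hy.1, hy.2]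
  have him : ∀ (t : ℝ) (z : ℂ), (t + l1 * I + z * (l2 - l1 : ℝ)).im = l1 + z.im * (l2 - l1) := by
    intro t z; simp
  have h := integral_shift (volume : Measure ℝ) (l2 - l1)
    (fun t z => V (t + l1 * I + z * (l2 - l1 : ℝ))) (fun e x z => by
      congr 1; simp; ring) (fun t z h1 h2 => by
        have h3 := hr z.im ⟨h1, h2⟩; rw [← him t z] at h3
        exact (hd _ h3.1 h3.2).comp z (by fun_prop)) (by
        refine hco.comp (Continuous.continuousOn (by fun_prop)) ?_; rintro ⟨t, y⟩ ⟨-, hy⟩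
        refine ⟨mem_univ _, ?_⟩; have := hr y hy; simp only [mem_preimage, him]
        simpa using this) (fun t => |C'| * rexp (-|t|)) (integrable_exp_neg_abs.const_mul _)
    (rexp |l2 - l1|) (fun t x hx => by
      have h1 : |t| ≤ |t + x • (l2 - l1)| + |l2 - l1| := by
        have h1 := abs_sub_abs_le_abs_sub t (-(x * (l2 - l1)))
        rw [abs_neg, sub_neg_eq_add, abs_mul, abs_of_nonneg hx.1] at h1
        have h2 : x * |l2 - l1| ≤ |l2 - l1| := mul_le_of_le_one_left (abs_nonneg _) hx.2
        simp only [smul_eq_mul]; linarith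
      have h2 : rexp (-|t + x • (l2 - l1)|) ≤ rexp |l2 - l1| * rexp (-|t|) := by
        rw [← Real.exp_add, exp_le_exp]; linarith
      have := mul_le_mul_of_nonneg_left h2 (abs_nonneg C'); linarith) (fun t y hy => by
        have h3 := hr y hy
        have h4 := hb' (t + l1 * I + (y * I) * (l2 - l1 : ℝ)) (by rw [him]; simpa using h3.1)
          (by rw [him]; simpa using h3.2)
        simpa using h4)
  convert h using 3 with t t
  · simp
  · congr 1; push_cast; ring

/-! ### The residue theorem for a strip. -/

theorem integral_inv_cosh : ∫ x : ℝ, (Real.cosh x)⁻¹ = π := by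
  have hd : ∀ x : ℝ, HasDerivAt (fun x => Real.arctan (Real.sinh x)) ((Real.cosh x)⁻¹) x := by
    intro x; have h := (Real.hasDerivAt_arctan (Real.sinh x)).comp x (Real.hasDerivAt_sinh x)
    have e : (Real.cosh x)⁻¹ = 1 / (1 + Real.sinh x ^ 2) * Real.cosh x := by
      have := Real.cosh_sq x; rw [one_div, add_comm, ← this, sq]; field_simp [(cosh_pos x).ne']
    rw [e]; exact h
  have hi : Integrable (fun x : ℝ => (Real.cosh x)⁻¹) := by
    refine ((integrable_exp_neg_abs).const_mul 2).mono'
      (Continuous.aestronglyMeasurable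
        (Real.continuous_cosh.inv₀ fun x => (cosh_pos x).ne')) (ae_of_all _ fun x => ?_)
    rw [Real.norm_of_nonneg (inv_nonneg.2 (cosh_pos x).le), Real.exp_neg, ← div_eq_mul_inv,
      inv_eq_one_div, div_le_div_iff₀ (cosh_pos x) (exp_pos _), ← cosh_abs,
      cosh_eq]
    have := exp_pos (-|x|); linarith
  have htop : Tendsto (fun x => Real.arctan (Real.sinh x)) atTop (𝓝 (π / 2)) := by
    refine (Real.tendsto_arctan_atTop.mono_right nhdsWithin_le_nhds).comp ?_
    refine tendsto_atTop_mono' _ ?_ tendsto_id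
    filter_upwards [eventually_ge_atTop 0] with x hx using Real.self_le_sinh_iff.2 hx
  have hbot : Tendsto (fun x => Real.arctan (Real.sinh x)) atBot (𝓝 (-(π / 2))) := by
    refine (Real.tendsto_arctan_atBot.mono_right nhdsWithin_le_nhds).comp ?_
    refine tendsto_atBot_mono' _ ?_ tendsto_id
    filter_upwards [eventually_le_atBot 0] with x hx using Real.sinh_le_self_iff.2 hx
  rw [integral_of_hasDerivAt_of_tendsto hd hi hbot htop]; ring

theorem cosh_re (z : ℂ) : (cosh z).re = Real.cosh z.re * Real.cos z.im := by
  conv_lhs => rw [← re_add_im z, cosh_add, sinh_mul_I, cosh_mul_I]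
  simp [← ofReal_sinh, ← ofReal_cosh, ← ofReal_cos, ← ofReal_sin]

theorem cosh_im (z : ℂ) : (cosh z).im = Real.sinh z.re * Real.sin z.im := by
  conv_lhs => rw [← re_add_im z, cosh_add, sinh_mul_I, cosh_mul_I]
  simp [← ofReal_sinh, ← ofReal_cosh, ← ofReal_cos, ← ofReal_sin]

theorem sinh_im (z : ℂ) : (sinh z).im = Real.cosh z.re * Real.sin z.im := by
  conv_lhs => rw [← re_add_im z, sinh_add, sinh_mul_I, cosh_mul_I]
  simp [← ofReal_sinh, ← ofReal_cosh, ← ofReal_cos, ← ofReal_sin]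

theorem sinh_re (z : ℂ) : (sinh z).re = Real.sinh z.re * Real.cos z.im := by
  conv_lhs => rw [← re_add_im z, sinh_add, sinh_mul_I, cosh_mul_I]
  simp [← ofReal_sinh, ← ofReal_cosh, ← ofReal_cos, ← ofReal_sin]

theorem abs_sinh_re_le (z : ℂ) : |Real.sinh z.re| ≤ ‖sinh z‖ := by
  rw [← abs_of_nonneg (norm_nonneg (sinh z)), ← sq_le_sq, ← normSq_eq_norm_sq,
    normSq_apply, sinh_re, sinh_im]
  have h3 := Real.cosh_sq z.re; have h4 := Real.sin_sq_add_cos_sq z.im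
  nlinarith [sq_nonneg (Real.sin z.im), sq_nonneg (Real.sinh z.re)]

theorem sinh_ne_zero_of_im {z : ℂ} (h0 : z ≠ 0) (h1 : |z.im| < π) : sinh z ≠ 0 := by
  intro h; have hre : z.re = 0 := by
    have := abs_sinh_re_le z; rw [h, norm_zero] at this
    exact Real.sinh_eq_zero.1 (abs_eq_zero.1 (le_antisymm this (abs_nonneg _)))
  have hz : z = z.im * I := by
    conv_lhs => rw [← re_add_im z, hre]
    simp
  rw [hz, sinh_mul_I, mul_eq_zero, or_iff_left I_ne_zero, ← ofReal_sin, ofReal_eq_zero] at h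
  have := abs_lt.1 h1; rw [Real.sin_eq_zero_iff_of_lt_of_lt this.1 this.2] at h; rw [h] at hz
  simp at hz; exact h0 hz

theorem norm_inv_sinh_le (z : ℂ) (hz : 1 ≤ |z.re|) :
    ‖(sinh z)⁻¹‖ ≤ 4 * rexp (-|z.re|) := by
  have h1 : rexp |z.re| / 4 ≤ |Real.sinh z.re| := by
    rw [abs_sinh, Real.sinh_eq]; have h2 : rexp (-|z.re|) ≤ 1 := Real.exp_le_one_iff.2 (by linarith)
    have h3 : 2 ≤ rexp |z.re| := by have := Real.add_one_le_exp |z.re|; linarith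
    linarith
  have h4 := h1.trans (abs_sinh_re_le z); rw [norm_inv, Real.exp_neg]
  calc ‖sinh z‖⁻¹ ≤ (rexp |z.re| / 4)⁻¹ := inv_anti₀ (by positivity) h4
    _ = _ := by rw [inv_div]; ring

/-- At height `-π/2` the integrand is `i / cosh x`. The other heights follow by shifting the line,
since `1 / sinh` has no pole strictly between `-π` and `0`. -/
theorem integral_inv_sinh_below {α : ℝ} (h0 : 0 < α) (h1 : α < π) :
    ∫ x : ℝ, (sinh (x - α * I))⁻¹ = π * I := by
  have base : ∫ x : ℝ, (sinh (x - (π / 2 : ℝ) * I))⁻¹ = π * I := by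
    have : ∀ x : ℝ, (sinh (x - (π / 2 : ℝ) * I))⁻¹ = ((Real.cosh x)⁻¹ : ℝ) * I := by
      intro x; rw [sinh_sub, sinh_mul_I, cosh_mul_I, ← ofReal_sin, ← ofReal_cos,
        Real.sin_pi_div_two, Real.cos_pi_div_two]
      push_cast; simp [mul_comm]
    simp_rw [this]; rw [integral_mul_const, ← integral_inv_cosh]; congr 1; exact integral_ofReal
  have key : ∀ l1 l2 : ℝ, l1 ≤ l2 → -π < l1 → l2 < 0 →
      ∫ x : ℝ, (sinh (x + l1 * I))⁻¹ = ∫ x : ℝ, (sinh (x + l2 * I))⁻¹ := by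
    intro l1 l2 h12 ha hb
    refine integral_line_shift (fun z => (sinh z)⁻¹) h12 (fun z hz1 hz2 => ?_) 4 1
      (fun z _ _ hz => norm_inv_sinh_le z hz)
    refine (differentiable_sinh z).inv (sinh_ne_zero_of_im ?_ ?_)
    · rintro rfl; simp at hz2; linarith
    · rw [abs_lt]; constructor <;> linarith [pi_pos]
  have hpi := pi_pos; have e : ∀ (β : ℝ) , (fun x : ℝ => (sinh (x - β * I))⁻¹) =
      fun x : ℝ => (sinh (x + (-β : ℝ) * I))⁻¹ := by intro β; funext x; push_cast; ring_nf
  rw [e] at base ⊢; rcases le_total α (π / 2) with h | h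
  · rw [← key (-(π/2)) (-α) (by linarith) (by linarith) (by linarith), base]
  · rw [key (-α) (-(π/2)) (by linarith) (by linarith) (by linarith), base]

theorem integral_inv_sinh_above {α : ℝ} (h0 : 0 < α) (h1 : α < π) :
    ∫ x : ℝ, (sinh (x + α * I))⁻¹ = -(π * I) := by
  rw [← integral_inv_sinh_below h0 h1, ← integral_neg, ← integral_neg_eq_self]; congr 1; funext x
  rw [← inv_neg, ← sinh_neg]; congr 2; push_cast; ring

theorem integrable_line (V : ℂ → ℂ) (l : ℝ) (hd : ∀ z : ℂ, z.im = l → DifferentiableAt ℂ V z)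
    (C K : ℝ) (hb : ∀ z : ℂ, z.im = l → K ≤ |z.re| → ‖V z‖ ≤ C * rexp (-|z.re|)) :
    Integrable (fun x : ℝ => V (x + l * I)) := by
  have hc : Continuous (fun x : ℝ => V (x + l * I)) := by
    refine continuous_iff_continuousAt.2 fun x => ?_
    have h1 : ContinuousAt V (x + l * I) := (hd _ (by simp)).continuousAt
    exact ContinuousAt.comp (f := fun x : ℝ => (x + l * I : ℂ)) h1 (by fun_prop)
  obtain ⟨B, hB⟩ := (isCompact_Icc (a := -K) (b := K)).exists_bound_of_continuousOn
    hc.continuousOn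
  refine ((integrable_exp_neg_abs).const_mul (|C| + |B| * rexp |K|)).mono'
    hc.aestronglyMeasurable (ae_of_all _ fun x => ?_)
  have hx := exp_pos (-|x|)
  by_cases h : K ≤ |x|
  · have h1 := hb (x + l * I) (by simp) (by simpa using h)
    simp only [add_re, ofReal_re, mul_re, I_re, mul_zero, ofReal_im, I_im, mul_one, sub_self,
      add_zero] at h1
    refine h1.trans (mul_le_mul_of_nonneg_right ?_ hx.le); have := le_abs_self C
    have : 0 ≤ |B| * rexp |K| := by positivity
    linarith
  · push Not at h
    have h1 := hB x ⟨(abs_lt.1 h).1.le, (abs_lt.1 h).2.le⟩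
    have h2 : 1 ≤ rexp |K| * rexp (-|x|) := by
      rw [← Real.exp_add]; refine Real.one_le_exp ?_; have := le_abs_self K; linarith
    have h3 : |B| ≤ |B| * (rexp |K| * rexp (-|x|)) :=
      le_mul_of_one_le_right (abs_nonneg _) h2
    have h4 : 0 ≤ |C| * rexp (-|x|) := by positivity
    have := le_abs_self B; nlinarith

/-- The residue theorem for a strip: `V` has simple poles with residues `R p` at the points `p` of a
finite set. -/
theorem integral_cross {l1 l2 : ℝ} (hl : l2 - l1 < π) (s : Finset ℂ) (R : ℂ → ℂ)
    (hs : ∀ p ∈ s, l1 < p.im ∧ p.im < l2) :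
    ∀ V : ℂ → ℂ, l1 ≤ l2 →
    (∀ z : ℂ, l1 ≤ z.im → z.im ≤ l2 → z ∉ s → DifferentiableAt ℂ V z) →
    (∀ p ∈ s, Tendsto (fun z => (z - p) * V z) (𝓝[≠] p) (𝓝 (R p))) →
    (∃ C K : ℝ, ∀ z : ℂ, l1 ≤ z.im → z.im ≤ l2 → K ≤ |z.re| → ‖V z‖ ≤ C * rexp (-|z.re|)) →
    ((∫ x : ℝ, V (x + l1 * I)) - ∫ x : ℝ, V (x + l2 * I)) = 2 * π * I * ∑ p ∈ s, R p := by
  induction s using Finset.induction_on with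
  | empty =>
    rintro V hl' hd - ⟨C, K, hb⟩
    rw [integral_line_shift V hl' (fun z h1 h2 => hd z h1 h2 (by simp)) C K hb]
    simp
  | insert p s hp ih =>
    rintro V hl' hd hR ⟨C, K, hb⟩; have hpl := hs p (Finset.mem_insert_self _ _)
    have hs' : ∀ q ∈ s, l1 < q.im ∧ q.im < l2 := fun q hq => hs q (Finset.mem_insert_of_mem hq)
    -- This function has the same principal part at `p`, no other pole in a strip of height less
    -- than `π`, exponential decay, and integrals `± iπ R p` below and above `p`. Subtracting it
    -- leaves one pole fewer.
    set e : ℂ → ℂ := fun z => R p * (sinh (z - p))⁻¹ with he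
    have hsinh : ∀ z : ℂ, l1 ≤ z.im → z.im ≤ l2 → z ≠ p → sinh (z - p) ≠ 0 := by
      intro z h1 h2 h3; refine sinh_ne_zero_of_im (sub_ne_zero.2 h3) ?_
      rw [sub_im, abs_lt]; constructor <;> linarith
    have hde : ∀ z : ℂ, l1 ≤ z.im → z.im ≤ l2 → z ≠ p → DifferentiableAt ℂ e z := by
      intro z h1 h2 h3; have h4 : DifferentiableAt ℂ (fun z => sinh (z - p)) z := by fun_prop
      exact (h4.inv (hsinh z h1 h2 h3)).const_mul _
    set V1 : ℂ → ℂ := fun z => V z - e z with hV1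
    -- The singularity of `V1` at `p` is removable, but its value there is arbitrary and has to be
    -- replaced by the limit.
    set V' := update V1 p (limUnder (𝓝[≠] p) V1) with hV'
    have hV'ne : ∀ z, z ≠ p → V' z = V1 z := fun z hz => update_of_ne hz _ _
    have hV'ev : ∀ z, z ≠ p → V' =ᶠ[𝓝 z] V1 := fun z hz => by
      filter_upwards [isOpen_ne.mem_nhds hz] with w hw using hV'ne w hw
    have hlim0 : Tendsto (fun z => (z - p) * V1 z) (𝓝[≠] p) (𝓝 0) := by
      have h1 := hR p (Finset.mem_insert_self _ _)
      have h2 : Tendsto (fun z => (z - p) * e z) (𝓝[≠] p) (𝓝 (R p)) := by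
        have h3 : Tendsto (fun z => (z - p)⁻¹ * sinh (z - p)) (𝓝[≠] p) (𝓝 1) := by
          have h4 : HasDerivAt (fun z => sinh (z - p)) 1 p := by
            have := ((hasDerivAt_id p).sub_const p).csinh; simpa using this
          have h5 := hasDerivAt_iff_tendsto_slope.1 h4; refine h5.congr fun z => ?_
          simp [slope_def_module]
        have h6 := (h3.inv₀ one_ne_zero).const_mul (R p); rw [inv_one, mul_one] at h6
        refine h6.congr fun z => ?_
        simp only [he, mul_inv, inv_inv]; ring
      have h3 := h1.sub h2; rw [sub_self] at h3; refine h3.congr fun z => ?_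
      simp only [hV1]; ring
    have hdV1 : ∀ z : ℂ, l1 ≤ z.im → z.im ≤ l2 → z ∉ s → z ≠ p → DifferentiableAt ℂ V1 z :=
      fun z h1 h2 h3 h4 => (hd z h1 h2 (by simp [h3, h4])).sub (hde z h1 h2 h4)
    have hdV' : ∀ z : ℂ, l1 ≤ z.im → z.im ≤ l2 → z ∉ s → DifferentiableAt ℂ V' z := by
      intro z h1 h2 h3
      by_cases hz : z = p
      · subst hz; have hopen : IsOpen {w : ℂ | l1 < w.im ∧ w.im < l2 ∧ w ∉ s} := by
          refine (isOpen_lt continuous_const continuous_im).inter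
            ((isOpen_lt continuous_im continuous_const).inter ?_)
          exact (s.finite_toSet.isClosed).isOpen_compl
        have hnh := hopen.mem_nhds (show z ∈ _ from ⟨hpl.1, hpl.2, h3⟩)
        refine (differentiableOn_update_limUnder_of_isLittleO hnh (fun w hw => ?_) ?_).differentiableAt
          hnh
        · exact (hdV1 w hw.1.1.le hw.1.2.1.le hw.1.2.2 hw.2).differentiableWithinAt
        · rw [Asymptotics.isLittleO_iff_tendsto']
          · have h5 : Tendsto (fun w => (w - z) * V1 z) (𝓝[≠] z) (𝓝 0) := by
              have : Continuous fun w : ℂ => (w - z) * V1 z := by fun_prop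
              have h := this.tendsto z; rw [sub_self, zero_mul] at h
              exact h.mono_left nhdsWithin_le_nhds
            have h6 := hlim0.sub h5; rw [sub_self] at h6; refine h6.congr fun w => ?_
            rw [div_inv_eq_mul]; ring
          · filter_upwards [self_mem_nhdsWithin] with w hw h
            exact absurd (inv_eq_zero.1 h) (sub_ne_zero.2 hw)
      · exact (hdV1 z h1 h2 h3 hz).congr_of_eventuallyEq (hV'ev z hz)
    have hRV' : ∀ q ∈ s, Tendsto (fun z => (z - q) * V' z) (𝓝[≠] q) (𝓝 (R q)) := by
      intro q hq; have hqp : q ≠ p := fun h => hp (h ▸ hq)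
      have h1 := hR q (Finset.mem_insert_of_mem hq)
      have h2 : Tendsto (fun z => (z - q) * e z) (𝓝[≠] q) (𝓝 0) := by
        have h3 := (hde q (hs' q hq).1.le (hs' q hq).2.le hqp).continuousAt.tendsto
        have h4 : Tendsto (fun z : ℂ => z - q) (𝓝 q) (𝓝 0) := by
          have : Continuous fun z : ℂ => z - q := by fun_prop
          simpa using this.tendsto q
        simpa using (h4.mul h3).mono_left (nhdsWithin_le_nhds (s := {q}ᶜ))
      have h3 := h1.sub h2; rw [sub_zero] at h3; refine h3.congr' ?_
      filter_upwards [nhdsWithin_le_nhds (hV'ev q hqp)] with z hz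
      rw [hz]; simp only [hV1]; ring
    have hbe : ∀ z : ℂ, |p.re| + 1 ≤ |z.re| →
        ‖e z‖ ≤ (4 * ‖R p‖ * rexp |p.re|) * rexp (-|z.re|) := by
      intro z hz; have h1 : 1 ≤ |(z - p).re| := by
        rw [sub_re]; have := abs_sub_abs_le_abs_sub z.re p.re; linarith
      have h2 := norm_inv_sinh_le _ h1
      have h3 : rexp (-|(z - p).re|) ≤ rexp |p.re| * rexp (-|z.re|) := by
        rw [← Real.exp_add, exp_le_exp, sub_re]; have := abs_sub_abs_le_abs_sub z.re p.re; linarith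
      rw [he, norm_mul]; have := norm_nonneg (R p)
      calc _ ≤ ‖R p‖ * (4 * (rexp |p.re| * rexp (-|z.re|))) := by gcongr; linarith
        _ = _ := by ring
    have hbV' : ∀ z : ℂ, l1 ≤ z.im → z.im ≤ l2 → max K (|p.re| + 1) ≤ |z.re| →
        ‖V' z‖ ≤ (C + 4 * ‖R p‖ * rexp |p.re|) * rexp (-|z.re|) := by
      intro z h1 h2 h3; have hz : z ≠ p := by
        rintro rfl; have := (le_max_right _ _).trans h3; linarith
      rw [hV'ne z hz, add_mul]
      exact (norm_sub_le _ _).trans (add_le_add (hb z h1 h2 ((le_max_left _ _).trans h3))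
        (hbe z ((le_max_right _ _).trans h3)))
    have hih := ih hs' V' hl' hdV' hRV' ⟨_, _, hbV'⟩; have split : ∀ l : ℝ, (l = l1 ∨ l = l2) →
        ∫ x : ℝ, V (x + l * I) = (∫ x : ℝ, V' (x + l * I)) + ∫ x : ℝ, e (x + l * I) := by
      intro l hll; have hle : l1 ≤ l ∧ l ≤ l2 := by rcases hll with rfl | rfl <;> simp [hl']
      have hnp : l ≠ p.im := by rcases hll with rfl | rfl <;> linarith [hpl.1, hpl.2]
      have hns : ∀ q ∈ s, l ≠ q.im := fun q hq => by
        rcases hll with rfl | rfl <;> linarith [(hs' q hq).1, (hs' q hq).2]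
      rw [← integral_add]
      · congr 1; funext x; have : (x + l * I : ℂ) ≠ p := by intro h; apply hnp; rw [← h]; simp
        rw [hV'ne _ this]; simp only [hV1]; ring
      · refine integrable_line V' l (fun z hz => ?_) _ _ (fun z hz hk => hbV' z ?_ ?_ hk)
        · exact hdV' z (hz ▸ hle.1) (hz ▸ hle.2) fun h => hns z h hz.symm
        · exact hz ▸ hle.1
        · exact hz ▸ hle.2
      · refine integrable_line e l (fun z hz => ?_) _ _ (fun z hz hk => hbe z hk)
        exact hde z (hz ▸ hle.1) (hz ▸ hle.2) fun h => hnp (by rw [← hz, h])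
    have ints : ∀ l : ℝ, ∫ x : ℝ, e (x + l * I) =
        R p * ∫ x : ℝ, (sinh (x + (l - p.im : ℝ) * I))⁻¹ := by
      intro l; rw [← integral_const_mul, ← integral_add_right_eq_self _ p.re]; congr 1; funext x
      simp only [he]; congr 3; push_cast; linear_combination re_add_im p
    have e1 : ∫ x : ℝ, e (x + l1 * I) = R p * (π * I) := by
      rw [ints, ← integral_inv_sinh_below (α := p.im - l1) (by linarith) (by linarith)]
      congr 3; funext x; push_cast; congr 2; ring
    have e2 : ∫ x : ℝ, e (x + l2 * I) = -(R p * (π * I)) := by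
      rw [ints, integral_inv_sinh_above (α := l2 - p.im) (by linarith) (by linarith)]; ring
    rw [split l1 (Or.inl rfl), split l2 (Or.inr rfl), e1, e2, Finset.sum_insert hp]
    linear_combination hih

/-- A function holomorphic on a strip and vanishing on the real line vanishes. -/
theorem eq_zero_of_real {f : ℂ → ℂ} {a b : ℝ} (ha : a < 0) (hb : 0 < b)
    (hf : DifferentiableOn ℂ f {z | a < z.im ∧ z.im < b}) (h0 : ∀ x : ℝ, f x = 0) {z : ℂ}
    (hz1 : a < z.im) (hz2 : z.im < b) : f z = 0 := by
  have hopen : IsOpen {z : ℂ | a < z.im ∧ z.im < b} :=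
    (isOpen_lt continuous_const continuous_im).inter (isOpen_lt continuous_im continuous_const)
  have hconv : Convex ℝ {z : ℂ | a < z.im ∧ z.im < b} :=
    (convex_halfSpace_im_gt a).inter (convex_halfSpace_im_lt b)
  have h := (hf.analyticOnNhd hopen).eqOn_zero_of_preconnected_of_frequently_eq_zero
    hconv.isPreconnected (z₀ := 0) (by simp [ha, hb]) (by
      have ht : Tendsto (fun x : ℝ => (x : ℂ)) (𝓝[≠] 0) (𝓝[≠] 0) := by
        refine tendsto_nhdsWithin_iff.2 ⟨?_, ?_⟩
        · exact (continuous_ofReal.tendsto' 0 0 (by simp)).mono_left nhdsWithin_le_nhds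
        · filter_upwards [self_mem_nhdsWithin] with x hx
          simpa using hx
      exact ht.frequently (Eventually.frequently (.of_forall h0)))
  exact h ⟨hz1, hz2⟩

/-! ### Integrals over several real variables -/

theorem integrable_insertNth {n : ℕ} (k : Fin (n + 1)) {f : (Fin (n + 1) → ℝ) → ℂ}
    (hf : Integrable f) : Integrable (fun p : ℝ × (Fin n → ℝ) => f (k.insertNth p.1 p.2)) := by
  have h := ((volume_preserving_piFinSuccAbove (fun _ : Fin (n + 1) => ℝ) k).symm).integrable_comp_emb
    (MeasurableEquiv.measurableEmbedding _) (g := f)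
  exact h.2 hf

theorem integral_insertNth_prod {n : ℕ} (k : Fin (n + 1)) (f : (Fin (n + 1) → ℝ) → ℂ) :
    ∫ p : ℝ × (Fin n → ℝ), f (k.insertNth p.1 p.2) = ∫ t, f t :=
  ((volume_preserving_piFinSuccAbove (fun _ : Fin (n + 1) => ℝ) k).symm).integral_comp' f

theorem integral_comp_equiv {n m : ℕ} (σ : Fin n ≃ Fin m) (f : (Fin n → ℝ) → ℂ) :
    ∫ t : Fin m → ℝ, f (t ∘ σ) = ∫ t, f t := by
  have h := (volume_measurePreserving_piCongrLeft (fun _ : Fin n => ℝ) σ.symm).integral_comp' f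
  rw [← h]; congr 1; funext t; congr 1; funext i
  rw [MeasurableEquiv.coe_piCongrLeft, ← Equiv.symm_apply_apply σ i,
    Equiv.piCongrLeft_apply_apply]
  simp

theorem integrable_of_weight {n : ℕ} {f : (Fin n → ℝ) → ℂ} (hm : AEStronglyMeasurable f)
    {C : ℝ} (hb : ∀ t, ‖f t‖ ≤ C * weight t) : Integrable f :=
  ((integrable_weight n).const_mul C).mono' hm (ae_of_all _ hb)

/-! ### Words of roles and configurations -/

/-- The roles of the integration variables in the product of two fields `A B`: `th` and `et` are the
creators and annihilators of `A`, `P` and `Q` the creators of `B` to the left and to the right of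
`A`, `H` and `L` the contracted variables, `eB` the annihilators of `B` and `nu` the spectators. -/
inductive Role
  | th | et | P | H | L | Q | eB | nu
  deriving DecidableEq

instance : Fintype Role :=
  ⟨{.th, .et, .P, .H, .L, .Q, .eB, .nu}, fun b => by cases b <;> decide⟩

/-- A list of variables for each role. -/
abbrev Config (X : Type) : Type := Role → List X

/-- Put a variable in front of the list of a role. -/
def push {X : Type} (b : Role) (x : X) (C : Config X) : Config X := update C b (x :: C b)

@[simp] theorem push_same {X : Type} (b : Role) (x : X) (C : Config X) : push b x C b = x :: C b :=
  update_self _ _ _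

theorem push_of_ne {X : Type} {b b' : Role} (h : b' ≠ b) (x : X) (C : Config X) :
    push b x C b' = C b' :=
  update_of_ne h _ _

theorem push_comm {X : Type} {b b' : Role} (h : b ≠ b') (x y : X) (C : Config X) :
    push b x (push b' y C) = push b' y (push b x C) := by
  funext c
  by_cases h1 : c = b
  · subst h1; rw [push_same, push_of_ne h, push_of_ne h, push_same]
  · rw [push_of_ne h1]
    by_cases h2 : c = b'
    · subst h2; rw [push_same, push_same, push_of_ne h1]
    · rw [push_of_ne h2, push_of_ne h2, push_of_ne h1]

/-- Distribute the variables `t` over the roles given by the word. -/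
def config {X : Type} : (ω : List Role) → (Fin ω.length → X) → Config X
  | [], _ => fun _ => []
  | b :: ω, t => push b (t 0) (config ω fun i => t i.succ)

theorem push_map {X Y : Type} (f : Role → X → Y) (b : Role) (x : X) (C : Config X) :
    (fun c => (push b x C c).map (f c)) = push b (f b x) fun c => (C c).map (f c) := by
  funext c
  by_cases h : c = b
  · subst h; simp
  · simp [push_of_ne h]

theorem config_map {X Y : Type} (f : X → Y) : ∀ (ω : List Role) (t : Fin ω.length → X),
    (fun b => (config ω t b).map f) = config ω (f ∘ t)
  | [], _ => rfl
  | b :: ω, t => by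
    rw [config, push_map (fun _ => f), config_map f ω]
    rfl

theorem config_length {X : Type} : ∀ (ω : List Role) (t : Fin ω.length → X) (b : Role),
    (config ω t b).length = ω.count b
  | [], _, _ => rfl
  | c :: ω, t, b => by
    rw [config]
    by_cases h : b = c
    · subst h; simp [config_length ω]
    · rw [push_of_ne h, config_length ω, count_cons_of_ne (Ne.symm h)]

/-- Different letters write to different lists, so their order in the word is irrelevant; a
transposition of equal letters is represented by the identity. Integrals over configurations
therefore depend only on how often each role occurs. -/
theorem config_perm {ω ω' : List Role} (h : ω.Perm ω') :
    ∃ σ : Fin ω.length ≃ Fin ω'.length, ∀ (X : Type) (t : Fin ω'.length → X),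
      config ω (t ∘ σ) = config ω' t := by
  induction h with
  | nil => exact ⟨Equiv.refl _, fun X t => rfl⟩
  | @cons b ω ω' _ ih =>
    obtain ⟨σ, hσ⟩ := ih
    refine ⟨((finSuccEquiv ω.length).trans σ.optionCongr).trans (finSuccEquiv ω'.length).symm,
      fun X t => ?_⟩
    rw [config, config, ← hσ]; congr 1
  | swap b b' ω =>
    by_cases hb : b = b'
    · subst hb; exact ⟨Equiv.refl _, fun X t => rfl⟩
    · refine ⟨Equiv.swap 0 1, fun X t => ?_⟩
      simp only [config]; rw [push_comm (Ne.symm hb)]; congr 1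
  | trans _ _ ih1 ih2 =>
    obtain ⟨σ, hσ⟩ := ih1; obtain ⟨τ, hτ⟩ := ih2
    exact ⟨σ.trans τ, fun X t => by rw [← hτ X t, ← hσ X (t ∘ τ)]; rfl⟩

/-- Put the variables of role `b` on the line `ℝ + i lev b`. -/
def lift (lev : Role → ℝ) (C : Config ℝ) : Config ℂ :=
  fun b => (C b).map fun x : ℝ => (x : ℂ) + lev b * I

theorem lift_push (lev : Role → ℝ) (b : Role) (x : ℝ) (C : Config ℝ) :
    lift lev (push b x C) = push b (x + lev b * I) (lift lev C) :=
  push_map (fun b (x : ℝ) => (x : ℂ) + lev b * I) b x C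

theorem lift_config (lev : Role → ℝ) : ∀ (ω : List Role) (t : Fin ω.length → ℝ),
    lift lev (config ω t) = config ω fun i => (t i : ℂ) + lev (ω.get i) * I
  | [], _ => rfl
  | b :: ω, t => by rw [config, lift_push, lift_config lev ω]; rfl

/-- The integral of a function of a configuration, with measure `dx / 2π` for each variable. -/
def wint (ω : List Role) (lev : Role → ℝ) (W : Config ℂ → ℂ) : ℂ :=
  ((2 * π : ℂ) ^ ω.length)⁻¹ * ∫ t : Fin ω.length → ℝ, W (lift lev (config ω t))

theorem wint_perm {ω ω' : List Role} (h : ω.Perm ω') (lev : Role → ℝ) (W : Config ℂ → ℂ) :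
    wint ω lev W = wint ω' lev W := by
  obtain ⟨σ, hσ⟩ := config_perm h; rw [wint, wint, ← integral_comp_equiv σ]
  simp only [hσ, h.length_eq]

/-- The sum of the absolute values of the real parts of all variables. -/
def absSum (C : Config ℂ) : ℝ := ∑ b, ((C b).map fun z => |z.re|).sum

theorem absSum_push (b : Role) (z : ℂ) (C : Config ℂ) :
    absSum (push b z C) = |z.re| + absSum C := by
  have : ∀ c, ((push b z C c).map fun z => |z.re|).sum =
      (if c = b then |z.re| else 0) + ((C c).map fun z => |z.re|).sum := by
    intro c
    by_cases h : c = b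
    · subst h; simp
    · simp [push_of_ne h, h]
  simp only [absSum, this, sum_add_distrib, sum_ite_eq', Finset.mem_univ, if_true]

theorem absSum_config (lev : Role → ℝ) : ∀ (ω : List Role) (t : Fin ω.length → ℝ),
    absSum (lift lev (config ω t)) = ∑ i, |t i|
  | [], _ => by simp [absSum, lift, config]
  | b :: ω, t => by
    rw [config, lift_push, absSum_push, absSum_config lev ω]
    refine Eq.trans ?_ (Fin.sum_univ_succ fun i : Fin (ω.length + 1) => |t i|).symm
    simp

theorem weight_eq (lev : Role → ℝ) (ω : List Role) (t : Fin ω.length → ℝ) :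
    weight t = rexp (-absSum (lift lev (config ω t))) := by rw [absSum_config, weight]

/-! ### Analytic continuation of the relations for `S` -/

/-- The properties of the S-matrix on the strip `-δ < Im ζ < π + δ`. -/
structure StripS (S : ℂ → ℂ) (δ B : ℝ) : Prop where
  pos : 0 < δ
  le : δ ≤ 1 / 2
  one_le : 1 ≤ B
  diff : ∀ z : ℂ, -δ < z.im → z.im < π + δ → DifferentiableAt ℂ S z
  bound : ∀ z : ℂ, -δ < z.im → z.im < π + δ → ‖S z‖ ≤ B
  inv : ∀ z : ℂ, |z.im| < δ → S z * S (-z) = 1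
  cross : ∀ z : ℂ, -δ < z.im → z.im < π + δ → S (π * I - z) = S z
  herm : ∀ z : ℂ, -δ < z.im → z.im < π + δ →
    S (-conj z) = conj (S z)

theorem IsScatteringFunction.exists_stripS {S : ℂ → ℂ} (hS : IsScatteringFunction S) :
    ∃ δ B, StripS S δ B := by
  obtain ⟨δ0, h0, hd, C, hC⟩ := hS.regular
  have hopen : IsOpen {z : ℂ | -δ0 < z.im ∧ z.im < π + δ0} :=
    (isOpen_lt continuous_const continuous_im).inter (isOpen_lt continuous_im continuous_const)
  have hpi := pi_pos; set δ := min δ0 (1 / 2) with hδ; have hδ0 : 0 < δ := lt_min h0 (by norm_num)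
  have hδ1 : δ ≤ δ0 := min_le_left _ _
  have hd' : ∀ z : ℂ, -δ < z.im → z.im < π + δ → DifferentiableAt ℂ S z := fun z h1 h2 =>
    hd.differentiableAt (hopen.mem_nhds ⟨by linarith, by linarith⟩)
  refine ⟨δ, max C 1, hδ0, min_le_right _ _, le_max_right _ _, hd',
    fun z h1 h2 => (hC z (by linarith) (by linarith)).trans (le_max_left _ _), ?_, ?_, ?_⟩
  · intro z hz; rw [abs_lt] at hz
    have := eq_zero_of_real (f := fun z => S z * S (-z) - 1) (neg_lt_zero.2 hδ0) hδ0 (by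
      rintro w ⟨h1, h2⟩; refine DifferentiableAt.differentiableWithinAt (DifferentiableAt.sub_const
        (DifferentiableAt.mul (hd' w h1 (by linarith)) ?_) _)
      exact (hd' (-w) (by rw [neg_im]; linarith) (by rw [neg_im]; linarith)).comp w
        differentiableAt_id.neg) (fun x => by
        rw [hS.hermitian, mul_conj, normSq_eq_norm_sq, hS.unitary]; simp) hz.1 hz.2
    exact sub_eq_zero.1 this
  · intro z hz1 hz2; have := eq_zero_of_real (f := fun z => S (π * I - z) - S z) (neg_lt_zero.2 hδ0)
      (by positivity) (by
      rintro w ⟨h1, h2⟩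
      refine DifferentiableAt.differentiableWithinAt (DifferentiableAt.sub ?_ (hd' w h1 h2))
      refine DifferentiableAt.comp w (hd' _ ?_ ?_) (differentiableAt_id.const_sub _)
      · simp only [sub_im, mul_im, ofReal_re, I_im, mul_one, ofReal_im, I_re, mul_zero, add_zero]
        linarith
      · simp only [sub_im, mul_im, ofReal_re, I_im, mul_one, ofReal_im, I_re, mul_zero, add_zero]
        linarith) (fun x => by rw [hS.crossing x (by simp) (by simp [hpi.le])]; simp) hz1 hz2
    exact sub_eq_zero.1 this
  · intro z hz1 hz2; have := eq_zero_of_real (f := fun z => conj (S (-conj z)) - S z)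
      (neg_lt_zero.2 hδ0) (by positivity) (by
      rintro w ⟨h1, h2⟩
      refine DifferentiableAt.differentiableWithinAt (DifferentiableAt.sub ?_ (hd' w h1 h2))
      have h3 : DifferentiableAt ℂ (fun z => S (-z)) (conj w) := by
        refine DifferentiableAt.comp _ (hd' _ ?_ ?_) differentiableAt_id.neg
        · simpa using h1
        · simpa using h2
      simpa [comp_def] using h3.conj_conj) (fun x => by
        rw [conj_ofReal, hS.hermitian]; simp) hz1 hz2
    rw [← sub_eq_zero.1 this, conj_conj]

/-! ### Functions of lists -/

/-- A sequence of functions of `n` variables as a function of lists. -/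
def onList {X Y : Type} (a : (n : ℕ) → (Fin n → X) → Y) (L : List X) : Y := a L.length L.get

theorem onList_eq {X Y : Type} (a : (n : ℕ) → (Fin n → X) → Y) {L : List X} {n : ℕ}
    (h : L.length = n) : onList a L = a n fun i => L.get (i.cast h.symm) := by subst h; rfl

theorem onList_ofFn {X Y : Type} (a : (n : ℕ) → (Fin n → X) → Y) {n : ℕ} (ζ : Fin n → X) :
    onList a (ofFn ζ) = a n ζ := by rw [onList_eq a (length_ofFn)]; congr 1; funext i; simp

/-- Complex differentiability of a function of lists. -/
def HoloAt (f : List ℂ → ℂ) (L : List ℂ) : Prop :=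
  ∀ (n : ℕ) (ζ : Fin n → ℂ), L = ofFn ζ →
    DifferentiableAt ℂ (fun ζ' : Fin n → ℂ => f (ofFn ζ')) ζ

theorem HoloAt.comp {f : List ℂ → ℂ} {X : Type*} [NormedAddCommGroup X] [NormedSpace ℂ X]
    {ι : Type*} (M : List ι) (φ : ι → X → ℂ) {x : X} (h : HoloAt f (M.map fun i => φ i x))
    (hφ : ∀ i ∈ M, DifferentiableAt ℂ (φ i) x) :
    DifferentiableAt ℂ (fun x => f (M.map fun i => φ i x)) x := by
  have e : ∀ x, M.map (fun i => φ i x) = ofFn fun k : Fin M.length => φ (M.get k) x := by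
    intro x
    conv_lhs => rw [← ofFn_get M, map_ofFn]
    rfl
  simp only [e]; exact (h _ _ (e x)).comp x (f := fun x => fun k : Fin M.length => φ (M.get k) x)
    (differentiableAt_pi.2 fun k => hφ _ (get_mem _ _))

theorem HoloAt.continuousAt_comp {f : List ℂ → ℂ} {X : Type*} [TopologicalSpace X]
    {ι : Type*} (M : List ι) (φ : ι → X → ℂ) {x : X} (h : HoloAt f (M.map fun i => φ i x))
    (hφ : ∀ i ∈ M, ContinuousAt (φ i) x) :
    ContinuousAt (fun x => f (M.map fun i => φ i x)) x := by
  have e : ∀ x, M.map (fun i => φ i x) = ofFn fun k : Fin M.length => φ (M.get k) x := by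
    intro x
    conv_lhs => rw [← ofFn_get M, map_ofFn]
    rfl
  simp only [e]
  exact (h _ _ (e x)).continuousAt.comp (f := fun x => fun k : Fin M.length => φ (M.get k) x)
    (continuousAt_pi.2 fun k => hφ _ (get_mem _ _))

/-- Functions holomorphic on a convex domain that vanish at real points vanish. -/
theorem eq_zero_of_real_points {n : ℕ} {D : Set (Fin n → ℂ)} (hD : IsOpen D) (hconv : Convex ℝ D)
    {E : (Fin n → ℂ) → ℂ} (hE : DifferentiableOn ℂ E D)
    (h0 : ∀ x : Fin n → ℝ, (fun i => (x i : ℂ)) ∈ D → E (fun i => (x i : ℂ)) = 0)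
    (hre : ∀ ζ ∈ D, (fun i => ((ζ i).re : ℂ)) ∈ D) {ζ : Fin n → ℂ} (hζ : ζ ∈ D) : E ζ = 0 := by
  -- The complex line through `Re ζ` at `t = 0` and `ζ` at `t = i`. For real `t` it consists of real
  -- points, where `E` vanishes, and convexity of `D` makes its preimage connected, so the identity
  -- theorem in one variable suffices.
  set l : ℂ → Fin n → ℂ := fun t i => ((ζ i).re : ℂ) + t * (ζ i).im with hl
  have hlc : Differentiable ℂ l := by rw [hl, differentiable_pi]; intro i; fun_prop
  set U := l ⁻¹' D with hU; have hUo : IsOpen U := hD.preimage hlc.continuous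
  have hUc : Convex ℝ U := by
    intro s hs t ht p q hp hq hpq; have : l (p • s + q • t) = p • l s + q • l t := by
      funext i; simp only [hl, Pi.add_apply, Pi.smul_apply, real_smul]
      have : (p : ℂ) + q = 1 := by exact_mod_cast hpq
      linear_combination (-((ζ i).re : ℂ)) * this
    rw [hU, mem_preimage, this]; exact hconv hs ht hp hq hpq
  have h0U : (0 : ℂ) ∈ U := by simpa [hU, hl] using hre ζ hζ
  have hIU : I ∈ U := by
    have : l I = ζ := by funext i; simp [hl, mul_comm I, re_add_im]
    rw [hU, mem_preimage, this]; exact hζ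
  have hf : DifferentiableOn ℂ (fun t => E (l t)) U := hE.comp hlc.differentiableOn fun t ht => ht
  have hz := (hf.analyticOnNhd hUo).eqOn_zero_of_preconnected_of_frequently_eq_zero
    hUc.isPreconnected h0U (by
      have ht : Tendsto (fun x : ℝ => (x : ℂ)) (𝓝[≠] 0) (𝓝[≠] 0) := by
        refine tendsto_nhdsWithin_iff.2 ⟨?_, ?_⟩
        · exact (continuous_ofReal.tendsto' 0 0 (by simp)).mono_left nhdsWithin_le_nhds
        · filter_upwards [self_mem_nhdsWithin] with x hx
          simpa using hx
      refine ht.frequently (Eventually.frequently ?_)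
      filter_upwards [ht (nhdsWithin_le_nhds (hUo.mem_nhds h0U))] with x hx
      have e : l x = fun i => (((ζ i).re + x * (ζ i).im : ℝ) : ℂ) := by funext i; simp [hl]
      have hx' : l x ∈ D := hx; rw [e] at hx' ⊢; exact h0 _ hx')
  have h1 := hz hIU; have : l I = ζ := by funext i; simp [hl, mul_comm I, re_add_im]
  simpa [this] using h1

theorem abs_cos_im_le (z : ℂ) : |Real.cos z.im| ≤ ‖cosh z‖ := by
  rw [← abs_of_nonneg (norm_nonneg (cosh z)), ← sq_le_sq, ← normSq_eq_norm_sq,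
    normSq_apply, cosh_re, cosh_im]
  have h3 := Real.cosh_sq z.re
  nlinarith [sq_nonneg (Real.sinh z.re * Real.cos z.im), sq_nonneg (Real.sinh z.re * Real.sin z.im)]

/-- In this range `cos (y / 2)` vanishes only at `y = π`. A gap `γ` between the height of a
difference and `π` thus bounds the pole factor from below, uniformly in the real parts. -/
theorem sin_le_abs_cos {γ y : ℝ} (hγ : 0 < γ) (hγ1 : γ ≤ 1) (h1 : -1 < y)
    (h2 : y < π + 1) (h3 : γ ≤ |y - π|) : Real.sin (γ / 2) ≤ |Real.cos (y / 2)| := by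
  have hpi := two_le_pi
  have key : ∀ u, γ / 2 ≤ u → u ≤ π - γ / 2 → Real.sin (γ / 2) ≤ Real.sin u := by
    intro u hu1 hu2; rcases le_total u (π / 2) with h | h
    · exact Real.sin_le_sin_of_le_of_le_pi_div_two (by linarith) h hu1
    · rw [← Real.sin_pi_sub u]
      exact Real.sin_le_sin_of_le_of_le_pi_div_two (by linarith) (by linarith) (by linarith)
  rcases le_abs'.1 h3 with h | h
  · have := key (π / 2 - y / 2) (by linarith) (by linarith); rw [Real.sin_pi_div_two_sub] at this
    exact this.trans (le_abs_self _)
  · have := key (y / 2 - π / 2) (by linarith) (by linarith); rw [Real.sin_sub_pi_div_two] at this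
    exact this.trans (neg_le_abs _)

/-! ### Coefficient functions on lists -/

/-- The difference of the two rapidities lies in the `δ`-neighbourhood of the strip. -/
def TubeRel (δ : ℝ) (z w : ℂ) : Prop := -δ < (z - w).im ∧ (z - w).im < π + δ

/-- Moreover the difference is not at a pole. -/
def RegRel (δ : ℝ) (z w : ℂ) : Prop := TubeRel δ z w ∧ cosh ((z - w) / 2) ≠ 0

/-- Moreover the pole factor is bounded away from zero. -/
def CoshRel (δ γ : ℝ) (z w : ℂ) : Prop := TubeRel δ z w ∧ γ ≤ ‖cosh ((z - w) / 2)‖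

theorem coshRel_of_gap {δ γ : ℝ} (hδ : δ ≤ 1 / 2) (hγ : 0 < γ) (hγ1 : γ ≤ 1) {z w : ℂ}
    (h : TubeRel δ z w) (hg : γ ≤ |(z - w).im - π|) : CoshRel δ (Real.sin (γ / 2)) z w := by
  have h1 := sin_le_abs_cos hγ hγ1 (by linarith [h.1]) (by linarith [h.2]) hg
  refine ⟨h, h1.trans ?_⟩; have h2 := abs_cos_im_le ((z - w) / 2)
  rwa [show ((z - w) / 2).im = (z - w).im / 2 by simp] at h2

theorem sin_half_pos {γ : ℝ} (hγ : 0 < γ) (hγ1 : γ ≤ 1) : 0 < Real.sin (γ / 2) :=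
  Real.sin_pos_of_pos_of_lt_pi (by linarith) (by have := two_le_pi; linarith)

theorem CoshRel.regRel {δ γ : ℝ} (hγ : 0 < γ) {z w : ℂ} (h : CoshRel δ γ z w) : RegRel δ z w :=
  ⟨h.1, fun h0 => by have := h.2; rw [h0, norm_zero] at this; linarith⟩

/-- `poleFactor` on lists. -/
def poleL : List ℂ → ℂ
  | [] => 1
  | x :: L => (L.map fun y => cosh ((x - y) / 2)).prod * poleL L

theorem poleFactor_eq : ∀ (n : ℕ) (ζ : Fin n → ℂ), poleFactor n ζ = poleL (ofFn ζ)
  | 0, ζ => by simp [poleFactor, poleL]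
  | n + 1, ζ => by
    rw [ofFn_succ, poleL, ← poleFactor_eq n, poleFactor, poleFactor, Fin.prod_univ_succ]; congr 1
    · rw [prod_filter, Fin.prod_univ_succ, map_ofFn, prod_ofFn]; simp
    · refine Finset.prod_congr rfl fun i _ => ?_
      rw [prod_filter, prod_filter, Fin.prod_univ_succ]; simp

theorem poleL_append_singleton (w : ℂ) : ∀ L : List ℂ,
    poleL (L ++ [w]) = poleL L * (L.map fun z => cosh ((z - w) / 2)).prod
  | [] => by simp [poleL]
  | x :: L => by
    simp only [cons_append, poleL, poleL_append_singleton w L, map_append, prod_append,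
      map_cons, prod_cons, map_nil, prod_nil]
    ring

theorem poleL_ne_zero {δ : ℝ} : ∀ {L : List ℂ}, L.Pairwise (RegRel δ) → poleL L ≠ 0
  | [], _ => one_ne_zero
  | x :: L, h => by
    rw [pairwise_cons] at h; refine mul_ne_zero (List.prod_ne_zero ?_) (poleL_ne_zero h.2)
    rw [mem_map]; rintro ⟨y, hy, h0⟩; exact (h.1 y hy).2 h0

theorem norm_list_prod_ge {c : ℝ} (hc : 0 ≤ c) {ι : Type*} (f : ι → ℂ) : ∀ L : List ι,
    (∀ i ∈ L, c ≤ ‖f i‖) → c ^ L.length ≤ ‖(L.map f).prod‖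
  | [], _ => by simp
  | i :: L, h => by
    rw [map_cons, prod_cons, norm_mul, length_cons, pow_succ']
    exact mul_le_mul (h i (by simp)) (norm_list_prod_ge hc f L fun j hj => h j (by simp [hj]))
      (by positivity) (norm_nonneg _)

theorem norm_poleL_ge {δ γ : ℝ} (hγ : 0 < γ) (n : ℕ) :
    ∃ c > 0, ∀ L : List ℂ, L.length = n → L.Pairwise (CoshRel δ γ) → c ≤ ‖poleL L‖ := by
  induction n with
  | zero => exact ⟨1, one_pos, fun L hL _ => by rw [length_eq_zero_iff.1 hL]; simp [poleL]⟩
  | succ n ih =>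
    obtain ⟨c, hc, h⟩ := ih; refine ⟨γ ^ n * c, by positivity, ?_⟩; rintro (_ | ⟨x, L⟩) hL hp
    · simp at hL
    · rw [pairwise_cons] at hp; have hLn : L.length = n := by simpa using hL
      rw [poleL, norm_mul]; have h1 := norm_list_prod_ge hγ.le (fun y => cosh ((x - y) / 2)) L
        (fun y hy => (hp.1 y hy).2)
      rw [hLn] at h1; exact mul_le_mul h1 (h L hLn hp.2) hc.le (norm_nonneg _)

theorem isOpen_tube (n : ℕ) (δ : ℝ) : IsOpen (tube n δ) := by
  have : tube n δ = ⋂ i, ⋂ j, {ζ | i < j → -δ < (ζ i - ζ j).im ∧ (ζ i - ζ j).im < π + δ} := by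
    ext ζ; simp [tube]
  rw [this]; refine isOpen_iInter_of_finite fun i => isOpen_iInter_of_finite fun j => ?_
  by_cases h : i < j
  · simp only [h, true_imp_iff]; have hc : Continuous fun ζ : Fin n → ℂ => (ζ i - ζ j).im :=
      continuous_im.comp ((continuous_apply i).sub (continuous_apply j))
    exact (isOpen_lt continuous_const hc).inter (isOpen_lt hc continuous_const)
  · simp [h]

theorem convex_tube (n : ℕ) (δ : ℝ) : Convex ℝ (tube n δ) := by
  intro ζ hζ ξ hξ p q hp hq hpq i j hij; have h1 := hζ i j hij; have h2 := hξ i j hij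
  have e : ((p • ζ + q • ξ) i - (p • ζ + q • ξ) j).im = p * (ζ i - ζ j).im + q * (ξ i - ξ j).im := by
    simp [real_smul]; ring
  rw [e]; have hc := (convex_Ioo (𝕜 := ℝ) (-δ) (π + δ)) (show (ζ i - ζ j).im ∈ _ from h1)
    (show (ξ i - ξ j).im ∈ _ from h2) hp hq hpq
  simpa using hc

theorem mem_tube_of_pairwise {δ δ' : ℝ} (h : δ ≤ δ') {L : List ℂ} {n : ℕ} (hn : L.length = n)
    (hL : L.Pairwise (TubeRel δ)) : (fun i => L.get (i.cast hn.symm)) ∈ tube n δ' := by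
  subst hn; intro i j hij; have := List.pairwise_iff_get.1 hL i j hij
  exact ⟨lt_of_le_of_lt (by linarith) this.1, lt_of_lt_of_le this.2 (by linarith)⟩

theorem mem_regularTube_of_pairwise {δ δ' : ℝ} (h : δ ≤ δ') {L : List ℂ} {n : ℕ} (hn : L.length = n)
    (hL : L.Pairwise (RegRel δ)) : (fun i => L.get (i.cast hn.symm)) ∈ regularTube n δ' := by
  refine ⟨mem_tube_of_pairwise h hn (hL.imp fun h => h.1), ?_⟩
  subst hn; rw [poleFactor_eq]; have : ofFn (fun i => L.get (Fin.cast rfl i)) = L := ofFn_get L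
  rw [this]; exact poleL_ne_zero hL

/-- The properties of the coefficients with at most `N` variables, for lists. -/
structure CoefData (S : ℂ → ℂ) (a : Coefficients) (δ : ℝ) (N : ℕ) : Prop where
  holo : ∀ L : List ℂ, L.length ≤ N → L.Pairwise (RegRel δ) → HoloAt (onList a) L
  bound : ∀ γ > 0, ∃ C r : ℝ, 0 ≤ C ∧ 0 ≤ r ∧ ∀ L : List ℂ, L.length ≤ N → L.Pairwise (CoshRel δ γ) →
    ‖onList a L‖ ≤ C * rexp (r * (L.map fun z => |z.re|).sum)
  exch : ∀ (L1 L2 : List ℂ) (x y : ℂ), (L1 ++ x :: y :: L2).length ≤ N →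
    (L1 ++ x :: y :: L2).Pairwise (RegRel δ) → (L1 ++ y :: x :: L2).Pairwise (RegRel δ) →
    onList a (L1 ++ x :: y :: L2) = S (x - y) * onList a (L1 ++ y :: x :: L2)
  -- The singular pair stands at the two ends of the list; one cyclic step relates this to a pair
  -- `(ϑ + iπ, ϑ)` at the front. Both members may move, and the point `x` and the list `L` need not
  -- be real.
  kin : ∀ (L : List ℂ) (x : ℂ), L.length + 2 ≤ N → L.Pairwise (RegRel δ) →
    (∀ z ∈ L, TubeRel δ x z ∧ cosh ((x - z) / 2) ≠ 0 ∧
      cosh ((z - (x - π * I)) / 2) ≠ 0) →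
    ∀ (l : Filter ℂ) (u v : ℂ → ℂ), Tendsto u l (𝓝 x) → Tendsto v l (𝓝 x) → (∀ᶠ w in l, u w ≠ v w) →
    Tendsto (fun w => (u w - v w) * onList a (u w :: L ++ [v w - π * I])) l
      (𝓝 (-I * (1 - (L.map fun z => S (x - z)).prod) * onList a L))

theorem CoefData.mono {S : ℂ → ℂ} {a : Coefficients} {δ δ' : ℝ} {N : ℕ} (h : CoefData S a δ N)
    (hδ : δ' ≤ δ) : CoefData S a δ' N := by
  have t : ∀ {z w : ℂ}, TubeRel δ' z w → TubeRel δ z w := fun h =>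
    ⟨by linarith [h.1], by linarith [h.2]⟩
  have r : ∀ {z w : ℂ}, RegRel δ' z w → RegRel δ z w := fun h => ⟨t h.1, h.2⟩
  have g : ∀ {γ : ℝ} {z w : ℂ}, CoshRel δ' γ z w → CoshRel δ γ z w := fun h => ⟨t h.1, h.2⟩
  refine ⟨fun L hL hp => h.holo L hL (hp.imp r), fun γ hγ => ?_, fun L1 L2 x y hn h1 h2 =>
    h.exch L1 L2 x y hn (h1.imp r) (h2.imp r),
    fun L x hn h1 h2 => h.kin L x hn (h1.imp r) fun z hz => ⟨t (h2 z hz).1, (h2 z hz).2⟩⟩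
  obtain ⟨C, r, h0, h1, h2⟩ := h.bound γ hγ; exact ⟨C, r, h0, h1, fun L hn hp => h2 L hn (hp.imp g)⟩

theorem differentiableAt_list_prod {X : Type*} [NormedAddCommGroup X] [NormedSpace ℂ X] {ι : Type*}
    (φ : ι → X → ℂ) {x : X} : ∀ M : List ι, (∀ i ∈ M, DifferentiableAt ℂ (φ i) x) →
    DifferentiableAt ℂ (fun x => (M.map fun i => φ i x).prod) x
  | [], _ => by simp
  | i :: M, h => by
    simp only [map_cons, prod_cons]
    exact (h i (by simp)).mul (differentiableAt_list_prod φ M fun j hj => h j (by simp [hj]))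

theorem tendsto_list_prod {X : Type*} {l : Filter X} {ι : Type*} (φ : ι → X → ℂ) (c : ι → ℂ) :
    ∀ M : List ι, (∀ i ∈ M, Tendsto (φ i) l (𝓝 (c i))) →
    Tendsto (fun x => (M.map fun i => φ i x).prod) l (𝓝 (M.map c).prod)
  | [], _ => by simpa using tendsto_const_nhds
  | i :: M, h => by
    simp only [map_cons, prod_cons]
    exact (h i (by simp)).mul (tendsto_list_prod φ c M fun j hj => h j (by simp [hj]))

theorem cosh_half_pi_sub (u : ℂ) : cosh ((π * I - u) / 2) = -I * sinh (u / 2) := by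
  rw [sub_div, cosh_sub, show (π * I / 2 : ℂ) = (π / 2 : ℝ) * I by push_cast; ring,
    cosh_mul_I, sinh_mul_I, ← ofReal_cos, ← ofReal_sin, Real.cos_pi_div_two,
    Real.sin_pi_div_two]
  simp

theorem tendsto_div_sinh_half (x : ℂ) :
    Tendsto (fun w : ℂ => (w - x) / sinh ((w - x) / 2)) (𝓝[≠] x) (𝓝 2) := by
  have h4 : HasDerivAt (fun z : ℂ => sinh ((z - x) / 2)) (1 / 2) x := by
    have := (((hasDerivAt_id x).sub_const x).div_const 2).csinh; simpa using this
  have h5 := (hasDerivAt_iff_tendsto_slope.1 h4).inv₀ (by norm_num); rw [one_div, inv_inv] at h5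
  refine h5.congr fun z => ?_
  simp [slope_def_module, div_eq_mul_inv, mul_comm]

theorem pairwise_append_singleton {α : Type*} {R : α → α → Prop} {L : List α} {w : α} :
    (L ++ [w]).Pairwise R ↔ L.Pairwise R ∧ ∀ z ∈ L, R z w := by simp [pairwise_append]

theorem list_prod_ne_zero {α : Type*} {L : List α} {φ : α → ℂ} (h : ∀ z ∈ L, φ z ≠ 0) :
    (L.map φ).prod ≠ 0 :=
  List.prod_ne_zero fun h0 => by obtain ⟨z, hz, e⟩ := mem_map.1 h0; exact h z hz e

theorem cosh_half_sub_two_pi (z : ℂ) : cosh ((z + 2 * π * I) / 2) = -cosh (z / 2) := by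
  rw [show (z + 2 * π * I) / 2 = z / 2 + π * I by ring, cosh_add_pi_mul_I]

/-! ### Kinematic residues and their continuation to complex rapidities. -/

/-- A function `f = g / poleL` with `g` analytic that is invariant under cyclic permutations. -/
structure PoleData (f g : List ℂ → ℂ) (δ : ℝ) (N : ℕ) : Prop where
  pos : 0 < δ
  le : δ ≤ 1 / 2
  holo : ∀ L : List ℂ, L.length ≤ N → L.Pairwise (TubeRel δ) → HoloAt g L
  eq_div : ∀ L : List ℂ, L.length ≤ N → L.Pairwise (RegRel δ) → f L = g L / poleL L
  cyc : ∀ (L : List ℂ) (x : ℂ), (x :: L).length ≤ N → (x :: L).Pairwise (RegRel δ) →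
    (L ++ [x - 2 * π * I]).Pairwise (RegRel δ) → f (x :: L) = f (L ++ [x - 2 * π * I])

/-- The pole factors between `x`, `x - iπ` and the elements of `L`. -/
def coshL (x : ℂ) (L : List ℂ) : ℂ :=
  (L.map fun z => cosh ((x - z) / 2)).prod * (L.map fun z => cosh ((z - (x - π * I)) / 2)).prod

variable {S : ℂ → ℂ} {f g : List ℂ → ℂ} {δ : ℝ} {N : ℕ} {L : List ℂ} {x : ℂ}

theorem coshL_ne_zero (hx : ∀ z ∈ L, TubeRel δ x z ∧ cosh ((x - z) / 2) ≠ 0 ∧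
    cosh ((z - (x - π * I)) / 2) ≠ 0) : coshL x L ≠ 0 :=
  mul_ne_zero (list_prod_ne_zero fun z hz => (hx z hz).2.1) (list_prod_ne_zero fun z hz => (hx z hz).2.2)

theorem pairwise_tube_ends (hδ : 0 < δ) (hL : L.Pairwise (TubeRel δ)) (hx : ∀ z ∈ L, TubeRel δ x z) :
    (x :: L ++ [x - π * I]).Pairwise (TubeRel δ) := by
  have hpi := pi_pos; rw [pairwise_append_singleton, pairwise_cons]
  refine ⟨⟨hx, hL⟩, fun z hz => ?_⟩
  rcases mem_cons.1 hz with rfl | hz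
  · simp [TubeRel, hδ]; linarith
  · have := hx z hz; simp only [TubeRel, sub_im] at this; simp [TubeRel]; constructor <;> linarith

/-- All conditions are open and hold at the limit point, except for the pole factor between the two
ends. That one is `-i sinh ((v - u) / 2)` and is nonzero because `u ≠ v`. -/
theorem eventually_pairwise_regRel (hδ : 0 < δ) (hδ1 : δ ≤ 1 / 2) (hL : L.Pairwise (RegRel δ))
    (hx : ∀ z ∈ L, TubeRel δ x z ∧ cosh ((x - z) / 2) ≠ 0 ∧
      cosh ((z - (x - π * I)) / 2) ≠ 0) {ι : Type*} {l : Filter ι} {u v : ι → ℂ}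
    (hu : Tendsto u l (𝓝 x)) (hv : Tendsto v l (𝓝 x)) (huv : ∀ᶠ i in l, u i ≠ v i) :
    ∀ᶠ i in l, (u i :: L ++ [v i - π * I]).Pairwise (RegRel δ) := by
  have hpi := two_le_pi; have im1 : ∀ w : ℂ, (w - π * I).im = w.im - π := fun w => by simp
  have evl : ∀ (φ : ℂ → ℂ) (U : Set ℂ) (w : ι → ℂ), Tendsto w l (𝓝 x) → Continuous φ → IsOpen U →
      φ x ∈ U → ∀ᶠ i in l, φ (w i) ∈ U := fun φ U w hw hφ hU h =>
    hw.eventually (hφ.continuousAt.eventually (hU.mem_nhds h))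
  have hset : IsOpen {z : ℂ | -δ < z.im ∧ z.im < π + δ ∧ cosh (z / 2) ≠ 0} :=
    (isOpen_lt continuous_const continuous_im).inter ((isOpen_lt continuous_im continuous_const).inter
      (isOpen_ne.preimage (continuous_cosh.comp (continuous_id.div_const 2))))
  have h1 : ∀ᶠ i in l, ∀ z ∈ {z | z ∈ L}, RegRel δ z (v i - π * I) := by
    rw [eventually_all_finite (finite_toSet L)]; intro z hz; have t := (hx z hz).1
    simp only [TubeRel, sub_im] at t
    filter_upwards [evl (fun w => z - (w - π * I)) _ v hv (by fun_prop) hset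
      ⟨by rw [sub_im, im1]; linarith, by rw [sub_im, im1]; linarith, (hx z hz).2.2⟩] with i hi
    exact ⟨⟨hi.1, hi.2.1⟩, hi.2.2⟩
  have h3 : ∀ᶠ i in l, ∀ z ∈ {z | z ∈ L}, RegRel δ (u i) z := by
    rw [eventually_all_finite (finite_toSet L)]; intro z hz; have t := (hx z hz).1
    filter_upwards [evl (fun w => w - z) _ u hu (by fun_prop) hset
      ⟨t.1, t.2, (hx z hz).2.1⟩] with i hi
    exact ⟨⟨hi.1, hi.2.1⟩, hi.2.2⟩
  have h2 : ∀ᶠ i in l, |(v i - u i).im| < δ := by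
    have := (continuous_abs.comp continuous_im).continuousAt.eventually
      (IsOpen.mem_nhds isOpen_Iio (show |(0 : ℂ).im| ∈ Iio δ by simpa using hδ))
    have hvu : Tendsto (fun i => v i - u i) l (𝓝 0) := by simpa using hv.sub hu
    exact hvu.eventually this
  filter_upwards [h1, h2, h3, huv] with i h1 h2 h3 h4
  rw [cons_append, pairwise_cons, pairwise_append_singleton]; refine ⟨fun z hz => ?_, hL, h1⟩
  rw [mem_append, List.mem_singleton] at hz; rcases hz with hz | rfl
  · exact h3 z hz
  · rw [abs_lt, sub_im] at h2
    refine ⟨⟨by rw [sub_im, im1]; linarith, by rw [sub_im, im1]; linarith⟩, ?_⟩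
    rw [show u i - (v i - π * I) = π * I - (v i - u i) by ring, cosh_half_pi_sub]
    refine mul_ne_zero (neg_ne_zero.2 I_ne_zero) (sinh_ne_zero_of_im ?_ ?_)
    · exact div_ne_zero (sub_ne_zero.2 h4.symm) two_ne_zero
    · rw [show ((v i - u i) / 2).im = ((v i).im - (u i).im) / 2 by simp, abs_lt]
      constructor <;> linarith

/-- The residue in terms of the analytic function `g = a * poleL`. -/
theorem PoleData.tendsto_residue (hg : PoleData f g δ N) (hN : L.length + 2 ≤ N) (hL : L.Pairwise (RegRel δ))
    (hx : ∀ z ∈ L, TubeRel δ x z ∧ cosh ((x - z) / 2) ≠ 0 ∧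
      cosh ((z - (x - π * I)) / 2) ≠ 0) {ι : Type*} {l : Filter ι} {u v : ι → ℂ}
    (hu : Tendsto u l (𝓝 x)) (hv : Tendsto v l (𝓝 x)) (huv : ∀ᶠ i in l, u i ≠ v i) :
    Tendsto (fun i => (v i - u i) * f (u i :: L ++ [v i - π * I])) l
      (𝓝 (I * 2 * (g (x :: L ++ [x - π * I]) / (coshL x L * poleL L)))) := by
  have tub := pairwise_tube_ends hg.pos (hL.imp fun h => h.1) fun z hz => (hx z hz).1
  have hvu : Tendsto (fun i => v i - u i) l (𝓝[≠] 0) := by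
    refine tendsto_nhdsWithin_iff.2 ⟨by simpa using hv.sub hu, ?_⟩
    filter_upwards [huv] with i hi
    exact sub_ne_zero.2 hi.symm
  have hgc : Tendsto (fun i => g (u i :: L ++ [v i - π * I])) l
      (𝓝 (g (x :: L ++ [x - π * I]))) := by
    set M : List (ℂ × ℂ → ℂ) := (fun p => p.1) :: (L.map fun z _ => z) ++ [fun p => p.2 - π * I] with hM
    have e : ∀ p, M.map (fun φ => φ p) = p.1 :: L ++ [p.2 - π * I] := by
      intro w; simp [hM, comp_def]
    have h := HoloAt.continuousAt_comp (f := g) M (fun φ w => φ w) (x := (x, x)) (by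
      rw [e]; exact hg.holo _ (by simp; omega) tub) (by
      intro φ hφ; simp only [hM, cons_append, mem_cons, mem_append, mem_map,
        List.not_mem_nil, or_false] at hφ
      rcases hφ with rfl | ⟨z, -, rfl⟩ | rfl <;> fun_prop)
    have h' := h.tendsto.comp (hu.prodMk_nhds hv); simpa only [e, comp_def] using h'
  have hcosh : ∀ (φ : ℂ → ℂ) (w : ι → ℂ), Tendsto w l (𝓝 x) → Continuous φ →
      Tendsto (fun i => cosh (φ (w i))) l (𝓝 (cosh (φ x))) := fun φ w hw hφ =>
    (continuous_cosh.comp hφ).continuousAt.tendsto.comp hw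
  have hden : Tendsto (fun i => (L.map fun z => cosh ((z - (v i - π * I)) / 2)).prod) l
      (𝓝 (L.map fun z => cosh ((z - (x - π * I)) / 2)).prod) :=
    tendsto_list_prod _ _ _ fun z _ => hcosh (fun w => (z - (w - π * I)) / 2) v hv (by fun_prop)
  have hden1 : Tendsto (fun i => (L.map fun z => cosh ((u i - z) / 2)).prod) l
      (𝓝 (L.map fun z => cosh ((x - z) / 2)).prod) :=
    tendsto_list_prod _ _ _ fun z _ => hcosh (fun w => (w - z) / 2) u hu (by fun_prop)
  -- The only factor of `poleL` that tends to zero is `-i sinh ((v - u) / 2)`. The quotient of `v -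
  -- u` by `sinh ((v - u) / 2)` tends to `2`, and all other factors are continuous.
  have lim := (((tendsto_div_sinh_half 0).comp hvu).const_mul I).mul (hgc.div
    ((hden1.mul hden).mul_const (poleL L)) (mul_ne_zero (coshL_ne_zero hx) (poleL_ne_zero hL)))
  refine lim.congr' ?_
  filter_upwards [eventually_pairwise_regRel hg.pos hg.le hL hx hu hv huv] with i hw
  rw [hg.eq_div _ (by simp; omega) hw]
  have e1 : poleL (u i :: L ++ [v i - π * I]) = (-I * sinh ((v i - u i) / 2)) *
      ((L.map fun z => cosh ((u i - z) / 2)).prod *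
        (L.map fun z => cosh ((z - (v i - π * I)) / 2)).prod * poleL L) := by
    rw [cons_append, poleL, poleL_append_singleton, map_append, prod_append,
      ← cosh_half_pi_sub]
    simp only [map_cons, map_nil, prod_cons, prod_nil, mul_one]
    rw [show u i - (v i - π * I) = π * I - (v i - u i) by ring]; ring
  rw [e1]; have hI : (-I : ℂ)⁻¹ = I := by rw [inv_neg, inv_I, neg_neg]
  have alg : ∀ u s c d : ℂ, I * (u / s) * (c / d) = u * (c / (-I * s * d)) := by
    intro u s c d; simp only [div_eq_mul_inv, mul_inv, hI]; ring
  simp only [comp_apply, sub_zero]; exact alg _ _ _ _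

theorem pairwise_regRel_ofReal {δ : ℝ} (hδ : 0 < δ) (L : List ℝ) :
    (L.map fun x : ℝ => (x : ℂ)).Pairwise (RegRel δ) := by
  have hpi := pi_pos; rw [pairwise_map]
  refine List.pairwise_of_forall fun x y => ⟨⟨by simpa using hδ, by simp; linarith⟩, ?_⟩
  rw [← ofReal_sub, show ((x - y : ℝ) : ℂ) / 2 = ((x - y) / 2 : ℝ) by push_cast; rfl, ← ofReal_cosh,
    ne_eq, ofReal_eq_zero]
  exact (cosh_pos _).ne'

theorem cosh_shift_ne_zero {x z : ℝ} (h : z ≠ x) :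
    cosh (((z : ℂ) - (x - π * I)) / 2) ≠ 0 := by
  rw [show ((z : ℂ) - (x - π * I)) = π * I - ((x - z : ℝ) : ℂ) by push_cast; ring,
    cosh_half_pi_sub]
  refine mul_ne_zero (neg_ne_zero.2 I_ne_zero) (sinh_ne_zero_of_im ?_ ?_)
  · rw [ne_eq, div_eq_zero_iff, ofReal_eq_zero]; simpa [sub_eq_zero] using h.symm
  · rw [show (((x - z : ℝ) : ℂ) / 2).im = 0 by simp, abs_zero]; exact pi_pos

/-- The identity between analytic functions that expresses the kinematic pole relation. -/
def KinIdentity (S : ℂ → ℂ) (g : List ℂ → ℂ) (x : ℂ) (L : List ℂ) : Prop :=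
  2 * g (x :: L ++ [x - π * I]) = (1 - (L.map fun z => S (x - z)).prod) * g L * coshL x L

/-- A cyclic step carries `(ϑ + iπ + iε, ϑ, θ)` to `(ϑ, θ, ϑ - iπ + iε)`, whose residue is known in
terms of `g`. Uniqueness of limits equates it with the residue prescribed for `f`. -/
theorem PoleData.kinIdentity_of_ne (hg : PoleData f g δ N) (ϑ : ℝ) (θ : List ℝ) (hN : θ.length + 2 ≤ N)
    (hy : ∀ x ∈ θ, x ≠ ϑ)
    (hkin : Tendsto (fun ε : ℂ => ε * f ((ϑ + π * I + I * ε) :: (ϑ : ℂ) :: θ.map ofReal))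
      (𝓝[≠] 0) (𝓝 ((1 - ((θ.map ofReal).map fun z => S (ϑ - z)).prod) * f (θ.map ofReal)))) :
    KinIdentity S g ϑ (θ.map ofReal) := by
  have hδ := hg.pos; have hpi := pi_pos; set M : List ℂ := θ.map ofReal with hM
  have hMreg : M.Pairwise (RegRel δ) := pairwise_regRel_ofReal hδ _
  have hMlen : M.length = θ.length := by simp [hM]
  have hcond : ∀ z ∈ M, TubeRel δ ϑ z ∧ cosh ((ϑ - z) / 2) ≠ 0 ∧
      cosh ((z - (ϑ - π * I)) / 2) ≠ 0 := by
    intro z hz; rw [hM, mem_map] at hz; obtain ⟨u, hu, rfl⟩ := hz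
    refine ⟨by simp [TubeRel]; constructor <;> linarith, ?_, cosh_shift_ne_zero (hy u hu)⟩
    rw [← ofReal_sub, show ((ϑ - u : ℝ) : ℂ) / 2 = ((ϑ - u) / 2 : ℝ) by push_cast; rfl,
      ← ofReal_cosh, ne_eq, ofReal_eq_zero]
    exact (cosh_pos _).ne'
  have htend : Tendsto (fun ε : ℂ => (ϑ : ℂ) + I * ε) (𝓝[≠] 0) (𝓝 (ϑ : ℂ)) := by
    have : Continuous fun ε : ℂ => (ϑ : ℂ) + I * ε := by fun_prop
    exact (this.tendsto' 0 _ (by simp)).mono_left nhdsWithin_le_nhds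
  have huv : ∀ᶠ ε in 𝓝[≠] (0 : ℂ), (ϑ : ℂ) ≠ ϑ + I * ε := by
    filter_upwards [self_mem_nhdsWithin] with ε hε
    simpa using hε
  have hres' := (hg.tendsto_residue (by rw [hMlen]; exact hN) hMreg hcond tendsto_const_nhds htend
    huv).const_mul (-I)
  have hev : ∀ᶠ ε in 𝓝[≠] (0:ℂ), ε * f ((ϑ + π * I + I * ε) :: (ϑ : ℂ) :: M) = -I * ((ϑ + I * ε - ϑ) *
        f (↑ϑ :: M ++ [ϑ + I * ε - π * I])) := by
    have hsmall : ∀ᶠ ε in 𝓝 (0:ℂ), |ε.re| < δ := by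
      have c1 : Continuous fun w : ℂ => |w.re| := by fun_prop
      exact c1.continuousAt.eventually (IsOpen.mem_nhds isOpen_Iio (by simpa using hδ))
    filter_upwards [nhdsWithin_le_nhds hsmall, eventually_pairwise_regRel hδ hg.le hMreg hcond
      tendsto_const_nhds htend huv] with ε hs reg2
    rw [abs_lt] at hs; have e2 : ϑ + π * I + I * ε - 2 * π * I = ϑ + I * ε - π * I := by ring
    rw [hg.cyc _ _ (by simp [hMlen]; omega) (pairwise_cons.2 ⟨fun z hz => ?_,
      (pairwise_append_singleton.1 reg2).1⟩) (by rwa [e2]), e2, add_sub_cancel_left]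
    · linear_combination (ε * f ((ϑ : ℂ) :: M ++ [ϑ + I * ε - π * I])) * I_mul_I
    · have h := (pairwise_append_singleton.1 reg2).2 z hz; have hz0 : z.im = 0 := by
        rcases mem_cons.1 hz with rfl | hz
        · simp
        · obtain ⟨u, -, rfl⟩ := mem_map.1 hz; simp
      refine ⟨by simp [TubeRel, hz0]; constructor <;> linarith, ?_⟩
      rw [show ϑ + π * I + I * ε - z = -(z - (ϑ + I * ε - π * I)) + 2 * π * I by ring,
        cosh_half_sub_two_pi, neg_div, cosh_neg]
      exact neg_ne_zero.2 h.2
  have huniq := tendsto_nhds_unique (hkin.congr' hev) hres'; have n2 := poleL_ne_zero hMreg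
  rw [hg.eq_div M (by omega) hMreg, mul_div_assoc', mul_div_assoc', mul_div_assoc',
    div_eq_div_iff n2 (mul_ne_zero (coshL_ne_zero hcond) n2)] at huniq
  rw [KinIdentity]; refine mul_right_cancel₀ n2 ?_
  linear_combination (2 * g ((ϑ : ℂ) :: M ++ [ϑ - π * I]) * poleL M) * I_mul_I - huniq

/-- A small displacement of the coordinate `y 0` alone avoids the finitely many coincidences, and
`E` is continuous. The pole relation is assumed only for rapidities different from `ϑ`, so the
coincident points have to be recovered in this way. -/
theorem zero_of_off_diagonal {n : ℕ} {E : (Fin (n + 1) → ℂ) → ℂ}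
    (hE : ∀ y : Fin (n + 1) → ℝ, ContinuousAt E fun i => (y i : ℂ))
    (h0 : ∀ y : Fin (n + 1) → ℝ, (∀ i : Fin n, y i.succ ≠ y 0) → E (fun i => (y i : ℂ)) = 0)
    (y : Fin (n + 1) → ℝ) : E (fun i => (y i : ℂ)) = 0 := by
  set φ : ℝ → Fin (n + 1) → ℝ := fun s => Fin.cons (y 0 + s) (Fin.tail y) with hφ
  have hφ0 : φ 0 = y := by simp [hφ]
  have hφc : Continuous fun s => (fun i => ((φ s i : ℝ) : ℂ)) := by
    refine continuous_pi fun i => continuous_ofReal.comp ?_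
    refine Fin.cases ?_ (fun i => ?_) i
    · simp only [hφ, Fin.cons_zero]; fun_prop
    · simp only [hφ, Fin.cons_succ]; fun_prop
  have hc : ContinuousAt (fun s => E (fun i => ((φ s i : ℝ) : ℂ))) 0 :=
    ContinuousAt.comp (g := E) (hE (φ 0)) hφc.continuousAt
  have hfin : Set.Finite (Set.range fun i : Fin n => y i.succ - y 0) := Set.finite_range _
  have hev : ∀ᶠ s in 𝓝[≠] (0:ℝ), E (fun i => ((φ s i : ℝ) : ℂ)) = 0 := by
    have h2 : ∀ᶠ s in 𝓝[≠] (0:ℝ), s ∉ (Set.range fun i : Fin n => y i.succ - y 0) \ {0} :=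
      nhdsWithin_le_nhds (((hfin.subset sdiff_subset).isClosed.isOpen_compl).mem_nhds (by simp))
    filter_upwards [h2, self_mem_nhdsWithin] with s hs hs0
    refine h0 _ fun i hi => hs ⟨⟨i, ?_⟩, hs0⟩
    simp only [hφ, Fin.cons_succ, Fin.cons_zero, Fin.tail] at hi; simp only [hi]; ring
  have hlim := (hc.tendsto.mono_left (nhdsWithin_le_nhds (s := {0}ᶜ))).congr' hev
  have := tendsto_nhds_unique hlim tendsto_const_nhds; rwa [hφ0] at this

-- Written for `g` with the pole factors multiplied out, both sides of the identity are analytic on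
-- the whole tube, so it suffices to know it at real points. Off the coincidences these are covered
-- by the hypothesis, and the rest follows by continuity.
set_option maxHeartbeats 600000 in
theorem KinIdentity.extend {δ0 B : ℝ} (hS : StripS S δ0 B) (hg : PoleData f g δ N) (hδ0 : δ ≤ δ0)
    (h : ∀ (ϑ : ℝ) (θ : List ℝ), θ.length + 2 ≤ N → (∀ x ∈ θ, x ≠ ϑ) →
      KinIdentity S g ϑ (θ.map ofReal))
    (hN : L.length + 2 ≤ N) (hL : (x :: L).Pairwise (TubeRel δ)) : KinIdentity S g x L := by
  have hδ := hg.pos; set n := L.length with hn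
  set tl : (Fin (n + 1) → ℂ) → List ℂ := fun ξ => ofFn (Fin.tail ξ) with htl
  set E : (Fin (n + 1) → ℂ) → ℂ := fun ξ => 2 * g (ξ 0 :: tl ξ ++ [ξ 0 - π * I]) -
    (1 - ((tl ξ).map fun z => S (ξ 0 - z)).prod) * g (tl ξ) * coshL (ξ 0) (tl ξ) with hEdef
  have hpw : ∀ ξ ∈ tube (n + 1) δ, (tl ξ).Pairwise (TubeRel δ) ∧ (∀ z ∈ tl ξ, TubeRel δ (ξ 0) z) := by
    intro ξ hξ; constructor
    · rw [htl, List.pairwise_ofFn]; intro i j hij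
      exact hξ i.succ j.succ (Fin.succ_lt_succ_iff.2 hij)
    · intro z hz; simp only [htl, mem_ofFn, Fin.tail] at hz; obtain ⟨i, rfl⟩ := hz
      exact hξ 0 i.succ (Fin.succ_pos i)
  have hpi := pi_pos; have htlmap : ∀ ξ, tl ξ = (finRange n).map fun i => ξ i.succ := by
    intro ξ; rw [← ofFn_eq_map]; rfl
  have hEd : DifferentiableOn ℂ E (tube (n + 1) δ) := by
    intro ξ hξ; refine DifferentiableAt.differentiableWithinAt ?_
    have p0 : ∀ i : Fin (n + 1), DifferentiableAt ℂ (fun ξ : Fin (n + 1) → ℂ => ξ i) ξ := fun i =>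
      differentiableAt_apply i ξ
    have d1 : DifferentiableAt ℂ (fun ξ => g (ξ 0 :: tl ξ ++ [ξ 0 - π * I])) ξ := by
      set M : List ((Fin (n + 1) → ℂ) → ℂ) := (fun ξ => ξ 0) ::
        ((finRange n).map fun i ξ => ξ i.succ) ++ [fun ξ => ξ 0 - π * I] with hM
      have e : ∀ ξ, M.map (fun φ => φ ξ) = ξ 0 :: tl ξ ++ [ξ 0 - π * I] := by
        intro ξ; rw [htlmap]; simp [hM, comp_def]
      have h := HoloAt.comp (f := g) M (fun φ ξ => φ ξ) (x := ξ) (by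
        rw [e]; exact hg.holo _ (by simp [htl]; omega) (pairwise_tube_ends hδ (hpw ξ hξ).1 (hpw ξ hξ).2)) (by
        intro φ hφ; simp only [hM, cons_append, mem_cons, mem_append, mem_map,
          List.not_mem_nil, or_false] at hφ
        rcases hφ with rfl | ⟨z, -, rfl⟩ | rfl
        · exact p0 0
        · exact p0 _
        · exact (p0 0).sub_const _)
      simpa only [e] using h
    have d2 : DifferentiableAt ℂ (fun ξ => g (tl ξ)) ξ := by
      simp only [htlmap]
      refine HoloAt.comp (f := g) (finRange n) (fun i (ξ : Fin (n + 1) → ℂ) => ξ i.succ) ?_ fun i _ => p0 _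
      rw [← htlmap]; exact hg.holo _ (by simp [htl]; omega) (hpw ξ hξ).1
    have d3 : DifferentiableAt ℂ (fun ξ => ((tl ξ).map fun z => S (ξ 0 - z)).prod) ξ := by
      simp only [htlmap, map_map, comp_def]
      refine differentiableAt_list_prod (fun i (ξ : Fin (n + 1) → ℂ) => S (ξ 0 - ξ (Fin.succ i))) _ fun i _ => ?_
      have h := (hpw ξ hξ).2 (ξ i.succ) (by rw [htlmap]; simp)
      exact (hS.diff _ (by linarith [h.1]) (by linarith [h.2])).comp ξ ((p0 0).sub (p0 _))
    have d4 : DifferentiableAt ℂ (fun ξ => ((tl ξ).map fun z => cosh ((ξ 0 - z) / 2)).prod) ξ := by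
      simp only [htlmap, map_map, comp_def]
      exact differentiableAt_list_prod (fun i (ξ : Fin (n + 1) → ℂ) => cosh ((ξ 0 - ξ (Fin.succ i)) / 2)) _
        fun i _ => by fun_prop
    have d5 : DifferentiableAt ℂ (fun ξ => ((tl ξ).map fun z =>
        cosh ((z - (ξ 0 - π * I)) / 2)).prod) ξ := by
      simp only [htlmap, map_map, comp_def]; exact differentiableAt_list_prod
        (fun i (ξ : Fin (n + 1) → ℂ) => cosh ((ξ (Fin.succ i) - (ξ 0 - π * I)) / 2)) _
        fun i _ => by fun_prop
    exact (d1.const_mul 2).sub (((d3.const_sub 1).mul d2).mul (d4.mul d5))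
  have hrealmem : ∀ y : Fin (n + 1) → ℝ, (fun i => (y i : ℂ)) ∈ tube (n + 1) δ := by
    intro y i j _; simp; constructor <;> linarith
  have h0 : ∀ y : Fin (n + 1) → ℝ, (∀ i : Fin n, y i.succ ≠ y 0) → E (fun i => (y i : ℂ)) = 0 := by
    intro y hy; have hk := h (y 0) (ofFn fun i => y (Fin.succ i)) (by simpa using hN) (by
      intro u hu; rw [mem_ofFn] at hu; obtain ⟨i, rfl⟩ := hu; exact hy i)
    rw [map_ofFn] at hk; exact sub_eq_zero.2 hk
  have h1 := zero_of_off_diagonal (fun y =>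
    (hEd.differentiableAt ((isOpen_tube _ _).mem_nhds (hrealmem y))).continuousAt) h0
  have hfinal := eq_zero_of_real_points (isOpen_tube _ _) (convex_tube _ _) hEd (fun y _ => h1 y)
    (fun ζ _ => hrealmem fun i => (ζ i).re) (ζ := (x :: L).get)
    (mem_tube_of_pairwise le_rfl rfl hL)
  have e3 : tl (x :: L).get = L := by rw [htl]; exact ofFn_get L
  have e4 : (x :: L).get 0 = x := rfl; simp only [hEdef] at hfinal; rw [e3, e4] at hfinal
  exact sub_eq_zero.1 hfinal

/-! ### Rotation of several variables -/

/-- An entire test function on `ℂ²`. -/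
def gauss (A : ℝ) (q ζ : Fin 2 → ℂ) : ℂ :=
  exp (-A * ((ζ 0 - q 0) ^ 2 + (ζ 1 - q 1) ^ 2))

theorem differentiable_gauss (A : ℝ) (q : Fin 2 → ℂ) : Differentiable ℂ (gauss A q) := by
  unfold gauss; fun_prop

theorem exp_mul_gauss_le {A : ℝ} (hA : 0 < A) (r B : ℝ) (hr : 0 ≤ r) (q : Fin 2 → ℂ) :
    ∃ C : ℝ, 0 ≤ C ∧ ∀ ζ : Fin 2 → ℂ, (∀ i, |(ζ i).im| ≤ B) →
      rexp (r * (|(ζ 0).re| + |(ζ 1).re|)) * ‖gauss A q ζ‖ ≤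
        C * rexp (-(|(ζ 0).re| + |(ζ 1).re|)) := by
  have key : ∀ p : ℂ, ∃ c : ℝ, ∀ z : ℂ, |z.im| ≤ B →
      (r + 1) * |z.re| - A * ((z - p) ^ 2).re ≤ c := by
    intro p
    refine ⟨(r + 1) ^ 2 / (4 * A) + (r + 1) * |p.re| + A * (B + |p.im|) ^ 2, fun z hz => ?_⟩
    have h1 : ((z - p) ^ 2).re = (z.re - p.re) ^ 2 - (z.im - p.im) ^ 2 := by
      rw [sq, mul_re, sub_re, sub_im]; ring
    have h2 : |z.re| ≤ |z.re - p.re| + |p.re| := by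
      have := abs_add_le (z.re - p.re) p.re; simpa using this
    have h3 : (z.im - p.im) ^ 2 ≤ (B + |p.im|) ^ 2 := by
      rw [← sq_abs]; refine pow_le_pow_left₀ (abs_nonneg _) ((abs_sub _ _).trans (by linarith)) 2
    have h4 : (r + 1) * |z.re - p.re| ≤ (r + 1) ^ 2 / (4 * A) + A * (z.re - p.re) ^ 2 := by
      have h5 : (r + 1) ^ 2 / (4 * A) + A * (z.re - p.re) ^ 2 - (r + 1) * |z.re - p.re| =
          A * (|z.re - p.re| - (r + 1) / (2 * A)) ^ 2 := by
        rw [← sq_abs (z.re - p.re)]; field_simp; ring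
      have : 0 ≤ A * (|z.re - p.re| - (r + 1) / (2 * A)) ^ 2 := by positivity
      linarith
    rw [h1]; nlinarith
  obtain ⟨c0, h0⟩ := key (q 0); obtain ⟨c1, h1⟩ := key (q 1)
  refine ⟨rexp (c0 + c1), (exp_pos _).le, fun ζ hζ => ?_⟩
  rw [gauss, norm_exp, ← Real.exp_add, ← Real.exp_add, exp_le_exp]; have := h0 _ (hζ 0)
  have := h1 _ (hζ 1); have e : (-(A : ℂ) * ((ζ 0 - q 0) ^ 2 + (ζ 1 - q 1) ^ 2)).re =
      -(A * ((ζ 0 - q 0) ^ 2).re) - A * ((ζ 1 - q 1) ^ 2).re := by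
    rw [← ofReal_neg, re_ofReal_mul, add_re]; ring
  rw [e]; linarith

theorem tendsto_norm_pow_mul_gauss : Tendsto (fun x : Fin 2 → ℝ => ‖x‖ ^ 2 *
    (π⁻¹ * rexp (-∑ i, x i ^ 2))) (Bornology.cobounded _) (𝓝 0) := by
  have h1 : Tendsto (fun y : ℝ => π⁻¹ * (y * rexp (-y))) atTop (𝓝 0) := by
    have := (Real.tendsto_pow_mul_exp_neg_atTop_nhds_zero 1).const_mul π⁻¹; simpa using this
  have h2 : Tendsto (fun x : Fin 2 → ℝ => ‖x‖ ^ 2) (Bornology.cobounded _) atTop :=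
    (tendsto_pow_atTop two_ne_zero).comp tendsto_norm_cobounded_atTop
  refine squeeze_zero (fun x => by positivity) (fun x => ?_) (h1.comp h2)
  simp only [comp_apply]; have : ‖x‖ ^ 2 ≤ ∑ i, x i ^ 2 := by
    obtain ⟨i, hi⟩ : ∃ i, ‖x‖ = ‖x i‖ := by
      obtain ⟨i, -, hi⟩ := Finset.exists_mem_eq_sup Finset.univ Finset.univ_nonempty fun i => ‖x i‖₊
      exact ⟨i, by rw [Pi.norm_def, hi]; rfl⟩
    rw [hi, norm_eq_abs, sq_abs]
    exact single_le_sum (f := fun i => x i ^ 2) (fun i _ => sq_nonneg _) (Finset.mem_univ i)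
  have := exp_le_exp.2 (neg_le_neg this); have hpi := pi_pos
  calc ‖x‖ ^ 2 * (π⁻¹ * rexp (-∑ i, x i ^ 2))
      ≤ ‖x‖ ^ 2 * (π⁻¹ * rexp (-‖x‖ ^ 2)) := by gcongr
    _ = _ := by ring

/-- Gaussians of growing steepness form an approximate identity at `p`. Since `h` may grow
exponentially, one factor `gauss 1` is split off to make it integrable; the kernel of scale `c`
therefore corresponds to `A = c ^ 2 + 1`. -/
theorem eq_zero_of_integral_gauss {h : (Fin 2 → ℝ) → ℂ} (hc : Continuous h) {C r : ℝ} (hr : 0 ≤ r)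
    (hb : ∀ t, ‖h t‖ ≤ C * rexp (r * (|t 0| + |t 1|))) (p : Fin 2 → ℝ)
    (h0 : ∀ A : ℝ, 0 < A → ∫ t : Fin 2 → ℝ, h t * gauss A (fun i => p i) (fun i => t i) = 0) : h p = 0 := by
  set q : Fin 2 → ℂ := fun i => p i
  set k : (Fin 2 → ℝ) → ℂ := fun t => h t * gauss 1 q (fun i => t i) with hk
  have hg : ∀ A, Continuous fun t : Fin 2 → ℝ => gauss A q (fun i => t i) := fun A =>
    (differentiable_gauss A q).continuous.comp (continuous_pi fun i =>
      continuous_ofReal.comp (continuous_apply i))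
  have hkc : Continuous k := hc.mul (hg 1); obtain ⟨D, hD0, hD⟩ := exp_mul_gauss_le one_pos r 0 hr q
  have hki : Integrable k := by
    refine integrable_of_weight hkc.aestronglyMeasurable (C := |C| * D) fun t => ?_
    rw [hk, norm_mul]; have := hD (fun i => t i) (by simp)
    simp only [ofReal_re] at this
    calc ‖h t‖ * ‖gauss 1 q fun i => t i‖
        ≤ (|C| * rexp (r * (|t 0| + |t 1|))) * ‖gauss 1 q fun i => t i‖ := by
          refine mul_le_mul_of_nonneg_right ((hb t).trans ?_) (norm_nonneg _)
          exact mul_le_mul_of_nonneg_right (le_abs_self C) (exp_pos _).le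
      _ ≤ |C| * (D * rexp (-(|t 0| + |t 1|))) := by
          rw [mul_assoc]; exact mul_le_mul_of_nonneg_left this (abs_nonneg _)
      _ = |C| * D * weight t := by rw [weight, Fin.sum_univ_two]; ring
  have hInt : ∫ x : Fin 2 → ℝ, π⁻¹ * rexp (-∑ i, x i ^ 2) = 1 := by
    rw [integral_const_mul]
    have : ∀ x : Fin 2 → ℝ, rexp (-∑ i, x i ^ 2) = ∏ i, rexp (-1 * x i ^ 2) := by
      intro x; rw [← Real.exp_sum]; congr 1; simp
    simp only [this]
    rw [integral_fintype_prod_volume_eq_prod (fun _ : Fin 2 => fun y : ℝ => rexp (-1 * y ^ 2))]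
    simp only [integral_gaussian]; rw [Fin.prod_univ_two, div_one, Real.mul_self_sqrt pi_pos.le,
      inv_mul_cancel₀ Real.pi_ne_zero]
  have hfr : Module.finrank ℝ (Fin 2 → ℝ) = 2 := by simp
  have hlim := tendsto_integral_comp_smul_smul_of_integrable' (μ := (volume : Measure (Fin 2 → ℝ)))
    (φ := fun x : Fin 2 → ℝ => π⁻¹ * rexp (-∑ i, x i ^ 2)) (fun x => by
      have := pi_pos; positivity) hInt (by rw [hfr]; exact tendsto_norm_pow_mul_gauss) hki
      (x₀ := p) hkc.continuousAt
  have hz : ∀ c : ℝ, ∫ x : Fin 2 → ℝ, (c ^ Module.finrank ℝ (Fin 2 → ℝ) * (π⁻¹ *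
      rexp (-∑ i, (c • (p - x)) i ^ 2))) • k x = 0 := by
    intro c; have e : ∀ x : Fin 2 → ℝ, (c ^ Module.finrank ℝ (Fin 2 → ℝ) * (π⁻¹ *
      rexp (-∑ i, (c • (p - x)) i ^ 2))) • k x = ((c ^ 2 * π⁻¹ : ℝ) : ℂ) *
        (h x * gauss (c ^ 2 + 1) q (fun i => x i)) := by
      intro x; rw [hfr, hk, real_smul]; have : gauss (c ^ 2 + 1) q (fun i => x i) =
          (rexp (-∑ i, (c • (p - x)) i ^ 2) : ℂ) * gauss 1 q (fun i => x i) := by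
        rw [ofReal_exp, gauss, gauss, ← exp_add, Fin.sum_univ_two]; congr 1
        simp only [Pi.smul_apply, Pi.sub_apply, smul_eq_mul, q]; push_cast; ring
      rw [this]; push_cast; ring
    simp only [e]; rw [integral_const_mul, h0 _ (by positivity), mul_zero]
  simp only [hz] at hlim; have h1 := tendsto_nhds_unique hlim tendsto_const_nhds
  have h2 : gauss 1 q (fun i => (p i : ℂ)) = 1 := by simp [gauss, q]
  simpa [hk, h2] using h1

/-- An affine function of two variables. -/
def affine (e : ℂ × ℝ × ℝ) (ζ : Fin 2 → ℂ) : ℂ := e.1 + e.2.1 * ζ 0 + e.2.2 * ζ 1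

theorem differentiable_affine (e : ℂ × ℝ × ℝ) : Differentiable ℂ (affine e) := by
  unfold affine; fun_prop

theorem affine_im (e : ℂ × ℝ × ℝ) (ζ : Fin 2 → ℂ) :
    (affine e ζ).im = e.1.im + e.2.1 * (ζ 0).im + e.2.2 * (ζ 1).im := by simp [affine]

/-- The tube condition at both ends of a shift of the two variables by `i v0`, `i v1`. -/
def AffineRel (v0 v1 : ℝ) (e e' : ℂ × ℝ × ℝ) : Prop :=
  (0 ≤ e.1.im - e'.1.im ∧ e.1.im - e'.1.im ≤ π) ∧
  0 ≤ e.1.im - e'.1.im + (e.2.1 - e'.2.1) * v0 + (e.2.2 - e'.2.2) * v1 ∧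
  e.1.im - e'.1.im + (e.2.1 - e'.2.1) * v0 + (e.2.2 - e'.2.2) * v1 ≤ π

theorem sum_abs_affine_le (M : List (ℂ × ℝ × ℝ)) : ∃ D k : ℝ, 0 ≤ k ∧ ∀ ζ : Fin 2 → ℂ,
    ((M.map fun e => affine e ζ).map fun z => |z.re|).sum ≤ D + k * (|(ζ 0).re| + |(ζ 1).re|) := by
  induction M with
  | nil => exact ⟨0, 0, le_rfl, by simp⟩
  | cons e M ih =>
    obtain ⟨D, k, hk, h⟩ := ih
    refine ⟨D + |e.1.re|, k + (|e.2.1| + |e.2.2|), by positivity, fun ζ => ?_⟩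
    simp only [map_cons, sum_cons]
    have h1 : (affine e ζ).re = e.1.re + e.2.1 * (ζ 0).re + e.2.2 * (ζ 1).re := by simp [affine]
    have h2 := abs_add_three e.1.re (e.2.1 * (ζ 0).re) (e.2.2 * (ζ 1).re)
    rw [abs_mul, abs_mul] at h2; rw [h1]; have := h ζ; have a0 := abs_nonneg (ζ 0).re
    have a1 := abs_nonneg (ζ 1).re; have b0 := abs_nonneg e.2.1; have b1 := abs_nonneg e.2.2
    nlinarith [mul_nonneg b0 a1, mul_nonneg b1 a0]

/-- Properties of the analytic function `a * poleL`. -/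
structure AnalyticCyc (g : List ℂ → ℂ) (δ C r : ℝ) (N : ℕ) : Prop where
  pos : 0 < δ
  holo : ∀ L : List ℂ, L.length ≤ N → L.Pairwise (TubeRel δ) → HoloAt g L
  nonneg : 0 ≤ r
  bound : ∀ L : List ℂ, L.length ≤ N → L.Pairwise (TubeRel δ) →
    ‖g L‖ ≤ C * rexp (r * (L.map fun z => |z.re|).sum)
  cyc : ∀ (L : List ℂ) (x : ℂ), (x :: L).length ≤ N → (x :: L).Pairwise (TubeRel δ) →
    (L ++ [x - 2 * π * I]).Pairwise (TubeRel δ) →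
    g (x :: L) = (-1) ^ L.length * g (L ++ [x - 2 * π * I])

variable {g : List ℂ → ℂ} {δ C r : ℝ} {N : ℕ}

/-- The integral of `g` along an affine family of lists against a Gaussian. -/
def gaussInt (g : List ℂ → ℂ) (A : ℝ) (M : List (ℂ × ℝ × ℝ)) (q : Fin 2 → ℂ) : ℂ :=
  ∫ t : Fin 2 → ℝ, g (M.map fun e => affine e fun i => t i) * gauss A q fun i => t i

/-- The tube conditions are affine in the shift, so they hold along the whole path once they hold at
both ends, and the Gaussian absorbs the exponential growth of `g`. The displacement reappears in the
constants of the affine list and in the centre of the Gaussian. -/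
theorem AnalyticCyc.gaussInt_shift (hg : AnalyticCyc g δ C r N) (v0 v1 : ℝ)
    {M M' : List (ℂ × ℝ × ℝ)} (hM : M.length ≤ N) {A : ℝ} (hA : 0 < A) (q : Fin 2 → ℂ)
    (hM' : M.map (fun e => (e.1 + e.2.1 * v0 * I + e.2.2 * v1 * I, e.2)) = M')
    (hT : M.Pairwise (AffineRel v0 v1)) :
    gaussInt g A M q = gaussInt g A M' ![q 0 - v0 * I, q 1 - v1 * I] := by
  set F : (Fin 2 → ℂ) → ℂ := fun ζ => g (M.map fun e => affine e ζ) * gauss A q ζ with hF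
  have hp : ∀ ζ : Fin 2 → ℂ, ∀ y ∈ Icc (0:ℝ) 1, (ζ 0).im = y * v0 → (ζ 1).im = y * v1 →
      (M.map fun e => affine e ζ).Pairwise (TubeRel δ) := by
    intro ζ y hy h0 h1; rw [pairwise_map]; refine hT.imp fun ⟨h2, h3⟩ => ?_
    rw [TubeRel, sub_im, affine_im, affine_im, h0, h1]; have := hg.pos
    constructor <;> nlinarith [hy.1, hy.2]
  have hFd : ∀ ζ : Fin 2 → ℂ, ∀ y ∈ Icc (0:ℝ) 1, (ζ 0).im = y * v0 → (ζ 1).im = y * v1 →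
      DifferentiableAt ℂ F ζ := by
    intro ζ y hy h0 h1; refine DifferentiableAt.mul (HoloAt.comp M (fun e ζ => affine e ζ)
      (hg.holo _ (by simpa using hM) (hp ζ y hy h0 h1)) fun e _ => differentiable_affine e ζ)
      (differentiable_gauss A q ζ)
  obtain ⟨D, k, hk, hDk⟩ := sum_abs_affine_le M; have := hg.nonneg
  obtain ⟨E, hE0, hE⟩ := exp_mul_gauss_le hA (r * k) (|v0| + |v1|) (by positivity) q
  have h := integral_pi_shift F (fun _ => 0) ![v0, v1] (by
      intro t z hz0 hz1
      refine (hFd (fun i => t i + (0:ℝ) * I + z * (![v0, v1] i : ℝ)) z.im ⟨hz0, hz1⟩ (by simp) (by simp)).comp z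
        (f := fun z i => (t i : ℂ) + ((0:ℝ) : ℂ) * I + z * (![v0, v1] i : ℝ))
        (differentiableAt_pi.2 fun i => by fun_prop)) (by
      rintro ⟨t, y⟩ ⟨-, hy⟩; refine ContinuousAt.continuousWithinAt ?_
      refine ContinuousAt.comp (g := F) (hFd _ y hy (by simp) (by simp)).continuousAt ?_
      refine Continuous.continuousAt (continuous_pi fun i => ?_)
      fun_prop) (|C| * rexp (r * D) * E) (by
      intro t y hy; set ζ : Fin 2 → ℂ := fun i => t i + ((0:ℝ) + y * ![v0, v1] i : ℝ) * I with hζ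
      have i0 : (ζ 0).im = y * v0 := by simp [hζ]
      have i1 : (ζ 1).im = y * v1 := by simp [hζ]
      have r0 : (ζ 0).re = t 0 := by simp [hζ]
      have r1 : (ζ 1).re = t 1 := by simp [hζ]
      have hb1 := hg.bound _ (by simpa using hM) (hp ζ y hy i0 i1); have hb2 := hE ζ (by
        intro i; have hy1 : ∀ v : ℝ, |y * v| ≤ |v| := fun v => by
          rw [abs_mul, abs_of_nonneg hy.1]; exact mul_le_of_le_one_left (abs_nonneg _) hy.2
        fin_cases i
        · show |(ζ 0).im| ≤ _; rw [i0]; exact (hy1 v0).trans (le_add_of_nonneg_right (abs_nonneg _))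
        · show |(ζ 1).im| ≤ _; rw [i1]; exact (hy1 v1).trans (le_add_of_nonneg_left (abs_nonneg _)))
      have hb3 := mul_le_mul_of_nonneg_left (hDk ζ) hg.nonneg; rw [hF, norm_mul]
      calc ‖g (M.map fun e => affine e ζ)‖ * ‖gauss A q ζ‖
          ≤ (|C| * rexp (r * (D + k * (|(ζ 0).re| + |(ζ 1).re|)))) * ‖gauss A q ζ‖ := by
            refine mul_le_mul_of_nonneg_right (hb1.trans ?_) (norm_nonneg _)
            exact mul_le_mul (le_abs_self C) (exp_le_exp.2 hb3) (exp_pos _).le (abs_nonneg _)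
        _ = |C| * rexp (r * D) *
            (rexp (r * k * (|(ζ 0).re| + |(ζ 1).re|)) * ‖gauss A q ζ‖) := by
            rw [mul_add, Real.exp_add]; ring_nf
        _ ≤ |C| * rexp (r * D) * (E * rexp (-(|(ζ 0).re| + |(ζ 1).re|))) :=
            mul_le_mul_of_nonneg_left hb2 (by positivity)
        _ = |C| * rexp (r * D) * E * weight t := by rw [r0, r1, weight, Fin.sum_univ_two]; ring)
  rw [gaussInt, gaussInt, ← hM']; convert h using 4 with t t
  · simp
  · simp
  · rw [map_map]; congr 1; refine map_congr_left fun e _ => ?_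
    simp [affine]; ring
  · simp only [gauss]; congr 1; simp; left; ring

theorem abs_sinh_re_le_cosh (z : ℂ) : |Real.sinh z.re| ≤ ‖cosh z‖ := by
  rw [← abs_of_nonneg (norm_nonneg (cosh z)), ← sq_le_sq, ← normSq_eq_norm_sq,
    normSq_apply, cosh_re, cosh_im]
  have h3 := Real.cosh_sq z.re; have h4 := Real.sin_sq_add_cos_sq z.im
  nlinarith [sq_nonneg (Real.cos z.im)]

theorem cosh_ne_zero_of_re {z : ℂ} (h : z.re ≠ 0) : cosh z ≠ 0 := by
  intro h0; have := abs_sinh_re_le_cosh z; rw [h0, norm_zero] at this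
  exact h (Real.sinh_eq_zero.1 (abs_nonpos_iff.1 this))

theorem cosh_ne_zero_of_im {z : ℂ} (h : |z.im| < π) : cosh (z / 2) ≠ 0 := by
  intro h0; have := abs_cos_im_le (z / 2); rw [h0, norm_zero] at this
  have h1 : 0 < Real.cos ((z / 2).im) := by
    rw [show (z / 2).im = z.im / 2 by simp]; rw [abs_lt] at h
    exact Real.cos_pos_of_mem_Ioo ⟨by linarith, by linarith⟩
  exact h1.ne' (abs_nonpos_iff.1 this)

theorem list_prod_neg {ι : Type*} (φ : ι → ℂ) : ∀ L : List ι,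
    (L.map fun i => -φ i).prod = (-1) ^ L.length * (L.map φ).prod
  | [] => by simp
  | i :: L => by simp only [map_cons, prod_cons, list_prod_neg φ L, length_cons, pow_succ]; ring

variable {f g : List ℂ → ℂ} {δ C r : ℝ} {N : ℕ}

/-- The sign comes from `cosh ((z + 2πi) / 2) = -cosh (z / 2)`, applied to each pole factor that
involves `x`. At a pole the relation for `f` says nothing, but a small real displacement of `x`
leaves all poles and `g` is continuous. -/
theorem PoleData.cyc_analytic (hg : PoleData f g δ N)
    (L : List ℂ) (x : ℂ) (hN : (x :: L).length ≤ N) (h1 : (x :: L).Pairwise (TubeRel δ))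
    (h2 : (L ++ [x - 2 * π * I]).Pairwise (TubeRel δ)) :
    g (x :: L) = (-1) ^ L.length * g (L ++ [x - 2 * π * I]) := by
  have hpi := two_le_pi; have hδ := hg.le; rw [pairwise_cons] at h1
  rw [pairwise_append_singleton] at h2
  have him : ∀ z w : ℂ, (z - (w - 2 * π * I)).im = 2 * π - (w - z).im := by intro z w; simp; ring
  -- The tube conditions before and after the cyclic step force `Im (x - y)` to lie within `δ` of
  -- `π` for every `y` in `L`. Elements of `L` therefore differ in height by less than `2δ < π`, and
  -- no pole occurs among them.
  have hLr : L.Pairwise (RegRel δ) := by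
    have h3 : L.Pairwise fun y y' => y ∈ L ∧ y' ∈ L ∧ TubeRel δ y y' :=
      List.Pairwise.and_mem.1 h1.2
    refine h3.imp fun {y y'} h => ⟨h.2.2, cosh_ne_zero_of_im ?_⟩
    have a1 := h1.1 y h.1; have a2 := h1.1 y' h.2.1; have a3 := h2.2 y h.1; have a4 := h2.2 y' h.2.1
    rw [TubeRel, him] at a3 a4; simp only [TubeRel, sub_im] at a1 a2 a3 a4
    rw [sub_im, abs_lt]; constructor <;> linarith
  set φ : ℝ → ℂ := fun t => g ((x + t) :: L) - (-1) ^ L.length * g (L ++ [x + t - 2 * π * I]) with hφ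
  have T1 : ∀ t : ℝ, ((x + t) :: L).Pairwise (TubeRel δ) := fun t =>
    pairwise_cons.2 ⟨fun y hy => by
      have := h1.1 y hy; simp only [TubeRel, sub_im, add_im, ofReal_im, add_zero] at this ⊢
      exact this, h1.2⟩
  have T2 : ∀ t : ℝ, (L ++ [x + t - 2 * π * I]).Pairwise (TubeRel δ) := fun t =>
    pairwise_append_singleton.2 ⟨h2.1, fun y hy => by
      have := h2.2 y hy; simp only [TubeRel, sub_im, add_im, ofReal_im, add_zero] at this ⊢
      exact this⟩
  have hc : Continuous φ := by
    rw [continuous_iff_continuousAt]; intro t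
    refine ContinuousAt.sub ?_ (continuousAt_const.mul ?_)
    · set M : List (ℝ → ℂ) := (fun t => x + t) :: (L.map fun z _ => z) with hM
      have e : ∀ w, M.map (fun φ => φ w) = (x + w) :: L := by intro w; simp [hM, comp_def]
      have h := HoloAt.continuousAt_comp (f := g) M (fun φ w => φ w) (x := t) (by
        rw [e]; exact hg.holo _ (by simpa using hN) (T1 t)) (by
        intro φ hφ; simp only [hM, mem_cons, mem_map] at hφ
        rcases hφ with rfl | ⟨z, -, rfl⟩ <;> fun_prop)
      simpa only [e] using h
    · set M : List (ℝ → ℂ) := (L.map fun z _ => z) ++ [fun t : ℝ => x + t - 2 * π * I] with hM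
      have e : ∀ w, M.map (fun φ => φ w) = L ++ [x + w - 2 * π * I] := by
        intro w; simp [hM, comp_def]
      have h := HoloAt.continuousAt_comp (f := g) M (fun φ w => φ w) (x := t) (by
        rw [e]; exact hg.holo _ (by simpa using hN) (T2 t)) (by
        intro φ hφ; simp only [hM, mem_append, List.mem_singleton, mem_map] at hφ
        rcases hφ with ⟨z, -, rfl⟩ | rfl <;> fun_prop)
      simpa only [e] using h
  have hfin : Set.Finite ((fun y : ℂ => (y - x).re) '' {y | y ∈ L}) := (finite_toSet L).image _
  have hev : ∀ᶠ t in 𝓝[≠] (0:ℝ), φ t = 0 := by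
    have h3 : ∀ᶠ t in 𝓝[≠] (0:ℝ), t ∉ ((fun y : ℂ => (y - x).re) '' {y | y ∈ L}) \ {0} :=
      nhdsWithin_le_nhds (((hfin.subset sdiff_subset).isClosed.isOpen_compl).mem_nhds (by simp))
    filter_upwards [h3, self_mem_nhdsWithin] with t ht ht0
    have hne : ∀ y ∈ L, (x + t - y).re ≠ 0 := by
      intro y hy h0; refine ht ⟨⟨y, hy, ?_⟩, ht0⟩; simp only [add_re, sub_re, ofReal_re] at h0 ⊢
      linarith
    have r1 : ((x + t) :: L).Pairwise (RegRel δ) := by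
      rw [pairwise_cons]
      exact ⟨fun y hy => ⟨(pairwise_cons.1 (T1 t)).1 y hy, cosh_ne_zero_of_re (by
        simpa using hne y hy)⟩, hLr⟩
    have r2 : (L ++ [x + t - 2 * π * I]).Pairwise (RegRel δ) := by
      rw [pairwise_append_singleton]
      refine ⟨hLr, fun y hy => ⟨(pairwise_append_singleton.1 (T2 t)).2 y hy, cosh_ne_zero_of_re ?_⟩⟩
      have := hne y hy; simp only [add_re, sub_re, ofReal_re] at this; simp
      intro h; apply this; linarith
    have e := hg.cyc L (x + t) (by simpa using hN) r1 r2
    rw [hg.eq_div _ (by simpa using hN) r1, hg.eq_div _ (by simpa using hN) r2] at e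
    have p1 := poleL_ne_zero r1; have p2 := poleL_ne_zero r2
    have e2 : poleL (L ++ [x + t - 2 * π * I]) = (-1) ^ L.length * poleL ((x + t) :: L) := by
      rw [poleL_append_singleton, poleL]
      have : (L.map fun z => cosh ((z - (x + t - 2 * π * I)) / 2)) =
          L.map fun z => -cosh ((x + t - z) / 2) := by
        refine map_congr_left fun z _ => ?_
        rw [show z - (x + t - 2 * π * I) = (z - (x + t)) + 2 * π * I by ring,
          cosh_half_sub_two_pi, ← cosh_neg, ← neg_div, neg_sub]
      rw [this, list_prod_neg]; ring
    rw [e2] at e p2; rw [div_eq_div_iff p1 p2] at e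
    have hs : ((-1 : ℂ) ^ L.length) * (-1) ^ L.length = 1 := by rw [← mul_pow]; simp
    simp only [hφ]; rw [sub_eq_zero]; refine mul_right_cancel₀ p1 ?_
    linear_combination (-1) ^ L.length * e - g ((x + t) :: L) * poleL ((x + t) :: L) * hs
  have := tendsto_nhds_unique ((hc.tendsto 0).mono_left (nhdsWithin_le_nhds (s := {0}ᶜ)))
    ((tendsto_congr' hev).2 tendsto_const_nhds)
  simp only [hφ, ofReal_zero, add_zero] at this; exact sub_eq_zero.1 this

theorem AnalyticCyc.continuous_affine_list (hg : AnalyticCyc g δ C r N) (M : List (ℂ × ℝ × ℝ))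
    (hM : M.length ≤ N) (hT : M.Pairwise (AffineRel 0 0)) :
    Continuous (fun t : Fin 2 → ℝ => g (M.map fun e => affine e fun i => (t i : ℂ))) ∧
    ∃ D k : ℝ, 0 ≤ D ∧ 0 ≤ k ∧ ∀ t : Fin 2 → ℝ,
      ‖g (M.map fun e => affine e fun i => (t i : ℂ))‖ ≤ D * rexp (k * (|t 0| + |t 1|)) := by
  have hp : ∀ t : Fin 2 → ℝ, (M.map fun e => affine e fun i => (t i : ℂ)).Pairwise (TubeRel δ) := by
    intro t; rw [pairwise_map]; refine hT.imp fun h => ?_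
    rw [TubeRel, sub_im, affine_im, affine_im]; have := hg.pos; have := h.1
    simp; constructor <;> linarith
  constructor
  · rw [continuous_iff_continuousAt]; intro t
    refine HoloAt.continuousAt_comp M (fun e (t : Fin 2 → ℝ) => affine e fun i => (t i : ℂ))
      (hg.holo _ (by simpa using hM) (hp t)) fun e _ => ?_
    exact ((differentiable_affine e).continuous.comp (continuous_pi fun i =>
      continuous_ofReal.comp (continuous_apply i))).continuousAt
  · obtain ⟨D, k, hk, hDk⟩ := sum_abs_affine_le M; have hr := hg.nonneg
    refine ⟨|C| * rexp (r * D), r * k, by positivity, by positivity, fun t => ?_⟩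
    refine (hg.bound _ (by simpa using hM) (hp t)).trans ?_
    have := mul_le_mul_of_nonneg_left (hDk fun i => (t i : ℂ)) hr
    calc _ ≤ |C| * rexp (r * (D + k * (|t 0| + |t 1|))) :=
          mul_le_mul (le_abs_self C) (exp_le_exp.2 this) (exp_pos _).le (abs_nonneg _)
      _ = _ := by rw [mul_add, Real.exp_add]; ring_nf

theorem integrable_mul_gauss {h : (Fin 2 → ℝ) → ℂ} (hc : Continuous h) {D k : ℝ} (hD0 : 0 ≤ D)
    (hk : 0 ≤ k) (hb : ∀ t, ‖h t‖ ≤ D * rexp (k * (|t 0| + |t 1|))) {A : ℝ} (hA : 0 < A)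
    (q : Fin 2 → ℂ) : Integrable fun t : Fin 2 → ℝ => h t * gauss A q (fun i => (t i : ℂ)) := by
  obtain ⟨E, hE0, hE⟩ := exp_mul_gauss_le hA k 0 hk q
  have hg : Continuous fun t : Fin 2 → ℝ => gauss A q (fun i => t i) :=
    (differentiable_gauss A q).continuous.comp (continuous_pi fun i =>
      continuous_ofReal.comp (continuous_apply i))
  refine integrable_of_weight (hc.mul hg).aestronglyMeasurable (C := D * E) fun t => ?_
  rw [norm_mul]; have := hE (fun i => t i) (by simp)
  simp only [ofReal_re] at this
  calc ‖h t‖ * ‖gauss A q fun i => t i‖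
      ≤ (D * rexp (k * (|t 0| + |t 1|))) * ‖gauss A q fun i => t i‖ :=
        mul_le_mul_of_nonneg_right (hb t) (norm_nonneg _)
    _ ≤ D * (E * rexp (-(|t 0| + |t 1|))) := by
        rw [mul_assoc]; exact mul_le_mul_of_nonneg_left this hD0
    _ = D * E * weight t := by rw [weight, Fin.sum_univ_two]; ring

variable {g : List ℂ → ℂ} {δ C r : ℝ} {N : ℕ}

theorem pairwise_const {α : Type*} {p : Prop} (h : p) (L : List α) : L.Pairwise fun _ _ => p :=
  List.pairwise_of_forall fun _ _ => h

theorem pairwise_of_all {α : Type*} {P : α → α → Prop} {L : List α} (h : ∀ x ∈ L, ∀ y ∈ L, P x y) :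
    L.Pairwise P :=
  List.pairwise_iff_forall_sublist.2 fun hs => h _ (hs.subset (by simp)) _ (hs.subset (by simp))

/-- Induction on the number of rotated variables. Rotating the last one, `x`, directly would put it
`2πi` above the others, outside the tube. The other variables, `Y`, are therefore raised to the real
line beforehand and lowered again once `x` has been brought to the front and down to the real line;
then the induction hypothesis rotates them past `x` and `R`, and finally `x` is raised. Since the
intermediate identities live at different heights, they are compared as integrals against entire
Gaussians, in the variable `x` and a common translation of `Y`. -/
theorem AnalyticCyc.rotate_real (hg : AnalyticCyc g δ C r N) (n : ℕ) : ∀ X R : List ℝ,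
    X.length = n → X.length + R.length ≤ N →
    g (R.map ofReal ++ X.map fun x : ℝ => (x : ℂ) - π * I) =
      (-1) ^ (X.length * R.length) * g ((X.map fun x : ℝ => (x : ℂ) + π * I) ++ R.map ofReal) := by
  induction n with
  | zero => intro X R hX _; rw [length_eq_zero_iff.1 hX]; simp
  | succ n ih =>
    intro X R hX hN; obtain ⟨Y, x, rfl⟩ : ∃ Y x, X = Y ++ [x] := by
      rcases List.eq_nil_or_concat' X with rfl | h
      · simp at hX
      · exact h
    have hY : Y.length = n := by simpa using hX
    have hδ := hg.pos; have hpi := pi_pos; rw [length_append, List.length_singleton] at hN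
    set Rr : List (ℂ × ℝ × ℝ) := R.map fun r : ℝ => ((r : ℂ), (0:ℝ), (0:ℝ))
    set Yt : ℂ → List (ℂ × ℝ × ℝ) := fun c => Y.map fun y : ℝ => ((y : ℂ) + c, (0:ℝ), (1:ℝ))
    set M1 : ℂ → ℂ → List (ℂ × ℝ × ℝ) := fun c c' => Rr ++ (Yt c ++ [(c', 1, 0)])
    set M2 : ℂ → ℂ → List (ℂ × ℝ × ℝ) := fun c c' => (c', 1, 0) :: (Rr ++ Yt c)
    set M3 : ℂ → ℂ → List (ℂ × ℝ × ℝ) := fun c c' => Yt c ++ (c', 1, 0) :: Rr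
    have l1 : ∀ c c', (M1 c c').length ≤ N := fun c c' => by simp [M1, Rr, Yt]; omega
    have l2 : ∀ c c', (M2 c c').length ≤ N := fun c c' => by simp [M2, Rr, Yt]; omega
    have l3 : ∀ c c', (M3 c c').length ≤ N := fun c c' => by simp [M3, Rr, Yt]; omega
    -- Order of moves: `s1` raises `Y`, `c2` cycles `x`, `s3` lowers `x`, `s4` lowers `Y`, `c4` is
    -- the induction hypothesis, `s5` raises `x`. The displacements of the centre of the Gaussian
    -- cancel along this path.
    have key : ∀ A : ℝ, 0 < A → ∀ q : Fin 2 → ℂ, gaussInt g A (M1 (-π * I) (-π * I)) q =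
        (-1) ^ ((Y.length + 1) * R.length) * gaussInt g A (M3 (π * I) (π * I)) q := by
      intro A hA q
      have s1 := hg.gaussInt_shift 0 π (l1 (-π * I) (-π * I)) hA q (M' := M1 0 (-π * I))
        (by simp [M1, Rr, Yt, comp_def]) (by simp [M1, Rr, Yt, pairwise_append, pairwise_map, AffineRel, or_imp, forall_and, pairwise_const, hpi.le])
      have s3 := hg.gaussInt_shift (-π) 0 (l2 0 (π * I)) hA ![q 0 - (0:ℝ) * I, q 1 - π * I]
        (M' := M2 0 0) (by simp [M2, Rr, Yt, comp_def]) (by simp [M2, Rr, Yt, pairwise_append, pairwise_map, AffineRel, or_imp, forall_and, pairwise_const, hpi.le])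
      have s4 := hg.gaussInt_shift 0 (-π) (l2 0 0) hA ![q 0 + π * I, q 1 - π * I]
        (M' := M2 (-π * I) 0) (by simp [M2, Rr, Yt, comp_def]) (by simp [M2, Rr, Yt, pairwise_append, pairwise_map, AffineRel, or_imp, forall_and, pairwise_const, hpi.le])
      have s5 := hg.gaussInt_shift π 0 (l3 (π * I) 0) hA ![q 0 + π * I, q 1]
        (M' := M3 (π * I) (π * I)) (by simp [M3, Rr, Yt, comp_def]) (by simp [M3, Rr, Yt, pairwise_append, pairwise_map, AffineRel, or_imp, forall_and, pairwise_const, hpi.le])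
      have c2 : ∀ q, gaussInt g A (M1 0 (-π * I)) q =
          (-1) ^ (R.length + Y.length) * gaussInt g A (M2 0 (π * I)) q := by
        intro q; rw [gaussInt, gaussInt, ← integral_const_mul]; congr 1 with t; rw [← mul_assoc]
        congr 1
        have f : 0 < π + δ ∧ 0 < δ + π ∧ π < π + δ ∧ π - 2 * π < δ ∧ 2 * π - π < π + δ := by
          refine ⟨?_, ?_, ?_, ?_, ?_⟩ <;> linarith
        have := hg.cyc ((Rr ++ Yt 0).map fun e => affine e fun i => (t i : ℂ)) (t 0 + π * I)
          (by simp [Rr, Yt]; omega) (by simp [Rr, Yt, affine, pairwise_append, pairwise_map, TubeRel, or_imp, forall_and, pairwise_const, hδ, f])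
          (by simp [Rr, Yt, affine, pairwise_append, pairwise_map, TubeRel, or_imp, forall_and, pairwise_const, hδ, f])
        rw [show (t 0 : ℂ) + π * I - 2 * π * I = -π * I + t 0 by ring] at this
        simp [M1, M2, affine, add_comm _ (t 0 : ℂ)] at this ⊢; rw [this, ← mul_assoc]
        simp [Rr, Yt, ← mul_pow]
      have c4 : ∀ q, gaussInt g A (M2 (-π * I) 0) q =
          (-1) ^ (Y.length * (R.length + 1)) * gaussInt g A (M3 (π * I) 0) q := by
        intro q; rw [gaussInt, gaussInt, ← integral_const_mul]; congr 1 with t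
        have := ih (Y.map (· + t 1)) (t 0 :: R) (by simpa using hY) (by simp; omega)
        rw [← mul_assoc]; congr 1
        simpa [M2, M3, Rr, Yt, affine, comp_def, sub_eq_add_neg, add_right_comm] using this
      have e3 : (![![q 0 - (0:ℝ) * I, q 1 - π * I] 0 - (-π : ℝ) * I,
          ![q 0 - (0:ℝ) * I, q 1 - π * I] 1 - (0:ℝ) * I] : Fin 2 → ℂ) =
          ![q 0 + π * I, q 1 - π * I] := by simp
      have e4 : (![![q 0 + π * I, q 1 - π * I] 0 - (0:ℝ) * I,
          ![q 0 + π * I, q 1 - π * I] 1 - (-π : ℝ) * I] : Fin 2 → ℂ) = ![q 0 + π * I, q 1] := by simp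
      have e5 : (![![q 0 + π * I, q 1] 0 - π * I, ![q 0 + π * I, q 1] 1 - (0:ℝ) * I] : Fin 2 → ℂ) =
          q := by ext i; fin_cases i <;> simp
      rw [s1, c2, s3, e3, s4, e4, c4, s5, e5, ← mul_assoc, ← pow_add, show R.length + Y.length +
        Y.length * (R.length + 1) = (Y.length + 1) * R.length + 2 * Y.length by ring, pow_add, pow_mul]
      simp
    obtain ⟨cJ1, D1, k1, hD1, hk1, b1⟩ := hg.continuous_affine_list _ (l1 (-π * I) (-π * I))
      (by simp [M1, Rr, Yt, pairwise_append, pairwise_map, AffineRel, or_imp, forall_and, pairwise_const, hpi.le])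
    obtain ⟨cJ3, D3, k3, hD3, hk3, b3⟩ := hg.continuous_affine_list _ (l3 (π * I) (π * I))
      (by simp [M3, Rr, Yt, pairwise_append, pairwise_map, AffineRel, or_imp, forall_and, pairwise_const, hpi.le])
    set σ : ℂ := (-1) ^ ((Y.length + 1) * R.length) with hσ
    have hz := eq_zero_of_integral_gauss (h := fun t => _ - σ * _) (cJ1.sub (continuous_const.mul cJ3)) (C := D1 + D3)
        (r := k1 + k3) (by positivity) (fun t => by
          have a0 : 0 ≤ |t 0| + |t 1| := by positivity
          refine (norm_sub_le _ _).trans ?_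
          rw [norm_mul, show ‖σ‖ = 1 by simp [hσ], one_mul, add_mul]
          refine add_le_add ((b1 t).trans ?_) ((b3 t).trans ?_) <;> gcongr <;> linarith)
        ![x, 0] (fun A hA => by
          simp only [sub_mul, mul_assoc]
          rw [integral_sub (integrable_mul_gauss cJ1 hD1 hk1 b1 hA _)
            ((integrable_mul_gauss cJ3 hD3 hk3 b3 hA _).const_mul σ), integral_const_mul, sub_eq_zero]
          exact key A hA _)
    rw [sub_eq_zero] at hz
    simpa [hσ, M1, M3, Rr, Yt, affine, comp_def, sub_eq_add_neg, add_comm] using hz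

variable {g : List ℂ → ℂ} {δ C r : ℝ} {N : ℕ}

theorem holoAt_family {f : List ℂ → ℂ} {X : Type*} [NormedAddCommGroup X] [NormedSpace ℂ X]
    (M : List (X → ℂ)) (ℓ : X → List ℂ) (e : ∀ x, ℓ x = M.map fun φ => φ x) {x : X}
    (h : HoloAt f (ℓ x)) (hφ : ∀ φ ∈ M, DifferentiableAt ℂ φ x) :
    DifferentiableAt ℂ (fun x => f (ℓ x)) x := by
  simp only [e]; exact HoloAt.comp M (fun φ x => φ x) (by rwa [← e]) hφ

theorem tubeRel_of_im {δ : ℝ} {z w : ℂ} (h1 : -δ < z.im - w.im) (h2 : z.im - w.im < π + δ) :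
    TubeRel δ z w := by rw [TubeRel, sub_im]; exact ⟨h1, h2⟩

theorem pairwise_tube_rot (hδ : 0 < δ) {X R : List ℂ} (hX : ∀ z ∈ X, |z.im| < δ / 2)
    (hR : ∀ z ∈ R, |z.im| < δ / 2) :
    (R ++ X.map fun z => z - π * I).Pairwise (TubeRel δ) ∧
    ((X.map fun z => z + π * I) ++ R).Pairwise (TubeRel δ) := by
  have hpi := pi_pos; have im1 : ∀ w : ℂ, (w - π * I).im = w.im - π := fun w => by simp
  have im2 : ∀ w : ℂ, (w + π * I).im = w.im + π := fun w => by simp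
  simp only [abs_lt] at hX hR; rw [pairwise_append, pairwise_append]
  refine ⟨⟨pairwise_of_all fun z hz w hw => ?_, ?_, ?_⟩, ?_, pairwise_of_all fun z hz w hw => ?_, ?_⟩
  · have := hR z hz; have := hR w hw; apply tubeRel_of_im <;> linarith
  · rw [pairwise_map]; refine pairwise_of_all fun z hz w hw => ?_
    have := hX z hz; have := hX w hw; apply tubeRel_of_im <;> rw [im1, im1] <;> linarith
  · intro z hz w hw; obtain ⟨u, hu, rfl⟩ := mem_map.1 hw; have := hR z hz; have := hX u hu
    apply tubeRel_of_im <;> rw [im1] <;> linarith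
  · rw [pairwise_map]; refine pairwise_of_all fun z hz w hw => ?_
    have := hX z hz; have := hX w hw; apply tubeRel_of_im <;> rw [im2, im2] <;> linarith
  · have := hR z hz; have := hR w hw; apply tubeRel_of_im <;> linarith
  · intro z hz w hw; obtain ⟨u, hu, rfl⟩ := mem_map.1 hz; have := hR w hw; have := hX u hu
    apply tubeRel_of_im <;> rw [im2] <;> linarith

theorem AnalyticCyc.rotate (hg : AnalyticCyc g δ C r N) (X R : List ℂ) (hN : X.length + R.length ≤ N)
    (hX : ∀ z ∈ X, |z.im| < δ / 2) (hR : ∀ z ∈ R, |z.im| < δ / 2) :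
    g (R ++ X.map fun z => z - π * I) =
      (-1) ^ (X.length * R.length) * g ((X.map fun z => z + π * I) ++ R) := by
  have hδ := hg.pos; set m := X.length; set n := R.length
  set ℓX : (Fin (m + n) → ℂ) → List ℂ := fun ζ => ofFn fun i : Fin m => ζ (Fin.castAdd n i) with hℓX
  set ℓR : (Fin (m + n) → ℂ) → List ℂ := fun ζ => ofFn fun i : Fin n => ζ (Fin.natAdd m i) with hℓR
  set D : Set (Fin (m + n) → ℂ) := {ζ | ∀ i, |(ζ i).im| < δ / 2} with hD; have hDo : IsOpen D := by
    have : D = ⋂ i, {ζ | |(ζ i).im| < δ / 2} := by ext; simp [hD]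
    rw [this]; exact isOpen_iInter_of_finite fun i => isOpen_lt
      (continuous_abs.comp (continuous_im.comp (continuous_apply i))) continuous_const
  have hDc : Convex ℝ D := by
    intro ζ hζ ξ hξ p q hp hq hpq i; have h1 := abs_lt.1 (hζ i); have h2 := abs_lt.1 (hξ i)
    have hc := (convex_Ioo (𝕜 := ℝ) (-(δ / 2)) (δ / 2)) (show (ζ i).im ∈ _ from h1)
      (show (ξ i).im ∈ _ from h2) hp hq hpq
    rw [abs_lt]; simpa using hc
  have hmX : ∀ ζ ∈ D, ∀ z ∈ ℓX ζ, |z.im| < δ / 2 := by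
    intro ζ hζ z hz; obtain ⟨i, rfl⟩ := (mem_ofFn' _ _).1 hz; exact hζ _
  have hmR : ∀ ζ ∈ D, ∀ z ∈ ℓR ζ, |z.im| < δ / 2 := by
    intro ζ hζ z hz; obtain ⟨i, rfl⟩ := (mem_ofFn' _ _).1 hz; exact hζ _
  set E : (Fin (m + n) → ℂ) → ℂ := fun ζ => g (ℓR ζ ++ (ℓX ζ).map fun z => z - π * I) -
    (-1) ^ (m * n) * g (((ℓX ζ).map fun z => z + π * I) ++ ℓR ζ) with hE
  have hEd : DifferentiableOn ℂ E D := by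
    intro ζ hζ; have T := pairwise_tube_rot hδ (hmX ζ hζ) (hmR ζ hζ)
    refine DifferentiableAt.differentiableWithinAt (DifferentiableAt.sub ?_ (DifferentiableAt.const_mul ?_ _))
    · refine holoAt_family (((finRange n).map fun i ζ => ζ (Fin.natAdd m i)) ++
        (finRange m).map fun i ζ => ζ (Fin.castAdd n i) - π * I) _ (fun ζ => ?_)
        (hg.holo _ (by simp [hℓX, hℓR]; omega) T.1) ?_
      · simp [hℓX, hℓR, ofFn_eq_map, comp_def]
      · intro φ hφ; simp only [mem_append, mem_map] at hφ
        rcases hφ with ⟨i, -, rfl⟩ | ⟨i, -, rfl⟩ <;> fun_prop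
    · refine holoAt_family (((finRange m).map fun i ζ => ζ (Fin.castAdd n i) + π * I) ++
        (finRange n).map fun i ζ => ζ (Fin.natAdd m i)) _ (fun ζ => ?_)
        (hg.holo _ (by simp [hℓX, hℓR]; omega) T.2) ?_
      · simp [hℓX, hℓR, ofFn_eq_map, comp_def]
      · intro φ hφ; simp only [mem_append, mem_map] at hφ
        rcases hφ with ⟨i, -, rfl⟩ | ⟨i, -, rfl⟩ <;> fun_prop
  have hz := eq_zero_of_real_points hDo hDc hEd (fun x _ => by
      have h := hg.rotate_real m (ofFn fun i => x (Fin.castAdd n i))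
        (ofFn fun i => x (Fin.natAdd m i)) (by simp) (by simpa using hN)
      rw [length_ofFn, length_ofFn] at h; simp only [hE, hℓX, hℓR]; rw [sub_eq_zero]
      simpa [map_ofFn, comp_def] using h) (fun ζ hζ i => by simpa using half_pos hδ)
    (ζ := Fin.append X.get R.get) (fun i => by
      refine Fin.addCases (fun i => ?_) (fun i => ?_) i
      · rw [Fin.append_left]; exact hX _ (get_mem _ _)
      · rw [Fin.append_right]; exact hR _ (get_mem _ _))
  have e1 : ℓX (Fin.append X.get R.get) = X := by simp only [hℓX, Fin.append_left]; exact ofFn_get X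
  have e2 : ℓR (Fin.append X.get R.get) = R := by
    simp only [hℓR, Fin.append_right]; exact ofFn_get R
  simp only [hE] at hz; rw [e1, e2] at hz; exact sub_eq_zero.1 hz

theorem poleL_append : ∀ A B : List ℂ, poleL (A ++ B) = poleL A * poleL B *
    (A.map fun x => (B.map fun y => cosh ((x - y) / 2)).prod).prod
  | [], B => by simp [poleL]
  | x :: A, B => by
    simp only [cons_append, poleL, poleL_append A B, map_append, prod_append,
      map_cons, prod_cons]
    ring

theorem poleL_map_add (c : ℂ) : ∀ A : List ℂ, poleL (A.map fun z => z + c) = poleL A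
  | [] => rfl
  | x :: A => by
    simp only [map_cons, poleL, poleL_map_add c A, map_map, comp_def,
      add_sub_add_right_eq_sub]

theorem prod_prod_comm {ι κ : Type*} (φ : ι → κ → ℂ) (A : List ι) (B : List κ) :
    (A.map fun x => (B.map fun y => φ x y).prod).prod =
      (B.map fun y => (A.map fun x => φ x y).prod).prod := by
  induction A with
  | nil => simp
  | cons x A ih => simp [ih, prod_map_mul]

theorem poleL_rotate (X R : List ℂ) : poleL (R ++ X.map fun z => z - π * I) =
    (-1) ^ (X.length * R.length) * poleL ((X.map fun z => z + π * I) ++ R) := by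
  rw [poleL_append, poleL_append, poleL_map_add]
  have h1 : poleL (X.map fun z => z - π * I) = poleL X := by
    simpa only [sub_eq_add_neg] using poleL_map_add (-(π * I)) X
  rw [h1]; have h2 : (R.map fun x => ((X.map fun z => z - π * I).map fun y =>
      cosh ((x - y) / 2)).prod).prod = (-1) ^ (X.length * R.length) *
      ((X.map fun z => z + π * I).map fun x => (R.map fun y => cosh ((x - y) / 2)).prod).prod := by
    simp only [map_map, comp_def]; rw [prod_prod_comm (fun r x => cosh ((r - (x - π * I)) / 2))]
    have h3 : ∀ x : ℂ, (R.map fun r => cosh ((r - (x - π * I)) / 2)).prod =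
        (-1) ^ R.length * (R.map fun r => cosh ((x + π * I - r) / 2)).prod := by
      intro x; rw [← list_prod_neg]; congr 1; refine map_congr_left fun r _ => ?_
      rw [← cosh_neg ((x + π * I - r) / 2), ← neg_div, ← cosh_half_sub_two_pi]; congr 1; ring
    simp only [h3]
    rw [prod_map_mul, List.map_const', List.prod_replicate, ← pow_mul, mul_comm R.length]
  rw [h2]; ring

/-! ### Uniform data for coefficients with boundedly many variables. -/

/-- Rotation of several variables at once. -/
def Rotates (a : Coefficients) (δ : ℝ) (N : ℕ) : Prop :=
  ∀ X R : List ℂ, X.length + R.length ≤ N → (∀ z ∈ X, |z.im| < δ / 2) → (∀ z ∈ R, |z.im| < δ / 2) →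
    (R ++ X.map fun z => z - π * I).Pairwise (RegRel δ) →
    onList a (R ++ X.map fun z => z - π * I) = onList a ((X.map fun z => z + π * I) ++ R)

theorem pole_ne_zero_iff {δ : ℝ} : ∀ {L : List ℂ}, L.Pairwise (TubeRel δ) → poleL L ≠ 0 →
    L.Pairwise (RegRel δ)
  | [], _, _ => List.Pairwise.nil
  | x :: L, h, h0 => by
    rw [pairwise_cons] at h ⊢; rw [poleL] at h0
    refine ⟨fun y hy => ⟨h.1 y hy, fun hc => left_ne_zero_of_mul h0 (List.prod_eq_zero ?_)⟩,
      pole_ne_zero_iff h.2 (right_ne_zero_of_mul h0)⟩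
    exact mem_map.2 ⟨y, hy, hc⟩

theorem AnalyticCyc.rotates {a : Coefficients} (hg : AnalyticCyc g δ C r N)
    (hfg : ∀ L : List ℂ, L.length ≤ N → L.Pairwise (RegRel δ) → onList a L = g L / poleL L) :
    Rotates a δ N := by
  intro X R hN hX hR hreg; have T := pairwise_tube_rot hg.pos hX hR; have h0 := poleL_ne_zero hreg
  have hp := poleL_rotate X R; rw [hp] at h0
  have hreg2 := pole_ne_zero_iff T.2 (right_ne_zero_of_mul h0)
  rw [hfg _ (by simp; omega) hreg, hfg _ (by simpa using hN) hreg2, hp, hg.rotate X R hN hX hR,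
    mul_div_mul_left _ _ (left_ne_zero_of_mul h0)]

theorem Rotates.mono {a : Coefficients} {δ δ' : ℝ} {N : ℕ} (h : Rotates a δ N) (hδ : δ' ≤ δ) :
    Rotates a δ' N := fun X R hN hX hR hp =>
  h X R hN (fun z hz => (hX z hz).trans_le (by linarith)) (fun z hz => (hR z hz).trans_le (by linarith))
    (hp.imp fun h => ⟨⟨by linarith [h.1.1], by linarith [h.1.2]⟩, h.2⟩)

/-- The neighbourhoods and the growth constants may depend on the order without any uniformity. Only
orders up to `N` are needed at a time, so a minimum of widths and sums of absolute values of the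
constants serve them all. -/
theorem exists_coefData {S : ℂ → ℂ} {a : Coefficients} {δ0 B : ℝ} (hS : StripS S δ0 B)
    (ha : IsLocalCoefficients S a) (N : ℕ) : ∃ δ, 0 < δ ∧ δ ≤ δ0 ∧ CoefData S a δ N ∧ Rotates a δ N := by
  obtain ⟨δn, hpos, hmer, hex, hcy, hki⟩ := ha
  obtain ⟨δ, hδ, hδ0, hδn⟩ : ∃ δ, 0 < δ ∧ δ ≤ δ0 ∧ ∀ n ≤ N, δ ≤ δn n := by
    have h := (range (N + 1)).exists_min_image δn ⟨0, by simp⟩; obtain ⟨m, -, hm⟩ := h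
    exact ⟨min δ0 (δn m), lt_min hS.pos (hpos m), min_le_left _ _, fun n hn =>
      (min_le_right _ _).trans (hm n (by simp; omega))⟩
  have hδ1 : δ ≤ 1 / 2 := hδ0.trans hS.le; choose G hGd hGa C r hGb using hmer
  set g : List ℂ → ℂ := onList G with hg
  have hgh : ∀ L : List ℂ, L.length ≤ N → L.Pairwise (TubeRel δ) → HoloAt g L := by
    rintro L hL hp n ζ rfl; have hn : (ofFn ζ).length = n := length_ofFn
    have hm := mem_tube_of_pairwise (hδn n (by simpa using hL)) hn hp
    have hm' : ζ ∈ tube n (δn n) := by convert hm using 1; funext i; simp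
    have := (hGd n).differentiableAt ((isOpen_tube n _).mem_nhds hm')
    simpa only [hg, onList_ofFn] using this
  have hfg : ∀ L : List ℂ, L.length ≤ N → L.Pairwise (RegRel δ) → onList a L = g L / poleL L := by
    intro L hL hp; have hm := mem_regularTube_of_pairwise (hδn L.length hL) rfl hp
    have := hGa _ _ hm; rw [poleFactor_eq] at this
    have e : ofFn (fun i : Fin L.length => L.get (Fin.cast rfl i)) = L := ofFn_get L
    rw [e] at this; exact this
  have hreg : ∀ L : List ℂ, L.length ≤ N → L.Pairwise (RegRel δ) → HoloAt (onList a) L := by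
    rintro L hL hp n ζ rfl; have hn : (ofFn ζ).length = n := length_ofFn
    have hm := mem_regularTube_of_pairwise (hδn n (by simpa using hL)) hn hp
    have hm' : ζ ∈ regularTube n (δn n) := by convert hm using 1; funext i; simp
    have hpd : Differentiable ℂ (poleFactor n) := by unfold poleFactor; fun_prop
    have hop : IsOpen (regularTube n (δn n)) :=
      (isOpen_tube n _).inter (isOpen_ne.preimage hpd.continuous)
    have h1 := (hGd n).differentiableAt ((isOpen_tube n _).mem_nhds hm'.1)
    have h2 := h1.fun_mul ((hpd ζ).fun_inv hm'.2); refine h2.congr_of_eventuallyEq ?_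
    filter_upwards [hop.mem_nhds hm'] with ξ hξ
    simp only [onList_ofFn]; rw [hGa n ξ hξ, div_eq_mul_inv]
  have hcyc : ∀ (L : List ℂ) (x : ℂ), (x :: L).length ≤ N → (x :: L).Pairwise (RegRel δ) →
      (L ++ [x - 2 * π * I]).Pairwise (RegRel δ) →
      onList a (x :: L) = onList a (L ++ [x - 2 * π * I]) := by
    intro L x hN h1 h2; have hlen : (L ++ [x - 2 * π * I]).length = L.length + 1 := by simp
    rw [onList_eq a hlen]
    have hcyc : cycle (x :: L).get = fun i => (L ++ [x - 2 * π * I]).get (i.cast hlen.symm) := by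
      funext k; simp only [cycle, get_eq_getElem, Fin.val_cast]
      refine Fin.lastCases ?_ (fun k => ?_) k
      · simp
      · simp [Fin.tail]
    have := hcy L.length (x :: L).get (mem_regularTube_of_pairwise (hδn _ hN) rfl h1) (by
      rw [hcyc]; exact mem_regularTube_of_pairwise (hδn _ hN) hlen h2)
    rw [hcyc] at this; exact this
  have hgb : ∀ L : List ℂ, L.length ≤ N → L.Pairwise (TubeRel δ) →
      ‖g L‖ ≤ (∑ n ∈ range (N + 1), |C n|) *
        rexp ((∑ n ∈ range (N + 1), |r n|) * (L.map fun z => |z.re|).sum) := by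
    intro L hL hp; have hmem : L.length ∈ range (N + 1) := by simp; omega
    have hm := mem_tube_of_pairwise (hδn L.length hL) rfl hp
    have hb : ‖g L‖ ≤ C L.length * rexp (r L.length * ∑ i, |(L.get i).re|) := hGb _ _ hm
    have hsum : ∑ i, |(L.get i).re| = (L.map fun z => |z.re|).sum := by
      conv_rhs => rw [← ofFn_get L, map_ofFn, sum_ofFn]
      rfl
    rw [hsum] at hb; have hs0 : 0 ≤ (L.map fun z => |z.re|).sum := List.sum_nonneg (by
      intro x hx; rw [mem_map] at hx; obtain ⟨z, -, rfl⟩ := hx; exact abs_nonneg _)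
    have h1 : r L.length ≤ ∑ n ∈ range (N + 1), |r n| := (le_abs_self _).trans
      (single_le_sum (f := fun n => |r n|) (fun n _ => abs_nonneg _) hmem)
    have h2 : C L.length ≤ ∑ n ∈ range (N + 1), |C n| := (le_abs_self _).trans
      (single_le_sum (f := fun n => |C n|) (fun n _ => abs_nonneg _) hmem)
    exact hb.trans (mul_le_mul h2 (exp_le_exp.2 (mul_le_mul_of_nonneg_right h1 hs0))
      (exp_pos _).le (Finset.sum_nonneg fun n _ => abs_nonneg _))
  have hp : PoleData (onList a) g δ N := ⟨hδ, hδ1, hgh, hfg, hcyc⟩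
  have hac : AnalyticCyc g δ (∑ n ∈ range (N + 1), |C n|) (∑ n ∈ range (N + 1), |r n|) N :=
    ⟨hδ, hgh, Finset.sum_nonneg fun n _ => abs_nonneg _, hgb, hp.cyc_analytic⟩
  refine ⟨δ, hδ, hδ0, ⟨hreg, ?_, ?_, ?_⟩, hac.rotates hfg⟩
  · intro γ hγ; choose c hc hcb using fun n => norm_poleL_ge (δ := δ) hγ n
    refine ⟨(∑ n ∈ range (N + 1), |C n|) * ∑ n ∈ range (N + 1), (c n)⁻¹,
      ∑ n ∈ range (N + 1), |r n|,
      mul_nonneg (Finset.sum_nonneg fun n _ => abs_nonneg _)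
        (Finset.sum_nonneg fun n _ => (inv_pos.2 (hc n)).le),
      Finset.sum_nonneg fun n _ => abs_nonneg _, fun L hL hp => ?_⟩
    have hmem : L.length ∈ range (N + 1) := by simp; omega
    rw [hfg L hL (hp.imp fun h => h.regRel hγ), norm_div, div_eq_mul_inv, mul_right_comm]
    have h1 : ‖poleL L‖⁻¹ ≤ ∑ n ∈ range (N + 1), (c n)⁻¹ :=
      (inv_anti₀ (hc _) (hcb _ L rfl hp)).trans
        (single_le_sum (f := fun n => (c n)⁻¹) (fun n _ => (inv_pos.2 (hc n)).le) hmem)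
    exact mul_le_mul (hgb L hL (hp.imp fun h => h.1)) h1 (inv_nonneg.2 (norm_nonneg _))
      (mul_nonneg (Finset.sum_nonneg fun n _ => abs_nonneg _) (exp_pos _).le)
  · intro L1 L2 x y hN h1 h2; set L := L1 ++ x :: y :: L2 with hL
    have hlen : (L1 ++ y :: x :: L2).length = L.length := by simp [hL]
    rw [onList_eq a hlen]; have hi : L1.length < L.length := by simp [hL]
    have hj : L1.length + 1 < L.length := by simp [hL]
    have hsw : L.get ∘ Equiv.swap ⟨L1.length, hi⟩ ⟨L1.length + 1, hj⟩ =
        fun i => (L1 ++ y :: x :: L2).get (i.cast hlen.symm) := by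
      funext k; simp only [comp_apply, get_eq_getElem, Fin.val_cast]; rw [Equiv.swap_apply_def]
      split_ifs with hk hk
      · subst hk; simp [hL]
      · subst hk; simp [hL]
      · have hk1 : (k : ℕ) ≠ L1.length := fun h => by apply_assumption; exact Fin.ext h
        have hk2 : (k : ℕ) ≠ L1.length + 1 := fun h => hk (Fin.ext h)
        simp only [hL, List.getElem_append]; split_ifs with hlt
        · rfl
        · obtain ⟨m, hm⟩ : ∃ m, (k : ℕ) - L1.length = m + 2 := ⟨k - L1.length - 2, by omega⟩
          simp [hm]
    have := hex L.length ⟨L1.length, hi⟩ ⟨L1.length + 1, hj⟩ rfl L.get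
      (mem_regularTube_of_pairwise (hδn _ hN) rfl h1) (by
        rw [hsw]; exact mem_regularTube_of_pairwise (hδn _ hN) hlen h2)
    rw [hsw] at this; simpa [onList, hL] using this
  · intro L x hN hL hx l u v hu hv huv; have hres := (hp.tendsto_residue hN hL hx hu hv huv).neg
    have hE : KinIdentity S g x L := by
      refine KinIdentity.extend hS hp hδ0 (fun ϑ θ hN hy => hp.kinIdentity_of_ne ϑ θ hN hy ?_) hN
        (pairwise_cons.2 ⟨fun z hz => (hx z hz).1, hL.imp fun h => h.1⟩)
      have hk := hki θ.length ϑ θ.get fun i => hy _ (get_mem _ _)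
      have e1 : ofFn (fun i => ((θ.get i : ℝ) : ℂ)) = θ.map ofReal := by
        conv_rhs => rw [← ofFn_get θ, map_ofFn]
        rfl
      have e2 : ∀ ε : ℂ, a (θ.length + 2) (Fin.cons (ϑ + π * I + I * ε)
          (Fin.cons (ϑ : ℂ) fun i => ((θ.get i : ℝ) : ℂ))) =
          onList a ((ϑ + π * I + I * ε) :: (ϑ : ℂ) :: θ.map ofReal) := by
        intro ε; rw [← onList_ofFn a, ofFn_succ, ofFn_succ]
        simp only [Fin.cons_zero, Fin.cons_succ, e1]
      simp only [e2] at hk; rw [← onList_ofFn a, e1] at hk; rw [← e1, map_ofFn, prod_ofFn]; rw [e1]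
      exact hk
    have n2 := poleL_ne_zero hL; have e : -I * (1 - (L.map fun z => S (x - z)).prod) * onList a L =
        -(I * 2 * (g (x :: L ++ [x - π * I]) / (coshL x L * poleL L))) := by
      rw [hfg L (by omega) hL, mul_div_assoc', mul_div_assoc', ← neg_div,
        div_eq_div_iff n2 (mul_ne_zero (coshL_ne_zero hx) n2), mul_assoc I, hE]
      ring
    rw [e]; refine hres.congr fun w => ?_
    ring

/-! ### Smearing at complex momenta -/

/-- `smear` at complex momenta. -/
def smearC (f : ℝ × ℝ → ℂ) (P : ℂ × ℂ) : ℂ :=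
  ∫ x : ℝ × ℝ, f x * exp (-I * (P.1 * x.1 - P.2 * x.2))

theorem smear_eq (f : ℝ × ℝ → ℂ) (P : ℝ × ℝ) : smear f P = smearC f (P.1, P.2) := by
  simp [smear, smearC]

theorem norm_exp_phase (P : ℂ × ℂ) (x : ℝ × ℝ) :
    ‖exp (-I * (P.1 * x.1 - P.2 * x.2))‖ = rexp (P.1.im * x.1 - P.2.im * x.2) := by
  rw [norm_exp]; congr 1; simp

theorem continuous_phase (P : ℂ × ℂ) :
    Continuous fun x : ℝ × ℝ => exp (-I * (P.1 * x.1 - P.2 * x.2)) := by fun_prop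

theorem IsTestFunction.integrable_mul {f : ℝ × ℝ → ℂ} (hf : IsTestFunction f) {h : ℝ × ℝ → ℂ}
    (hh : Continuous h) : Integrable fun x => f x * h x :=
  (hf.1.continuous.mul hh).integrable_of_hasCompactSupport hf.2.mul_right

theorem IsTestFunction.exists_radius {f : ℝ × ℝ → ℂ} (hf : IsTestFunction f) :
    ∃ R : ℝ, 0 ≤ R ∧ ∀ x ∈ tsupport f, |x.1| ≤ R ∧ |x.2| ≤ R := by
  obtain ⟨R, hR⟩ := hf.2.isBounded.exists_norm_le
  refine ⟨max R 0, le_max_right _ _, fun x hx => ?_⟩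
  have := hR x hx; exact ⟨(norm_fst_le x).trans (this.trans (le_max_left _ _)),
    (norm_snd_le x).trans (this.trans (le_max_left _ _))⟩

theorem IsTestFunction.differentiable_smearC {f : ℝ × ℝ → ℂ} (hf : IsTestFunction f) :
    Differentiable ℂ (smearC f) := by
  intro P; obtain ⟨R, hR0, hR⟩ := hf.exists_radius; set A : ℝ × ℝ → (ℂ × ℂ →L[ℂ] ℂ) := fun x =>
    (-I) • ((x.1 : ℂ) • ContinuousLinearMap.fst ℂ ℂ ℂ - (x.2 : ℂ) • ContinuousLinearMap.snd ℂ ℂ ℂ) with hA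
  have hAc : Continuous A := by simp only [hA]; fun_prop
  have hAn : ∀ x ∈ tsupport f, ‖A x‖ ≤ 2 * R := by
    intro x hx; obtain ⟨h1, h2⟩ := hR x hx; simp only [hA]
    rw [norm_smul, norm_neg, norm_I, one_mul]; refine (norm_sub_le _ _).trans ?_
    rw [norm_smul, norm_smul, norm_real, norm_real]
    have h3 := ContinuousLinearMap.norm_fst_le ℂ ℂ ℂ
    have h4 := ContinuousLinearMap.norm_snd_le ℂ ℂ ℂ; have := mul_le_mul h1 h3 (norm_nonneg _) hR0
    have := mul_le_mul h2 h4 (norm_nonneg _) hR0; simp only [norm_eq_abs]; linarith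
  have hd : ∀ (x : ℝ × ℝ) (Q : ℂ × ℂ), HasFDerivAt (fun Q : ℂ × ℂ =>
      f x * exp (-I * (Q.1 * x.1 - Q.2 * x.2)))
      (f x • exp (-I * (Q.1 * x.1 - Q.2 * x.2)) • A x) Q := by
    intro x Q; have e : ∀ Q : ℂ × ℂ, -I * (Q.1 * x.1 - Q.2 * x.2) = A x Q := by
      intro Q; simp [hA]; ring
    simp only [e]; exact ((A x).hasFDerivAt (x := Q)).cexp.const_mul (f x)
  refine (hasFDerivAt_integral_of_dominated_of_fderiv_le (s := Metric.ball P 1)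
    (F := fun (Q : ℂ × ℂ) (x : ℝ × ℝ) => f x * exp (-I * (Q.1 * x.1 - Q.2 * x.2)))
    (F' := fun Q x => f x • exp (-I * (Q.1 * x.1 - Q.2 * x.2)) • A x)
    (bound := fun x => ‖f x‖ * (rexp (2 * (‖P‖ + 1) * R) * (2 * R)))
    (Metric.ball_mem_nhds P one_pos) (.of_forall fun Q =>
      (hf.1.continuous.mul (continuous_phase Q)).aestronglyMeasurable)
    (hf.integrable_mul (continuous_phase P))
    ((hf.1.continuous.smul ((continuous_phase P).smul hAc)).aestronglyMeasurable) ?_ ?_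
    (.of_forall fun x Q _ => hd x Q)).differentiableAt
  · refine .of_forall fun x Q hQ => ?_
    by_cases hx : x ∈ tsupport f
    · rw [norm_smul, norm_smul, norm_exp_phase]; refine mul_le_mul_of_nonneg_left ?_ (norm_nonneg _)
      refine mul_le_mul (exp_le_exp.2 ?_) (hAn x hx) (norm_nonneg _) (exp_pos _).le
      have hQ' : ‖Q‖ ≤ ‖P‖ + 1 := by
        rw [Metric.mem_ball, dist_eq_norm] at hQ; have := norm_le_norm_add_norm_sub' Q P; linarith
      have h1 := ((abs_im_le_norm Q.1).trans (norm_fst_le Q)).trans hQ'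
      have h2 := ((abs_im_le_norm Q.2).trans (norm_snd_le Q)).trans hQ'; obtain ⟨h3, h4⟩ := hR x hx
      have h5 := mul_le_mul h1 h3 (abs_nonneg _) (by positivity)
      have h6 := mul_le_mul h2 h4 (abs_nonneg _) (by positivity); rw [← abs_mul] at h5 h6
      have := le_abs_self (Q.1.im * x.1); have := neg_abs_le (Q.2.im * x.2); linarith
    · simp [image_eq_zero_of_notMem_tsupport hx]
  · exact ((hf.1.continuous.integrable_of_hasCompactSupport hf.2).norm).mul_const _

theorem IsTestFunction.norm_smearC_le {f : ℝ × ℝ → ℂ} (hf : IsTestFunction f) {P : ℂ × ℂ} {R : ℝ}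
    (hR : ∀ x ∈ tsupport f, P.1.im * x.1 - P.2.im * x.2 ≤ R) :
    ‖smearC f P‖ ≤ (∫ x, ‖f x‖) * rexp R := by
  rw [smearC, ← integral_mul_const]
  refine norm_integral_le_of_norm_le ((hf.1.continuous.integrable_of_hasCompactSupport hf.2).norm.mul_const _)
    (.of_forall fun x => ?_)
  rw [norm_mul, norm_exp_phase]
  by_cases hx : x ∈ tsupport f
  · exact mul_le_mul_of_nonneg_left (exp_le_exp.2 (hR x hx)) (norm_nonneg _)
  · rw [image_eq_zero_of_notMem_tsupport hx, norm_zero, zero_mul, zero_mul]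

theorem IsTestFunction.fderiv_apply {f : ℝ × ℝ → ℂ} (hf : IsTestFunction f) (v : ℝ × ℝ) :
    IsTestFunction fun x => fderiv ℝ f x v := by
  refine ⟨?_, hf.2.fderiv_apply (𝕜 := ℝ) v⟩
  exact (hf.1.fderiv_right (m := (⊤ : ℕ∞)) (by simp)).clm_apply contDiff_const

theorem IsTestFunction.smearC_fderiv {f : ℝ × ℝ → ℂ} (hf : IsTestFunction f) (v : ℝ × ℝ) (P : ℂ × ℂ) :
    smearC (fun x => fderiv ℝ f x v) P = I * (P.1 * v.1 - P.2 * v.2) * smearC f P := by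
  set e : ℝ × ℝ → ℂ := fun x => exp (-I * (P.1 * x.1 - P.2 * x.2)) with he
  have hed : ∀ x, HasFDerivAt e (e x • (-I) • (P.1 • ofRealCLM.comp (ContinuousLinearMap.fst ℝ ℝ ℝ) -
      P.2 • ofRealCLM.comp (ContinuousLinearMap.snd ℝ ℝ ℝ))) x := by
    intro x; have h1 : HasFDerivAt (fun x : ℝ × ℝ => -I * (P.1 * x.1 - P.2 * x.2))
        ((-I) • (P.1 • ofRealCLM.comp (ContinuousLinearMap.fst ℝ ℝ ℝ) -
          P.2 • ofRealCLM.comp (ContinuousLinearMap.snd ℝ ℝ ℝ))) x := by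
      have := ((-I) • (P.1 • ofRealCLM.comp (ContinuousLinearMap.fst ℝ ℝ ℝ) -
          P.2 • ofRealCLM.comp (ContinuousLinearMap.snd ℝ ℝ ℝ)) : ℝ × ℝ →L[ℝ] ℂ).hasFDerivAt (x := x)
      refine this.congr_of_eventuallyEq (.of_forall fun y => ?_)
      simp
    exact h1.cexp
  have hef : ∀ x, fderiv ℝ e x v = -(I * (P.1 * v.1 - P.2 * v.2)) * e x := by
    intro x; rw [(hed x).fderiv]; simp; ring
  have hec : Continuous e := continuous_phase P
  have h := integral_mul_fderiv_eq_neg_fderiv_mul_of_integrable (μ := (volume : Measure (ℝ × ℝ)))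
    (f := f) (g := e) (v := v) ((hf.fderiv_apply v).integrable_mul hec) (by
      simp only [hef]; exact hf.integrable_mul (continuous_const.mul hec)) (hf.integrable_mul hec)
    (fun x _ => (hf.1.differentiable (by simp)) x) (fun x _ => (hed x).differentiableAt)
  simp only [hef] at h
  rw [smearC, smearC, ← neg_eq_iff_eq_neg.2 h, ← integral_const_mul, ← integral_neg]
  congr 1; funext x; ring

/-- Integration by parts: each derivative of `f` along `v` produces one factor of the momentum
component and does not enlarge the support, so the exponential bound at complex momenta is kept. -/
theorem IsTestFunction.norm_smearC_pow_le {f : ℝ × ℝ → ℂ} (hf : IsTestFunction f) (v : ℝ × ℝ) (N : ℕ) :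
    ∃ C : ℝ, 0 ≤ C ∧ ∀ (P : ℂ × ℂ) (R : ℝ), (∀ x ∈ tsupport f, P.1.im * x.1 - P.2.im * x.2 ≤ R) →
      ‖P.1 * v.1 - P.2 * v.2‖ ^ N * ‖smearC f P‖ ≤ C * rexp R := by
  induction N generalizing f with
  | zero => exact ⟨∫ x, ‖f x‖, integral_nonneg fun _ => norm_nonneg _, fun P R hR => by
      simpa using hf.norm_smearC_le hR⟩
  | succ N ih =>
    obtain ⟨C, hC, h⟩ := ih (hf.fderiv_apply v); refine ⟨C, hC, fun P R hR => ?_⟩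
    have := h P R fun x hx => hR x (tsupport_fderiv_apply_subset ℝ v hx)
    rw [hf.smearC_fderiv, norm_mul, norm_mul, norm_I, one_mul, ← mul_assoc] at this; rwa [pow_succ]

/-- Decay of the smeared exponential at complex momenta. -/
theorem IsTestFunction.norm_smearC_decay {f : ℝ × ℝ → ℂ} (hf : IsTestFunction f) (N : ℕ) :
    ∃ C : ℝ, 0 ≤ C ∧ ∀ (P : ℂ × ℂ) (R : ℝ), (∀ x ∈ tsupport f, P.1.im * x.1 - P.2.im * x.2 ≤ R) →
      (1 + ‖P.1‖ + ‖P.2‖) ^ N * ‖smearC f P‖ ≤ C * rexp R := by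
  obtain ⟨C0, hC0, h0⟩ := hf.norm_smearC_pow_le (1, 0) 0
  obtain ⟨C1, hC1, h1⟩ := hf.norm_smearC_pow_le (1, 0) N
  obtain ⟨C2, hC2, h2⟩ := hf.norm_smearC_pow_le (0, 1) N
  refine ⟨3 ^ N * (C0 + C1 + C2), by positivity, fun P R hR => ?_⟩
  have a0 := h0 P R hR; have a1 := h1 P R hR; have a2 := h2 P R hR
  simp only [ofReal_one, mul_one, ofReal_zero, mul_zero, sub_zero, zero_sub, norm_neg, pow_zero,
    one_mul] at a0 a1 a2
  have key : (1 + ‖P.1‖ + ‖P.2‖) ^ N ≤ 3 ^ N * (1 + ‖P.1‖ ^ N + ‖P.2‖ ^ N) := by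
    set m := max 1 (max ‖P.1‖ ‖P.2‖) with hm; have b1 : 1 ≤ m := le_max_left _ _
    have b2 : ‖P.1‖ ≤ m := (le_max_left _ _).trans (le_max_right _ _)
    have b3 : ‖P.2‖ ≤ m := (le_max_right _ _).trans (le_max_right _ _)
    have h3 : (1 + ‖P.1‖ + ‖P.2‖) ^ N ≤ (3 * m) ^ N :=
      pow_le_pow_left₀ (by positivity) (by linarith) N
    rw [mul_pow] at h3; refine h3.trans (mul_le_mul_of_nonneg_left ?_ (by positivity))
    have c1 : 0 ≤ ‖P.1‖ ^ N := by positivity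
    have c2 : 0 ≤ ‖P.2‖ ^ N := by positivity
    rcases max_choice 1 (max ‖P.1‖ ‖P.2‖) with h | h <;> rw [hm, h]
    · rw [one_pow]; linarith
    · rcases max_choice ‖P.1‖ ‖P.2‖ with h' | h' <;> rw [h'] <;> linarith
  calc _ ≤ 3 ^ N * (1 + ‖P.1‖ ^ N + ‖P.2‖ ^ N) * ‖smearC f P‖ :=
        mul_le_mul_of_nonneg_right key (norm_nonneg _)
    _ = 3 ^ N * (‖smearC f P‖ + ‖P.1‖ ^ N * ‖smearC f P‖ + ‖P.2‖ ^ N * ‖smearC f P‖) := by ring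
    _ ≤ 3 ^ N * (C0 * rexp R + C1 * rexp R + C2 * rexp R) := by gcongr
    _ = _ := by ring

/-- The bound for a product of two smeared exponentials. -/
theorem norm_smearC_mul_le {f g : ℝ × ℝ → ℂ} (hf : IsTestFunction f) (hg : IsTestFunction g) (N : ℕ) :
    ∃ C : ℝ, 0 ≤ C ∧ ∀ (P Q : ℂ × ℂ) (R : ℝ), (∀ x ∈ tsupport f, ∀ y ∈ tsupport g,
      (P.1.im * x.1 - P.2.im * x.2) + (Q.1.im * y.1 - Q.2.im * y.2) ≤ R) →
      (1 + ‖P.1‖ + ‖P.2‖) ^ N * (‖smearC f P‖ * ‖smearC g Q‖) ≤ C * rexp R := by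
  obtain ⟨C, hC, h⟩ := hf.norm_smearC_decay N
  refine ⟨C * ∫ x, ‖g x‖, mul_nonneg hC (integral_nonneg fun _ => norm_nonneg _), fun P Q R hR => ?_⟩
  rcases (tsupport f).eq_empty_or_nonempty with he | hne
  · have : f = 0 := by rwa [tsupport_eq_empty_iff] at he
    rw [this, smearC]; simp only [Pi.zero_apply, zero_mul, integral_zero, norm_zero, mul_zero]
    exact mul_nonneg (mul_nonneg hC (integral_nonneg fun _ => norm_nonneg _)) (exp_pos _).le
  -- The hypothesis bounds only sums of the two exponents. Taking the maximum of the first exponent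
  -- over the support splits it into a bound for each factor.
  obtain ⟨x0, hx0, hmax⟩ := hf.2.isCompact.exists_isMaxOn hne
    (f := fun x : ℝ × ℝ => P.1.im * x.1 - P.2.im * x.2) (by fun_prop)
  have h1 := h P (P.1.im * x0.1 - P.2.im * x0.2) fun x hx => hmax hx
  have h2 := hg.norm_smearC_le (P := Q) (R := R - (P.1.im * x0.1 - P.2.im * x0.2)) fun y hy => by
    have := hR x0 hx0 y hy; linarith
  calc _ = ((1 + ‖P.1‖ + ‖P.2‖) ^ N * ‖smearC f P‖) * ‖smearC g Q‖ := by ring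
    _ ≤ (C * rexp (P.1.im * x0.1 - P.2.im * x0.2)) *
        ((∫ x, ‖g x‖) * rexp (R - (P.1.im * x0.1 - P.2.im * x0.2))) :=
        mul_le_mul h1 h2 (norm_nonneg _) (mul_nonneg hC (exp_pos _).le)
    _ = C * (∫ x, ‖g x‖) * (rexp (P.1.im * x0.1 - P.2.im * x0.2) *
        rexp (R - (P.1.im * x0.1 - P.2.im * x0.2))) := by ring
    _ = _ := by rw [← Real.exp_add]; congr 2; ring

/-! ### Momenta of complex rapidities -/

/-- The momentum of particles with complex rapidities. -/
def psum (μ : ℝ) (L : List ℂ) : ℂ × ℂ :=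
  (μ * (L.map cosh).sum, μ * (L.map sinh).sum)

/-- The sum of the `cosh` of the real parts. -/
def coshSum (L : List ℂ) : ℝ := (L.map fun z => Real.cosh z.re).sum

theorem psum_nil (μ : ℝ) : psum μ [] = 0 := by simp [psum]

theorem psum_cons (μ : ℝ) (z : ℂ) (L : List ℂ) :
    psum μ (z :: L) = (μ * cosh z, μ * sinh z) + psum μ L := by simp [psum, mul_add]

theorem psum_append (μ : ℝ) (L M : List ℂ) : psum μ (L ++ M) = psum μ L + psum μ M := by
  simp [psum, mul_add]

theorem psum_perm (μ : ℝ) {L M : List ℂ} (h : L.Perm M) : psum μ L = psum μ M := by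
  simp only [psum, (h.map _).sum_eq]

theorem coshSum_append (L M : List ℂ) : coshSum (L ++ M) = coshSum L + coshSum M := by
  simp [coshSum]

theorem coshSum_perm {L M : List ℂ} (h : L.Perm M) : coshSum L = coshSum M := by
  simp only [coshSum, (h.map _).sum_eq]

theorem coshSum_nonneg (L : List ℂ) : 0 ≤ coshSum L := List.sum_nonneg (by
  intro x hx; rw [mem_map] at hx; obtain ⟨z, -, rfl⟩ := hx; exact (cosh_pos _).le)

theorem norm_cosh_le (z : ℂ) : ‖cosh z‖ ≤ Real.cosh z.re := by
  rw [cosh, cosh_eq, norm_div]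
  refine (div_le_div_of_nonneg_right (norm_add_le _ _) (norm_nonneg _)).trans ?_
  rw [norm_exp, norm_exp]; simp

theorem norm_sinh_le (z : ℂ) : ‖sinh z‖ ≤ Real.cosh z.re := by
  rw [sinh, cosh_eq, norm_div]
  refine (div_le_div_of_nonneg_right (norm_sub_le _ _) (norm_nonneg _)).trans ?_
  rw [norm_exp, norm_exp]; simp

theorem norm_psum_le {μ : ℝ} (hμ : 0 < μ) (L : List ℂ) :
    ‖(psum μ L).1‖ ≤ μ * coshSum L ∧ ‖(psum μ L).2‖ ≤ μ * coshSum L := by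
  induction L with
  | nil => simp [psum, coshSum]
  | cons z L ih =>
    rw [psum_cons, show coshSum (z :: L) = Real.cosh z.re + coshSum L by simp [coshSum], mul_add]
    refine ⟨(norm_add_le _ _).trans (add_le_add ?_ ih.1), (norm_add_le _ _).trans (add_le_add ?_ ih.2)⟩
    · simp only [norm_mul, norm_real, norm_eq_abs, abs_of_pos hμ]
      exact mul_le_mul_of_nonneg_left (norm_cosh_le z) hμ.le
    · simp only [norm_mul, norm_real, norm_eq_abs, abs_of_pos hμ]
      exact mul_le_mul_of_nonneg_left (norm_sinh_le z) hμ.le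

/-- The contracted rapidities lie on a common line along which `exp (-i p · (x - y))` does not
grow. -/
def KinOK (f g : ℝ × ℝ → ℂ) (w : List ℂ) : Prop :=
  (∀ z ∈ w, z.im = 0) ∨ RightOf f g ∧ ∃ l : ℝ, ∀ z ∈ w, 0 ≤ z.im ∧ z.im ≤ π ∧ |z.im - l| ≤ 1

theorem KinOK.exists_level {f g : ℝ × ℝ → ℂ} {w : List ℂ} (h : KinOK f g w) :
    ∃ l : ℝ, ∀ z ∈ w, |z.im - l| ≤ 1 := by
  rcases h with h | ⟨-, l, h⟩
  · exact ⟨0, fun z hz => by rw [h z hz]; simp⟩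
  · exact ⟨l, fun z hz => (h z hz).2.2⟩

/-- For one rapidity the right side is `μ cosh (Re z) cos (Im z - l)`, and the cosine is at least
`1/2`. Momenta of rapidities near a common line thus cannot cancel, and decay in the total momentum
is decay in every contracted rapidity. -/
theorem coshSum_le_psum {μ : ℝ} (hμ : 0 < μ) (l : ℝ) (w : List ℂ) (h : ∀ z ∈ w, |z.im - l| ≤ 1) :
    μ / 2 * coshSum w ≤ (psum μ w).1.re * Real.cos l + (psum μ w).2.im * Real.sin l := by
  induction w with
  | nil => simp [psum, coshSum]
  | cons z L ih =>
    have ih := ih fun y hy => h y (by simp [hy])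
    rw [psum_cons, show coshSum (z :: L) = Real.cosh z.re + coshSum L by simp [coshSum]]
    have h1 : (1 : ℝ) / 2 ≤ Real.cos (z.im - l) := by
      have a1 := Real.one_sub_sq_div_two_le_cos (x := z.im - l)
      have a2 := (sq_le_one_iff_abs_le_one _).2 (h z (by simp)); linarith
    rw [Real.cos_sub] at h1; have h2 := mul_le_mul_of_nonneg_left h1 (mul_pos hμ (cosh_pos z.re)).le
    simp only [Prod.fst_add, Prod.snd_add, add_re, add_im, re_ofReal_mul, im_ofReal_mul, cosh_re, sinh_im]
    nlinarith

/-- The imaginary part of `p(z)` is `μ sin (Im z)` times the vector `(sinh Re z, cosh Re z)`. For `0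
≤ Im z ≤ π` the sine is nonnegative, and the Minkowski product of that vector with a point of the
right wedge is negative. This is where the relative position of the supports enters. -/
theorem psum_im_le {μ : ℝ} (hμ : 0 < μ) {f g : ℝ × ℝ → ℂ} {w : List ℂ} (h : KinOK f g w) {x y : ℝ × ℝ}
    (hx : x ∈ tsupport f) (hy : y ∈ tsupport g) :
    (psum μ w).1.im * (x.1 - y.1) - (psum μ w).2.im * (x.2 - y.2) ≤ 0 := by
  have key : ∀ z ∈ w, Real.sin z.im * (Real.sinh z.re * (x.1 - y.1) - Real.cosh z.re * (x.2 - y.2)) ≤ 0 := by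
    intro z hz; rcases h with h | ⟨hr, l, h⟩
    · rw [h z hz]; simp
    · obtain ⟨h0, h1, -⟩ := h z hz
      refine mul_nonpos_of_nonneg_of_nonpos (Real.sin_nonneg_of_nonneg_of_le_pi h0 h1) ?_
      have h2 := hr x hx y hy; have h3 : |Real.sinh z.re| ≤ Real.cosh z.re := by
        rw [abs_le]; have := Real.cosh_sq z.re; have := cosh_pos z.re; constructor <;> nlinarith
      have h4 := mul_le_mul h3 h2.le (abs_nonneg _) (cosh_pos z.re).le; rw [← abs_mul] at h4
      linarith [le_abs_self (Real.sinh z.re * (x.1 - y.1))]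
  clear h
  induction w with
  | nil => simp [psum]
  | cons z L ih =>
    have ih := ih fun y hy => key y (by simp [hy])
    have h1 := mul_le_mul_of_nonneg_left (key z (by simp)) hμ.le; rw [psum_cons]
    simp only [Prod.fst_add, Prod.snd_add, add_im, im_ofReal_mul, cosh_im, sinh_im]; nlinarith

theorem one_add_pow_le_exp (N : ℕ) {x : ℝ} (hx : 0 ≤ x) :
    (1 + x) ^ N ≤ (N.factorial * rexp 1) * rexp x := by
  have := Real.pow_div_factorial_le_exp (x := 1 + x) (by linarith) N
  rw [div_le_iff₀ (by positivity), Real.exp_add] at this; linarith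

/-- The decay of the product of the smeared exponentials in the contracted rapidities. -/
theorem norm_smearC_contracted_le {μ : ℝ} (hμ : 0 < μ) {f g : ℝ × ℝ → ℂ} (hf : IsTestFunction f)
    (hg : IsTestFunction g) (N : ℕ) : ∃ C K : ℝ, 0 ≤ C ∧ 0 ≤ K ∧ ∀ (w : List ℂ) (X Y : ℂ × ℂ), KinOK f g w →
      (1 + coshSum w) ^ N * (‖smearC f (psum μ w + X)‖ * ‖smearC g (Y - psum μ w)‖) ≤
        C * rexp (K * (‖X.1‖ + ‖X.2‖ + ‖Y.1‖ + ‖Y.2‖)) := by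
  obtain ⟨C, hC, h⟩ := norm_smearC_mul_le hf hg N; obtain ⟨R1, hR1, h1⟩ := hf.exists_radius
  obtain ⟨R2, hR2, h2⟩ := hg.exists_radius; set D := 1 + 2 / μ with hD
  have hD0 : 1 ≤ D := by rw [hD]; linarith [div_pos two_pos hμ]
  refine ⟨D ^ N * (N.factorial * rexp 1) * C, 1 + (R1 + R2), by positivity, by positivity,
    fun w X Y hw => ?_⟩
  set P := psum μ w + X with hP; set Q := Y - psum μ w with hQ
  have hXY : 0 ≤ ‖X.1‖ + ‖X.2‖ + ‖Y.1‖ + ‖Y.2‖ := by positivity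
  have hR := h P Q ((R1 + R2) * (‖X.1‖ + ‖X.2‖ + ‖Y.1‖ + ‖Y.2‖)) (by
    intro x hx y hy; have a := psum_im_le hμ hw hx hy
    have b : ∀ (c : ℂ) (r R : ℝ), |r| ≤ R → |c.im * r| ≤ ‖c‖ * R := fun c r R hr => by
      rw [abs_mul]; exact mul_le_mul (abs_im_le_norm c) hr (abs_nonneg _) (norm_nonneg _)
    have b1 := abs_le.1 (b X.1 x.1 _ (h1 x hx).1); have b2 := abs_le.1 (b X.2 x.2 _ (h1 x hx).2)
    have b3 := abs_le.1 (b Y.1 y.1 _ (h2 y hy).1); have b4 := abs_le.1 (b Y.2 y.2 _ (h2 y hy).2)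
    simp only [hP, hQ, Prod.fst_add, Prod.snd_add, Prod.fst_sub, Prod.snd_sub, add_im, sub_im]
    have c1 := mul_nonneg hR2 (norm_nonneg X.1); have c2 := mul_nonneg hR2 (norm_nonneg X.2)
    have c3 := mul_nonneg hR1 (norm_nonneg Y.1); have c4 := mul_nonneg hR1 (norm_nonneg Y.2)
    nlinarith)
  obtain ⟨l, hl⟩ := hw.exists_level; have hlow := coshSum_le_psum hμ l w hl
  have h0 := coshSum_nonneg w; have hx : μ / 2 * coshSum w ≤ ‖P.1‖ + ‖P.2‖ + (‖X.1‖ + ‖X.2‖) := by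
    have e1 : ‖(psum μ w).1‖ ≤ ‖P.1‖ + ‖X.1‖ := by
      have : (psum μ w).1 = P.1 - X.1 := by simp [hP]
      rw [this]; exact norm_sub_le _ _
    have e2 : ‖(psum μ w).2‖ ≤ ‖P.2‖ + ‖X.2‖ := by
      have : (psum μ w).2 = P.2 - X.2 := by simp [hP]
      rw [this]; exact norm_sub_le _ _
    have e3 : (psum μ w).1.re * Real.cos l ≤ ‖(psum μ w).1‖ := by
      refine (le_abs_self _).trans ?_; rw [abs_mul]
      exact (mul_le_mul (abs_re_le_norm _) (Real.abs_cos_le_one l) (abs_nonneg _) (norm_nonneg _)).trans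
        (mul_one _).le
    have e4 : (psum μ w).2.im * Real.sin l ≤ ‖(psum μ w).2‖ := by
      refine (le_abs_self _).trans ?_; rw [abs_mul]
      exact (mul_le_mul (abs_im_le_norm _) (Real.abs_sin_le_one l) (abs_nonneg _) (norm_nonneg _)).trans
        (mul_one _).le
    linarith
  -- The test function `f` provides decay in its total momentum `P`, of which the contracted
  -- momentum is the part left after removing `X`. The factor in `X` is later absorbed into the
  -- exponential.
  have hc : 1 + coshSum w ≤ D * (1 + ‖P.1‖ + ‖P.2‖) * (1 + (‖X.1‖ + ‖X.2‖)) := by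
    have e : coshSum w ≤ 2 / μ * (‖P.1‖ + ‖P.2‖ + (‖X.1‖ + ‖X.2‖)) := by
      have := mul_le_mul_of_nonneg_left hx (div_pos two_pos hμ).le
      have e' : 2 / μ * (μ / 2 * coshSum w) = coshSum w := by field_simp
      linarith
    set p := ‖P.1‖ + ‖P.2‖ with hp; set q := ‖X.1‖ + ‖X.2‖ with hq
    have hp0 : 0 ≤ p := by positivity
    have hq0 : 0 ≤ q := by positivity
    have hm : 0 ≤ 2 / μ := by positivity
    rw [add_assoc 1]; nlinarith [mul_nonneg hp0 hq0, mul_nonneg hm (mul_nonneg hp0 hq0)]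
  have hpow : (1 + coshSum w) ^ N ≤ D ^ N * (1 + ‖P.1‖ + ‖P.2‖) ^ N *
      ((N.factorial * rexp 1) * rexp (‖X.1‖ + ‖X.2‖)) := by
    refine (pow_le_pow_left₀ (by linarith) hc N).trans ?_; rw [mul_pow, mul_pow]
    exact mul_le_mul_of_nonneg_left (one_add_pow_le_exp N (by positivity)) (by positivity)
  calc _ ≤ D ^ N * (1 + ‖P.1‖ + ‖P.2‖) ^ N * ((N.factorial * rexp 1) * rexp (‖X.1‖ + ‖X.2‖)) *
        (‖smearC f P‖ * ‖smearC g Q‖) := mul_le_mul_of_nonneg_right hpow (by positivity)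
    _ = D ^ N * (N.factorial * rexp 1) * rexp (‖X.1‖ + ‖X.2‖) *
        ((1 + ‖P.1‖ + ‖P.2‖) ^ N * (‖smearC f P‖ * ‖smearC g Q‖)) := by ring
    _ ≤ D ^ N * (N.factorial * rexp 1) * rexp (‖X.1‖ + ‖X.2‖ + ‖Y.1‖ + ‖Y.2‖) *
        (C * rexp ((R1 + R2) * (‖X.1‖ + ‖X.2‖ + ‖Y.1‖ + ‖Y.2‖))) := by
        refine mul_le_mul (mul_le_mul_of_nonneg_left (exp_le_exp.2 ?_) (by positivity)) hR
          (by positivity) (by positivity)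
        linarith [norm_nonneg Y.1, norm_nonneg Y.2]
    _ = D ^ N * (N.factorial * rexp 1) * C * (rexp (‖X.1‖ + ‖X.2‖ + ‖Y.1‖ + ‖Y.2‖) *
        rexp ((R1 + R2) * (‖X.1‖ + ‖X.2‖ + ‖Y.1‖ + ‖Y.2‖))) := by ring
    _ = _ := by rw [← Real.exp_add]; congr 2; ring

theorem exp_abs_le (x : ℝ) : rexp |x| ≤ 2 * Real.cosh x := by
  rw [← cosh_abs, cosh_eq]; linarith [exp_pos (-|x|)]

theorem abs_le_cosh (x : ℝ) : |x| ≤ Real.cosh x := by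
  rw [← cosh_abs, cosh_eq]; have h1 := Real.quadratic_le_exp_of_nonneg (abs_nonneg x)
  have h2 := Real.add_one_le_exp (-|x|); nlinarith [sq_nonneg (|x| - 2)]

/-- The sum of the absolute values of the real parts. -/
def reSum (L : List ℂ) : ℝ := (L.map fun z => |z.re|).sum

theorem reSum_append (L M : List ℂ) : reSum (L ++ M) = reSum L + reSum M := by simp [reSum]

theorem reSum_perm {L M : List ℂ} (h : L.Perm M) : reSum L = reSum M := by
  simp only [reSum, (h.map _).sum_eq]

theorem reSum_nonneg (L : List ℂ) : 0 ≤ reSum L := List.sum_nonneg (by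
  intro x hx; rw [mem_map] at hx; obtain ⟨z, -, rfl⟩ := hx; exact abs_nonneg _)

theorem reSum_le_coshSum (L : List ℂ) : reSum L ≤ coshSum L :=
  List.sum_le_sum fun z _ => abs_le_cosh z.re

/-- Exponential growth of the coefficients in the rapidities is only polynomial growth in the
momenta. Hence the faster than polynomial decay coming from smooth test functions controls the
contracted variables. -/
theorem exp_reSum_le (L : List ℂ) : rexp (reSum L) ≤ (2 * (1 + coshSum L)) ^ L.length := by
  induction L with
  | nil => simp [reSum]
  | cons z L ih =>
    have h0 := coshSum_nonneg L; have h1 := cosh_pos z.re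
    rw [show reSum (z :: L) = |z.re| + reSum L by simp [reSum],
      show coshSum (z :: L) = Real.cosh z.re + coshSum L by simp [coshSum], Real.exp_add,
      length_cons, pow_succ']
    refine mul_le_mul ((exp_abs_le _).trans (by linarith)) (ih.trans ?_) (exp_pos _).le (by linarith)
    exact pow_le_pow_left₀ (by linarith) (by linarith) _

theorem exp_mul_reSum_le (L : List ℂ) (R n : ℕ) (hn : L.length ≤ n) :
    rexp (R * reSum L) ≤ 2 ^ (n * R) * (1 + coshSum L) ^ (n * R) := by
  rw [← mul_pow, pow_mul, mul_comm, Real.exp_mul, Real.rpow_natCast]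
  refine pow_le_pow_left₀ (exp_pos _).le ((exp_reSum_le L).trans ?_) R
  exact pow_le_pow_right₀ (by linarith [coshSum_nonneg L]) hn

/-! ### Vectors -/

/-- The properties of the analytic continuation of the wave functions of a vector, for lists. -/
structure VecData (S : ℂ → ℂ) (ψ : List ℂ → ℂ) (κ : ℝ) (N : ℕ) : Prop where
  holo : ∀ L : List ℂ, (∀ z ∈ L, |z.im| < κ) → HoloAt ψ L
  bound : ∀ c : ℝ, ∃ C : ℝ, 0 ≤ C ∧ ∀ L : List ℂ, (∀ z ∈ L, |z.im| < κ) →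
    ‖ψ L‖ ≤ C * rexp (-c * coshSum L)
  zero : ∀ L : List ℂ, N < L.length → ψ L = 0
  exch : ∀ (L1 L2 : List ℂ) (x y : ℂ), (∀ z ∈ L1 ++ x :: y :: L2, |z.im| < κ) →
    ψ (L1 ++ x :: y :: L2) = S (y - x) * ψ (L1 ++ y :: x :: L2)

theorem VecData.mono {S : ℂ → ℂ} {ψ : List ℂ → ℂ} {κ κ' : ℝ} {N N' : ℕ} (h : VecData S ψ κ N)
    (hκ : κ' ≤ κ) (hN : N ≤ N') : VecData S ψ κ' N' := by
  refine ⟨fun L hL => h.holo L fun z hz => (hL z hz).trans_le hκ, fun c => ?_,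
    fun L hL => h.zero L (by omega), fun L1 L2 x y hL => h.exch L1 L2 x y fun z hz => (hL z hz).trans_le hκ⟩
  obtain ⟨C, hC, hb⟩ := h.bound c; exact ⟨C, hC, fun L hL => hb L fun z hz => (hL z hz).trans_le hκ⟩

theorem onList_swap {X Y : Type} (a : (n : ℕ) → (Fin n → X) → Y) (L1 L2 : List X) (x y : X) {n : ℕ}
    (hn : (L1 ++ x :: y :: L2).length = n) (hi : L1.length < n) (hj : L1.length + 1 < n) :
    a n ((fun i : Fin n => (L1 ++ x :: y :: L2).get (i.cast hn.symm)) ∘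
      Equiv.swap ⟨L1.length, hi⟩ ⟨L1.length + 1, hj⟩) = onList a (L1 ++ y :: x :: L2) := by
  have hlen : (L1 ++ y :: x :: L2).length = n := by rw [← hn]; simp
  rw [onList_eq a hlen]; congr 1; funext k; simp only [comp_apply, get_eq_getElem, Fin.val_cast]
  rw [Equiv.swap_apply_def]; split_ifs with hk hk'
  · subst hk; simp
  · subst hk'; simp
  · have hk1 : (k : ℕ) ≠ L1.length := fun h => hk (Fin.ext h)
    have hk2 : (k : ℕ) ≠ L1.length + 1 := fun h => hk' (Fin.ext h)
    simp only [List.getElem_append]; split_ifs with hlt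
    · rfl
    · obtain ⟨m, hm⟩ : ∃ m, (k : ℕ) - L1.length = m + 2 := ⟨k - L1.length - 2, by omega⟩; simp [hm]

theorem isOpen_strip (n : ℕ) (κ : ℝ) : IsOpen {ζ : Fin n → ℂ | ∀ i, |(ζ i).im| < κ} := by
  simp only [setOf_forall]; exact isOpen_iInter_of_finite fun i =>
    isOpen_lt (continuous_abs.comp (continuous_im.comp (continuous_apply i))) continuous_const

theorem convex_strip (n : ℕ) (κ : ℝ) : Convex ℝ {ζ : Fin n → ℂ | ∀ i, |(ζ i).im| < κ} := by
  intro ζ hζ ξ hξ p q hp hq hpq i; have h1 := abs_lt.1 (hζ i); have h2 := abs_lt.1 (hξ i)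
  have e : ((p • ζ + q • ξ) i).im = p * (ζ i).im + q * (ξ i).im := by simp [real_smul]
  rw [e, abs_lt]; have hc := (convex_Ioo (𝕜 := ℝ) (-κ) κ) (show (ζ i).im ∈ _ from h1)
    (show (ξ i).im ∈ _ from h2) hp hq hpq
  simpa using hc

/-- The factor `√n!` makes `ψ` the vacuum component of a product of annihilators applied to `Ψ`,
which is the form in which the vectors enter. The exchange relation is continued from real points;
`κ ≤ δ / 2` keeps the differences of rapidities in the domain of `S`. -/
theorem IsTestVector.exists_vecData {S : ℂ → ℂ} {δ B : ℝ} (hS : StripS S δ B) {Ψ : FockFn}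
    (hΨ : IsTestVector S Ψ) : ∃ (κ : ℝ) (N : ℕ) (ψ : List ℂ → ℂ), 0 < κ ∧ VecData S ψ κ N ∧
      (∀ t : List ℝ, ψ (t.map ofReal) = √(t.length.factorial) * onList Ψ t) ∧
      ∀ n, N < n → Ψ n = 0 := by
  obtain ⟨N, hN⟩ := hΨ.finite; choose κn hκn F hFd hFr hFb using hΨ.analytic
  obtain ⟨κ, hκ, hκδ, hκn'⟩ : ∃ κ, 0 < κ ∧ κ ≤ δ / 2 ∧ ∀ n ≤ N, κ ≤ κn n := by
    obtain ⟨m, -, hm⟩ := (range (N + 1)).exists_min_image κn ⟨0, by simp⟩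
    exact ⟨min (δ / 2) (κn m), lt_min (half_pos hS.pos) (hκn m), min_le_left _ _, fun n hn =>
      (min_le_right _ _).trans (hm n (by simp; omega))⟩
  set G : Coefficients := fun n ζ => if n ≤ N then √n.factorial * F n ζ else 0 with hG
  have hGd : ∀ n, DifferentiableOn ℂ (G n) {ζ | ∀ i, |(ζ i).im| < κ} := by
    intro n
    by_cases hn : n ≤ N
    · simp only [hG, hn, if_true]
      exact ((hFd n).mono fun ζ hζ i => (hζ i).trans_le (hκn' n hn)).const_mul _
    · simp only [hG, hn, if_false]; exact differentiableOn_const _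
  have hGr : ∀ n (t : Fin n → ℝ), G n (fun i => (t i : ℂ)) = √n.factorial * Ψ n t := by
    intro n t
    by_cases hn : n ≤ N
    · simp only [hG, hn, if_true, hFr]
    · simp [hG, hn, hN n (by omega)]
  refine ⟨κ, N, onList G, hκ, ⟨?_, ?_, ?_, ?_⟩, ?_, hN⟩
  · rintro L hL n ζ rfl; simp only [onList_ofFn]
    refine (hGd n).differentiableAt ((isOpen_strip n κ).mem_nhds fun i => hL _ ?_)
    exact (mem_ofFn' _ _).2 ⟨i, rfl⟩
  · intro c; choose C hC using fun n => hFb n c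
    refine ⟨∑ n ∈ range (N + 1), √n.factorial * |C n|,
      Finset.sum_nonneg fun n _ => by positivity, fun L hL => ?_⟩
    by_cases hn : L.length ≤ N
    · have e : onList G L = √L.length.factorial * F L.length L.get := by
        simp only [onList, hG, hn, if_true]
      have hs : ∑ i, Real.cosh (L.get i).re = coshSum L := by
        rw [coshSum]
        conv_rhs => rw [← ofFn_get L, map_ofFn, sum_ofFn]
        rfl
      have hb := hC L.length L.get fun i => (hL _ (get_mem _ _)).trans_le (hκn' _ hn)
      rw [hs] at hb; rw [e, norm_mul, norm_real, norm_eq_abs, abs_of_nonneg (Real.sqrt_nonneg _)]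
      refine (mul_le_mul_of_nonneg_left (hb.trans (mul_le_mul_of_nonneg_right (le_abs_self _)
        (exp_pos _).le)) (Real.sqrt_nonneg _)).trans ?_
      rw [← mul_assoc]; exact mul_le_mul_of_nonneg_right (single_le_sum
        (f := fun n : ℕ => √n.factorial * |C n|) (fun n _ => by positivity)
        (by simp; omega)) (exp_pos _).le
    · have e : onList G L = 0 := by simp only [onList, hG, hn, if_false]
      rw [e, norm_zero]
      exact mul_nonneg (Finset.sum_nonneg fun n _ => by positivity) (exp_pos _).le
  · intro L hL; simp only [onList, hG, not_le.2 hL, if_false]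
  · intro L1 L2 x y hL; set L := L1 ++ x :: y :: L2 with hLd
    have hi : L1.length < L.length := by simp [hLd]
    have hj : L1.length + 1 < L.length := by simp [hLd]
    set i : Fin L.length := ⟨L1.length, hi⟩; set j : Fin L.length := ⟨L1.length + 1, hj⟩
    have hsw : G L.length (L.get ∘ Equiv.swap i j) = onList G (L1 ++ y :: x :: L2) :=
      onList_swap G L1 L2 x y rfl hi hj
    have key := eq_zero_of_real_points (isOpen_strip L.length κ) (convex_strip L.length κ)
      (E := fun ζ => G L.length ζ - S (ζ j - ζ i) * G L.length (ζ ∘ Equiv.swap i j)) (by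
        refine (hGd _).sub (DifferentiableOn.mul ?_ ?_)
        · intro ζ hζ; have h1 := abs_lt.1 (hζ i); have h2 := abs_lt.1 (hζ j); have hpi := pi_pos
          refine (DifferentiableAt.comp ζ (hS.diff (ζ j - ζ i) ?_ ?_) (by fun_prop)).differentiableWithinAt
          · rw [sub_im]; linarith
          · rw [sub_im]; linarith
        · refine (hGd _).comp (Differentiable.differentiableOn ?_) fun ζ hζ k => hζ _
          rw [differentiable_pi]; intro k
          exact differentiable_apply (𝕜 := ℂ) (Equiv.swap i j k)) (by
        intro t _; have h1 := hΨ.symm L.length i j rfl t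
        have e : (fun k => (t k : ℂ)) ∘ Equiv.swap i j = fun k => (((t ∘ Equiv.swap i j) k : ℝ) : ℂ) := rfl
        simp only [e, hGr]; rw [h1]; ring) (by
        intro ζ hζ k
        simpa using (abs_nonneg _).trans_lt (hζ k)) (ζ := L.get) (fun k => hL _ (get_mem _ _))
    rw [hsw, sub_eq_zero] at key; have ei : L.get i = x := by simp [i, hLd]
    have ej : L.get j = y := by simp [j, hLd]
    rw [ei, ej] at key; exact key
  · intro t; rw [onList_eq G (n := t.length) (by simp)]
    exact (congrArg _ (by funext i; simp)).trans (hGr t.length t.get)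

/-- The complex conjugate function `z ↦ conj (f (conj z))`. -/
def conjFn (f : List ℂ → ℂ) (L : List ℂ) : ℂ := conj (f (L.map conj))

theorem HoloAt.conjFn {f : List ℂ → ℂ} {L : List ℂ} (h : HoloAt f (L.map conj)) :
    HoloAt (ZF.conjFn f) L := by
  rintro n ζ rfl; have h1 := h n (fun i => conj (ζ i)) (by rw [map_ofFn]; rfl)
  have e : (fun ζ' : Fin n → ℂ => ZF.conjFn f (ofFn ζ')) = fun ζ' =>
      conj (f (ofFn fun i => conj (ζ' i))) := by funext ζ'; rw [ZF.conjFn, map_ofFn]; rfl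
  rw [e]; have h2 := h1.star_star; have e2 : star (fun i => conj (ζ i)) = ζ := by funext i; simp
  rw [e2] at h2; exact h2

theorem coshSum_map_conj (L : List ℂ) : coshSum (L.map conj) = coshSum L := by
  simp [coshSum, comp_def]

theorem mem_map_conj {L : List ℂ} {κ : ℝ} (h : ∀ z ∈ L, |z.im| < κ) :
    ∀ z ∈ L.map conj, |z.im| < κ := by
  intro z hz; obtain ⟨w, hw, rfl⟩ := mem_map.1 hz; simpa using h w hw

theorem VecData.conj_exch {S : ℂ → ℂ} {δ B : ℝ} (hS : StripS S δ B) {ψ : List ℂ → ℂ} {κ : ℝ} {N : ℕ}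
    (h : VecData S ψ κ N) (hκ : κ ≤ δ / 2) (L1 L2 : List ℂ) (x y : ℂ)
    (hL : ∀ z ∈ L1 ++ x :: y :: L2, |z.im| < κ) :
    conjFn ψ (L1 ++ x :: y :: L2) = S (x - y) * conjFn ψ (L1 ++ y :: x :: L2) := by
  have hx := abs_lt.1 (hL x (by simp)); have hy := abs_lt.1 (hL y (by simp))
  have hL' := mem_map_conj hL; rw [map_append, map_cons, map_cons] at hL'; have hpi := pi_pos
  rw [conjFn, conjFn, map_append, map_cons, map_cons, h.exch _ _ _ _ hL', map_mul,
    map_append, map_cons, map_cons, ← hS.herm]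
  · congr 2; simp
  · simp only [sub_im, conj_im]; linarith
  · simp only [sub_im, conj_im]; linarith

theorem StripS.mono {S : ℂ → ℂ} {δ δ' B : ℝ} (h : StripS S δ B) (h0 : 0 < δ') (hδ : δ' ≤ δ) :
    StripS S δ' B :=
  ⟨h0, hδ.trans h.le, h.one_le, fun z h1 h2 => h.diff z (by linarith) (by linarith),
    fun z h1 h2 => h.bound z (by linarith) (by linarith), fun z h1 => h.inv z (by linarith),
    fun z h1 h2 => h.cross z (by linarith) (by linarith),
    fun z h1 h2 => h.herm z (by linarith) (by linarith)⟩

/-! ### The integrand of the matrix elements of a product of two fields -/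

/-- Two fields, two test functions and two vectors, with common bounds for the domains of
analyticity and the numbers of variables. -/
structure Model where
  μ : ℝ
  S : ℂ → ℂ
  a : Coefficients
  b : Coefficients
  f : ℝ × ℝ → ℂ
  g : ℝ × ℝ → ℂ
  φ : List ℂ → ℂ
  ψ : List ℂ → ℂ
  δ : ℝ
  B : ℝ
  N : ℕ
  pos : 0 < μ
  strip : StripS S δ B
  ha : CoefData S a δ N
  hb : CoefData S b δ N
  hf : IsTestFunction f
  hg : IsTestFunction g
  hφ : VecData S φ (δ / 2) N
  hψ : VecData S ψ (δ / 2) N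

/-- The arguments of the coefficient `a`, as pairs of a variable `x` and `(α, β)` that stand for
`x + α + β e`. For `k = true` they are in the order of the Wick product, and otherwise in an
equivalent one. -/
def aSym {X : Type} (k : Bool) (C : Config X) : List (X × ℂ × ℂ) :=
  if k then (C .H).reverse.map (fun x => (x, 0, 0)) ++ (C .L ++ C .et).map (fun x => (x, 0, -I)) ++
    (C .th).reverse.map (fun x => (x, -(π * I), I))
  else (C .th).reverse.map (fun x => (x, π * I, 0)) ++
    ((C .H).reverse ++ (C .L ++ C .et)).map (fun x => (x, 0, 0))

/-- The arguments of the coefficient `b`. -/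
def bSym {X : Type} (C : Config X) : List (X × ℂ × ℂ) :=
  (C .eB).map (fun x => (x, 0, -I)) ++
    ((C .Q).reverse ++ (C .L).reverse ++ C .H ++ C .P).map (fun x => (x, -(π * I), I))

/-- Evaluation of the symbolic arguments. -/
def symEval (e : ℂ) (M : List (ℂ × ℂ × ℂ)) : List ℂ := M.map fun p => p.1 + p.2.1 + p.2.2 * e

/-- The product of the S-matrix elements of all pairs. -/
def sProd (S : ℂ → ℂ) (L M : List ℂ) : ℂ := (L.map fun x => (M.map fun y => S (x - y)).prod).prod

namespace Model

variable (m : Model)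

/-- The smeared exponentials. -/
def smears (C : Config ℂ) : ℂ :=
  smearC m.f (psum m.μ (C .H ++ C .L) + (psum m.μ (C .et) - psum m.μ (C .th))) *
    smearC m.g ((psum m.μ (C .eB) - psum m.μ (C .P ++ C .Q)) - psum m.μ (C .H ++ C .L))

/-- The factors that depend on the vectors. -/
def vecs (C : Config ℂ) : ℂ :=
  conjFn m.φ ((C .P).reverse ++ (C .th ++ (C .Q ++ C .nu))) * m.ψ (C .eB ++ (C .et ++ C .nu))

/-- The integrand. -/
def W (k : Bool) (e1 e2 : ℂ) (C : Config ℂ) : ℂ :=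
  m.smears C * onList m.a (symEval e1 (aSym k C)) * onList m.b (symEval e2 (bSym C)) *
    sProd m.S (C .Q) (C .et) * m.vecs C

/-- Configurations where the integrand is regular, with a relation `R` for the arguments of `a` and
`b`. -/
structure Adm (R : ℂ → ℂ → Prop) (k : Bool) (e1 e2 : ℂ) (C : Config ℂ) : Prop where
  len : ∑ b, (C b).length ≤ m.N
  a : (symEval e1 (aSym k C)).Pairwise R
  b : (symEval e2 (bSym C)).Pairwise R
  s : ∀ q ∈ C .Q, ∀ e ∈ C .et, |(q - e).im| < m.δ
  vec : ∀ r, r ≠ .H → r ≠ .L → ∀ z ∈ C r, |z.im| < m.δ / 2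
  kin : KinOK m.f m.g (C .H ++ C .L)

end Model

theorem sum_role (F : Role → ℕ) : ∑ b, F b = F .th + F .et + F .P + F .H + F .L + F .Q + F .eB + F .nu := by
  simp only [Finset.sum, Finset.univ, Fintype.elems]; simp; ring

theorem sum_role_real (F : Role → ℝ) : ∑ b, F b = F .th + F .et + F .P + F .H + F .L + F .Q + F .eB + F .nu := by
  simp only [Finset.sum, Finset.univ, Fintype.elems]; simp; ring

theorem length_symEval (e : ℂ) (M : List (ℂ × ℂ × ℂ)) : (symEval e M).length = M.length := by simp [symEval]

theorem length_aSym {X : Type} (k : Bool) (C : Config X) :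
    (aSym k C).length = (C .H).length + (C .L).length + (C .et).length + (C .th).length := by
  cases k <;> simp [aSym] <;> ring

theorem length_bSym {X : Type} (C : Config X) :
    (bSym C).length = (C .eB).length + (C .Q).length + (C .L).length + (C .H).length + (C .P).length := by
  simp [bSym]; ring

theorem aSym_map {X Y : Type} (f : X → Y) (k : Bool) (C : Config X) :
    aSym k (fun b => (C b).map f) = (aSym k C).map (Prod.map f id) := by
  cases k <;> simp [aSym, comp_def]

theorem bSym_map {X Y : Type} (f : X → Y) (C : Config X) :
    bSym (fun b => (C b).map f) = (bSym C).map (Prod.map f id) := by simp [bSym, comp_def]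

theorem reSum_symEval_a (k : Bool) (e : ℝ) (C : Config ℂ) :
    reSum (symEval e (aSym k C)) = reSum (C .H) + reSum (C .L) + reSum (C .et) + reSum (C .th) := by
  cases k <;> simp [reSum, symEval, aSym, comp_def] <;> ring

theorem reSum_symEval_b (e : ℝ) (C : Config ℂ) :
    reSum (symEval e (bSym C)) = reSum (C .eB) + reSum (C .Q) + reSum (C .L) + reSum (C .H) + reSum (C .P) := by
  simp [reSum, symEval, bSym, comp_def]; ring

theorem norm_list_prod_le {c : ℝ} (hc : 1 ≤ c) {ι : Type*} (f : ι → ℂ) : ∀ L : List ι,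
    (∀ i ∈ L, ‖f i‖ ≤ c) → ‖(L.map f).prod‖ ≤ c ^ L.length
  | [], _ => by simp
  | i :: L, h => by
    rw [map_cons, prod_cons, norm_mul, length_cons, pow_succ']
    exact mul_le_mul (h i (by simp)) (norm_list_prod_le hc f L fun j hj => h j (by simp [hj]))
      (norm_nonneg _) (by linarith)

theorem differentiableAt_list_sum {X : Type*} [NormedAddCommGroup X] [NormedSpace ℂ X] {ι : Type*}
    (φ : ι → X → ℂ) {x : X} : ∀ M : List ι, (∀ i ∈ M, DifferentiableAt ℂ (φ i) x) →
    DifferentiableAt ℂ (fun x => (M.map fun i => φ i x).sum) x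
  | [], _ => by simp
  | i :: M, h => by
    simp only [map_cons, sum_cons]
    exact (h i (by simp)).add (differentiableAt_list_sum φ M fun j hj => h j (by simp [hj]))

theorem differentiable_psum {n : ℕ} (μ : ℝ) (M : List (Fin n)) :
    Differentiable ℂ fun p : (Fin n → ℂ) × ℂ × ℂ => psum μ (M.map p.1) := by
  intro p; simp only [psum, map_map, comp_def]
  refine DifferentiableAt.prodMk (DifferentiableAt.const_mul ?_ _) (DifferentiableAt.const_mul ?_ _)
  · exact differentiableAt_list_sum (fun i (p : (Fin n → ℂ) × ℂ × ℂ) => cosh (p.1 i)) M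
      fun i _ => by fun_prop
  · exact differentiableAt_list_sum (fun i (p : (Fin n → ℂ) × ℂ × ℂ) => sinh (p.1 i)) M
      fun i _ => by fun_prop

namespace Model

variable (m : Model)

theorem differentiableAt_W (k : Bool) (ω : List Role) (ζ : Fin ω.length → ℂ) (e1 e2 : ℂ)
    (h : m.Adm (RegRel m.δ) k e1 e2 (config ω ζ)) :
    DifferentiableAt ℂ (fun p : (Fin ω.length → ℂ) × ℂ × ℂ => m.W k p.2.1 p.2.2 (config ω p.1)) (ζ, e1, e2) := by
  set M : Config (Fin ω.length) := config ω id with hM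
  have hC : ∀ z : Fin ω.length → ℂ, config ω z = fun b => (M b).map z := fun z => by
    rw [hM, config_map]; rfl
  have hps := fun L => differentiable_psum (n := ω.length) m.μ L (ζ, e1, e2)
  have hl := h.len; rw [hC] at h; simp only [config_length, sum_role] at hl
  have la : (aSym k M).length ≤ m.N := by rw [length_aSym]; simp only [hM, config_length]; omega
  have lb : (bSym M).length ≤ m.N := by rw [length_bSym]; simp only [hM, config_length]; omega
  have ea : ∀ (k : Bool) (e : ℂ) (z : Fin ω.length → ℂ), symEval e (aSym k fun b => (M b).map z) =
      (aSym k M).map fun q => z q.1 + q.2.1 + q.2.2 * e := fun k e z => by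
    rw [aSym_map, symEval, map_map]; rfl
  have eb : ∀ (e : ℂ) (z : Fin ω.length → ℂ), symEval e (bSym fun b => (M b).map z) =
      (bSym M).map fun q => z q.1 + q.2.1 + q.2.2 * e := fun e z => by
    rw [bSym_map, symEval, map_map]; rfl
  have dz : ∀ i, DifferentiableAt ℂ (fun p : (Fin ω.length → ℂ) × ℂ × ℂ => p.1 i) (ζ, e1, e2) := fun i => by
    fun_prop
  simp only [hC, W]
  refine DifferentiableAt.fun_mul (DifferentiableAt.fun_mul (DifferentiableAt.fun_mul (DifferentiableAt.fun_mul ?_ ?_) ?_) ?_) ?_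
  · simp only [smears, ← map_append]; exact DifferentiableAt.fun_mul
      ((m.hf.differentiable_smearC _).comp _ ((hps _).add ((hps _).sub (hps _))))
      ((m.hg.differentiable_smearC _).comp _ (((hps _).sub (hps _)).sub (hps _)))
  · simp only [ea]; have h1 := h.a; rw [ea] at h1
    exact HoloAt.comp (aSym k M) (fun q (p : (Fin ω.length → ℂ) × ℂ × ℂ) => p.1 q.1 + q.2.1 + q.2.2 * p.2.1)
      (m.ha.holo _ (by rw [length_map]; exact la) h1) fun q _ => by fun_prop
  · simp only [eb]; have h1 := h.b; rw [eb] at h1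
    exact HoloAt.comp (bSym M) (fun q (p : (Fin ω.length → ℂ) × ℂ × ℂ) => p.1 q.1 + q.2.1 + q.2.2 * p.2.2)
      (m.hb.holo _ (by rw [length_map]; exact lb) h1) fun q _ => by fun_prop
  · simp only [sProd, map_map, comp_def]; have hpi := pi_pos
    refine differentiableAt_list_prod (fun q (p : (Fin ω.length → ℂ) × ℂ × ℂ) =>
      ((M .et).map fun e => m.S (p.1 q - p.1 e)).prod) (M .Q) fun q hq => ?_
    refine differentiableAt_list_prod (fun e (p : (Fin ω.length → ℂ) × ℂ × ℂ) => m.S (p.1 q - p.1 e)) (M .et)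
      fun e he => ?_
    have h1 := abs_lt.1 (h.s _ (List.mem_map_of_mem hq) _ (List.mem_map_of_mem he))
    exact (m.strip.diff (ζ q - ζ e) h1.1 (by linarith)).comp (ζ, e1, e2) ((dz q).sub (dz e))
  · simp only [vecs, ← map_append, ← map_reverse]
    have hv : ∀ r, r ≠ .H → r ≠ .L → ∀ i ∈ M r, |(ζ i).im| < m.δ / 2 := fun r h1 h2 i hi =>
      h.vec r h1 h2 _ (List.mem_map_of_mem hi)
    refine DifferentiableAt.fun_mul ?_ ?_
    · refine HoloAt.comp _ (fun q (p : (Fin ω.length → ℂ) × ℂ × ℂ) => p.1 q)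
        (HoloAt.conjFn (m.hφ.holo _ (mem_map_conj fun z hz => ?_))) fun q _ => dz q
      obtain ⟨i, hi, rfl⟩ := mem_map.1 hz; simp only [mem_append, mem_reverse] at hi
      rcases hi with hi | hi | hi | hi <;> exact hv _ (by simp) (by simp) i hi
    · refine HoloAt.comp _ (fun q (p : (Fin ω.length → ℂ) × ℂ × ℂ) => p.1 q)
        (m.hψ.holo _ fun z hz => ?_) fun q _ => dz q
      obtain ⟨i, hi, rfl⟩ := mem_map.1 hz; simp only [mem_append] at hi
      rcases hi with hi | hi | hi <;> exact hv _ (by simp) (by simp) i hi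

/-- Contracted rapidities are controlled by the decay of the smeared exponentials, all others by the
decay of the wave functions. The bound is uniform in the regularization parameters and in the
heights, as needed both for contour shifts and for dominated convergence. -/
theorem norm_W_le {γ : ℝ} (hγ : 0 < γ) : ∃ K : ℝ, 0 ≤ K ∧ ∀ (k : Bool) (e1 e2 : ℝ) (C : Config ℂ),
    m.Adm (CoshRel m.δ γ) k e1 e2 C → ‖m.W k e1 e2 C‖ ≤ K * rexp (-absSum C) := by
  obtain ⟨Ca, ra, hCa, hra, ha⟩ := m.ha.bound γ hγ; obtain ⟨Cb, rb, hCb, hrb, hb⟩ := m.hb.bound γ hγ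
  -- The growth rates of the two coefficients, plus `1` for the decay that is to be left over. An
  -- exponential of rate `R` in the contracted rapidities costs a polynomial of degree at most `N R`
  -- in their `cosh`.
  obtain ⟨R, hR⟩ := exists_nat_ge (ra + rb + 1)
  obtain ⟨Cs, Ks, hCs, hKs, hs⟩ := norm_smearC_contracted_le m.pos m.hf m.hg (m.N * R)
  -- The wave functions have to beat the rate `R` and, in addition, the exponential in the momenta
  -- of the uncontracted variables that bounds the smeared factors.
  set c : ℝ := R + 2 * m.μ * Ks with hc; obtain ⟨Cu, hCu, hu⟩ := m.hφ.bound c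
  obtain ⟨Cv, hCv, hv⟩ := m.hψ.bound c; have hB := m.strip.one_le
  refine ⟨2 ^ (m.N * R) * Cs * Ca * Cb * (m.B ^ m.N) ^ m.N * Cu * Cv, by positivity, fun k e1 e2 C h => ?_⟩
  have hμ := m.pos; have hl := h.len; rw [sum_role] at hl; set w := C .H ++ C .L with hw
  set O1 := (C .P).reverse ++ (C .th ++ (C .Q ++ C .nu)) with hO1
  set O2 := C .eB ++ (C .et ++ C .nu) with hO2
  have hwl : w.length ≤ m.N := by rw [hw, length_append]; omega
  have nn := coshSum_nonneg; have rn := reSum_nonneg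
  have h1 : ‖onList m.a (symEval e1 (aSym k C))‖ ≤ Ca * rexp (ra * (reSum w + reSum O1 + reSum O2)) := by
    refine (ha _ (by rw [length_symEval, length_aSym]; omega) h.a).trans
      (mul_le_mul_of_nonneg_left (exp_le_exp.2 (mul_le_mul_of_nonneg_left ?_ hra)) hCa)
    change reSum _ ≤ _; rw [reSum_symEval_a, hw, hO1, hO2]
    simp only [reSum_append, reSum_perm (reverse_perm _)]
    linarith [rn (C .P), rn (C .Q), rn (C .nu), rn (C .eB)]
  have h2 : ‖onList m.b (symEval e2 (bSym C))‖ ≤ Cb * rexp (rb * (reSum w + reSum O1 + reSum O2)) := by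
    refine (hb _ (by rw [length_symEval, length_bSym]; omega) h.b).trans
      (mul_le_mul_of_nonneg_left (exp_le_exp.2 (mul_le_mul_of_nonneg_left ?_ hrb)) hCb)
    change reSum _ ≤ _; rw [reSum_symEval_b, hw, hO1, hO2]
    simp only [reSum_append, reSum_perm (reverse_perm _)]
    linarith [rn (C .th), rn (C .et), rn (C .nu)]
  have h3 : ‖sProd m.S (C .Q) (C .et)‖ ≤ (m.B ^ m.N) ^ m.N := by
    have hpi := pi_pos
    refine (norm_list_prod_le (one_le_pow₀ (n := m.N) hB) _ _ fun q hq => ?_).trans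
      (pow_le_pow_right₀ (one_le_pow₀ hB) (by omega))
    refine (norm_list_prod_le hB _ _ fun e he => ?_).trans (pow_le_pow_right₀ hB (by omega))
    have h1 := abs_lt.1 (h.s _ hq _ he); exact m.strip.bound _ h1.1 (by linarith)
  have h4 : ‖m.vecs C‖ ≤ Cu * rexp (-c * coshSum O1) * (Cv * rexp (-c * coshSum O2)) := by
    rw [vecs, norm_mul]; refine mul_le_mul ?_ ?_ (norm_nonneg _) (by positivity)
    · rw [conjFn, RCLike.norm_conj, ← coshSum_map_conj O1]
      refine hu _ (mem_map_conj fun z hz => ?_)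
      simp only [mem_append, mem_reverse] at hz
      rcases hz with hz | hz | hz | hz <;> exact h.vec _ (by simp) (by simp) z hz
    · refine hv _ fun z hz => ?_
      simp only [mem_append] at hz
      rcases hz with hz | hz | hz <;> exact h.vec _ (by simp) (by simp) z hz
  have h5 : rexp (R * reSum w) * ‖m.smears C‖ ≤ 2 ^ (m.N * R) * Cs *
      rexp (2 * m.μ * Ks * (coshSum O1 + coshSum O2)) := by
    have h6 := hs w (psum m.μ (C .et) - psum m.μ (C .th)) (psum m.μ (C .eB) - psum m.μ (C .P ++ C .Q)) h.kin
    rw [← norm_mul] at h6; change (1 + coshSum w) ^ (m.N * R) * ‖m.smears C‖ ≤ _ at h6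
    have h7 : ‖(psum m.μ (C .et) - psum m.μ (C .th)).1‖ + ‖(psum m.μ (C .et) - psum m.μ (C .th)).2‖ +
        ‖(psum m.μ (C .eB) - psum m.μ (C .P ++ C .Q)).1‖ + ‖(psum m.μ (C .eB) - psum m.μ (C .P ++ C .Q)).2‖ ≤
        2 * m.μ * (coshSum O1 + coshSum O2) := by
      have i1 := norm_psum_le hμ (C .et); have i2 := norm_psum_le hμ (C .th)
      have i3 := norm_psum_le hμ (C .eB); have i4 := norm_psum_le hμ (C .P ++ C .Q)
      have j1 := norm_sub_le (psum m.μ (C .et)).1 (psum m.μ (C .th)).1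
      have j2 := norm_sub_le (psum m.μ (C .et)).2 (psum m.μ (C .th)).2
      have j3 := norm_sub_le (psum m.μ (C .eB)).1 (psum m.μ (C .P ++ C .Q)).1
      have j4 := norm_sub_le (psum m.μ (C .eB)).2 (psum m.μ (C .P ++ C .Q)).2
      have e : coshSum O1 + coshSum O2 = coshSum (C .P ++ C .Q) + coshSum (C .th) + coshSum (C .eB) +
          coshSum (C .et) + 2 * coshSum (C .nu) := by
        rw [hO1, hO2]; simp only [coshSum_append, coshSum_perm (reverse_perm _)]; ring
      rw [e]; simp only [Prod.fst_sub, Prod.snd_sub]; have := mul_nonneg hμ.le (nn (C .nu))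
      linarith
    calc _ ≤ 2 ^ (m.N * R) * (1 + coshSum w) ^ (m.N * R) * ‖m.smears C‖ :=
          mul_le_mul_of_nonneg_right (exp_mul_reSum_le w R m.N hwl) (norm_nonneg _)
      _ = 2 ^ (m.N * R) * ((1 + coshSum w) ^ (m.N * R) * ‖m.smears C‖) := by ring
      _ ≤ 2 ^ (m.N * R) * (Cs * rexp (Ks * (2 * m.μ * (coshSum O1 + coshSum O2)))) := by
          refine mul_le_mul_of_nonneg_left (h6.trans (mul_le_mul_of_nonneg_left
            (exp_le_exp.2 (mul_le_mul_of_nonneg_left h7 hKs)) hCs)) (by positivity)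
      _ = _ := by
          rw [show Ks * (2 * m.μ * (coshSum O1 + coshSum O2)) =
            2 * m.μ * Ks * (coshSum O1 + coshSum O2) by ring]
          ring
  have h5' : ‖m.smears C‖ ≤ 2 ^ (m.N * R) * Cs *
      rexp (2 * m.μ * Ks * (coshSum O1 + coshSum O2) - R * reSum w) := by
    rw [Real.exp_sub, ← mul_div_assoc, le_div_iff₀ (exp_pos _), mul_comm]; exact h5
  have hab : absSum C ≤ reSum w + reSum O1 + reSum O2 := by
    have : absSum C = ∑ b, reSum (C b) := rfl; rw [this, sum_role_real, hw, hO1, hO2]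
    simp only [reSum_append, reSum_perm (reverse_perm _)]; linarith [rn (C .nu)]
  have hfin : (2 * m.μ * Ks * (coshSum O1 + coshSum O2) - R * reSum w) + ra * (reSum w + reSum O1 + reSum O2) +
      rb * (reSum w + reSum O1 + reSum O2) + (-c * coshSum O1) + (-c * coshSum O2) ≤ -absSum C := by
    have w1 := reSum_le_coshSum O1; have w2 := reSum_le_coshSum O2
    have hR0 : (0 : ℝ) ≤ R := cast_nonneg _; have e3 := mul_le_mul_of_nonneg_left w1 hR0
    have e4 := mul_le_mul_of_nonneg_left w2 hR0
    have e5 := mul_le_mul_of_nonneg_right hR (add_nonneg (add_nonneg (rn w) (rn O1)) (rn O2))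
    rw [hc]; nlinarith
  calc ‖m.W k e1 e2 C‖ = ‖m.smears C‖ * ‖onList m.a (symEval e1 (aSym k C))‖ *
        ‖onList m.b (symEval e2 (bSym C))‖ * ‖sProd m.S (C .Q) (C .et)‖ * ‖m.vecs C‖ := by
        rw [W]; simp only [norm_mul]
    _ ≤ (2 ^ (m.N * R) * Cs * rexp (2 * m.μ * Ks * (coshSum O1 + coshSum O2) - R * reSum w)) *
        (Ca * rexp (ra * (reSum w + reSum O1 + reSum O2))) *
        (Cb * rexp (rb * (reSum w + reSum O1 + reSum O2))) * (m.B ^ m.N) ^ m.N *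
        (Cu * rexp (-c * coshSum O1) * (Cv * rexp (-c * coshSum O2))) := by gcongr
    _ = 2 ^ (m.N * R) * Cs * Ca * Cb * (m.B ^ m.N) ^ m.N * Cu * Cv *
        rexp ((2 * m.μ * Ks * (coshSum O1 + coshSum O2) - R * reSum w) +
          ra * (reSum w + reSum O1 + reSum O2) + rb * (reSum w + reSum O1 + reSum O2) +
          (-c * coshSum O1) + (-c * coshSum O2)) := by simp only [Real.exp_add]; ring
    _ ≤ _ := mul_le_mul_of_nonneg_left (exp_le_exp.2 hfin) (by positivity)

end Model

/-! ### Admissible levels -/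

theorem coshRel_of_im {δ γ : ℝ} (hδ : δ ≤ 1 / 2) (hγ : 0 < γ) (hγ1 : γ ≤ 1) {z w : ℂ}
    (h1 : -δ < z.im - w.im) (h2 : z.im - w.im < π + δ)
    (h3 : z.im - w.im ≤ π - γ ∨ π + γ ≤ z.im - w.im) : CoshRel δ (Real.sin (γ / 2)) z w := by
  refine coshRel_of_gap hδ hγ hγ1 ⟨by rwa [sub_im], by rwa [sub_im]⟩ ?_; rw [sub_im]
  rcases h3 with h | h
  · rw [abs_of_neg (by linarith)]; linarith
  · rw [abs_of_pos (by linarith)]; linarith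

theorem pairwise_map_of_all {X : Type*} {R : ℂ → ℂ → Prop} (f : X → ℂ) {L : List X}
    (h : ∀ x ∈ L, ∀ y ∈ L, R (f x) (f y)) : (L.map f).Pairwise R := by
  rw [pairwise_map]
  exact List.Pairwise.imp_of_mem (R := fun _ _ => True) (fun {x y} hx hy _ => h x hx y hy)
    (by simp [List.pairwise_iff_forall_sublist])

theorem symEval_aSym_true (e : ℂ) (C : Config ℂ) : symEval e (aSym true C) =
    (C .H).reverse ++ ((C .L).map (fun x => x - e * I) ++ (C .et).map (fun x => x - e * I)) ++
      (C .th).reverse.map (fun x => x - π * I + e * I) := by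
  simp [symEval, aSym, comp_def, sub_eq_add_neg, mul_comm]

theorem symEval_aSym_false (e : ℂ) (C : Config ℂ) : symEval e (aSym false C) =
    (C .th).reverse.map (fun x => x + π * I) ++ ((C .H).reverse ++ (C .L ++ C .et)) := by
  simp [symEval, aSym, comp_def]

theorem symEval_bSym (e : ℂ) (C : Config ℂ) : symEval e (bSym C) =
    (C .eB).map (fun x => x - e * I) ++ ((C .Q).reverse ++ (C .L).reverse ++ C .H ++ C .P).map
      (fun x => x - π * I + e * I) := by simp [symEval, bSym, comp_def, sub_eq_add_neg, mul_comm]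

theorem pairwise_aSym_true {R : ℂ → ℂ → Prop} {e : ℂ} {C : Config ℂ}
    (hHH : ∀ x ∈ C .H, ∀ y ∈ C .H, R x y)
    (hLL : ∀ x ∈ C .L ++ C .et, ∀ y ∈ C .L ++ C .et, R (x - e * I) (y - e * I))
    (htt : ∀ x ∈ C .th, ∀ y ∈ C .th, R (x - π * I + e * I) (y - π * I + e * I))
    (hHL : ∀ x ∈ C .H, ∀ y ∈ C .L ++ C .et, R x (y - e * I))
    (hHt : ∀ x ∈ C .H, ∀ y ∈ C .th, R x (y - π * I + e * I))
    (hLt : ∀ x ∈ C .L ++ C .et, ∀ y ∈ C .th, R (x - e * I) (y - π * I + e * I)) :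
    (symEval e (aSym true C)).Pairwise R := by
  rw [symEval_aSym_true, ← map_append, pairwise_append, pairwise_append]
  have h1 := pairwise_map_of_all (R := R) id (L := (C .H).reverse) (by simpa using hHH)
  rw [List.map_id] at h1
  refine ⟨⟨h1, pairwise_map_of_all _ hLL, ?_⟩, pairwise_map_of_all _ (by simpa using htt), ?_⟩
  · intro x hx y hy; obtain ⟨z, hz, rfl⟩ := mem_map.1 hy; exact hHL x (by simpa using hx) z hz
  · intro x hx y hy; obtain ⟨z, hz, rfl⟩ := mem_map.1 hy; rw [mem_append] at hx
    rcases hx with hx | hx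
    · exact hHt x (by simpa using hx) z (by simpa using hz)
    · obtain ⟨x', hx', rfl⟩ := mem_map.1 hx; exact hLt x' hx' z (by simpa using hz)

theorem pairwise_aSym_false {R : ℂ → ℂ → Prop} {e : ℂ} {C : Config ℂ}
    (htt : ∀ x ∈ C .th, ∀ y ∈ C .th, R (x + π * I) (y + π * I))
    (hHH : ∀ x ∈ C .H, ∀ y ∈ C .H, R x y)
    (hLL : ∀ x ∈ C .L ++ C .et, ∀ y ∈ C .L ++ C .et, R x y)
    (htH : ∀ x ∈ C .th, ∀ y ∈ C .H, R (x + π * I) y)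
    (htL : ∀ x ∈ C .th, ∀ y ∈ C .L ++ C .et, R (x + π * I) y)
    (hHL : ∀ x ∈ C .H, ∀ y ∈ C .L ++ C .et, R x y) :
    (symEval e (aSym false C)).Pairwise R := by
  rw [symEval_aSym_false, pairwise_append, pairwise_append]
  refine ⟨pairwise_map_of_all _ (by simpa using htt), ⟨pairwise_of_all (by simpa using hHH),
    pairwise_of_all hLL, fun x hx y hy => hHL x (by simpa using hx) y hy⟩, ?_⟩
  intro x hx y hy; obtain ⟨z, hz, rfl⟩ := mem_map.1 hx; rw [mem_append, mem_reverse] at hy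
  rcases hy with hy | hy
  · exact htH z (by simpa using hz) y hy
  · exact htL z (by simpa using hz) y hy

theorem pairwise_bSym {R : ℂ → ℂ → Prop} {e : ℂ} {C : Config ℂ}
    (hee : ∀ x ∈ C .eB, ∀ y ∈ C .eB, R (x - e * I) (y - e * I))
    (hww : ∀ x ∈ (C .Q).reverse ++ (C .L).reverse ++ C .H ++ C .P,
      ∀ y ∈ (C .Q).reverse ++ (C .L).reverse ++ C .H ++ C .P,
      R (x - π * I + e * I) (y - π * I + e * I))
    (hew : ∀ x ∈ C .eB, ∀ y ∈ (C .Q).reverse ++ (C .L).reverse ++ C .H ++ C .P,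
      R (x - e * I) (y - π * I + e * I)) :
    (symEval e (bSym C)).Pairwise R := by
  rw [symEval_bSym, pairwise_append]
  refine ⟨pairwise_map_of_all _ hee, pairwise_map_of_all _ hww, ?_⟩; intro x hx y hy
  obtain ⟨z, hz, rfl⟩ := mem_map.1 hy; obtain ⟨x', hx', rfl⟩ := mem_map.1 hx; exact hew x' hx' z hz

theorem mem_lift_im {lev : Role → ℝ} {C : Config ℝ} {b : Role} {z : ℂ} (h : z ∈ lift lev C b) :
    z.im = lev b := by obtain ⟨x, -, rfl⟩ := mem_map.1 h; simp

namespace Model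

variable (m : Model)

/-- The basic unit for the levels of the variables. -/
def s : ℝ := m.δ / 8

theorem s_pos : 0 < m.s := by have := m.strip.pos; unfold s; linarith

theorem s_le : m.s ≤ 1 / 16 := by have := m.strip.le; unfold s; linarith

theorem δ_eq : m.δ = 8 * m.s := by unfold s; ring

theorem s_facts : 0 < m.s ∧ m.s ≤ 1 / 16 ∧ m.δ = 8 * m.s ∧ 3 < π :=
  ⟨m.s_pos, m.s_le, m.δ_eq, Real.pi_gt_three⟩

theorem sin_s_pos : 0 < Real.sin (m.s / 2) :=
  sin_half_pos m.s_pos (by have := m.s_le; linarith)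

variable {m} in
theorem coshRel_of_le {z w : ℂ} (h1 : -m.δ < z.im - w.im) (h2 : z.im - w.im ≤ π - m.s) :
    CoshRel m.δ (Real.sin (m.s / 2)) z w := by
  obtain ⟨hs, hs1, hδ, hpi⟩ := m.s_facts
  exact coshRel_of_im m.strip.le hs (by linarith) h1 (by linarith) (Or.inl h2)

variable {m} in
theorem coshRel_of_ge {z w : ℂ} (h1 : π + m.s ≤ z.im - w.im) (h2 : z.im - w.im < π + m.δ) :
    CoshRel m.δ (Real.sin (m.s / 2)) z w := by
  obtain ⟨hs, hs1, hδ, hpi⟩ := m.s_facts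
  exact coshRel_of_im m.strip.le hs (by linarith) (by linarith) h2 (Or.inr h1)

/-- The levels of the variables. -/
def levels (ρ : ℝ) : Role → ℝ
  | .H => 3 * m.s
  | .th => 2 * m.s
  | .P => 2 * m.s
  | .Q => 2 * m.s
  | .L => ρ
  | .et => -m.s
  | .eB => -m.s
  | .nu => 0

/-- The path from the real contours (`y = 0`) to the levels (`y = 1`). An annihilation argument
minus a creation argument has height at most `π - 2e - y s`, so poles are avoided through `e > 0` at
one end and through the levels at the other. Contracted variables leave the real line only if `f`
lies to the right of `g`. -/
theorem adm_levels {ρ y γ : ℝ} (hρ0 : 0 ≤ ρ) (hρ1 : ρ ≤ m.s) (hρ : ρ = 0 ∨ RightOf m.f m.g)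
    (hy0 : 0 ≤ y) (hy1 : y ≤ 1) (hγ : 0 < γ) {e1 e2 : ℝ} (h10 : 0 ≤ e1) (h11 : e1 ≤ m.s) (h20 : 0 ≤ e2)
    (h21 : e2 ≤ m.s) (h1 : γ ≤ 2 * e1 + y * m.s) (h2 : γ ≤ 2 * e2 + y * m.s) {C : Config ℂ}
    (hC : ∀ b, ∀ z ∈ C b, z.im = y * m.levels ρ b) (hH : C .H = []) (hlen : ∑ b, (C b).length ≤ m.N) :
    m.Adm (CoshRel m.δ (Real.sin (γ / 2))) true e1 e2 C := by
  obtain ⟨hs, hs1, hδ, hpi⟩ := m.s_facts; have hys : y * m.s ≤ m.s := by nlinarith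
  have hys0 : 0 ≤ y * m.s := by positivity
  have hyρ : y * ρ ≤ y * m.s := mul_le_mul_of_nonneg_left hρ1 hy0
  have hyρ0 : 0 ≤ y * ρ := by positivity
  have hL : ∀ z ∈ C .L, z.im = y * ρ := hC .L; have heB : ∀ z ∈ C .eB, z.im = y * -m.s := hC .eB
  have hth : ∀ z ∈ C .th, z.im = y * (2 * m.s) := hC .th
  have key : ∀ {z w : ℂ}, -m.δ < z.im - w.im → z.im - w.im ≤ π - γ →
      CoshRel m.δ (Real.sin (γ / 2)) z w := fun h3 h4 =>
    coshRel_of_im m.strip.le hγ (by linarith) h3 (by linarith) (Or.inl h4)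
  have hLe : ∀ z ∈ C .L ++ C .et, -(y * m.s) ≤ z.im ∧ z.im ≤ y * ρ := by
    intro z hz; rcases mem_append.1 hz with hz | hz <;> rw [hC _ z hz] <;> simp only [levels] <;>
      constructor <;> linarith
  have hw : ∀ z ∈ (C .Q).reverse ++ (C .L).reverse ++ C .H ++ C .P, y * ρ ≤ z.im ∧ z.im ≤ 2 * (y * m.s) := by
    intro z hz; simp only [hH, mem_append, mem_reverse, append_nil] at hz
    rcases hz with (hz | hz) | hz <;> rw [hC _ z hz] <;> simp only [levels] <;> constructor <;> linarith
  refine ⟨hlen, pairwise_aSym_true (by simp [hH]) ?_ ?_ (by simp [hH]) (by simp [hH]) ?_,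
    pairwise_bSym ?_ ?_ ?_, ?_, ?_, ?_⟩
  iterate 6
    intro x hx z hz
    first | have := hLe x hx | have := hth x hx | have := heB x hx | have := hw x hx
    first | have := hLe z hz | have := hth z hz | have := heB z hz | have := hw z hz
    apply key <;> simp <;> linarith
  · intro q hq e he; rw [sub_im, hC _ q hq, hC _ e he, abs_lt]
    simp only [levels]; constructor <;> linarith
  · intro r h1 h2 z hz; rw [abs_lt, hC r z hz]
    cases r <;> simp only [levels] <;> constructor <;> linarith
  · rw [hH, nil_append]; rcases hρ with rfl | hr
    · exact Or.inl fun z hz => by rw [hL z hz, mul_zero]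
    · refine Or.inr ⟨hr, 0, fun z hz => ?_⟩
      have := hL z hz; refine ⟨by linarith, by linarith, ?_⟩; rw [abs_le]; constructor <;> linarith

/-! ### Integrals of the integrand -/

theorem continuous_lift_config (lev : Role → ℝ) (ω : List Role) :
    Continuous fun t : Fin ω.length → ℝ => fun i => (t i : ℂ) + lev (ω.get i) * I := by fun_prop

variable {m}

theorem Adm.mono {R R' : ℂ → ℂ → Prop} (h : ∀ z w, R z w → R' z w) {k : Bool} {e1 e2 : ℂ} {C : Config ℂ}
    (hA : m.Adm R k e1 e2 C) : m.Adm R' k e1 e2 C :=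
  ⟨hA.len, hA.a.imp (h _ _), hA.b.imp (h _ _), hA.s, hA.vec, hA.kin⟩

theorem Adm.reg {γ : ℝ} (hγ : 0 < γ) {k : Bool} {e1 e2 : ℂ} {C : Config ℂ}
    (hA : m.Adm (CoshRel m.δ γ) k e1 e2 C) : m.Adm (RegRel m.δ) k e1 e2 C :=
  hA.mono fun _ _ h => h.regRel hγ

theorem continuous_W {k : Bool} {lev : Role → ℝ} {e1 e2 : ℂ} {ω : List Role}
    (h : ∀ t, m.Adm (RegRel m.δ) k e1 e2 (lift lev (config ω t))) :
    Continuous fun t => m.W k e1 e2 (lift lev (config ω t)) := by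
  simp only [lift_config] at h ⊢; refine continuous_iff_continuousAt.2 fun t => ?_
  exact ContinuousAt.comp (x := t)
    (g := fun p : (Fin ω.length → ℂ) × ℂ × ℂ => m.W k p.2.1 p.2.2 (config ω p.1))
    (f := fun t : Fin ω.length → ℝ =>
      ((fun i => (t i : ℂ) + lev (ω.get i) * I, e1, e2) : (Fin ω.length → ℂ) × ℂ × ℂ))
    (m.differentiableAt_W k ω _ e1 e2 (h t)).continuousAt
    ((continuous_lift_config lev ω).prodMk continuous_const).continuousAt

theorem integrable_W {k : Bool} {lev : Role → ℝ} {e1 e2 : ℝ} {ω : List Role} {γ : ℝ} (hγ : 0 < γ)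
    (h : ∀ t, m.Adm (CoshRel m.δ γ) k e1 e2 (lift lev (config ω t))) :
    Integrable fun t => m.W k e1 e2 (lift lev (config ω t)) := by
  obtain ⟨K, -, hK⟩ := m.norm_W_le hγ
  refine integrable_of_weight (C := K) (continuous_W fun t => (h t).reg hγ).aestronglyMeasurable fun t => ?_
  rw [weight_eq lev]; exact hK _ _ _ _ (h t)

theorem wint_shift {k : Bool} {lev lev' : Role → ℝ} {e1 e2 : ℝ} {ω : List Role} {γ : ℝ} (hγ : 0 < γ)
    (h : ∀ y : ℝ, 0 ≤ y → y ≤ 1 → ∀ t, m.Adm (CoshRel m.δ γ) k e1 e2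
      (lift (fun b => lev b + y * (lev' b - lev b)) (config ω t))) :
    wint ω lev (m.W k e1 e2) = wint ω lev' (m.W k e1 e2) := by
  obtain ⟨K, -, hK⟩ := m.norm_W_le hγ; rw [wint, wint]; congr 1; simp only [lift_config]
  have key := integral_pi_shift (fun ζ => m.W k e1 e2 (config ω ζ)) (fun i => lev (ω.get i))
    (fun i => lev' (ω.get i) - lev (ω.get i)) ?_ ?_ K ?_
  · rw [key]; congr 1; funext t; congr 2; funext i; push_cast; ring
  · intro t z h0 h1
    have h2 := (h z.im h0 h1 fun i => t i + z.re * (lev' (ω.get i) - lev (ω.get i))).reg hγ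
    rw [lift_config] at h2
    have e : (fun i => ((t i + z.re * (lev' (ω.get i) - lev (ω.get i)) : ℝ) : ℂ) +
        ((lev (ω.get i) + z.im * (lev' (ω.get i) - lev (ω.get i)) : ℝ) : ℂ) * I) =
        fun i => (t i : ℂ) + lev (ω.get i) * I + z * ((lev' (ω.get i) - lev (ω.get i) : ℝ) : ℂ) := by
      funext i
      conv_rhs => rw [← re_add_im z]
      push_cast; ring
    rw [e] at h2; have h3 := m.differentiableAt_W k ω _ e1 e2 h2
    exact DifferentiableAt.comp z (g := fun p : (Fin ω.length → ℂ) × ℂ × ℂ => m.W k p.2.1 p.2.2 (config ω p.1))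
      (f := fun z : ℂ => ((fun i => (t i : ℂ) + lev (ω.get i) * I +
        z * ((lev' (ω.get i) - lev (ω.get i) : ℝ) : ℂ), e1, e2) : (Fin ω.length → ℂ) × ℂ × ℂ))
      h3 (DifferentiableAt.prodMk (by fun_prop) (by fun_prop))
  · rintro ⟨t, y⟩ ⟨-, h0, h1⟩; have h2 := (h y h0 h1 t).reg hγ; rw [lift_config] at h2
    have h3 := (m.differentiableAt_W k ω _ e1 e2 h2).continuousAt
    refine (ContinuousAt.comp (x := ((t, y) : (Fin ω.length → ℝ) × ℝ))
      (g := fun p : (Fin ω.length → ℂ) × ℂ × ℂ => m.W k p.2.1 p.2.2 (config ω p.1))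
      (f := fun p : (Fin ω.length → ℝ) × ℝ => ((fun i => (p.1 i : ℂ) +
        ((lev (ω.get i) + p.2 * (lev' (ω.get i) - lev (ω.get i)) : ℝ) : ℂ) * I, e1, e2) :
          (Fin ω.length → ℂ) × ℂ × ℂ)) h3 ?_).continuousWithinAt
    exact (Continuous.prodMk (by fun_prop) continuous_const).continuousAt
  · rintro t y ⟨h0, h1⟩; have h2 := hK _ _ _ _ (h y h0 h1 t); rw [← weight_eq, lift_config] at h2
    exact h2

/-- Dominated convergence. Since the distance `γ` to the poles is uniform down to `e1 = e2 = 0`, one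
weight dominates all integrands and the value at `0` is itself regular. -/
theorem tendsto_wint {lev : Role → ℝ} {ω : List Role} {γ r : ℝ} (hγ : 0 < γ) (hr : 0 < r)
    (h : ∀ e1 e2 : ℝ, 0 ≤ e1 → e1 ≤ r → 0 ≤ e2 → e2 ≤ r → ∀ t,
      m.Adm (CoshRel m.δ γ) true e1 e2 (lift lev (config ω t))) :
    Tendsto (fun e : ℝ × ℝ => wint ω lev (m.W true e.1 e.2)) (𝓝[>] 0 ×ˢ 𝓝[>] 0)
      (𝓝 (wint ω lev (m.W true 𝟎 𝟎))) := by
  obtain ⟨K, -, hK⟩ := m.norm_W_le hγ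
  have hev : ∀ᶠ e : ℝ × ℝ in 𝓝[>] 0 ×ˢ 𝓝[>] 0, (0 ≤ e.1 ∧ e.1 ≤ r) ∧ (0 ≤ e.2 ∧ e.2 ≤ r) := by
    have h1 : ∀ᶠ e : ℝ in 𝓝[>] 0, 0 ≤ e ∧ e ≤ r := by
      filter_upwards [Ioc_mem_nhdsGT hr] with e he
      exact ⟨he.1.le, he.2⟩
    exact h1.prod_mk h1
  refine Tendsto.const_mul _ ?_
  refine tendsto_integral_filter_of_dominated_convergence (fun t => K * weight t) ?_ ?_
    ((integrable_weight _).const_mul K) ?_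
  · filter_upwards [hev] with e he
    exact (continuous_W fun t => (h _ _ he.1.1 he.1.2 he.2.1 he.2.2 t).reg hγ).aestronglyMeasurable
  · filter_upwards [hev] with e he
    refine ae_of_all _ fun t => ?_
    rw [weight_eq lev]; exact hK _ _ _ _ (h _ _ he.1.1 he.1.2 he.2.1 he.2.2 t)
  · refine ae_of_all _ fun t => ?_
    have h2 := (h 0 0 le_rfl hr.le le_rfl hr.le t).reg hγ; rw [lift_config] at h2 ⊢
    have h3 := (m.differentiableAt_W true ω _ _ _ h2).continuousAt
    have h4 : Tendsto (fun e : ℝ × ℝ => ((fun i => (t i : ℂ) + lev (ω.get i) * I, ((e.1 : ℝ) : ℂ), ((e.2 : ℝ) : ℂ)) :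
        (Fin ω.length → ℂ) × ℂ × ℂ)) (𝓝 (0, 0))
        (𝓝 (fun i => (t i : ℂ) + lev (ω.get i) * I, 𝟎, 𝟎)) := by
      refine Continuous.tendsto' ?_ _ _ rfl; fun_prop
    refine Tendsto.comp (g := fun p : (Fin ω.length → ℂ) × ℂ × ℂ => m.W true p.2.1 p.2.2 (config ω p.1))
      (f := fun e : ℝ × ℝ => (fun i => (t i : ℂ) + lev (ω.get i) * I, ((e.1 : ℝ) : ℂ), ((e.2 : ℝ) : ℂ)))
      h3.tendsto (h4.mono_left ?_)
    rw [nhds_prod_eq]; exact Filter.prod_mono nhdsWithin_le_nhds nhdsWithin_le_nhds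

end Model

/-! ### Rearrangement of integration variables -/

theorem length_config {X : Type} (ω : List Role) (t : Fin ω.length → X) :
    ∑ b, (config ω t b).length = ω.length := by
  induction ω with
  | nil => simp [config]
  | cons c ω ih =>
    have : ∀ b, (config (c :: ω) t b).length = (if b = c then 1 else 0) +
        (config ω (fun i => t i.succ) b).length := by
      intro b; rw [config]
      by_cases h : b = c
      · subst h; simp [add_comm]
      · rw [push_of_ne h]; simp [h]
    simp only [this, sum_add_distrib, ih]; simp [add_comm]

/-- Insert a variable at position `p` of the list of role `b`. -/
def ins {X : Type} (b : Role) (p : ℕ) (x : X) (C : Config X) : Config X :=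
  update C b ((C b).take p ++ x :: (C b).drop p)

theorem ins_same {X : Type} (b : Role) (p : ℕ) (x : X) (C : Config X) :
    ins b p x C b = (C b).take p ++ x :: (C b).drop p := update_self _ _ _

theorem ins_of_ne {X : Type} {b b' : Role} (h : b' ≠ b) (p : ℕ) (x : X) (C : Config X) :
    ins b p x C b' = C b' := update_of_ne h _ _

theorem ins_push_of_ne {X : Type} {b c : Role} (h : c ≠ b) (p : ℕ) (x y : X) (C : Config X) :
    ins b p x (push c y C) = push c y (ins b p x C) := by
  funext d
  by_cases h1 : d = b
  · subst h1; rw [ins_same, push_of_ne h.symm, push_of_ne h.symm, ins_same]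
  · rw [ins_of_ne h1]
    by_cases h2 : d = c
    · subst h2; rw [push_same, push_same, ins_of_ne h1]
    · rw [push_of_ne h2, push_of_ne h2, ins_of_ne h1]

theorem ins_push_same {X : Type} (b : Role) (p : ℕ) (x y : X) (C : Config X) :
    ins b (p + 1) x (push b y C) = push b y (ins b p x C) := by
  funext d
  by_cases h1 : d = b
  · subst h1; rw [ins_same, push_same, push_same, ins_same]; simp
  · rw [ins_of_ne h1, push_of_ne h1, push_of_ne h1, ins_of_ne h1]

/-- Inserting a variable at position `p` of its list differs from prepending it by a permutation of
the integration variables. Consequently all positions at which a created particle can be inserted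
contribute the same integral. -/
theorem config_ins (b : Role) : ∀ (ω : List Role) (p : ℕ), p ≤ ω.count b →
    ∃ σ : Fin (ω.length + 1) ≃ Fin (ω.length + 1), ∀ (X : Type) (t : Fin (ω.length + 1) → X),
      config (b :: ω) (t ∘ σ) = ins b p (t 0) (config ω fun i => t i.succ)
  | _, 0, _ => ⟨Equiv.refl _, fun X t => rfl⟩
  | [], p + 1, h => by simp at h
  | c :: ω, p + 1, h => by
    by_cases hc : c = b
    · subst hc; obtain ⟨σ, hσ⟩ := config_ins c ω p (by simpa using h)
      refine ⟨(((finSuccEquiv (ω.length + 1)).trans σ.optionCongr).trans (finSuccEquiv (ω.length + 1)).symm).trans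
        (Equiv.swap 0 1), fun X t => ?_⟩
      have h1 := hσ X fun i => (t ∘ Equiv.swap 0 1) i.succ
      have e : (fun i : Fin ω.length => (t ∘ Equiv.swap 0 1) i.succ.succ) = fun i => t i.succ.succ := by
        funext i; simp only [comp_apply]; rw [Equiv.swap_apply_of_ne_of_ne (Fin.succ_ne_zero _)]
        exact fun h => Fin.succ_ne_zero i (Fin.succ_injective _ h)
      have e0 : (t ∘ Equiv.swap 0 1) (Fin.succ 0) = t 0 := by simp
      rw [e0, e] at h1
      change push c _ (config (c :: ω) _) = ins c (p + 1) (t 0) (push c (t 1) (config ω fun i => t i.succ.succ))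
      rw [ins_push_same, ← h1]; congr 1
    · obtain ⟨σ, hσ⟩ := config_ins b ω (p + 1) (by rwa [count_cons_of_ne hc] at h)
      refine ⟨(Equiv.swap 0 1).trans ((((finSuccEquiv (ω.length + 1)).trans σ.optionCongr).trans
        (finSuccEquiv (ω.length + 1)).symm).trans (Equiv.swap 0 1)), fun X t => ?_⟩
      have h1 := hσ X fun i => (t ∘ Equiv.swap 0 1) i.succ
      have e : (fun i : Fin ω.length => (t ∘ Equiv.swap 0 1) i.succ.succ) = fun i => t i.succ.succ := by
        funext i; simp only [comp_apply]; rw [Equiv.swap_apply_of_ne_of_ne (Fin.succ_ne_zero _)]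
        exact fun h => Fin.succ_ne_zero i (Fin.succ_injective _ h)
      have e0 : (t ∘ Equiv.swap 0 1) (Fin.succ 0) = t 0 := by simp
      rw [e0, e] at h1
      change _ = ins b (p + 1) (t 0) (push c (t 1) (config ω fun i => t i.succ.succ))
      rw [ins_push_of_ne hc, ← h1]
      set u : Fin (ω.length + 2) → X := (t ∘ Equiv.swap 0 1) ∘ ((((finSuccEquiv (ω.length + 1)).trans σ.optionCongr).trans
        (finSuccEquiv (ω.length + 1)).symm)) with hu
      change config (b :: c :: ω) (u ∘ Equiv.swap 0 1) = _
      have h2 : config (b :: c :: ω) (u ∘ Equiv.swap 0 1) = config (c :: b :: ω) u := by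
        simp only [config]; rw [push_comm (Ne.symm hc)]; congr 1
      rw [h2, config]; congr 1

/-- The integral of a function of a configuration of real variables, with measure `dx / 2π` for each
variable. -/
def rint (ω : List Role) (F : Config ℝ → ℂ) : ℂ :=
  ((2 * π : ℂ) ^ ω.length)⁻¹ * ∫ t : Fin ω.length → ℝ, F (config ω t)

theorem wint_eq_rint (ω : List Role) (lev : Role → ℝ) (W : Config ℂ → ℂ) :
    wint ω lev W = rint ω fun C => W (lift lev C) := rfl

theorem integrable_comp_equiv {n m : ℕ} (σ : Fin n ≃ Fin m) {f : (Fin n → ℝ) → ℂ} :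
    Integrable (fun t : Fin m → ℝ => f (t ∘ σ)) ↔ Integrable f := by
  have h := (volume_measurePreserving_piCongrLeft (fun _ : Fin n => ℝ) σ.symm).integrable_comp_emb
    (MeasurableEquiv.measurableEmbedding _) (g := f)
  rw [← h]; refine integrable_congr (ae_of_all _ fun t => ?_)
  simp only [comp_apply]; congr 1; funext i
  rw [MeasurableEquiv.coe_piCongrLeft, ← Equiv.symm_apply_apply σ i,
    Equiv.piCongrLeft_apply_apply]
  simp

theorem rint_perm {ω ω' : List Role} (h : ω.Perm ω') (F : Config ℝ → ℂ) : rint ω F = rint ω' F := by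
  obtain ⟨σ, hσ⟩ := config_perm h; rw [rint, rint, ← integral_comp_equiv σ]
  simp only [hσ, h.length_eq]

theorem integrable_perm {ω ω' : List Role} (h : ω.Perm ω') {F : Config ℝ → ℂ} :
    Integrable (fun t => F (config ω t)) ↔ Integrable fun t => F (config ω' t) := by
  obtain ⟨σ, hσ⟩ := config_perm h; rw [← integrable_comp_equiv σ]; simp only [hσ]

theorem rint_cons_ins {b : Role} {ω : List Role} {p : ℕ} (hp : p ≤ ω.count b) (F : Config ℝ → ℂ) :
    rint (b :: ω) F = ((2 * π : ℂ) ^ (ω.length + 1))⁻¹ *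
      ∫ t : Fin (ω.length + 1) → ℝ, F (ins b p (t 0) (config ω fun i => t i.succ)) := by
  obtain ⟨σ, hσ⟩ := config_ins b ω p hp; rw [rint]; congr 1
  refine (integral_comp_equiv σ fun t => F (config (b :: ω) t)).symm.trans ?_
  simp only [hσ]

theorem integrable_cons_ins {b : Role} {ω : List Role} {p : ℕ} (hp : p ≤ ω.count b) {F : Config ℝ → ℂ} :
    Integrable (fun t => F (config (b :: ω) t)) ↔
      Integrable fun t : Fin (ω.length + 1) → ℝ => F (ins b p (t 0) (config ω fun i => t i.succ)) := by
  obtain ⟨σ, hσ⟩ := config_ins b ω p hp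
  refine (integrable_comp_equiv σ (f := fun t => F (config (b :: ω) t))).symm.trans ?_
  simp only [hσ]

/-- Reverse the order of the variables of role `b`. -/
def revRole {X : Type} (b : Role) (C : Config X) : Config X := update C b (C b).reverse

theorem config_rev (b : Role) : ∀ ω : List Role,
    ∃ σ : Fin ω.length ≃ Fin ω.length, ∀ (X : Type) (t : Fin ω.length → X),
      config ω (t ∘ σ) = revRole b (config ω t)
  | [] => ⟨Equiv.refl _, fun X t => by funext c; by_cases h : c = b <;> simp [config, revRole, Function.update_apply]⟩
  | c :: ω => by
    obtain ⟨σ, hσ⟩ := config_rev b ω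
    by_cases hc : c = b
    · subst hc; obtain ⟨τ, hτ⟩ := config_ins c ω (ω.count c) le_rfl
      refine ⟨τ.trans (((finSuccEquiv ω.length).trans σ.optionCongr).trans (finSuccEquiv ω.length).symm),
        fun X t => ?_⟩
      refine (hτ X (t ∘ (((finSuccEquiv ω.length).trans σ.optionCongr).trans
        (finSuccEquiv ω.length).symm))).trans ?_
      have e : (fun i : Fin ω.length => (t ∘ (((finSuccEquiv ω.length).trans σ.optionCongr).trans
        (finSuccEquiv ω.length).symm)) i.succ) = (fun i => t i.succ) ∘ σ := by funext i; simp
      rw [e, hσ X]; funext d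
      by_cases hd : d = c
      · subst hd; have hl := config_length ω (fun i => t i.succ) d
        rw [ins_same, revRole, revRole, update_self, update_self, config, push_same,
          List.take_of_length_le (by simp [hl]), List.drop_of_length_le (by simp [hl]), List.reverse_cons]
        simp
      · rw [ins_of_ne hd, revRole, revRole, update_of_ne hd, update_of_ne hd, config,
          push_of_ne hd]
    · refine ⟨((finSuccEquiv ω.length).trans σ.optionCongr).trans (finSuccEquiv ω.length).symm,
        fun X t => ?_⟩
      change push c _ (config ω ((fun i => t i.succ) ∘ σ)) = _
      rw [hσ X]; funext d
      by_cases hd : d = b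
      · subst hd; rw [push_of_ne (Ne.symm hc), revRole, revRole, update_self, update_self, config,
          push_of_ne (Ne.symm hc)]
      · rw [revRole, revRole, update_of_ne hd, config]
        by_cases hd' : d = c
        · subst hd'; rw [push_same, push_same, update_of_ne hd]; rfl
        · rw [push_of_ne hd', push_of_ne hd', update_of_ne hd]

theorem rint_rev (b : Role) (ω : List Role) (F : Config ℝ → ℂ) :
    rint ω (fun C => F (revRole b C)) = rint ω F := by
  obtain ⟨σ, hσ⟩ := config_rev b ω
  conv_rhs => rw [rint, ← integral_comp_equiv σ]
  simp only [hσ, rint]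

/-! ### Integration over the variables of one role -/

theorem integral_sum_equiv {l n k : ℕ} (e : Fin l ⊕ Fin n ≃ Fin k) (f : (Fin k → ℝ) → ℂ) :
    (Integrable f → Integrable fun p : (Fin n → ℝ) × (Fin l → ℝ) => f (Sum.elim p.2 p.1 ∘ e.symm)) ∧
    ∫ t, f t = ∫ p : (Fin n → ℝ) × (Fin l → ℝ), f (Sum.elim p.2 p.1 ∘ e.symm) := by
  have h1 := volume_measurePreserving_piCongrLeft (fun _ : Fin k => ℝ) e
  have h2 := volume_measurePreserving_sumPiEquivProdPi_symm (fun _ : Fin l ⊕ Fin n => ℝ)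
  have h3 : MeasurePreserving (MeasurableEquiv.prodComm : (Fin n → ℝ) × (Fin l → ℝ) ≃ᵐ _) volume volume :=
    Measure.measurePreserving_swap
  set E := (MeasurableEquiv.prodComm.trans (MeasurableEquiv.sumPiEquivProdPi (fun _ : Fin l ⊕ Fin n => ℝ)).symm).trans
    (MeasurableEquiv.piCongrLeft (fun _ : Fin k => ℝ) e) with hE
  have h4 : MeasurePreserving E volume volume := h1.comp (h2.comp h3)
  have h5 : ∀ p : (Fin n → ℝ) × (Fin l → ℝ), E p = Sum.elim p.2 p.1 ∘ e.symm := by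
    intro p; funext i; obtain ⟨j, rfl⟩ := e.surjective i
    have : E p (e j) = (MeasurableEquiv.sumPiEquivProdPi (fun _ : Fin l ⊕ Fin n => ℝ)).symm (p.2, p.1) j := by
      rw [hE]; simp only [MeasurableEquiv.trans_apply]
      rw [MeasurableEquiv.coe_piCongrLeft, Equiv.piCongrLeft_apply_apply]; rfl
    rw [this]; simp only [comp_apply, Equiv.symm_apply_apply]
    cases j <;> rfl
  constructor
  · intro hf; have := (h4.integrable_comp_emb E.measurableEmbedding (g := f)).2 hf
    simpa only [comp_def, h5] using this
  · rw [← h4.integral_comp' f]; simp only [h5]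

theorem config_replicate_append {X : Type} (b : Role) (ω : List Role) (l : ℕ) :
    ∃ e : Fin l ⊕ Fin ω.length ≃ Fin (replicate l b ++ ω).length,
      ∀ (η : Fin l → X) (t : Fin ω.length → X), config (replicate l b ++ ω) (Sum.elim η t ∘ e.symm) =
        update (config ω t) b (ofFn η ++ config ω t b) := by
  induction l with
  | zero => exact ⟨Equiv.emptySum _ _, fun η t => by simp; rfl⟩
  | succ l ih =>
    obtain ⟨e, he⟩ := ih
    set e' : Fin (l + 1) ⊕ Fin ω.length ≃ Fin ((replicate l b ++ ω).length + 1) :=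
      (((finSuccEquiv l).trans (Equiv.optionEquivSumPUnit.{0} _)).sumCongr (Equiv.refl _)).trans
        ((((Equiv.sumComm _ _).sumCongr (Equiv.refl _)).trans (Equiv.sumAssoc _ _ _)).trans
        (((Equiv.refl _).sumCongr e).trans ((Equiv.sumComm _ _).trans
          ((Equiv.optionEquivSumPUnit.{0} _).symm.trans (finSuccEquiv _).symm)))) with hed
    refine ⟨e', fun η t => ?_⟩
    have h0 : e'.symm 0 = Sum.inl 0 := by rw [Equiv.symm_apply_eq]; simp [hed]
    have h1 : ∀ i : Fin (replicate l b ++ ω).length, Sum.elim η t (e'.symm i.succ) =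
        (Sum.elim (fun j => η j.succ) t ∘ e.symm) i := by
      intro i; obtain ⟨j, rfl⟩ := e.surjective i
      have : e'.symm (e j).succ = Sum.map Fin.succ id j := by
        rw [Equiv.symm_apply_eq]
        cases j <;> simp [hed] <;> rfl
      rw [this]
      cases j <;> simp
    change push b (Sum.elim η t (e'.symm 0)) (config (replicate l b ++ ω) fun i =>
      Sum.elim η t (e'.symm i.succ)) = _
    rw [h0, funext h1, he]; funext c
    by_cases hc : c = b
    · subst hc; simp [ofFn_succ]
    · rw [push_of_ne hc, update_of_ne hc, update_of_ne hc]

/-- Fubini's theorem in the form in which the integrals of the annihilation operators, which stand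
inside the integrand, become integrations over variables with a role of their own. -/
theorem rint_pull (b : Role) (ω : List Role) (l : ℕ) {F : Config ℝ → ℂ}
    (hF : Integrable fun t => F (config (replicate l b ++ ω) t)) :
    (Integrable fun t => ((2 * π : ℂ) ^ l)⁻¹ * ∫ η : Fin l → ℝ,
      F (update (config ω t) b (ofFn η ++ config ω t b))) ∧
    rint (replicate l b ++ ω) F = rint ω fun C => ((2 * π : ℂ) ^ l)⁻¹ * ∫ η : Fin l → ℝ,
      F (update C b (ofFn η ++ C b)) := by
  obtain ⟨e, he⟩ := config_replicate_append (X := ℝ) b ω l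
  have h1 := (integral_sum_equiv e fun t => F (config (replicate l b ++ ω) t)).1 hF
  have h2 := (integral_sum_equiv e fun t => F (config (replicate l b ++ ω) t)).2
  simp only [he] at h1 h2; refine ⟨h1.integral_prod_left.const_mul _, ?_⟩
  rw [rint, h2, rint, Measure.volume_eq_prod, integral_prod _ h1, integral_const_mul, ← mul_assoc]
  congr 1; rw [length_append, length_replicate, pow_add, mul_inv, mul_comm]

/-! ### Creation operators on lists -/

/-- The summation index is the position of the created particle in the list. The default `0` of
`getD` is never reached because `p < T.length`. -/
theorem onList_create (S : ℂ → ℂ) (χ : ℝ → FockFn) (T : List ℝ) :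
    onList (create S χ) T = (√T.length : ℂ)⁻¹ * ∑ p ∈ range T.length,
      ((T.take p).map fun y : ℝ => S ((T.getD p 0 : ℝ) - y)).prod * onList (χ (T.getD p 0)) (T.eraseIdx p) := by
  rcases T with _ | ⟨x, T'⟩
  · simp [onList, create]
  · set T := x :: T' with hT; have hl : T.length = T'.length + 1 := by simp [hT]
    rw [onList_eq _ hl, create]
    conv_rhs => rw [hl]
    congr 1
    · simp
    · rw [← Fin.sum_univ_eq_sum_range (fun p => ((T.take p).map fun y : ℝ => S ((T.getD p 0 : ℝ) - y)).prod *
        onList (χ (T.getD p 0)) (T.eraseIdx p))]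
      refine sum_congr rfl fun k _ => ?_
      have hk : (k : ℕ) < T.length := by rw [hl]; exact k.2
      have e1 : T.getD k 0 = T.get (k.cast hl.symm) := by rw [List.getD_eq_getElem _ _ hk]; rfl
      have e2 : ∏ j ∈ Finset.univ.filter (· < k), S ((T.get (k.cast hl.symm) : ℝ) - (T.get (j.cast hl.symm) : ℝ)) =
          ((T.take k).map fun y : ℝ => S ((T.getD k 0 : ℝ) - y)).prod := by
        rw [e1]; have h3 : T.take k = ofFn fun j : Fin k => T.get ⟨j, j.2.trans hk⟩ := by
          refine List.ext_getElem (by simp; omega) fun i h1 h2 => ?_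
          simp
        rw [h3, map_ofFn, prod_ofFn]; symm
        refine Finset.prod_bij (fun (j : Fin k) _ => (⟨j, j.2.trans k.2⟩ : Fin (T'.length + 1))) ?_ ?_ ?_ ?_
        · intro j _; exact mem_filter.2 ⟨Finset.mem_univ _, j.2⟩
        · intro i _ j _ h; simpa [Fin.ext_iff] using h
        · intro j hj; rw [mem_filter] at hj; exact ⟨⟨j, hj.2⟩, Finset.mem_univ _, rfl⟩
        · intro j _; rfl
      have e3 : onList (χ (T.getD k 0)) (T.eraseIdx k) = χ (T.get (k.cast hl.symm)) T'.length
          fun i => T.get ((k.succAbove i).cast hl.symm) := by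
        have hle : (T.eraseIdx k).length = T'.length := by rw [List.length_eraseIdx_of_lt hk, hl]; rfl
        rw [onList_eq _ hle, e1]; congr 1; funext i
        simp only [get_eq_getElem, Fin.val_cast, List.getElem_eraseIdx]
        by_cases h : (i : ℕ) < k
        · rw [Fin.succAbove_of_castSucc_lt _ _ (by simpa [Fin.lt_def] using h)]; simp [h]
        · rw [Fin.succAbove_of_le_castSucc _ _ (by simpa [Fin.le_def] using h)]; simp [h]
      rw [e2, e3]

theorem create_smul (S : ℂ → ℂ) (c : ℂ) (χ : ℝ → FockFn) : create S (fun θ => c • χ θ) = c • create S χ := by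
  funext n t
  cases n with
  | zero => simp [create]
  | succ n =>
    simp only [create, Pi.smul_apply, smul_eq_mul, mul_sum]; refine sum_congr rfl fun k _ => by ring

theorem createMany_smul (S : ℂ → ℂ) (c : ℂ) : ∀ (r : ℕ) (χ : (Fin r → ℝ) → FockFn),
    createMany S r (fun t => c • χ t) = c • createMany S r χ
  | 0, χ => rfl
  | r + 1, χ => by
    rw [createMany, createMany, ← create_smul]; congr 1; funext θ; exact createMany_smul S c r _

/-! ### Contraction of creation operators -/

/-- Append a variable to the list of role `b`. -/
def snocRole {X : Type} (b : Role) (x : X) (C : Config X) : Config X := update C b (C b ++ [x])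

theorem ins_length {X : Type} (b : Role) {p : ℕ} (x : X) (C : Config X) (hp : (C b).length = p) :
    ins b p x C = snocRole b x C := by rw [ins, snocRole, ← hp, List.take_length, List.drop_length]

/-- A product of creation operators whose effect on the lists of the roles `et` and `nu` is to be
evaluated. -/
def contractFn (S : ℂ → ℂ) (M : Config ℝ → List ℝ → FockFn) (et nu : Role) (s : ℕ) (C : Config ℝ) : ℂ :=
  onList (createMany S s fun t => M C (ofFn t)) (C et ++ C nu)

/-- The operators created from variables of role `et` acquire the role `L`, and those from
variables of role `nu` the role `Q`. -/
structure Contracts (S : ℂ → ℂ) (M : Config ℝ → List ℝ → FockFn) (et nu L Q : Role)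
    (A : Role → Prop) (n0 s0 l0 : ℕ) : Prop where
  ne : et ≠ nu ∧ L ≠ et ∧ L ≠ nu ∧ Q ≠ et ∧ Q ≠ nu ∧ L ≠ Q
  allowed_left : 0 < l0 → A L
  allowed_right : A Q
  -- The factors `S` collected by the creator on its way to position `p` are absorbed by the
  -- exchange relations of the integrand. The outcome does not depend on `p`.
  left : ∀ (C : Config ℝ) (p : ℕ) (x : ℝ) (u : List ℝ), ∑ b, (C b).length + 1 = n0 → u.length < s0 →
    (C et).length < l0 → (∀ b, ¬ A b → C b = []) → p ≤ (C et).length →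
    (((C et).take p).map fun y : ℝ => S (x - y)).prod • M (ins et p x C) (x :: u) = M (snocRole L x C) u
  right : ∀ (C : Config ℝ) (p : ℕ) (x : ℝ) (u : List ℝ), ∑ b, (C b).length + 1 = n0 → u.length < s0 →
    (C et).length ≤ l0 → (∀ b, ¬ A b → C b = []) → p ≤ (C nu).length →
    ((C et ++ (C nu).take p).map fun y : ℝ => S (x - y)).prod • M (ins nu p x C) (x :: u) = M (snocRole Q x C) u
  integrable : ∀ ω : List Role, ω.length = n0 → ω.count et ≤ l0 → (∀ b ∈ ω, A b) →
    Integrable fun t => contractFn S M et nu 0 (config ω t)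

theorem snocRole_of_ne {X : Type} {b b' : Role} (h : b' ≠ b) (x : X) (C : Config X) :
    snocRole b x C b' = C b' := update_of_ne h _ _

theorem getD_insert (A B : List ℝ) (x : ℝ) {p : ℕ} (hp : A.length = p) :
    (A ++ x :: B).getD p 0 = x ∧ (A ++ x :: B).take p = A ∧ (A ++ x :: B).eraseIdx p = A ++ B := by
  subst hp; refine ⟨by simp, by simp, ?_⟩; rw [List.eraseIdx_append_of_length_le le_rfl]; simp

/-- A summand of the creation operator. -/
def createTerm (S : ℂ → ℂ) (M : Config ℝ → List ℝ → FockFn) (et nu : Role) (s p : ℕ) (C : Config ℝ) : ℂ :=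
  (((C et ++ C nu).take p).map fun y : ℝ => S (((C et ++ C nu).getD p 0 : ℝ) - y)).prod *
    onList (createMany S s fun t => M C ((C et ++ C nu).getD p 0 :: ofFn t)) ((C et ++ C nu).eraseIdx p)

theorem contractFn_succ (S : ℂ → ℂ) (M : Config ℝ → List ℝ → FockFn) (et nu : Role) (s : ℕ) (C : Config ℝ) :
    contractFn S M et nu (s + 1) C = (√((C et).length + (C nu).length : ℕ) : ℂ)⁻¹ *
      (∑ p ∈ range (C et).length, createTerm S M et nu s p C +
        ∑ p ∈ range (C nu).length, createTerm S M et nu s ((C et).length + p) C) := by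
  rw [contractFn, createMany, onList_create, length_append, Finset.sum_range_add]
  simp only [createTerm, ofFn_succ, Fin.cons_zero, Fin.cons_succ]

namespace Contracts

variable {S : ℂ → ℂ} {M : Config ℝ → List ℝ → FockFn} {et nu L Q : Role} {A : Role → Prop} {n0 s0 l0 : ℕ}

theorem createTerm_left (h : Contracts S M et nu L Q A n0 s0 l0) {s : ℕ} (hs : s < s0) {C : Config ℝ} {p : ℕ} (x : ℝ)
    (hC : ∑ b, (C b).length + 1 = n0) (hl : (C et).length < l0) (hA : ∀ b, ¬ A b → C b = []) (hp : p ≤ (C et).length) :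
    createTerm S M et nu s p (ins et p x C) = contractFn S M et nu s (snocRole L x C) := by
  have e : ins et p x C et ++ ins et p x C nu = (C et).take p ++ x :: ((C et).drop p ++ C nu) := by
    rw [ins_same, ins_of_ne h.ne.1.symm]; simp
  obtain ⟨e1, e2, e3⟩ := getD_insert ((C et).take p) ((C et).drop p ++ C nu) x (p := p) (by simpa using hp)
  rw [createTerm, e, e1, e2, e3, ← append_assoc, take_append_drop]
  have h1 := createMany_smul S (((C et).take p).map fun y : ℝ => S (x - y)).prod s
    fun t => M (ins et p x C) (x :: ofFn t)
  have h2 : (fun t : Fin s → ℝ => (((C et).take p).map fun y : ℝ => S (x - y)).prod •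
      M (ins et p x C) (x :: ofFn t)) = fun t => M (snocRole L x C) (ofFn t) := by
    funext t; exact h.left C p x _ hC (by simpa using hs) hl hA hp
  rw [h2] at h1; rw [contractFn, h1, snocRole_of_ne h.ne.2.1.symm, snocRole_of_ne h.ne.2.2.1.symm]
  rfl

theorem createTerm_right (h : Contracts S M et nu L Q A n0 s0 l0) {s : ℕ} (hs : s < s0) {C : Config ℝ} {p : ℕ} (x : ℝ)
    (hC : ∑ b, (C b).length + 1 = n0) (hl : (C et).length ≤ l0) (hA : ∀ b, ¬ A b → C b = []) (hp : p ≤ (C nu).length) :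
    createTerm S M et nu s ((C et).length + p) (ins nu p x C) = contractFn S M et nu s (snocRole Q x C) := by
  have e : ins nu p x C et ++ ins nu p x C nu = (C et ++ (C nu).take p) ++ x :: (C nu).drop p := by
    rw [ins_same, ins_of_ne h.ne.1]; simp
  obtain ⟨e1, e2, e3⟩ := getD_insert (C et ++ (C nu).take p) ((C nu).drop p) x (p := (C et).length + p)
    (by simpa using hp)
  rw [createTerm, e, e1, e2, e3, append_assoc, take_append_drop]
  have h1 := createMany_smul S ((C et ++ (C nu).take p).map fun y : ℝ => S (x - y)).prod s
    fun t => M (ins nu p x C) (x :: ofFn t)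
  have h2 : (fun t : Fin s → ℝ => ((C et ++ (C nu).take p).map fun y : ℝ => S (x - y)).prod •
      M (ins nu p x C) (x :: ofFn t)) = fun t => M (snocRole Q x C) (ofFn t) := by
    funext t; exact h.right C p x _ hC (by simpa using hs) hl hA hp
  rw [h2] at h1
  rw [contractFn, h1, snocRole_of_ne h.ne.2.2.2.1.symm, snocRole_of_ne h.ne.2.2.2.2.1.symm]; rfl

/-- The integral of one term, when `b` is the role of the contracted variable and `b'` its new one. -/
theorem term_aux {b b' : Role} {ω : List Role} {p : ℕ} {F G : Config ℝ → ℂ}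
    (hp : p < ω.count b) (hFG : ∀ (t : Fin (ω.erase b).length → ℝ) (x : ℝ),
      F (ins b p x (config (ω.erase b) t)) = G (snocRole b' x (config (ω.erase b) t)))
    (hG : Integrable fun t => G (config (b' :: ω.erase b) t)) :
    Integrable (fun t => F (config ω t)) ∧ rint ω F = rint (b' :: ω.erase b) G := by
  have hb : b ∈ ω := count_pos_iff.1 (by omega); have hperm := List.perm_cons_erase hb
  have hc : p ≤ (ω.erase b).count b := by rw [count_erase_self]; omega
  have e : ∀ t : Fin ((ω.erase b).length + 1) → ℝ, F (ins b p (t 0) (config (ω.erase b) fun i => t i.succ)) =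
      G (ins b' ((ω.erase b).count b') (t 0) (config (ω.erase b) fun i => t i.succ)) := fun t => by
    rw [hFG, ins_length _ _ _ (config_length _ _ _)]
  constructor
  · rw [integrable_perm hperm, integrable_cons_ins hc]; simp only [e]
    exact (integrable_cons_ins le_rfl).1 hG
  · rw [rint_perm hperm, rint_cons_ins hc, rint_cons_ins (le_refl ((ω.erase b).count b'))]
    simp only [e]

/-- One creator is evaluated. Every position among the variables `et` gives the same integral, with
the variable renamed `L`, and every position among the variables `nu` gives the same integral, with
the variable renamed `Q`; hence the multiplicities. -/
theorem step (h : Contracts S M et nu L Q A n0 s0 l0) {s : ℕ} (hs : s < s0)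
    (ih : ∀ ω : List Role, ω.length = n0 → ω.count et ≤ l0 → (∀ b ∈ ω, A b) →
      Integrable fun t => contractFn S M et nu s (config ω t))
    (ω : List Role) (hω : ω.length = n0) (hl : ω.count et ≤ l0)
    (hA : ∀ b ∈ ω, A b) :
    (Integrable fun t => contractFn S M et nu (s + 1) (config ω t)) ∧
    rint ω (contractFn S M et nu (s + 1)) = (√(ω.count et + ω.count nu : ℕ) : ℂ)⁻¹ *
      (ω.count et * rint (L :: ω.erase et) (contractFn S M et nu s) +
        ω.count nu * rint (Q :: ω.erase nu) (contractFn S M et nu s)) := by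
  obtain ⟨n1, n2, n3, n4, n5, -⟩ := h.ne
  have hlen : ∀ b, b ∈ ω → (ω.erase b).length + 1 = n0 := fun b hb => by
    rw [List.length_erase_add_one hb, hω]
  have hcA : ∀ (b : Role) (t : Fin (ω.erase b).length → ℝ) (c : Role), ¬ A c → config (ω.erase b) t c = [] := by
    intro b t c hc; rw [← length_eq_zero_iff, config_length, count_eq_zero]
    exact fun hm => hc (hA c (List.mem_of_mem_erase hm))
  have tl : ∀ p ∈ range (ω.count et), Integrable (fun t => createTerm S M et nu s p (config ω t)) ∧
      rint ω (createTerm S M et nu s p) = rint (L :: ω.erase et) (contractFn S M et nu s) := by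
    intro p hp; rw [mem_range] at hp; have hmem : et ∈ ω := count_pos_iff.1 (by omega)
    refine term_aux hp (fun t x => h.createTerm_left hs x ?_ ?_ (hcA et t) ?_) (ih _ ?_ ?_ ?_)
    · rw [length_config, hlen et hmem]
    · rw [config_length, count_erase_self]; omega
    · rw [config_length, count_erase_self]; omega
    · rw [length_cons, hlen et hmem]
    · rw [count_cons_of_ne n2, count_erase_self]; omega
    · intro b hb; rcases mem_cons.1 hb with rfl | hb
      · exact h.allowed_left (by omega)
      · exact hA b (List.mem_of_mem_erase hb)
  have tr : ∀ p ∈ range (ω.count nu), Integrable (fun t => createTerm S M et nu s (ω.count et + p) (config ω t)) ∧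
      rint ω (createTerm S M et nu s (ω.count et + p)) = rint (Q :: ω.erase nu) (contractFn S M et nu s) := by
    intro p hp; rw [mem_range] at hp; have hmem : nu ∈ ω := count_pos_iff.1 (by omega)
    have hce : (ω.erase nu).count et = ω.count et := List.count_erase_of_ne n1
    refine term_aux hp (fun t x => ?_) (ih _ ?_ ?_ ?_)
    · rw [← hce, ← config_length (ω.erase nu) t et]
      refine h.createTerm_right hs x ?_ ?_ (hcA nu t) ?_
      · rw [length_config, hlen nu hmem]
      · rw [config_length, hce]; exact hl
      · rw [config_length, count_erase_self]; omega
    · rw [length_cons, hlen nu hmem]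
    · rw [count_cons_of_ne n4, hce]; exact hl
    · intro b hb; rcases mem_cons.1 hb with rfl | hb
      · exact h.allowed_right
      · exact hA b (List.mem_of_mem_erase hb)
  have e : ∀ t : Fin ω.length → ℝ, contractFn S M et nu (s + 1) (config ω t) =
      (√(ω.count et + ω.count nu : ℕ) : ℂ)⁻¹ *
      (∑ p ∈ range (ω.count et), createTerm S M et nu s p (config ω t) +
        ∑ p ∈ range (ω.count nu), createTerm S M et nu s (ω.count et + p) (config ω t)) := fun t => by
    rw [contractFn_succ, config_length, config_length]
  have i1 := integrable_finset_sum _ fun p hp => (tl p hp).1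
  have i2 := integrable_finset_sum _ fun p hp => (tr p hp).1
  constructor
  · simp only [e]; exact (i1.add i2).const_mul _
  · rw [rint]; simp only [e]
    rw [integral_const_mul, integral_add i1 i2, integral_finset_sum _ fun p hp => (tl p hp).1,
      integral_finset_sum _ fun p hp => (tr p hp).1, mul_left_comm, mul_add, mul_sum, mul_sum]
    congr 2
    · refine (sum_congr rfl fun p hp => (tl p hp).2).trans ?_
      rw [sum_const, card_range, nsmul_eq_mul]
    · refine (sum_congr rfl fun p hp => (tr p hp).2).trans ?_
      rw [sum_const, card_range, nsmul_eq_mul]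

theorem integrable_contractFn (h : Contracts S M et nu L Q A n0 s0 l0) : ∀ s, s ≤ s0 → ∀ ω : List Role, ω.length = n0 →
    ω.count et ≤ l0 → (∀ b ∈ ω, A b) → Integrable fun t => contractFn S M et nu s (config ω t)
  | 0, _ => h.integrable
  | s + 1, hs => fun ω h1 h2 h3 => (h.step hs (h.integrable_contractFn s (by omega)) ω h1 h2 h3).1

end Contracts

/-! ### Words with given numbers of variables -/

/-- A word with `v b` letters `b`. -/
def word (v : Role → ℕ) : List Role :=
  replicate (v .th) .th ++ (replicate (v .et) .et ++ (replicate (v .P) .P ++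
    (replicate (v .H) .H ++ (replicate (v .L) .L ++ (replicate (v .Q) .Q ++
      (replicate (v .eB) .eB ++ replicate (v .nu) .nu))))))

theorem count_word (v : Role → ℕ) (b : Role) : (word v).count b = v b := by
  cases b <;> simp [word, count_replicate]

theorem perm_word {ω : List Role} {v : Role → ℕ} (h : ∀ b, ω.count b = v b) : ω.Perm (word v) :=
  List.perm_iff_count.2 fun b => by rw [h, count_word]

theorem length_word (v : Role → ℕ) : (word v).length = ∑ b, v b := by
  rw [sum_role]; simp [word]; ring

/-- Euler's identity for a form of degree `k + 1` in two variables with coefficients `f`, evaluated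
at the point `(1, 1)`. -/
theorem euler_antidiagonal (f : ℕ → ℕ → ℂ) (k : ℕ) :
    ∑ q ∈ antidiagonal k, ((q.1 + 1 : ℂ) * f (q.1 + 1) q.2 + (q.2 + 1 : ℂ) * f q.1 (q.2 + 1)) =
      (k + 1 : ℂ) * ∑ q ∈ antidiagonal (k + 1), f q.1 q.2 := by
  have h1 : (k + 1 : ℂ) * ∑ q ∈ antidiagonal (k + 1), f q.1 q.2 =
      ∑ q ∈ antidiagonal (k + 1), (q.1 : ℂ) * f q.1 q.2 +
      ∑ q ∈ antidiagonal (k + 1), (q.2 : ℂ) * f q.1 q.2 := by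
    rw [mul_sum, ← sum_add_distrib]; refine sum_congr rfl fun q hq => ?_
    have : ((q.1 + q.2 : ℕ) : ℂ) = ((k + 1 : ℕ) : ℂ) := by rw [mem_antidiagonal.1 hq]
    push_cast at this; rw [← add_mul, this]
  rw [h1, Finset.Nat.sum_antidiagonal_succ (f := fun q : ℕ × ℕ => (q.1 : ℂ) * f q.1 q.2),
    Finset.Nat.sum_antidiagonal_succ' (f := fun q : ℕ × ℕ => (q.2 : ℂ) * f q.1 q.2), sum_add_distrib]
  simp

/-- Here `t s m p` stands for the state of the calculation with `s` creators still to be evaluated,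
`m` of them already contracted and `p` passed through. Each step applies Euler's identity in degree
one higher, and the degrees multiply up to the factorial. -/
theorem sum_of_recursion (t : ℕ → ℕ → ℕ → ℂ) (s : ℕ) (h : ∀ s' < s, ∀ m p, t (s' + 1) m p =
    (m + 1 : ℂ) * t s' (m + 1) p + (p + 1 : ℂ) * t s' m (p + 1)) :
    t s 0 0 = s.factorial * ∑ q ∈ antidiagonal s, t 0 q.1 q.2 := by
  have key : ∀ s' ≤ s, ∀ k, (k.factorial : ℂ) * ∑ q ∈ antidiagonal k, t s' q.1 q.2 =
      (k + s').factorial * ∑ q ∈ antidiagonal (k + s'), t 0 q.1 q.2 := by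
    intro s' hs'
    induction s' with
    | zero => intro k; rfl
    | succ s' ih =>
      intro k; have h1 := ih (by omega) (k + 1); rw [show k + 1 + s' = k + (s' + 1) by ring] at h1
      rw [← h1, sum_congr rfl fun q _ => h s' (by omega) q.1 q.2, euler_antidiagonal, factorial_succ]
      push_cast; ring
  have := key s le_rfl 0; simpa using this

/-- The combinatorial factor of a configuration. -/
def combFactor (a b m p : ℕ) : ℂ :=
  (√(a + b).factorial : ℂ) / (a.factorial * b.factorial * m.factorial * p.factorial)

theorem sqrt_factorial_succ (n : ℕ) : (√(n + 1).factorial : ℂ) * (√(n + 1 : ℕ) : ℂ)⁻¹ =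
    √n.factorial := by
  rw [factorial_succ, Nat.cast_mul, Real.sqrt_mul (cast_nonneg _), ofReal_mul, mul_comm, ← mul_assoc,
    inv_mul_cancel₀, one_mul]
  rw [Ne, ofReal_eq_zero, sqrt_eq_zero (cast_nonneg _)]; exact_mod_cast Nat.succ_ne_zero n

theorem factorial_ne (n : ℕ) : (n.factorial : ℂ) ≠ 0 := by exact_mod_cast n.factorial_ne_zero

theorem combFactor_left (a b m p : ℕ) : combFactor (a + 1) b m p * ((√(a + 1 + b : ℕ) : ℂ)⁻¹ * (a + 1 : ℕ)) =
    (m + 1 : ℂ) * combFactor a b (m + 1) p := by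
  have h := sqrt_factorial_succ (a + b); rw [show a + b + 1 = a + 1 + b by ring] at h
  rw [combFactor, combFactor, ← h, factorial_succ a, factorial_succ m]
  have := factorial_ne a; have := factorial_ne b; have := factorial_ne m; have := factorial_ne p
  have h1 : ((a + 1 : ℕ) : ℂ) ≠ 0 := by exact_mod_cast Nat.succ_ne_zero a
  have h2 : ((m + 1 : ℕ) : ℂ) ≠ 0 := by exact_mod_cast Nat.succ_ne_zero m
  push_cast at h1 h2 ⊢; field_simp

theorem combFactor_right (a b m p : ℕ) : combFactor a (b + 1) m p * ((√(a + (b + 1) : ℕ) : ℂ)⁻¹ * (b + 1 : ℕ)) =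
    (p + 1 : ℂ) * combFactor a b m (p + 1) := by
  have h := sqrt_factorial_succ (a + b); rw [show a + b + 1 = a + (b + 1) by ring] at h
  rw [combFactor, combFactor, ← h, factorial_succ b, factorial_succ p]
  have := factorial_ne a; have := factorial_ne b; have := factorial_ne m; have := factorial_ne p
  have h1 : ((b + 1 : ℕ) : ℂ) ≠ 0 := by exact_mod_cast Nat.succ_ne_zero b
  have h2 : ((p + 1 : ℕ) : ℂ) ≠ 0 := by exact_mod_cast Nat.succ_ne_zero p
  push_cast at h1 h2 ⊢; field_simp

/-- Move `m` variables from the role `et` to `L` and `p` variables from `nu` to `Q`. -/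
def moveCounts (v : Role → ℕ) (et nu L Q : Role) (m p : ℕ) : Role → ℕ := fun b =>
  if b = et then v et - m else if b = nu then v nu - p else if b = L then m else if b = Q then p else v b

/-- Wick's theorem for `s0` creators. The normalization `combFactor` turns the multiplicities and
square roots of `step` into the coefficients `m + 1` and `p + 1` of `sum_of_recursion`. Terms that
would use more variables than are available are set to zero, consistently with the vanishing
multiplicity. -/
theorem Contracts.formula {S : ℂ → ℂ} {M : Config ℝ → List ℝ → FockFn} {et nu L Q : Role} {A : Role → Prop}
    {n0 s0 l0 : ℕ} (h : Contracts S M et nu L Q A n0 s0 l0) {v : Role → ℕ} (hv : ∑ b, v b = n0)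
    (hL : v L = 0) (hQ : v Q = 0) (hl : v et ≤ l0) (hA : ∀ b, v b ≠ 0 → A b) :
    combFactor (v et) (v nu) 0 0 * rint (word v) (contractFn S M et nu s0) =
      s0.factorial * ∑ q ∈ antidiagonal s0, if q.1 ≤ v et ∧ q.2 ≤ v nu then
        combFactor (v et - q.1) (v nu - q.2) q.1 q.2 *
          rint (word (moveCounts v et nu L Q q.1 q.2)) (contractFn S M et nu 0) else 0 := by
  obtain ⟨n1, n2, n3, n4, n5, n6⟩ := h.ne
  set t : ℕ → ℕ → ℕ → ℂ := fun s m p => if m ≤ v et ∧ p ≤ v nu then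
    combFactor (v et - m) (v nu - p) m p *
      rint (word (moveCounts v et nu L Q m p)) (contractFn S M et nu s) else 0 with ht
  have h0 : moveCounts v et nu L Q 0 0 = v := by
    funext b; simp only [moveCounts]; split_ifs <;> simp_all
  have key := sum_of_recursion t s0 ?_
  · simp only [ht, Nat.zero_le, and_self, if_true, h0, Nat.sub_zero] at key; exact key
  intro s hs m p
  by_cases hmp : m ≤ v et ∧ p ≤ v nu
  swap
  · have c1 : ¬ (m + 1 ≤ v et ∧ p ≤ v nu) := by omega
    have c2 : ¬ (m ≤ v et ∧ p + 1 ≤ v nu) := by omega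
    simp only [ht, hmp, c1, c2, if_false, mul_zero, add_zero]
  obtain ⟨hm, hp⟩ := hmp; set w := moveCounts v et nu L Q m p with hw
  have wet : w et = v et - m := by simp [hw, moveCounts]
  have wnu : w nu = v nu - p := by simp [hw, moveCounts, n1.symm]
  have hsum : (word w).length = n0 := by
    rw [length_word, ← hv]
    have e : ∀ b, w b + ((if b = et then m else 0) + (if b = nu then p else 0)) =
        v b + ((if b = L then m else 0) + if b = Q then p else 0) := by
      intro b; simp only [hw, moveCounts]
      by_cases b1 : b = et
      · subst b1; simp [n1, n2.symm, n4.symm]; omega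
      by_cases b2 : b = nu
      · subst b2; simp [n1.symm, n3.symm, n5.symm]; omega
      by_cases b3 : b = L
      · subst b3; simp [b1, b2, n6, hL]
      by_cases b4 : b = Q
      · subst b4; simp [b1, b2, b3, hQ]
      · simp [b1, b2, b3, b4]
    have := sum_congr (s₁ := (Finset.univ : Finset Role)) rfl fun b _ => e b
    simp only [sum_add_distrib, sum_ite_eq', Finset.mem_univ, if_true] at this; omega
  have hAw : ∀ b ∈ word w, A b := by
    intro b hb; have hb' : w b ≠ 0 := by rw [← count_word w b]; exact (count_pos_iff.2 hb).ne'
    simp only [hw, moveCounts] at hb'; split_ifs at hb' with b1 b2 b3 b4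
    · exact hA b (by subst b1; omega)
    · exact hA b (by subst b2; omega)
    · subst b3; exact h.allowed_left (by omega)
    · subst b4; exact h.allowed_right
    · exact hA b hb'
  have st := (h.step hs (h.integrable_contractFn s hs.le) (word w) hsum
    (by rw [count_word, wet]; omega) hAw).2
  rw [count_word, count_word, wet, wnu] at st
  have pL : 0 < v et - m → rint (L :: (word w).erase et) (contractFn S M et nu s) =
      rint (word (moveCounts v et nu L Q (m + 1) p)) (contractFn S M et nu s) := by
    intro hpos; refine rint_perm (perm_word fun b => ?_) _
    rw [List.count_cons, count_erase, count_word]; simp only [hw, moveCounts]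
    by_cases b1 : b = et
    · subst b1; simp [n2]; omega
    by_cases b2 : b = nu
    · subst b2; simp [n1, n1.symm, n3]
    by_cases b3 : b = L
    · subst b3; simp [n2, n3, n2.symm]
    by_cases b4 : b = Q
    · subst b4; simp [n4, n5, n6.symm, n4.symm, Ne.symm n6]; exact n6
    · simp [b1, b2, b3, b4, Ne.symm b1, Ne.symm b3]
  have pQ : 0 < v nu - p → rint (Q :: (word w).erase nu) (contractFn S M et nu s) =
      rint (word (moveCounts v et nu L Q m (p + 1))) (contractFn S M et nu s) := by
    intro hpos; refine rint_perm (perm_word fun b => ?_) _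
    rw [List.count_cons, count_erase, count_word]; simp only [hw, moveCounts]
    by_cases b1 : b = et
    · subst b1; simp [n4, n1.symm]
    by_cases b2 : b = nu
    · subst b2; simp [n1.symm, n5]; omega
    by_cases b3 : b = L
    · subst b3; simp [n2, n3, n3.symm, n6, n6.symm]
    by_cases b4 : b = Q
    · subst b4; simp [n4, n5, n6.symm, n5.symm]
    · simp [b1, b2, b3, b4, Ne.symm b2, Ne.symm b4]
  have et1 : t (s + 1) m p = combFactor (v et - m) (v nu - p) m p * rint (word w) (contractFn S M et nu (s + 1)) := by
    simp only [ht, hm, hp, and_self, if_true, hw]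
  rw [et1, st, mul_add, mul_add]; congr 1
  · rcases Nat.eq_zero_or_pos (v et - m) with hz | hpos
    · have c1 : ¬ (m + 1 ≤ v et ∧ p ≤ v nu) := by omega
      simp only [ht, hz, c1, if_false]; simp
    · have c1 : m + 1 ≤ v et ∧ p ≤ v nu := by omega
      obtain ⟨a, ha⟩ : ∃ a, v et - m = a + 1 := ⟨v et - m - 1, by omega⟩
      have ha' : v et - (m + 1) = a := by omega
      simp only [ht, c1, and_self, if_true]
      rw [pL hpos, ha, ha', ← mul_assoc ((m : ℂ) + 1), ← combFactor_left]; ring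
  · rcases Nat.eq_zero_or_pos (v nu - p) with hz | hpos
    · have c1 : ¬ (m ≤ v et ∧ p + 1 ≤ v nu) := by omega
      simp only [ht, hz, c1, if_false]; simp
    · have c1 : m ≤ v et ∧ p + 1 ≤ v nu := by omega
      obtain ⟨a, ha⟩ : ∃ a, v nu - p = a + 1 := ⟨v nu - p - 1, by omega⟩
      have ha' : v nu - (p + 1) = a := by omega
      simp only [ht, c1, and_self, if_true]
      rw [pQ hpos, ha, ha', ← mul_assoc ((p : ℂ) + 1), ← combFactor_right]; ring

/-! ### Exchange of variables -/

theorem move_right {A : List ℂ → ℂ} {σ : ℂ → ℂ → ℂ} {D : List ℂ → Prop}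
    (h : ∀ (L1 L2 : List ℂ) (x y : ℂ), D (L1 ++ x :: y :: L2) → D (L1 ++ y :: x :: L2) →
      A (L1 ++ x :: y :: L2) = σ x y * A (L1 ++ y :: x :: L2)) (x : ℂ) (L2 : List ℂ) :
    ∀ (M L1 : List ℂ), (∀ M1 M2, M = M1 ++ M2 → D (L1 ++ (M1 ++ x :: (M2 ++ L2)))) →
      A (L1 ++ x :: (M ++ L2)) = (M.map (σ x)).prod * A (L1 ++ (M ++ x :: L2))
  | [], L1, _ => by simp
  | y :: M, L1, hD => by
    have h1 := h L1 (M ++ L2) x y (hD [] (y :: M) rfl) (by simpa using hD [y] M rfl)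
    have h2 := move_right h x L2 M (L1 ++ [y]) fun M1 M2 hM => by
      have := hD (y :: M1) M2 (by simp [hM]); simpa using this
    rw [append_assoc, append_assoc] at h2; rw [cons_append, h1, map_cons, prod_cons, mul_assoc]
    congr 1

theorem pairwise_move {R : ℂ → ℂ → Prop} {x : ℂ} {L1 M L2 : List ℂ} (h : (L1 ++ x :: (M ++ L2)).Pairwise R)
    (hx : ∀ y ∈ M, R y x) {M1 M2 : List ℂ} (hM : M = M1 ++ M2) : (L1 ++ (M1 ++ x :: (M2 ++ L2))).Pairwise R := by
  subst hM; simp only [pairwise_append, pairwise_cons, mem_append, mem_cons] at h ⊢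
  obtain ⟨h1, ⟨h2, ⟨h3, h4, h5⟩, h6, h7⟩, h8⟩ := h
  refine ⟨h1, ⟨h3, ⟨fun y hy => h2 y (by tauto), h4, h6, fun y hy z hz => h7 y (Or.inr hy) z hz⟩, ?_⟩, ?_⟩
  · rintro y hy z (rfl | hz | hz)
    · exact hx y (by simp [hy])
    · exact h5 y hy z hz
    · exact h7 y (Or.inl hy) z hz
  · rintro y hy z (hz | rfl | hz | hz)
    · exact h8 y hy z (by tauto)
    · exact h8 y hy z (by tauto)
    · exact h8 y hy z (by tauto)
    · exact h8 y hy z (by tauto)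

theorem CoefData.move {S : ℂ → ℂ} {a : Coefficients} {δ : ℝ} {N : ℕ} (h : CoefData S a δ N) {x : ℂ}
    {L1 M L2 : List ℂ} (hN : (L1 ++ x :: (M ++ L2)).length ≤ N) (hp : (L1 ++ x :: (M ++ L2)).Pairwise (RegRel δ))
    (hx : ∀ y ∈ M, RegRel δ y x) :
    onList a (L1 ++ x :: (M ++ L2)) = (M.map fun y => S (x - y)).prod * onList a (L1 ++ (M ++ x :: L2)) := by
  refine move_right (A := onList a) (σ := fun x y => S (x - y))
    (D := fun L => L.length ≤ N ∧ L.Pairwise (RegRel δ)) (fun L1 L2 x y h1 h2 => h.exch L1 L2 x y h1.1 h1.2 h2.2)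
    x L2 M L1 fun M1 M2 hM => ⟨?_, pairwise_move hp hx hM⟩
  subst hM; simp only [length_append, length_cons] at hN ⊢; omega

theorem VecData.conj_move {S : ℂ → ℂ} {δ B : ℝ} (hS : StripS S δ B) {ψ : List ℂ → ℂ} {N : ℕ}
    (h : VecData S ψ (δ / 2) N) {x : ℂ} {L1 M L2 : List ℂ} (hL : ∀ z ∈ L1 ++ x :: (M ++ L2), |z.im| < δ / 2) :
    conjFn ψ (L1 ++ x :: (M ++ L2)) = (M.map fun y => S (x - y)).prod * conjFn ψ (L1 ++ (M ++ x :: L2)) := by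
  refine move_right (A := conjFn ψ) (σ := fun x y => S (x - y)) (D := fun L => ∀ z ∈ L, |z.im| < δ / 2)
    (fun L1 L2 x y h1 _ => h.conj_exch hS le_rfl L1 L2 x y h1) x L2 M L1 fun M1 M2 hM z hz => hL z ?_
  subst hM; simp only [mem_append, mem_cons] at hz ⊢; tauto

theorem StripS.prod_inv {S : ℂ → ℂ} {δ B : ℝ} (hS : StripS S δ B) (x : ℂ) : ∀ M : List ℂ,
    (∀ y ∈ M, |(x - y).im| < δ) → (M.map fun y => S (x - y)).prod * (M.map fun y => S (y - x)).prod = 1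
  | [], _ => by simp
  | y :: M, h => by
    have h1 := hS.inv (x - y) (h y (by simp)); rw [neg_sub] at h1
    have h2 := hS.prod_inv x M fun z hz => h z (by simp [hz])
    simp only [map_cons, prod_cons]; linear_combination (S (x - y) * S (y - x)) * h2 + h1

theorem sProd_append_left (S : ℂ → ℂ) (A A' B : List ℂ) : sProd S (A ++ A') B = sProd S A B * sProd S A' B := by
  simp [sProd]

theorem sProd_append_right (S : ℂ → ℂ) (A B B' : List ℂ) : sProd S A (B ++ B') = sProd S A B * sProd S A B' := by
  simp [sProd, prod_map_mul]

theorem sProd_singleton_left (S : ℂ → ℂ) (x : ℂ) (B : List ℂ) : sProd S [x] B = (B.map fun y => S (x - y)).prod := by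
  simp [sProd]

theorem sProd_singleton_right (S : ℂ → ℂ) (A : List ℂ) (x : ℂ) : sProd S A [x] = (A.map fun y => S (y - x)).prod := by
  simp [sProd]

theorem regRel_of_im_eq {δ : ℝ} (hδ : 0 < δ) {z w : ℂ} (h : z.im = w.im) : RegRel δ z w := by
  have hpi := pi_pos
  refine ⟨⟨by rw [sub_im, h]; linarith, by rw [sub_im, h]; linarith⟩, cosh_ne_zero_of_im ?_⟩
  rw [sub_im, h]; simpa using hpi

namespace Model

variable (m : Model)

/-- The integrand before the contraction of the creators `u`. -/
def core (e1 e2 : ℂ) (C : Config ℂ) (u ν : List ℂ) : ℂ :=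
  m.smears (update C .Q (C .Q ++ u)) * onList m.a (symEval e1 (aSym true C)) *
    onList m.b (symEval e2 (bSym (update C .Q (C .Q ++ u)))) * sProd m.S (C .Q) (C .et) *
    (conjFn m.φ ((C .P).reverse ++ (C .th ++ (C .Q ++ C .nu))) * m.ψ (C .eB ++ ν))

theorem core_nil (e1 e2 : ℂ) (C : Config ℂ) : m.core e1 e2 C [] (C .et ++ C .nu) = m.W true e1 e2 C := by
  rw [core, append_nil, update_eq_self, W, vecs]

variable {m}

theorem adm_real {e1 e2 : ℝ} (h10 : 0 < e1) (h11 : e1 ≤ m.s) (h20 : 0 < e2) (h21 : e2 ≤ m.s) {C : Config ℂ}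
    (hC : ∀ b, ∀ z ∈ C b, z.im = 0) (hH : C .H = []) (hlen : ∑ b, (C b).length ≤ m.N) :
    m.Adm (CoshRel m.δ (Real.sin (min e1 e2 / 2))) true e1 e2 C := by
  have h1 := min_le_left e1 e2; have h2 := min_le_right e1 e2
  exact m.adm_levels (ρ := 0) (y := 0) le_rfl m.s_pos.le (Or.inl rfl) le_rfl zero_le_one (lt_min h10 h20)
    h10.le h11 h20.le h21 (by linarith) (by linarith) (fun b z hz => by rw [hC b z hz, zero_mul]) hH hlen

theorem sin_min_pos {e1 e2 : ℝ} (h10 : 0 < e1) (h11 : e1 ≤ m.s) (h20 : 0 < e2) :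
    0 < Real.sin (min e1 e2 / 2) :=
  sin_half_pos (lt_min h10 h20) ((min_le_left _ _).trans (by have := m.s_le; linarith))

/-- Exchange relation of `a`: carrying `x` past `E1` yields the factor on the left. Exchange
relation of `b`: carrying `x` past the variables `Q` yields `∏ S(x - y)`, which cancels the factors
`S(y - x)` that `x`, as a variable of role `et`, contributes to `sProd`. -/
theorem core_left {e1 e2 : ℝ} (h10 : 0 < e1) (h11 : e1 ≤ m.s) (h20 : 0 < e2) (h21 : e2 ≤ m.s) {C : Config ℂ}
    (hC : ∀ b, ∀ z ∈ C b, z.im = 0) (hH : C .H = []) {x : ℂ} (hx : x.im = 0) {u : List ℂ}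
    (hu : ∀ z ∈ u, z.im = 0) (hlen : ∑ b, (C b).length + u.length + 1 ≤ m.N) {E1 E2 : List ℂ}
    (hE : C .et = E1 ++ E2) (ν : List ℂ) :
    (E1.map fun y => m.S (x - y)).prod * m.core e1 e2 (update C .et (E1 ++ x :: E2)) (x :: u) ν =
      m.core e1 e2 (snocRole .L x C) u ν := by
  have hδ := m.strip.pos; set D : Config ℂ := update (snocRole .L x C) .Q (C .Q ++ u) with hD
  have hE' : ∀ z ∈ E1 ++ E2, z.im = 0 := fun z hz => hC .et z (hE ▸ hz)
  rw [sum_role] at hlen; have hDim : ∀ b, ∀ z ∈ D b, z.im = 0 := by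
    intro b z hz; rcases b <;> simp [hD, snocRole] at hz
    · exact hC _ z hz
    · exact hC _ z hz
    · exact hC _ z hz
    · exact hC _ z hz
    · rcases hz with hz | rfl
      exacts [hC _ z hz, hx]
    · rcases hz with hz | hz
      exacts [hC _ z hz, hu z hz]
    · exact hC _ z hz
    · exact hC _ z hz
  have adm := (adm_real h10 h11 h20 h21 hDim (by simp [hD, snocRole, hH]) (by
    rw [sum_role]; simp [hD, snocRole]; omega)).reg (sin_min_pos h10 h11 h20)
  set D' : Config ℂ := update (update C .et (E1 ++ x :: E2)) .Q (C .Q ++ x :: u) with hD'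
  have hDim' : ∀ b, ∀ z ∈ D' b, z.im = 0 := by
    intro b z hz; rcases b <;> simp [hD'] at hz
    · exact hC _ z hz
    · rcases hz with hz | rfl | hz
      exacts [hE' z (by simp [hz]), hx, hE' z (by simp [hz])]
    · exact hC _ z hz
    · exact hC _ z hz
    · exact hC _ z hz
    · rcases hz with hz | rfl | hz
      exacts [hC _ z hz, hx, hu z hz]
    · exact hC _ z hz
    · exact hC _ z hz
  have hel : (C .et).length = E1.length + E2.length := by rw [hE, length_append]
  have hDl : ∑ b, (D b).length ≤ m.N := by rw [sum_role]; simp [hD, snocRole]; omega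
  have pb : (symEval e2 (bSym D')).Pairwise (RegRel m.δ) := by
    rw [symEval_bSym]; have hs := m.s_le; have hs0 := m.s_pos; have hδ8 := m.δ_eq
    have hpi := Real.pi_gt_three
    have : ∀ z w : ℂ, z.im = 0 → w.im = 0 → RegRel m.δ (z - e2 * I) (w - π * I + e2 * I) := fun z w hz hw =>
      (coshRel_of_im m.strip.le (γ := e2) h20 (by linarith) (by simp [hz, hw]; linarith) (by simp [hz, hw]; linarith)
        (Or.inl (by simp [hz, hw]; linarith))).regRel (sin_half_pos h20 (by linarith))
    have hw : ∀ z ∈ (D' .Q).reverse ++ (D' .L).reverse ++ D' .H ++ D' .P, z.im = 0 := by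
      intro z hz; simp only [mem_append, mem_reverse] at hz
      rcases hz with ((hz | hz) | hz) | hz <;> exact hDim' _ z hz
    rw [pairwise_append]
    refine ⟨pairwise_map_of_all _ fun z hz w hw => regRel_of_im_eq hδ (by simp [hDim' _ z hz, hDim' _ w hw]),
      pairwise_map_of_all _ fun z hz w hw' => regRel_of_im_eq hδ (by simp [hw z hz, hw w hw']), ?_⟩
    intro z hz w hw'; obtain ⟨z', hz', rfl⟩ := mem_map.1 hz
    obtain ⟨w', hw'', rfl⟩ := mem_map.1 hw'; exact this _ _ (hDim' _ z' hz') (hw w' hw'')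
  have pa := adm.a
  have ea : symEval e1 (aSym true (snocRole .L x C)) = (C .L).map (fun x => x - e1 * I) ++ (x - e1 * I) ::
      (E1.map (fun x => x - e1 * I) ++ (E2.map (fun x => x - e1 * I) ++
        (C .th).reverse.map fun x => x - π * I + e1 * I)) := by
    rw [symEval_aSym_true]; simp [snocRole, hH, hE]
  have ea0 : symEval e1 (aSym true D) = symEval e1 (aSym true (snocRole .L x C)) := by
    rw [symEval_aSym_true, symEval_aSym_true]; simp [hD]
  have ea' : symEval e1 (aSym true (update C .et (E1 ++ x :: E2))) = (C .L).map (fun x => x - e1 * I) ++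
      (E1.map (fun x => x - e1 * I) ++ (x - e1 * I) :: (E2.map (fun x => x - e1 * I) ++
        (C .th).reverse.map fun x => x - π * I + e1 * I)) := by rw [symEval_aSym_true]; simp [hH]
  have eb : symEval e2 (bSym D) = ((C .eB).map (fun x => x - e2 * I) ++
      u.reverse.map fun x => x - π * I + e2 * I) ++ ((C .Q).reverse.map (fun x => x - π * I + e2 * I) ++
      (x - π * I + e2 * I) :: ((C .L).reverse ++ C .P).map fun x => x - π * I + e2 * I) := by
    rw [symEval_bSym]; simp [hD, snocRole, hH]
  have eb' : symEval e2 (bSym D') = ((C .eB).map (fun x => x - e2 * I) ++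
      u.reverse.map fun x => x - π * I + e2 * I) ++ (x - π * I + e2 * I) ::
      ((C .Q).reverse.map (fun x => x - π * I + e2 * I) ++
        ((C .L).reverse ++ C .P).map fun x => x - π * I + e2 * I) := by
    rw [symEval_bSym]; simp [hD', hH]
  rw [ea0, ea] at pa; rw [eb'] at pb; have ma := m.ha.move (by simp; omega) pa (by
      intro y hy; obtain ⟨z, hz, rfl⟩ := mem_map.1 hy
      exact regRel_of_im_eq hδ (by simp [hx, hE' z (by simp [hz])]))
  have mb := m.hb.move (by simp; omega) pb (by
      intro y hy; obtain ⟨z, hz, rfl⟩ := mem_map.1 hy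
      exact regRel_of_im_eq hδ (by simp [hx, hC .Q z (by simpa using hz)]))
  rw [← ea, ← ea'] at ma; rw [← eb, ← eb'] at mb
  simp only [map_map, comp_def, sub_sub_sub_cancel_right, add_sub_add_right_eq_sub] at ma mb
  have inv := m.strip.prod_inv x (C .Q) fun y hy => by rw [sub_im, hx, hC _ y hy]; simpa using hδ
  have hmr : ((C .Q).reverse.map fun y => m.S (x - y)).prod = ((C .Q).map fun y => m.S (x - y)).prod :=
    ((reverse_perm _).map _).prod_eq
  rw [hmr] at mb
  have es : sProd m.S (C .Q) (E1 ++ x :: E2) = sProd m.S (C .Q) (C .et) * ((C .Q).map fun y => m.S (y - x)).prod := by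
    rw [hE, show E1 ++ x :: E2 = E1 ++ ([x] ++ E2) by simp, sProd_append_right, sProd_append_right,
      sProd_append_right, sProd_singleton_right]
    ring
  have esm : m.smears D' = m.smears D := by
    have w1 : psum m.μ (D' .H ++ D' .L) + (psum m.μ (D' .et) - psum m.μ (D' .th)) =
        psum m.μ (D .H ++ D .L) + (psum m.μ (D .et) - psum m.μ (D .th)) := by
      simp only [hD, hD', snocRole]; simp [hH, hE, psum_append, psum_cons, psum_nil]; abel
    have w2 : psum m.μ (D' .eB) - psum m.μ (D' .P ++ D' .Q) - psum m.μ (D' .H ++ D' .L) =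
        psum m.μ (D .eB) - psum m.μ (D .P ++ D .Q) - psum m.μ (D .H ++ D .L) := by
      simp only [hD, hD', snocRole]; simp [hH, psum_append, psum_cons, psum_nil]; abel
    rw [smears, smears, w1, w2]
  rw [core, core]; have q1 : update C .et (E1 ++ x :: E2) .Q = C .Q := by simp
  have q2 : snocRole .L x C .Q = C .Q := by simp [snocRole]
  rw [q1, q2]
  change _ * (m.smears D' * _ * onList m.b (symEval e2 (bSym D')) * _ * _) = m.smears D * _ *
    onList m.b (symEval e2 (bSym D)) * _ * _
  rw [esm, ma, mb]
  simp only [snocRole, ne_eq, reduceCtorEq, not_false_eq_true, update_of_ne, update_self]; rw [es]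
  linear_combination ((E1.map fun y => m.S (x - y)).prod * m.smears D *
    onList m.a (symEval e1 (aSym true (update C .et (E1 ++ x :: E2)))) *
    onList m.b (symEval e2 (bSym D)) * sProd m.S (C .Q) (C .et) *
    (conjFn m.φ ((C .P).reverse ++ (C .th ++ (C .Q ++ C .nu))) * m.ψ (C .eB ++ ν))) * inv

/-- A creator that passes all annihilators of the first field leaves the factors `S` of these
passages in `sProd`; those of its passage through the spectators `N1` are absorbed by the symmetry
of the wave function of the left vector. -/
theorem core_right {e1 e2 : ℂ} {C : Config ℂ} (hC : ∀ b, ∀ z ∈ C b, z.im = 0) {x : ℂ} (hx : x.im = 0) {u : List ℂ}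
    {N1 N2 : List ℂ} (hN : C .nu = N1 ++ N2) (ν : List ℂ) :
    ((C .et ++ N1).map fun y => m.S (x - y)).prod * m.core e1 e2 (update C .nu (N1 ++ x :: N2)) (x :: u) ν =
      m.core e1 e2 (snocRole .Q x C) u ν := by
  have hδ := m.strip.pos; have hN' : ∀ z ∈ N1 ++ N2, z.im = 0 := fun z hz => hC .nu z (hN ▸ hz)
  have mv := m.hφ.conj_move m.strip (x := x) (L1 := (C .P).reverse ++ (C .th ++ C .Q)) (M := N1) (L2 := N2) (by
    intro z hz; have : z.im = 0 := by
      simp only [mem_append, mem_cons, mem_reverse] at hz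
      rcases hz with (hz | hz | hz) | rfl | hz | hz
      exacts [hC _ z hz, hC _ z hz, hC _ z hz, hx, hN' z (by simp [hz]), hN' z (by simp [hz])]
    rw [this]; simpa using hδ)
  have es : sProd m.S (C .Q ++ [x]) (C .et) = sProd m.S (C .Q) (C .et) * ((C .et).map fun y => m.S (x - y)).prod := by
    rw [sProd_append_left, sProd_singleton_left]
  rw [core, core]
  simp only [snocRole, ne_eq, reduceCtorEq, not_false_eq_true, update_of_ne, update_self,
    update_idem, smears, symEval_aSym_true, symEval_bSym, map_append, prod_append, hN, es]
  simp only [append_assoc, singleton_append] at mv ⊢; rw [mv]; ring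

end Model

/-! ### Wick monomials on lists -/

/-- A configuration of real variables as one of complex variables. -/
def realConfig (C : Config ℝ) : Config ℂ := fun b => (C b).map ofReal

theorem lift_zero (C : Config ℝ) : lift (fun _ => 0) C = realConfig C := by
  funext b; simp [lift, realConfig]

theorem annihilateMany_eq (Ψ : FockFn) : ∀ (l : ℕ) (η : Fin l → ℝ) (n : ℕ) (ν : Fin n → ℝ),
    annihilateMany l η Ψ n ν = (√n.factorial : ℂ)⁻¹ * √(n + l).factorial *
      onList Ψ ((ofFn η).reverse ++ ofFn ν)
  | 0, η, n, ν => by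
    have : (√n.factorial : ℂ) ≠ 0 := by
      rw [Ne, ofReal_eq_zero, sqrt_eq_zero (cast_nonneg _)]; exact_mod_cast n.factorial_ne_zero
    simp [annihilateMany, onList_ofFn, inv_mul_cancel₀ this]
  | l + 1, η, n, ν => by
    rw [annihilateMany, annihilate, annihilateMany_eq Ψ l, List.ofFn_cons, ofFn_succ (f := η),
      List.reverse_cons, append_assoc, singleton_append, show n + 1 + l = n + (l + 1) by ring,
      ← mul_assoc, ← mul_assoc]
    congr 2; have h := sqrt_factorial_succ n; have h0 : (√(n + 1).factorial : ℂ) ≠ 0 := by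
      rw [Ne, ofReal_eq_zero, sqrt_eq_zero (cast_nonneg _)]
      exact_mod_cast (n + 1).factorial_ne_zero
    have h1 : (√(n + 1 : ℕ) : ℂ) ≠ 0 := by
      rw [Ne, ofReal_eq_zero, sqrt_eq_zero (cast_nonneg _)]; exact_mod_cast n.succ_ne_zero
    rw [← h]; push_cast at h1 ⊢; field_simp

theorem reverse_ofFn {α : Type*} {n : ℕ} (f : Fin n → α) : (ofFn f).reverse = ofFn (f ∘ Fin.rev) := by
  refine List.ext_getElem (by simp) fun i h1 h2 => ?_
  simp only [List.getElem_reverse, List.getElem_ofFn, comp_apply, length_ofFn]; congr 1; ext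
  simp [Fin.val_rev]; omega

/-- The kernel of a Wick monomial. -/
def kern (μ : ℝ) (a : Coefficients) (f : ℝ × ℝ → ℂ) (e : ℝ) (θ η : List ℝ) : ℂ :=
  onList a (η.map (fun x : ℝ => (x : ℂ) - e * I) ++ θ.reverse.map fun x : ℝ => (x : ℂ) - π * I + e * I) *
    smearC f (psum μ (η.map ofReal) - psum μ (θ.map ofReal))

theorem psum_ofFn (μ : ℝ) {n : ℕ} (t : Fin n → ℝ) :
    psum μ ((ofFn t).map ofReal) = (((∑ i, momentum μ (t i)).1 : ℂ), ((∑ i, momentum μ (t i)).2 : ℂ)) := by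
  simp only [psum, momentum, Prod.fst_sum, Prod.snd_sum, map_ofFn, sum_ofFn, comp_apply,
    mul_sum]
  push_cast; rfl

theorem kern_eq (μ : ℝ) (a : Coefficients) (f : ℝ × ℝ → ℂ) (e : ℝ) {r l : ℕ} (θ : Fin r → ℝ) (η : Fin l → ℝ) :
    a (r + l) (contourPoints e θ η ∘ Fin.rev) * smear f (∑ i, momentum μ (η i) - ∑ i, momentum μ (θ i)) =
      kern μ a f e (ofFn θ) (ofFn η).reverse := by
  rw [kern, smear_eq, psum_perm μ ((reverse_perm _).map _), psum_ofFn, psum_ofFn]; congr 1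
  · rw [← onList_ofFn a]; congr 1
    have : ofFn (contourPoints e θ η ∘ Fin.rev) = (ofFn (contourPoints e θ η)).reverse := by
      rw [reverse_ofFn]
    rw [this, contourPoints, List.ofFn_fin_append, List.reverse_append, map_reverse, map_reverse,
      map_ofFn, map_ofFn]
    rfl
  · simp

/-- The vector created by the annihilation operators of a Wick monomial. -/
def annVec (μ : ℝ) (a : Coefficients) (f : ℝ × ℝ → ℂ) (e : ℝ) (l : ℕ) (χ : FockFn) (θ : List ℝ) :
    FockFn := fun n ν => (√n.factorial : ℂ)⁻¹ * (√(n + l).factorial *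
      (((2 * π : ℂ) ^ l)⁻¹ * ∫ η : Fin l → ℝ, kern μ a f e θ (ofFn η) *
        onList χ (ofFn η ++ ofFn ν)))

theorem fieldTerm_eq (μ : ℝ) (S : ℂ → ℂ) (a : Coefficients) (n : ℕ) (f : ℝ × ℝ → ℂ) (e : ℝ) (χ : FockFn) :
    fieldTerm μ S a n f e χ = ∑ q ∈ antidiagonal n,
      ((q.1.factorial : ℂ) * q.2.factorial)⁻¹ • createMany S q.1 fun t => annVec μ a f e q.2 χ (ofFn t) := by
  rw [fieldTerm]; refine sum_congr rfl fun q _ => ?_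
  push_cast; congr 1; rw [wickMonomial]; congr 1; funext θ n ν
  simp only [kern_eq, annihilateMany_eq, annVec]
  have e1 : ∀ η : Fin q.2 → ℝ, (ofFn η).reverse = ofFn (η ∘ Fin.revPerm) := fun η => by
    rw [reverse_ofFn]; rfl
  simp only [e1]; rw [integral_comp_equiv Fin.revPerm (fun η => kern μ a f e (ofFn θ) (ofFn η) *
    ((√n.factorial : ℂ)⁻¹ * √(n + q.2).factorial * onList χ (ofFn η ++ ofFn ν)))]
  rw [← integral_const_mul, ← integral_const_mul, ← integral_const_mul, ← integral_const_mul]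
  congr 1; funext η; push_cast; ring

/-- The configuration with variables of a single role. -/
def single (b : Role) (L : List ℝ) : Config ℝ := update (fun _ => []) b L

theorem config_replicate (b : Role) : ∀ (n : ℕ), ∃ σ : Fin (replicate n b).length ≃ Fin n,
    ∀ t : Fin n → ℝ, config (replicate n b) (t ∘ σ) = single b (ofFn t)
  | 0 => ⟨Equiv.refl _, fun t => by simp [single]; rfl⟩
  | n + 1 => by
    obtain ⟨σ, hσ⟩ := config_replicate b n
    refine ⟨(((finSuccEquiv _).trans σ.optionCongr).trans (finSuccEquiv n).symm :
      Fin ((replicate n b).length + 1) ≃ Fin (n + 1)), fun t => ?_⟩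
    have := hσ fun i => t i.succ
    change push b (t 0) (config (replicate n b) ((fun i => t i.succ) ∘ σ)) = _
    rw [this, ofFn_succ]; funext c
    by_cases hc : c = b
    · subst hc; simp [single]
    · rw [push_of_ne hc, single, single, update_of_ne hc, update_of_ne hc]

theorem rint_replicate (b : Role) (n : ℕ) {F : Config ℝ → ℂ}
    (hF : Integrable fun t => F (config (replicate n b) t)) :
    (Integrable fun t : Fin n → ℝ => F (single b (ofFn t))) ∧
    ((2 * π : ℂ) ^ n)⁻¹ * ∫ t : Fin n → ℝ, F (single b (ofFn t)) = rint (replicate n b) F := by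
  obtain ⟨σ, hσ⟩ := config_replicate b n; constructor
  · rw [← integrable_comp_equiv σ] at hF; simpa only [hσ] using hF
  · rw [rint, ← integral_comp_equiv σ]; simp only [hσ, length_replicate]

/-! ### Wick's theorem for the product of the two regularized fields. -/

namespace Model

variable (m : Model)

/-- The operators that create the particles of the second field, with the vector that remains to be
contracted. -/
def opB (e1 e2 : ℝ) (k : ℕ) : Config ℝ → List ℝ → FockFn := fun C u n ν =>
  (√n.factorial : ℂ)⁻¹ * (((2 * π : ℂ) ^ k)⁻¹ * ∫ η : Fin k → ℝ,
    m.core e1 e2 (realConfig (update C .eB (ofFn η ++ C .eB))) (u.map ofReal)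
      ((ofFn ν).map ofReal))

theorem realConfig_im (C : Config ℝ) : ∀ b, ∀ z ∈ realConfig C b, z.im = 0 := by
  intro b z hz; obtain ⟨x, -, rfl⟩ := mem_map.1 hz; simp

theorem realConfig_length (C : Config ℝ) (b : Role) : (realConfig C b).length = (C b).length := by
  simp [realConfig]

variable {m}

theorem contractFn_opB_zero (e1 e2 : ℝ) (k : ℕ) (C : Config ℝ) :
    contractFn m.S (m.opB e1 e2 k) .et .nu 0 C = (√((C .et).length + (C .nu).length).factorial : ℂ)⁻¹ *
      (((2 * π : ℂ) ^ k)⁻¹ * ∫ η : Fin k → ℝ, m.W true e1 e2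
        (realConfig (update C .eB (ofFn η ++ C .eB)))) := by
  rw [contractFn, onList, createMany, opB]; congr 2
  · rw [length_append]
  congr 2; funext η; rw [← core_nil, ofFn_get]; simp [realConfig]

theorem contracts_opB {e1 e2 : ℝ} (h10 : 0 < e1) (h11 : e1 ≤ m.s) (h20 : 0 < e2) (h21 : e2 ≤ m.s) (k n0 s0 l0 : ℕ)
    (hN : n0 + s0 + k ≤ m.N) :
    Contracts m.S (m.opB e1 e2 k) .et .nu .L .Q (fun b => b ≠ .H) n0 s0 l0 := by
  refine ⟨by decide, fun _ => by simp, by simp, ?_, ?_, ?_⟩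
  · intro C p x u hC hu _ hA hp; have hH : C .H = [] := hA .H (by simp); funext n ν
    rw [Pi.smul_apply, Pi.smul_apply, smul_eq_mul, opB, opB, mul_left_comm]; congr 1
    rw [mul_left_comm, ← integral_const_mul]; congr 2; funext η
    have key := m.core_left h10 h11 h20 h21 (C := realConfig (update C .eB (ofFn η ++ C .eB)))
      (realConfig_im _) (by simp [realConfig, hH]) (x := x) (by simp) (u := u.map ofReal) (by simp) (by
        simp only [realConfig_length, length_map]; rw [sum_role] at hC ⊢; simp
        omega) (E1 := ((C .et).take p).map ofReal) (E2 := ((C .et).drop p).map ofReal)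
      (by simp [realConfig, ← map_append]) ((ofFn ν).map ofReal)
    rw [map_map] at key; refine Eq.trans ?_ (key.trans ?_)
    · congr 2; funext b
      by_cases hb : b = .et
      · subst hb; simp [realConfig, ins]
      · by_cases hb' : b = .eB
        · subst hb'; simp [realConfig, ins]
        · simp [realConfig, ins, hb, hb']
    · congr 1; funext b
      by_cases hb : b = .L
      · subst hb; simp [realConfig, snocRole]
      · by_cases hb' : b = .eB
        · subst hb'; simp [realConfig, snocRole]
        · simp [realConfig, snocRole, hb, hb']
  · intro C p x u hC hu _ hA hp; funext n ν
    rw [Pi.smul_apply, Pi.smul_apply, smul_eq_mul, opB, opB, mul_left_comm]; congr 1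
    rw [mul_left_comm, ← integral_const_mul]; congr 2; funext η
    have key := m.core_right (e1 := e1) (e2 := e2) (C := realConfig (update C .eB (ofFn η ++ C .eB)))
      (realConfig_im _) (x := x) (by simp) (u := u.map ofReal) (N1 := ((C .nu).take p).map ofReal)
      (N2 := ((C .nu).drop p).map ofReal) (by simp [realConfig, ← map_append]) ((ofFn ν).map ofReal)
    refine Eq.trans ?_ (key.trans ?_)
    · congr 2
      · simp [realConfig, comp_def]
      · funext b
        by_cases hb : b = .nu
        · subst hb; simp [realConfig, ins]
        · by_cases hb' : b = .eB
          · subst hb'; simp [realConfig, ins]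
          · simp [realConfig, ins, hb, hb']
    · congr 1; funext b
      by_cases hb : b = .Q
      · subst hb; simp [realConfig, snocRole]
      · by_cases hb' : b = .eB
        · subst hb'; simp [realConfig, snocRole]
        · simp [realConfig, snocRole, hb, hb']
  · intro ω hω _ hA; simp only [contractFn_opB_zero, config_length]
    refine Integrable.const_mul (rint_pull .eB ω k (F := fun C => m.W true e1 e2 (realConfig C)) ?_).1 _
    simp only [← lift_zero]
    refine integrable_W (sin_min_pos h10 h11 h20) fun t => adm_real h10 h11 h20 h21
      (fun b z hz => mem_lift_im hz) ?_ ?_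
    · rw [lift, map_eq_nil_iff, ← length_eq_zero_iff, config_length, count_eq_zero]; intro hm
      rcases mem_append.1 hm with hm | hm
      · simp [List.mem_replicate] at hm
      · exact hA _ hm rfl
    · simp only [lift, length_map, length_config, length_append, length_replicate]; omega

/-- The contribution of the configurations with `v b` variables of role `b`. -/
def T (m : Model) (lev : Role → ℝ) (k : Bool) (e1 e2 : ℝ) (v : Role → ℕ) : ℂ :=
  (∏ b, ((v b).factorial : ℂ))⁻¹ * wint (word v) lev (m.W k e1 e2)

end Model

/-- The numbers of variables of the roles `th`, `et`, `L`, `Q`, `eB` and `nu`. -/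
def counts (r e l q k n : ℕ) : Role → ℕ
  | .th => r
  | .et => e
  | .P => 0
  | .H => 0
  | .L => l
  | .Q => q
  | .eB => k
  | .nu => n

theorem prod_role (F : Role → ℂ) : ∏ b, F b = F .th * F .et * F .P * F .H * F .L * F .Q * F .eB * F .nu := by
  simp only [Finset.prod, Finset.univ, Fintype.elems]; simp; ring

namespace Model

variable {m : Model}

/-- The `s` creators of the second field are distributed: `q.1` of them are contracted with
annihilators of the first field, `q.2` pass to its right. All square roots cancel, and the
factorials combine to the symmetric factor `1 / ∏ v_b!` of `T`. -/
theorem rint_opB {e1 e2 : ℝ} (h10 : 0 < e1) (h11 : e1 ≤ m.s) (h20 : 0 < e2) (h21 : e2 ≤ m.s) (s k r l n : ℕ)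
    (hN : r + l + n + s + k ≤ m.N) :
    (r.factorial * k.factorial * s.factorial : ℂ)⁻¹ * (combFactor l n 0 0 *
      rint (word (counts r l 0 0 0 n)) (contractFn m.S (m.opB e1 e2 k) .et .nu s)) =
    ∑ q ∈ antidiagonal s, if q.1 ≤ l ∧ q.2 ≤ n then
      m.T (fun _ => 0) true e1 e2 (counts r (l - q.1) q.1 q.2 k (n - q.2)) else 0 := by
  have h := m.contracts_opB h10 h11 h20 h21 k (r + l + n) s l hN
  have key := h.formula (v := counts r l 0 0 0 n) (by rw [sum_role]; simp [counts]) rfl rfl le_rfl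
    (by intro b; cases b <;> simp [counts])
  simp only [counts] at key
  change combFactor l n 0 0 * rint (word (counts r l 0 0 0 n)) _ = _ at key
  rw [key, mul_sum, mul_sum]; refine sum_congr rfl fun q hq => ?_
  by_cases hc : q.1 ≤ l ∧ q.2 ≤ n
  swap
  · simp [hc]
  simp only [hc, and_self, if_true]
  set w := moveCounts (counts r l 0 0 0 n) .et .nu .L .Q q.1 q.2 with hw
  have hInt : Integrable fun t => m.W true e1 e2 (realConfig (config (replicate k .eB ++ word w) t)) := by
    simp only [← lift_zero]
    refine integrable_W (sin_min_pos h10 h11 h20) fun t => adm_real h10 h11 h20 h21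
      (fun b z hz => mem_lift_im hz) ?_ ?_
    · rw [lift, map_eq_nil_iff, ← length_eq_zero_iff, config_length, count_append, count_word]
      simp [hw, moveCounts, counts, count_replicate]
    · simp only [lift, length_map, length_config, length_append, length_replicate, length_word]
      rw [sum_role]; have := mem_antidiagonal.1 hq; simp [hw, moveCounts, counts]; omega
  have w1 : rint (word w) (contractFn m.S (m.opB e1 e2 k) .et .nu 0) =
      (√((l - q.1) + (n - q.2)).factorial : ℂ)⁻¹ *
        rint (replicate k .eB ++ word w) (fun C => m.W true e1 e2 (realConfig C)) := by
    rw [(rint_pull .eB (word w) k hInt).2, rint, rint, mul_left_comm]; congr 1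
    rw [← integral_const_mul]; congr 1; funext t
    rw [contractFn_opB_zero, config_length, config_length, count_word, count_word]; rfl
  have w2 : rint (replicate k .eB ++ word w) (fun C => m.W true e1 e2 (realConfig C)) =
      wint (word (counts r (l - q.1) q.1 q.2 k (n - q.2))) (fun _ => 0) (m.W true e1 e2) := by
    rw [wint_eq_rint]; simp only [lift_zero]; refine rint_perm (perm_word fun b => ?_) _
    rw [count_append, count_word]
    cases b <;> simp [hw, moveCounts, counts, count_replicate]
  rw [w1, w2, T, combFactor, prod_role]; simp only [counts, Nat.factorial_zero, cast_one, mul_one]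
  have hs0 : (√((l - q.1) + (n - q.2)).factorial : ℂ) ≠ 0 := by
    rw [Ne, ofReal_eq_zero, sqrt_eq_zero (cast_nonneg _)]; exact_mod_cast Nat.factorial_ne_zero _
  have := factorial_ne r; have := factorial_ne s; have := factorial_ne k
  have := factorial_ne (l - q.1); have := factorial_ne (n - q.2); have := factorial_ne q.1; have := factorial_ne q.2
  field_simp

/-- The operators that create the particles of the first field, with the vector that remains to be
contracted. -/
def opA (m : Model) (e : ℝ) (l : ℕ) (χ : FockFn) : Config ℝ → List ℝ → FockFn := fun C u =>
  conjFn m.φ ((C .th ++ C .nu).map ofReal) • annVec m.μ m.a m.f e l χ (C .th ++ u)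

/-- The integrand before the evaluation of the creation operators of the second field. -/
def integrandA (m : Model) (e : ℝ) (χ : FockFn) (C : Config ℝ) : ℂ :=
  conjFn m.φ ((C .th ++ C .nu).map ofReal) * (kern m.μ m.a m.f e (C .th) (C .et) * onList χ (C .et ++ C .nu))

theorem integrandA_eq (e1 e2 : ℝ) {Ψ : FockFn}
    (hΨ : ∀ t : List ℝ, m.ψ (t.map ofReal) = √(t.length.factorial) * onList Ψ t) (k : ℕ) {C : Config ℝ}
    (hC : ∀ b, b ≠ .th → b ≠ .et → b ≠ .nu → C b = []) :
    m.integrandA e1 (fieldTerm m.μ m.S m.b k m.g e2 Ψ) C = ∑ q ∈ antidiagonal k,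
      ((q.1.factorial : ℂ) * q.2.factorial)⁻¹ * contractFn m.S (m.opB e1 e2 q.2) .et .nu q.1 C := by
  rw [fieldTerm_eq, integrandA, onList, Finset.sum_apply, Finset.sum_apply, mul_sum, mul_sum]
  refine sum_congr rfl fun q _ => ?_
  rw [Pi.smul_apply, Pi.smul_apply, smul_eq_mul, ← mul_assoc, mul_left_comm]; congr 1
  set c := conjFn m.φ ((C .th ++ C .nu).map ofReal) * kern m.μ m.a m.f e1 (C .th) (C .et) with hc
  have h : (fun t : Fin q.1 → ℝ => m.opB e1 e2 q.2 C (ofFn t)) =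
      fun t => c • annVec m.μ m.b m.g e2 q.2 Ψ (ofFn t) := by
    funext t n ν; rw [Pi.smul_apply, Pi.smul_apply, smul_eq_mul, opB, annVec, mul_left_comm c]
    congr 1; rw [mul_left_comm (√_ : ℂ), mul_left_comm c]; congr 1
    rw [← integral_const_mul, ← integral_const_mul]; congr 1; funext η
    have h0 : ∀ b, b ≠ .th → b ≠ .et → b ≠ .nu → b ≠ .eB →
        realConfig (update C .eB (ofFn η ++ C .eB)) b = [] := fun b h1 h2 h3 h4 => by
      simp [realConfig, h4, hC b h1 h2 h3]
    have hψ := hΨ (ofFn η ++ ofFn ν)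
    rw [length_append, length_ofFn, length_ofFn, add_comm q.2, map_append] at hψ; rw [core, smears]
    simp only [aSym, bSym, symEval, sProd, update_self, update_of_ne, ne_eq, reduceCtorEq,
      not_false_eq_true, h0 .P, h0 .H, h0 .L, h0 .Q, if_true, append_nil, nil_append, map_nil,
      reverse_nil, prod_nil]
    simp only [realConfig, update_self, update_of_ne, ne_eq, reduceCtorEq, not_false_eq_true,
      hC .eB, append_nil, hψ, hc, kern, psum_nil, zero_add, sub_zero, map_append, map_map,
      map_reverse, comp_def]
    simp only [add_zero, neg_mul, mul_comm I, sub_eq_add_neg, mul_neg]; ring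
  rw [contractFn, h, createMany_smul]; rfl

theorem integrandA_integrable {e1 e2 : ℝ} (h10 : 0 < e1) (h11 : e1 ≤ m.s) (h20 : 0 < e2) (h21 : e2 ≤ m.s) {Ψ : FockFn}
    (hΨ : ∀ t : List ℝ, m.ψ (t.map ofReal) = √(t.length.factorial) * onList Ψ t) (k : ℕ) {ω : List Role}
    (hω : ∀ b ∈ ω, b = .th ∨ b = .et ∨ b = .nu) (hN : ω.length + k ≤ m.N) :
    (Integrable fun t => m.integrandA e1 (fieldTerm m.μ m.S m.b k m.g e2 Ψ) (config ω t)) ∧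
    rint ω (m.integrandA e1 (fieldTerm m.μ m.S m.b k m.g e2 Ψ)) = ∑ q ∈ antidiagonal k,
      ((q.1.factorial : ℂ) * q.2.factorial)⁻¹ * rint ω (contractFn m.S (m.opB e1 e2 q.2) .et .nu q.1) := by
  have h0 : ∀ (t : Fin ω.length → ℝ) (b : Role), b ≠ .th → b ≠ .et → b ≠ .nu → config ω t b = [] := by
    intro t b h1 h2 h3; rw [← length_eq_zero_iff, config_length, count_eq_zero]; intro hb
    rcases hω b hb with h | h | h <;> contradiction
  have hi : ∀ q ∈ antidiagonal k, Integrable fun t => ((q.1.factorial : ℂ) * q.2.factorial)⁻¹ *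
      contractFn m.S (m.opB e1 e2 q.2) .et .nu q.1 (config ω t) := fun q hq => by
    have := mem_antidiagonal.1 hq
    exact ((m.contracts_opB h10 h11 h20 h21 q.2 ω.length q.1 (ω.count .et) (by omega)).integrable_contractFn q.1 le_rfl ω
      rfl le_rfl (fun b hb => by rcases hω b hb with h | h | h <;> simp [h])).const_mul _
  constructor
  · simp only [fun t => m.integrandA_eq e1 e2 hΨ k (h0 t)]
    exact integrable_finset_sum _ hi
  · simp only [rint, fun t => m.integrandA_eq e1 e2 hΨ k (h0 t)]
    rw [integral_finset_sum _ hi, mul_sum]; refine sum_congr rfl fun q _ => ?_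
    rw [integral_const_mul, mul_left_comm]

theorem contractFn_opA_zero (e : ℝ) (l : ℕ) (χ : FockFn) {C : Config ℝ} (hH : C .H = []) (he : C .et = []) :
    contractFn m.S (m.opA e l χ) .H .nu 0 C = (√(C .nu).length.factorial : ℂ)⁻¹ *
      √((C .nu).length + l).factorial * (((2 * π : ℂ) ^ l)⁻¹ * ∫ η : Fin l → ℝ,
        m.integrandA e χ (update C .et (ofFn η ++ C .et))) := by
  rw [contractFn, onList, createMany, opA, Pi.smul_apply, Pi.smul_apply, smul_eq_mul, annVec]
  simp only [integrandA, update_self, update_of_ne, ne_eq, reduceCtorEq, not_false_eq_true, he,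
    append_nil, ofFn_get, List.ofFn_zero]
  rw [integral_const_mul, hH, nil_append]; ring

/-- Nothing stands to the left of the first field, so its creators have no contractions. The roles
`H` and `P` serve as empty placeholders (`l0 = 0`), and the creators merely turn particles of the
left vector from role `nu` to role `th`. -/
theorem contracts_opA {e1 e2 : ℝ} (h10 : 0 < e1) (h11 : e1 ≤ m.s) (h20 : 0 < e2) (h21 : e2 ≤ m.s) {Ψ : FockFn}
    (hΨ : ∀ t : List ℝ, m.ψ (t.map ofReal) = √(t.length.factorial) * onList Ψ t) (k l n0 s0 : ℕ)
    (hN : n0 + l + k ≤ m.N) :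
    Contracts m.S (m.opA e1 l (fieldTerm m.μ m.S m.b k m.g e2 Ψ)) .H .nu .P .th (fun b => b = .th ∨ b = .nu)
      n0 s0 0 := by
  refine ⟨by decide, fun h => absurd h (by simp), by simp, fun C p x u _ _ h => absurd h (by simp), ?_, ?_⟩
  · intro C p x u _ _ _ hA hp; have hH : C .H = [] := hA .H (by simp)
    have key := m.hφ.conj_move m.strip (x := x) (L1 := (C .th).map ofReal) (M := ((C .nu).take p).map ofReal)
      (L2 := ((C .nu).drop p).map ofReal) (by
        have := m.strip.pos; intro z hz; simp only [← map_append, ← map_cons] at hz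
        obtain ⟨y, -, rfl⟩ := mem_map.1 hz; simp; linarith)
    rw [← map_append, take_append_drop] at key
    simp only [opA, ins, snocRole, hH, smul_smul, update_self, update_of_ne, ne_eq, reduceCtorEq,
      not_false_eq_true, append_assoc, singleton_append, nil_append, map_append, map_cons]
    congr 1; rw [key, map_map]; rfl
  · intro ω hω _ hA
    have hc : ∀ b, b ≠ .th → b ≠ .nu → ∀ t : Fin ω.length → ℝ, config ω t b = [] := fun b h1 h2 t => by
      rw [← length_eq_zero_iff, config_length, count_eq_zero]
      exact fun hb => by rcases hA b hb with h | h <;> contradiction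
    have e := fun t => contractFn_opA_zero (m := m) e1 l (fieldTerm m.μ m.S m.b k m.g e2 Ψ)
      (hc .H (by simp) (by simp) t) (hc .et (by simp) (by simp) t)
    simp only [config_length] at e; simp only [e]
    refine Integrable.const_mul (rint_pull .et ω l (m.integrandA_integrable h10 h11 h20 h21 hΨ k ?_ ?_).1).1 _
    · intro b hb; rcases mem_append.1 hb with hb | hb
      · exact Or.inr (Or.inl (List.eq_of_mem_replicate hb))
      · rcases hA b hb with h | h <;> simp [h]
    · rw [length_append, length_replicate]; omega

theorem rint_opA {e1 e2 : ℝ} (h10 : 0 < e1) (h11 : e1 ≤ m.s) (h20 : 0 < e2) (h21 : e2 ≤ m.s) {Ψ : FockFn}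
    (hΨ : ∀ t : List ℝ, m.ψ (t.map ofReal) = √(t.length.factorial) * onList Ψ t) (k l r n : ℕ)
    (hN : n + r + l + k ≤ m.N) :
    (r.factorial * l.factorial : ℂ)⁻¹ * ((√n.factorial : ℂ)⁻¹ * rint (replicate n .nu)
      (contractFn m.S (m.opA e1 l (fieldTerm m.μ m.S m.b k m.g e2 Ψ)) .H .nu r)) =
    if r ≤ n then ∑ p ∈ antidiagonal k, ∑ u ∈ antidiagonal p.1,
      if u.1 ≤ l ∧ u.2 ≤ n - r then
        m.T (fun _ => 0) true e1 e2 (counts r (l - u.1) u.1 u.2 p.2 (n - r - u.2)) else 0 else 0 := by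
  set χ := fieldTerm m.μ m.S m.b k m.g e2 Ψ with hχ
  have key := (m.contracts_opA h10 h11 h20 h21 hΨ k l n r (by omega)).formula (v := counts 0 0 0 0 0 n)
    (by rw [sum_role]; simp [counts]) rfl rfl le_rfl (by intro b; cases b <;> simp [counts])
  simp only [counts, Nat.le_zero] at key
  change combFactor 0 n 0 0 * rint (word (counts 0 0 0 0 0 n)) _ = _ at key
  have hs0 : ∀ n : ℕ, (√n.factorial : ℂ) ≠ 0 := fun n => by
    rw [Ne, ofReal_eq_zero, sqrt_eq_zero (cast_nonneg _)]; exact_mod_cast Nat.factorial_ne_zero _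
  have hsq : ∀ n : ℕ, (√n.factorial : ℂ) * √n.factorial = n.factorial := fun n => by
    rw [← ofReal_mul, Real.mul_self_sqrt (cast_nonneg _), ofReal_natCast]
  have hcomb : combFactor 0 n 0 0 = (√n.factorial : ℂ)⁻¹ := by
    rw [combFactor, zero_add, ← hsq n]; have := hs0 n; simp
  -- As there are no variables of role `H`, only the splitting without contractions survives.
  rw [hcomb, Finset.sum_eq_single (0, r), ← rint_perm (perm_word (ω := replicate n .nu) fun b => by
    cases b <;> simp [counts, count_replicate])] at key
  rotate_left
  · intro q hq hne; refine if_neg fun h => hne ?_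
    have := mem_antidiagonal.1 hq; ext
    · exact h.1
    · have := h.1; simp; omega
  · intro h; exact absurd (mem_antidiagonal.2 (by simp)) h
  rw [key]
  by_cases hr : r ≤ n
  swap
  · simp [hr]
  simp only [hr, and_true, if_true]
  set w := moveCounts (counts 0 0 0 0 0 n) .H .nu .P .th 0 r with hw
  have hcnt : ∀ b, w b = counts r 0 0 0 0 (n - r) b := by intro b; cases b <;> simp [hw, moveCounts, counts]
  have hw' : w = counts r 0 0 0 0 (n - r) := funext hcnt
  have hlen : (replicate l Role.et ++ word w).length = l + n := by
    rw [length_append, length_replicate, length_word, hw', sum_role]; simp [counts]; omega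
  have hI := m.integrandA_integrable h10 h11 h20 h21 hΨ k (ω := replicate l .et ++ word w) (by
    intro b hb; rcases mem_append.1 hb with hb | hb
    · exact Or.inr (Or.inl (List.eq_of_mem_replicate hb))
    · have := count_pos_iff.2 hb; rw [count_word, hcnt] at this
      cases b <;> simp [counts] at this ⊢) (by omega)
  have w1 : rint (word w) (contractFn m.S (m.opA e1 l χ) .H .nu 0) = (√(n - r).factorial : ℂ)⁻¹ *
      √(n - r + l).factorial * rint (replicate l .et ++ word w) (m.integrandA e1 χ) := by
    rw [(rint_pull .et (word w) l hI.1).2, rint, rint, mul_left_comm]; congr 1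
    rw [← integral_const_mul]; congr 1; funext t
    have hc : ∀ b, w b = 0 → config (word w) t b = [] := fun b hb => by
      rw [← length_eq_zero_iff, config_length, count_word, hb]
    rw [contractFn_opA_zero _ _ _ (hc .H (by simp [hcnt, counts])) (hc .et (by simp [hcnt, counts])), config_length,
      count_word, hcnt]
    rfl
  have hp : (replicate l Role.et ++ word w).Perm (word (counts r l 0 0 0 (n - r))) := perm_word fun b => by
    rw [count_append, count_word, hcnt]
    cases b <;> simp [counts, count_replicate]
  rw [w1, hI.2, mul_sum, mul_sum, mul_sum, mul_sum]; refine sum_congr rfl fun p hp' => ?_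
  have := mem_antidiagonal.1 hp'
  rw [← m.rint_opB h10 h11 h20 h21 p.1 p.2 r l (n - r) (by omega), rint_perm hp, combFactor, combFactor,
    add_comm l (n - r)]
  simp only [zero_add, Nat.sub_zero, Nat.factorial_zero, cast_one, one_mul, mul_one]
  have := hs0 (n - r); have := factorial_ne r; have := factorial_ne l; have := factorial_ne (n - r)
  have := factorial_ne p.1; have := factorial_ne p.2; field_simp

/-- The matrix elements of the product of the regularized fields. -/
theorem pairing_eq {e1 e2 : ℝ} (h10 : 0 < e1) (h11 : e1 ≤ m.s) (h20 : 0 < e2) (h21 : e2 ≤ m.s) {Φ Ψ : FockFn}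
    (hΦ : ∀ t : List ℝ, m.φ (t.map ofReal) = √(t.length.factorial) * onList Φ t)
    (hΨ : ∀ t : List ℝ, m.ψ (t.map ofReal) = √(t.length.factorial) * onList Ψ t) {n0 : ℕ}
    (hn0 : ∀ n, n0 < n → Φ n = 0) (j k : ℕ) (hN : n0 + j + k ≤ m.N) :
    pairing Φ (fieldTerm m.μ m.S m.a j m.f e1 (fieldTerm m.μ m.S m.b k m.g e2 Ψ)) =
    ∑ n ∈ range (n0 + 1), ∑ q ∈ antidiagonal j, if q.1 ≤ n then
      ∑ p ∈ antidiagonal k, ∑ u ∈ antidiagonal p.1,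
        if u.1 ≤ q.2 ∧ u.2 ≤ n - q.1 then
          m.T (fun _ => 0) true e1 e2 (counts q.1 (q.2 - u.1) u.1 u.2 p.2 (n - q.1 - u.2)) else 0 else 0 := by
  rw [pairing, tsum_eq_sum (s := range (n0 + 1))]
  swap
  · intro n hn; simp [hn0 n (by simpa using hn)]
  refine sum_congr rfl fun n hn => ?_
  have hn' : n ≤ n0 := by simpa [Nat.lt_succ_iff] using hn
  set χ := fieldTerm m.μ m.S m.b k m.g e2 Ψ with hχ
  have hi : ∀ q ∈ antidiagonal j, Integrable fun t =>
      contractFn m.S (m.opA e1 q.2 χ) .H .nu q.1 (config (replicate n .nu) t) := fun q hq => by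
    have := mem_antidiagonal.1 hq
    exact (m.contracts_opA h10 h11 h20 h21 hΨ k q.2 n q.1 (by omega)).integrable_contractFn q.1 le_rfl _ (by simp)
      (by simp [count_replicate]) (fun b hb => Or.inr (List.eq_of_mem_replicate hb))
  have hpt : ∀ t : Fin n → ℝ, conj (Φ n t) * fieldTerm m.μ m.S m.a j m.f e1 χ n t =
      ∑ q ∈ antidiagonal j, (q.1.factorial * q.2.factorial : ℂ)⁻¹ *
        ((√n.factorial : ℂ)⁻¹ * contractFn m.S (m.opA e1 q.2 χ) .H .nu q.1 (single .nu (ofFn t))) := by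
    intro t; rw [fieldTerm_eq, Finset.sum_apply, Finset.sum_apply, mul_sum]
    refine sum_congr rfl fun q _ => ?_
    rw [Pi.smul_apply, Pi.smul_apply, smul_eq_mul, mul_left_comm]; congr 1
    have h1 : conj (Φ n t) = (√n.factorial : ℂ)⁻¹ * conjFn m.φ ((ofFn t).map ofReal) := by
      have h2 : ((ofFn t).map ofReal).map conj = (ofFn t).map ofReal := by simp [comp_def]
      rw [conjFn, h2, hΦ, onList_ofFn, map_mul, conj_ofReal, length_ofFn, inv_mul_cancel_left₀]
      rw [Ne, ofReal_eq_zero, sqrt_eq_zero (cast_nonneg _)]; exact_mod_cast Nat.factorial_ne_zero _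
    rw [h1, mul_assoc]; congr 1; rw [contractFn]
    simp only [opA, single, update_self, update_of_ne, ne_eq, reduceCtorEq, not_false_eq_true,
      nil_append]
    rw [createMany_smul, ← onList_ofFn (createMany m.S q.1 _)]; rfl
  simp only [hpt]
  rw [integral_finset_sum _ fun q hq => (((rint_replicate .nu n (hi q hq)).1.const_mul _).const_mul _), mul_sum]
  refine sum_congr rfl fun q hq => ?_
  have := mem_antidiagonal.1 hq
  rw [← m.rint_opA h10 h11 h20 h21 hΨ k q.2 q.1 n (by omega), ← (rint_replicate .nu n (hi q hq)).2,
    integral_const_mul, integral_const_mul]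
  push_cast; ring

end Model

/-! ### The sum over configurations and the removal of the regularization. -/

/-- The numbers of variables that contribute to the product of the term of order `j` of the first field
with the term of order `k` of the second one, in states with at most `n0` particles. -/
def countsAB (n0 j k : ℕ) : Finset (Role → ℕ) :=
  (Fintype.piFinset fun _ => range (n0 + j + k + 1)).filter fun v =>
    v .P = 0 ∧ v .H = 0 ∧ v .th + v .et + v .L = j ∧ v .L + v .Q + v .eB = k ∧ v .th + v .Q + v .nu ≤ n0

theorem mem_countsAB {n0 j k : ℕ} {v : Role → ℕ} : v ∈ countsAB n0 j k ↔ v .P = 0 ∧ v .H = 0 ∧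
    v .th + v .et + v .L = j ∧ v .L + v .Q + v .eB = k ∧ v .th + v .Q + v .nu ≤ n0 := by
  simp only [countsAB, mem_filter, Fintype.mem_piFinset, mem_range, and_iff_right_iff_imp]
  rintro h b
  cases b <;> omega

/-- Reindexing. The particle number of the left vector is `n = th + Q + nu`, the creators and
annihilators of the first field number `th` and `et + L`, those of the second `L + Q` and `eB`. -/
theorem sum_countsAB (F : (Role → ℕ) → ℂ) (n0 j k : ℕ) :
    (∑ n ∈ range (n0 + 1), ∑ q ∈ antidiagonal j, if q.1 ≤ n then
      ∑ p ∈ antidiagonal k, ∑ u ∈ antidiagonal p.1,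
        if u.1 ≤ q.2 ∧ u.2 ≤ n - q.1 then F (counts q.1 (q.2 - u.1) u.1 u.2 p.2 (n - q.1 - u.2)) else 0 else 0) =
    ∑ v ∈ countsAB n0 j k, F v := by
  have h : ∀ n : ℕ, ∀ q : ℕ × ℕ, (if q.1 ≤ n then
      ∑ p ∈ antidiagonal k, ∑ u ∈ antidiagonal p.1,
        if u.1 ≤ q.2 ∧ u.2 ≤ n - q.1 then F (counts q.1 (q.2 - u.1) u.1 u.2 p.2 (n - q.1 - u.2)) else 0 else 0) =
      ∑ p ∈ antidiagonal k, ∑ u ∈ antidiagonal p.1,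
        if q.1 ≤ n ∧ u.1 ≤ q.2 ∧ u.2 ≤ n - q.1 then F (counts q.1 (q.2 - u.1) u.1 u.2 p.2 (n - q.1 - u.2)) else 0 := by
    intro n q
    by_cases hq : q.1 ≤ n <;> simp [hq]
  simp only [h]; simp only [sum_sigma']; rw [← sum_filter]
  refine sum_nbij' (fun x => counts x.2.1.1 (x.2.1.2 - x.2.2.2.1) x.2.2.2.1 x.2.2.2.2 x.2.2.1.2
      (x.1 - x.2.1.1 - x.2.2.2.2))
    (fun v => ⟨v .th + v .Q + v .nu, (v .th, v .et + v .L), (v .L + v .Q, v .eB), (v .L, v .Q)⟩) ?_ ?_ ?_ ?_ ?_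
  · rintro ⟨n, q, p, u⟩ hx; simp only [mem_filter, mem_sigma, mem_range, mem_antidiagonal] at hx
    simp only [mem_countsAB, counts, true_and]; omega
  · intro v hv; rw [mem_countsAB] at hv
    simp only [mem_filter, mem_sigma, mem_range, mem_antidiagonal, and_true]; omega
  · rintro ⟨n, ⟨q1, q2⟩, ⟨p1, p2⟩, ⟨u1, u2⟩⟩ hx
    simp only [mem_filter, mem_sigma, mem_range, mem_antidiagonal] at hx
    simp only [counts, Sigma.mk.injEq, heq_eq_eq, Prod.mk.injEq, and_true, true_and]; omega
  · intro v hv; rw [mem_countsAB] at hv; funext b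
    cases b <;> simp [counts] <;> omega
  · intro x _; rfl

namespace Model

variable {m : Model}

theorem lift_len {lev : Role → ℝ} {v : Role → ℕ} (hN : ∑ b, v b ≤ m.N) (t : Fin (word v).length → ℝ) :
    ∑ b, (lift lev (config (word v) t) b).length ≤ m.N := by
  simpa only [lift, length_map, length_config, length_word] using hN

theorem lift_nil {lev : Role → ℝ} {v : Role → ℕ} {b : Role} (h : v b = 0) (t : Fin (word v).length → ℝ) :
    lift lev (config (word v) t) b = [] := by
  rw [lift, map_eq_nil_iff, ← length_eq_zero_iff, config_length, count_word, h]

/-- For positive regularization the poles are at distance `min e1 e2` or more from the contours all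
along the way. Once the variables are at their levels, the distance no longer depends on the
regularization. -/
theorem T_shift {ρ : ℝ} (hρ0 : 0 ≤ ρ) (hρ1 : ρ ≤ m.s) (hρ : ρ = 0 ∨ RightOf m.f m.g) {e1 e2 : ℝ} (h10 : 0 < e1)
    (h11 : e1 ≤ m.s) (h20 : 0 < e2) (h21 : e2 ≤ m.s) {v : Role → ℕ} (hH : v .H = 0) (hN : ∑ b, v b ≤ m.N) :
    m.T (fun _ => 0) true e1 e2 v = m.T (m.levels ρ) true e1 e2 v := by
  refine congrArg (_ * ·) (wint_shift (m := m) (sin_min_pos h10 h11 h20) fun y hy0 hy1 t => ?_)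
  have h1 := min_le_left e1 e2; have h2 := min_le_right e1 e2
  have : 0 ≤ y * m.s := mul_nonneg hy0 m.s_pos.le
  exact m.adm_levels hρ0 hρ1 hρ hy0 hy1 (lt_min h10 h20) h10.le h11 h20.le h21 (by linarith) (by linarith)
    (fun b z hz => by rw [mem_lift_im hz]; ring) (lift_nil hH t) (lift_len hN t)

theorem tendsto_T {ρ : ℝ} (hρ0 : 0 ≤ ρ) (hρ1 : ρ ≤ m.s) (hρ : ρ = 0 ∨ RightOf m.f m.g) {v : Role → ℕ} (hH : v .H = 0)
    (hN : ∑ b, v b ≤ m.N) :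
    Tendsto (fun e : ℝ × ℝ => m.T (m.levels ρ) true e.1 e.2 v) (𝓝[>] 0 ×ˢ 𝓝[>] 0)
      (𝓝 (m.T (m.levels ρ) true 0 0 v)) := by
  refine Tendsto.const_mul _ (tendsto_wint m.sin_s_pos m.s_pos
    fun e1 e2 h10 h11 h20 h21 t => ?_)
  exact m.adm_levels hρ0 hρ1 hρ zero_le_one le_rfl m.s_pos h10 h11 h20 h21 (by linarith) (by linarith)
    (fun b z hz => by rw [mem_lift_im hz]; ring) (lift_nil hH t) (lift_len hN t)

/-- The vectors `Φ` and `Ψ` have the wave functions of the model and at most `n0` particles. -/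
structure Represents (m : Model) (Φ Ψ : FockFn) (n0 : ℕ) : Prop where
  left : ∀ t : List ℝ, m.φ (t.map ofReal) = √(t.length.factorial) * onList Φ t
  right : ∀ t : List ℝ, m.ψ (t.map ofReal) = √(t.length.factorial) * onList Ψ t
  left_zero : ∀ L : List ℂ, n0 < L.length → m.φ L = 0
  right_zero : ∀ L : List ℂ, n0 < L.length → m.ψ L = 0

theorem pairing_eq_sum {Φ Ψ : FockFn} {n0 : ℕ} (h : m.Represents Φ Ψ n0) {e1 e2 : ℝ} (h10 : 0 < e1) (h11 : e1 ≤ m.s)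
    (h20 : 0 < e2) (h21 : e2 ≤ m.s) {j k : ℕ} (hN : n0 + j + k ≤ m.N) :
    pairing Φ (fieldTerm m.μ m.S m.a j m.f e1 (fieldTerm m.μ m.S m.b k m.g e2 Ψ)) =
      ∑ v ∈ countsAB n0 j k, m.T (fun _ => 0) true e1 e2 v := by
  rw [m.pairing_eq h10 h11 h20 h21 h.left h.right (fun n hn => ?_) j k hN, sum_countsAB]
  funext t; have h1 := h.left (ofFn t)
  rw [h.left_zero _ (by simpa using hn), onList_ofFn, eq_comm, mul_eq_zero, ofReal_eq_zero,
    sqrt_eq_zero (cast_nonneg _)] at h1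
  exact h1.resolve_left (by exact_mod_cast Nat.factorial_ne_zero _)

/-- With `ρ = 0` this gives existence for arbitrary supports; with `ρ = s`, for wedge separated
supports, the form from which the contracted variables are raised. -/
theorem hasProductElement {Φ Ψ : FockFn} {n0 : ℕ} (h : m.Represents Φ Ψ n0) {ρ : ℝ} (hρ0 : 0 ≤ ρ) (hρ1 : ρ ≤ m.s)
    (hρ : ρ = 0 ∨ RightOf m.f m.g) {j k : ℕ} (hN : n0 + j + k ≤ m.N) :
    HasProductElement m.μ m.S m.a m.b m.f m.g Φ Ψ j k (∑ v ∈ countsAB n0 j k, m.T (m.levels ρ) true 0 0 v) := by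
  have hv : ∀ v ∈ countsAB n0 j k, v .H = 0 ∧ ∑ b, v b ≤ m.N := fun v hv => by
    rw [mem_countsAB] at hv; rw [sum_role]; omega
  refine (tendsto_finsetSum _ fun v h' => tendsto_T hρ0 hρ1 hρ (hv v h').1 (hv v h').2).congr' ?_
  have h1 : ∀ᶠ e : ℝ in 𝓝[>] 0, 0 < e ∧ e ≤ m.s := Ioc_mem_nhdsGT m.s_pos
  filter_upwards [h1.prod_mk h1] with e he
  rw [m.pairing_eq_sum h he.1.1 he.1.2 he.2.1 he.2.2 hN]
  exact sum_congr rfl fun v h' => (T_shift hρ0 hρ1 hρ he.1.1 he.1.2 he.2.1 he.2.2 (hv v h').1 (hv v h').2).symm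

end Model

theorem HasProductElement.eq {μ : ℝ} {S : ℂ → ℂ} {a b : Coefficients} {f g : ℝ × ℝ → ℂ} {Φ Ψ : FockFn} {j k : ℕ} {z : ℂ}
    (h : HasProductElement μ S a b f g Φ Ψ j k z) : productElement μ S a b f g Φ Ψ j k = z := Tendsto.limUnder_eq h

/-! ### Contractions above and below the created particles -/

theorem HoloAt.continuousAt_insert {f : List ℂ → ℂ} {L1 L2 : List ℂ} {x : ℂ} (h : HoloAt f (L1 ++ x :: L2)) :
    ContinuousAt (fun z => f (L1 ++ z :: L2)) x := by
  have e : ∀ z, (L1.map (fun y => (y, (0 : ℂ))) ++ ((0 : ℂ), (1 : ℂ)) :: L2.map fun y => (y, (0 : ℂ))).map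
      (fun p : ℂ × ℂ => p.1 + p.2 * z) = L1 ++ z :: L2 := fun z => by simp [comp_def]
  have := HoloAt.continuousAt_comp (f := f) _ (fun (p : ℂ × ℂ) z => p.1 + p.2 * z) (x := x) (by rw [e]; exact h)
    fun p _ => by fun_prop
  simpa only [e] using this

theorem cosh_half_add_pi (z x : ℂ) : cosh ((z - (x - π * I)) / 2) = sinh ((z - x) / 2) * I := by
  rw [show (z - (x - π * I)) / 2 = (z - x) / 2 + π / 2 * I by ring, cosh_add, cosh_mul_I, sinh_mul_I,
    cos_pi_div_two, sin_pi_div_two, mul_zero, zero_add, one_mul]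

namespace Model

variable {m : Model}

/-- A new variable of either role occupies the boundary between the lists `H` and `L`, in the
arguments of `a` as well as of `b`. Without regularization the two roles thus differ only by the
height of the contour. -/
theorem W_push_eq (m : Model) (z : ℂ) (C : Config ℂ) :
    m.W true 𝟎 𝟎 (push .L z C) = m.W true 𝟎 𝟎 (push .H z C) := by
  have h : psum m.μ (C .H ++ z :: C .L) = psum m.μ (z :: C .H ++ C .L) :=
    psum_perm m.μ (by simp)
  simp [W, smears, vecs, symEval_aSym_true, symEval_bSym, push, h]

/-- The contracted variables have levels between `s` and `3 * s`, and the others the standard levels. -/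
theorem adm_cross (hr : RightOf m.f m.g) {R : ℂ → ℂ → Prop}
    (hR : ∀ z w, CoshRel m.δ (Real.sin (m.s / 2)) z w → R z w) {C : Config ℂ}
    (hw : ∀ z ∈ C .H ++ C .L, m.s ≤ z.im ∧ z.im ≤ 3 * m.s)
    (hC : ∀ b, b ≠ .H → b ≠ .L → ∀ z ∈ C b, z.im = m.levels m.s b)
    (ht : ∀ z ∈ C .H ++ C .L, ∀ x ∈ C .th, R z (x - π * I)) (hlen : ∑ b, (C b).length ≤ m.N) :
    m.Adm R true 𝟎 𝟎 C := by
  obtain ⟨hs, hs1, hδ, hpi⟩ := m.s_facts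
  have key : ∀ {z w : ℂ}, -m.δ < z.im - w.im → z.im - w.im ≤ π - m.s → R z w := fun h3 h4 =>
    hR _ _ (coshRel_of_le h3 h4)
  have het : ∀ z ∈ C .et, z.im = -m.s := hC .et (by simp) (by simp)
  have heB : ∀ z ∈ C .eB, z.im = -m.s := hC .eB (by simp) (by simp)
  have hth : ∀ z ∈ C .th, z.im = 2 * m.s := hC .th (by simp) (by simp)
  have hQ : ∀ z ∈ C .Q, z.im = 2 * m.s := hC .Q (by simp) (by simp)
  have hP : ∀ z ∈ C .P, z.im = 2 * m.s := hC .P (by simp) (by simp)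
  have hH : ∀ z ∈ C .H, m.s ≤ z.im ∧ z.im ≤ 3 * m.s := fun z hz => hw z (by simp [hz])
  have hL : ∀ z ∈ C .L, m.s ≤ z.im ∧ z.im ≤ 3 * m.s := fun z hz => hw z (by simp [hz])
  have hLe : ∀ z ∈ C .L ++ C .et, -m.s ≤ z.im ∧ z.im ≤ 3 * m.s := fun z hz => by
    rcases mem_append.1 hz with hz | hz
    · have := hL z hz; constructor <;> linarith
    · have := het z hz; constructor <;> linarith
  have hB : ∀ z ∈ (C .Q).reverse ++ (C .L).reverse ++ C .H ++ C .P, m.s ≤ z.im ∧ z.im ≤ 3 * m.s := fun z hz => by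
    simp only [mem_append, mem_reverse] at hz; rcases hz with ((hz | hz) | hz) | hz
    · have := hQ z hz; constructor <;> linarith
    · exact hL z hz
    · exact hH z hz
    · have := hP z hz; constructor <;> linarith
  refine ⟨hlen, pairwise_aSym_true ?_ ?_ ?_ ?_ (fun x hx z hz => by simpa using ht x (by simp [hx]) z hz)
    fun x hx z hz => ?_, pairwise_bSym ?_ ?_ ?_, ?_, ?_, ?_⟩
  rotate_left 4
  · rcases mem_append.1 hx with hx | hx
    · simpa using ht x (by simp [hx]) z hz
    · have := het x hx; have := hth z hz; apply key <;> simp <;> linarith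
  rotate_right 4
  iterate 7
    intro x hx z hz
    first | have := hLe x hx | have := hH x hx | have := hth x hx | have := heB x hx | have := hB x hx
    first | have := hLe z hz | have := hH z hz | have := hth z hz | have := heB z hz | have := hB z hz
    apply key <;> simp <;> linarith
  · intro q hq e he; have := hQ q hq; have := het e he
    rw [sub_im, abs_lt]; constructor <;> linarith
  · intro r h1 h2 z hz; rw [hC r h1 h2 z hz, abs_lt]
    cases r <;> simp only [levels] <;> constructor <;> linarith
  · refine Or.inr ⟨hr, 0, fun z hz => ?_⟩
    have := hw z hz; refine ⟨by linarith, by linarith, ?_⟩; rw [abs_le]; constructor <;> linarith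

/-- One more contracted variable in the strip between the levels. -/
theorem adm_push (hr : RightOf m.f m.g) {R : ℂ → ℂ → Prop}
    (hR : ∀ z w, CoshRel m.δ (Real.sin (m.s / 2)) z w → R z w) {C : Config ℂ}
    (hC : ∀ b, ∀ z ∈ C b, z.im = m.levels m.s b) (hlen : ∑ b, (C b).length + 1 ≤ m.N) {z : ℂ}
    (h1 : m.s ≤ z.im) (h2 : z.im ≤ 3 * m.s) (h3 : ∀ x ∈ C .th, R z (x - π * I)) :
    m.Adm R true 𝟎 𝟎 (push .H z C) := by
  obtain ⟨hs, hs1, hδ, hpi⟩ := m.s_facts; rw [sum_role] at hlen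
  have hH : ∀ z ∈ C .H, z.im = 3 * m.s := hC .H; have hL : ∀ z ∈ C .L, z.im = m.s := hC .L
  refine adm_cross hr hR ?_ (fun b h1 h2 w hw => hC b w (by rwa [push_of_ne h1] at hw)) ?_ (by
    rw [sum_role]; simp [push]; omega) <;>
  simp only [push, update_self, update_of_ne, ne_eq, reduceCtorEq, not_false_eq_true,
    mem_append, mem_cons]
  · rintro w ((rfl | hw) | hw)
    · exact ⟨h1, h2⟩
    · rw [hH w hw]; constructor <;> linarith
    · rw [hL w hw]; constructor <;> linarith
  · rintro w hw y hy; have hy' : y.im = 2 * m.s := hC .th y hy; rcases hw with (rfl | hw) | hw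
    · exact h3 y hy
    · have := hH w hw; exact hR _ _ (coshRel_of_ge (by simp; linarith) (by simp; linarith))
    · have := hL w hw; exact hR _ _ (coshRel_of_le (by simp; linarith) (by simp; linarith))

theorem regRel_sub_pi {z x : ℂ} (hx : x.im = 2 * m.s) (h1 : m.s ≤ z.im) (h2 : z.im ≤ 3 * m.s)
    (hne : z ≠ x) : RegRel m.δ z (x - π * I) := by
  obtain ⟨hs, hs1, hδ, hpi⟩ := m.s_facts; refine ⟨⟨by simp; linarith, by simp; linarith⟩, ?_⟩
  rw [cosh_half_add_pi]
  refine mul_ne_zero (sinh_ne_zero_of_im (div_ne_zero (sub_ne_zero.2 hne) two_ne_zero) ?_) I_ne_zero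
  have : ((z - x) / 2).im = (z.im - x.im) / 2 := by simp
  rw [this, abs_lt]; constructor <;> linarith

theorem adm_cross_levels (hr : RightOf m.f m.g) {C : Config ℂ}
    (hC : ∀ b, ∀ z ∈ C b, z.im = m.levels m.s b) (hlen : ∑ b, (C b).length ≤ m.N) :
    m.Adm (CoshRel m.δ (Real.sin (m.s / 2))) true 𝟎 𝟎 C := by
  obtain ⟨hs, hs1, hδ, hpi⟩ := m.s_facts; have hH : ∀ z ∈ C .H, z.im = 3 * m.s := hC .H
  have hL : ∀ z ∈ C .L, z.im = m.s := hC .L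
  refine adm_cross hr (fun _ _ => id) (fun z hz => ?_) (fun b _ _ => hC b) (fun z hz x hx => ?_) hlen
  · rcases mem_append.1 hz with hz | hz
    · rw [hH z hz]; constructor <;> linarith
    · rw [hL z hz]; constructor <;> linarith
  · have hx' : x.im = 2 * m.s := hC .th x hx; rcases mem_append.1 hz with hz | hz
    · have := hH z hz; exact coshRel_of_ge (by simp; linarith) (by simp; linarith)
    · have := hL z hz; exact coshRel_of_le (by simp; linarith) (by simp; linarith)

/-- The heart of locality. Exchange relations bring `z` to the front of the arguments of `a` and `x
- iπ` to their end, where the kinematic residue is `-i (1 - ∏ S) a(K)`. The pair has disappeared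
from `a`, while `x - iπ` survives as a creation argument of `b`. Moving it inside `b` and inside the
wave function, the term `1` becomes the integrand with `x` to the left of all creators of `A` (role
`P`) and the term `∏ S` the one with `x` to their right (role `Q`), where it has also passed the
variables `et`. -/
theorem residue (hr : RightOf m.f m.g) {C : Config ℂ} (hC : ∀ b, ∀ z ∈ C b, z.im = m.levels m.s b)
    (hlen : ∑ b, (C b).length + 1 ≤ m.N) {A D : List ℂ} {x : ℂ} (hth : C .th = A ++ x :: D)
    (hne : ∀ y ∈ A ++ D, x ≠ y) :
    Tendsto (fun z => (z - x) * m.W true 𝟎 𝟎 (push .H z C)) (𝓝[≠] x)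
      (𝓝 (-I * (m.W true 𝟎 𝟎 (push .P x (update C .th (A ++ D))) -
        m.W true 𝟎 𝟎 (push .Q x (update C .th (A ++ D)))))) := by
  obtain ⟨hs, hs1, hδ, hpi⟩ := m.s_facts; have hxi : x.im = 2 * m.s := hC .th x (by simp [hth])
  have hAD : ∀ y ∈ A ++ D, y.im = 2 * m.s := fun y hy => hC .th y (by
    simp only [hth, mem_append, mem_cons] at hy ⊢; tauto)
  have hHi : ∀ y ∈ C .H, y.im = 3 * m.s := hC .H; have hLi : ∀ y ∈ C .L, y.im = m.s := hC .L
  have hei : ∀ y ∈ C .et, y.im = -m.s := hC .et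
  have hl : (C .th).length = A.length + D.length + 1 := by simp [hth]; ring
  rw [sum_role, hl] at hlen; set C' := update C .th (A ++ D) with hC'
  set K := (C .H).reverse ++ (C .L ++ C .et) ++ (D.reverse.map (fun y => y - π * I) ++
    A.reverse.map fun y => y - π * I) with hK
  have hmem : ∀ {b b' : Role} {z : ℂ}, b = .P ∨ b = .Q → z ∈ push b x C' b' → z.im = m.levels m.s b' := by
    intro b b' z hb hz
    by_cases h1 : b' = b
    · subst h1; rw [push_same, mem_cons] at hz; rcases hz with rfl | hz
      · rcases hb with rfl | rfl <;> exact hxi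
      · exact hC _ z (by rcases hb with rfl | rfl <;> simpa [hC'] using hz)
    · rw [push_of_ne h1] at hz
      by_cases h2 : b' = .th
      · subst h2; rw [hC', update_self] at hz; exact hAD z hz
      · rw [hC', update_of_ne h2] at hz; exact hC _ z hz
  have aP := (adm_cross_levels hr (C := push .P x C') (fun b z hz => hmem (Or.inl rfl) hz) (by
    rw [sum_role]; simp [push, hC']; omega)).reg (m.sin_s_pos)
  have aQ := (adm_cross_levels hr (C := push .Q x C') (fun b z hz => hmem (Or.inr rfl) hz) (by
    rw [sum_role]; simp [push, hC']; omega)).reg (m.sin_s_pos)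
  have gR : ∀ {z w : ℂ}, -m.δ < z.im - w.im → z.im - w.im ≤ π - m.s → RegRel m.δ z w := fun h3 h4 =>
    (coshRel_of_le h3 h4).regRel m.sin_s_pos
  set β : List ℂ := C .eB ++ (C .Q).reverse.map fun y => y - π * I with hβ
  set ξ : List ℂ := (C .L).reverse.map fun y => y - π * I with hξ
  set η : List ℂ := (C .H).map fun y => y - π * I with hη
  set π' : List ℂ := (C .P).map fun y => y - π * I with hπ'
  have bQe : symEval 𝟎 (bSym (push .Q x C')) = β ++ (x - π * I) :: (ξ ++ (η ++ π')) := by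
    simp [symEval_bSym, push, hC', hβ, hξ, hη, hπ']
  have bPe : symEval 𝟎 (bSym (push .P x C')) = (β ++ ξ) ++ (η ++ (x - π * I) :: π') := by
    simp [symEval_bSym, push, hC', hβ, hξ, hη, hπ']
  have bze : ∀ z, symEval 𝟎 (bSym (push .H z C)) = (β ++ ξ) ++ (z - π * I) :: (η ++ π') := fun z => by
    simp [symEval_bSym, push, hβ, hξ, hη, hπ']
  have hlβ : (β ++ (x - π * I) :: (ξ ++ (η ++ π'))).length ≤ m.N := by simp [hβ, hξ, hη, hπ']; omega
  have pQ := aQ.b; rw [bQe] at pQ; have hxξ : ∀ y ∈ ξ, RegRel m.δ y (x - π * I) := fun y hy => by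
    simp only [hξ, mem_map, mem_reverse] at hy; obtain ⟨w, hw, rfl⟩ := hy; have := hLi w hw
    apply gR <;> simp <;> linarith
  have pX := pairwise_move pQ hxξ (append_nil ξ).symm; rw [nil_append, ← append_assoc] at pX
  have mQ := m.hb.move hlβ pQ hxξ; rw [← append_assoc β ξ] at mQ
  have mP := m.hb.move (L1 := β ++ ξ) (by simp at hlβ ⊢; omega) pX fun y hy => by
    simp only [hη, mem_map] at hy; obtain ⟨w, hw, rfl⟩ := hy; have := hHi w hw
    apply gR <;> simp <;> linarith
  have hvec : ∀ z ∈ (C .P).reverse ++ x :: (A ++ (D ++ (C .Q ++ C .nu))), |z.im| < m.δ / 2 := fun z hz => by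
    have hz' : z.im = 2 * m.s ∨ z.im = 0 := by
      simp only [mem_append, mem_cons, mem_reverse] at hz
      rcases hz with hz | rfl | hz | hz | hz | hz
      exacts [Or.inl (hC .P z hz), Or.inl hxi, Or.inl (hAD z (by simp [hz])), Or.inl (hAD z (by simp [hz])),
        Or.inl (hC .Q z hz), Or.inr (hC .nu z hz)]
    rw [abs_lt]; rcases hz' with h | h <;> rw [h] <;> constructor <;> linarith
  have vA := m.hφ.conj_move m.strip hvec
  have vD := m.hφ.conj_move m.strip (L1 := (C .P).reverse ++ A) (x := x) (M := D) (L2 := C .Q ++ C .nu) fun z hz =>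
    hvec z (by simp only [mem_append, mem_cons] at hz ⊢; tauto)
  rw [append_assoc, append_assoc] at vD
  have aKe : ∀ b, b = .P ∨ b = .Q → symEval 𝟎 (aSym true (push b x C')) = K := by
    rintro b (rfl | rfl) <;> simp [symEval_aSym_true, push, hC', hK]
  have hKp := aP.a; rw [aKe _ (Or.inl rfl)] at hKp
  have hKl : K.length + 2 ≤ m.N := by simp [hK]; omega
  have hkin := m.ha.kin K x hKl hKp (fun z hz => by
    have hz' : (z.im = 3 * m.s ∨ z.im = m.s ∨ z.im = -m.s) ∨ ∃ y ∈ A ++ D, z = y - π * I := by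
      simp only [hK, mem_append, mem_reverse, mem_map] at hz
      rcases hz with (hz | hz | hz) | (⟨y, hy, rfl⟩ | ⟨y, hy, rfl⟩)
      exacts [Or.inl (Or.inl (hHi z hz)), Or.inl (Or.inr (Or.inl (hLi z hz))), Or.inl (Or.inr (Or.inr (hei z hz))),
        Or.inr ⟨y, by simp [hy], rfl⟩, Or.inr ⟨y, by simp [hy], rfl⟩]
    rcases hz' with hz' | ⟨y, hy, rfl⟩
    · have h1 : RegRel m.δ x z := by rcases hz' with h | h | h <;> apply gR <;> linarith
      have h2 : ∀ w : ℂ, w.im = z.im - x.im + π → w.im ≠ π → cosh (w / 2) ≠ 0 := fun w hw hw' => by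
        have h3 : CoshRel m.δ (Real.sin (m.s / 2)) w 0 := by
          refine coshRel_of_im m.strip.le hs (by linarith) ?_ ?_ ?_
          · rcases hz' with h | h | h <;> simp [hw] <;> linarith
          · rcases hz' with h | h | h <;> simp [hw] <;> linarith
          · rcases hz' with h | h | h
            exacts [Or.inr (by simp [hw]; linarith), Or.inl (by simp [hw]; linarith), Or.inl (by simp [hw]; linarith)]
        simpa using (h3.regRel (m.sin_s_pos)).2
      refine ⟨h1.1, h1.2, h2 _ (by simp; ring) ?_⟩
      rcases hz' with h | h | h <;> simp [h, hxi] <;> intro <;> linarith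
    · have hyi := hAD y hy
      obtain ⟨h1, h2⟩ := regRel_sub_pi (m := m) hyi (by linarith) (by linarith) (hne y hy)
      refine ⟨h1, h2, ?_⟩
      · refine cosh_ne_zero_of_im ?_
        simp [hyi, hxi]; positivity) (𝓝[≠] x) id (fun _ => x) (tendsto_id.mono_left nhdsWithin_le_nhds) tendsto_const_nhds
    self_mem_nhdsWithin
  set ρ : List ℂ := (C .L ++ C .et) ++ D.reverse.map fun y => y - π * I with hρ
  set α : List ℂ := A.reverse.map fun y => y - π * I with hα
  have eaz : ∀ z, symEval 𝟎 (aSym true (push .H z C)) =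
      (C .H).reverse ++ z :: (ρ ++ (x - π * I) :: α) := fun z => by
    simp [symEval_aSym_true, push, hth, hρ, hα]
  -- In the arguments of `a` the variable `z` is moved to the front past `H`, and `x - iπ` to the
  -- end past the creators `A` of the first field.
  have hev : ∀ᶠ z in 𝓝[≠] x, onList m.a (symEval 𝟎 (aSym true (push .H z C))) =
      ((C .H).map fun y => m.S (y - z)).prod * ((A.map fun y => m.S (x - y)).prod *
        onList m.a (z :: K ++ [x - π * I])) := by
    have h1 : ∀ᶠ z : ℂ in 𝓝[≠] x, m.s < z.im ∧ z.im < 3 * m.s :=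
      nhdsWithin_le_nhds (((isOpen_lt continuous_const continuous_im).inter
        (isOpen_lt continuous_im continuous_const)).mem_nhds ⟨by simp [hxi]; linarith, by simp [hxi]; linarith⟩)
    have h2 : ∀ᶠ z : ℂ in 𝓝[≠] x, z ∉ (A ++ D).toFinset :=
      nhdsWithin_le_nhds ((A ++ D).toFinset.finite_toSet.isClosed.isOpen_compl.mem_nhds fun h =>
        hne x (by simpa using h) rfl)
    filter_upwards [h1, h2, self_mem_nhdsWithin] with z hz hzAD hzx
    have hadm := (adm_push hr (R := RegRel m.δ) (fun _ _ h => h.regRel m.sin_s_pos) hC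
      (by rw [sum_role]; omega) hz.1.le hz.2.le fun y hy => regRel_sub_pi (hC .th y hy) hz.1.le hz.2.le (by
        rintro rfl; rw [hth] at hy; simp only [mem_append, mem_cons, List.mem_toFinset] at hy hzAD
        tauto)).a
    rw [eaz] at hadm ⊢; have hzH : ∀ y ∈ C .H, |(z - y).im| < m.δ := fun y hy => by
      rw [sub_im, hHi y hy, abs_lt]; constructor <;> linarith
    have hp : (z :: ((C .H).reverse ++ (ρ ++ (x - π * I) :: α))).Pairwise (RegRel m.δ) := by
      rw [pairwise_append, pairwise_cons] at hadm; rw [pairwise_cons, pairwise_append]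
      refine ⟨fun y hy => ?_, hadm.1, hadm.2.1.2, fun y hy w hw => hadm.2.2 y hy w (List.mem_cons_of_mem _ hw)⟩
      rcases mem_append.1 hy with hy | hy
      · have := hHi y (by simpa using hy); apply gR <;> linarith
      · exact hadm.2.1.1 y hy
    have m1 := m.ha.move (L1 := []) (x := z) (by simp [hρ, hα]; omega) hp fun y hy => (pairwise_append.1 hadm).2.2 y hy z (by simp)
    have m2 := m.ha.move (L1 := z :: ((C .H).reverse ++ ρ)) (x := x - π * I) (M := α) (L2 := [])
      (by simp [hρ, hα]; omega) (by simpa using hp) fun y hy => by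
        simp only [hα, mem_map, mem_reverse] at hy; obtain ⟨w, hw, rfl⟩ := hy
        exact regRel_of_im_eq m.strip.pos (by simp [hxi, hAD w (by simp [hw])])
    have hinv := m.strip.prod_inv z (C .H) hzH
    have e1 : ((C .H).reverse.map fun y => m.S (z - y)).prod = ((C .H).map fun y => m.S (z - y)).prod := by
      rw [map_reverse, prod_reverse]
    have e2 : (α.map fun y => m.S (x - π * I - y)).prod = (A.map fun y => m.S (x - y)).prod := by
      rw [hα, map_map, map_reverse, prod_reverse]; simp [comp_def]
    have e3 : z :: K ++ [x - π * I] = z :: ((C .H).reverse ++ ρ) ++ (α ++ [x - π * I]) := by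
      simp [hK, hρ, hα]
    simp only [nil_append, append_nil] at m1 m2
    have e4 : z :: ((C .H).reverse ++ ρ) ++ (x - π * I) :: α =
      z :: ((C .H).reverse ++ (ρ ++ (x - π * I) :: α)) := by simp
    rw [e3, ← e2, ← m2, e4, m1, e1]
    linear_combination -(onList m.a ((C .H).reverse ++ z :: (ρ ++ (x - π * I) :: α))) * hinv
  set c := sProd m.S (C .Q) (C .et) * (conjFn m.φ ((C .P).reverse ++ (A ++ x :: (D ++ (C .Q ++ C .nu)))) *
    m.ψ (C .eB ++ (C .et ++ C .nu))) * (A.map fun y => m.S (x - y)).prod with hc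
  set G : ℂ → ℂ := fun z => m.smears (push .H z C) * onList m.b (symEval 𝟎 (bSym (push .H z C))) *
    ((C .H).map fun y => m.S (y - z)).prod with hG
  have hGc : ContinuousAt G x := by
    refine ContinuousAt.mul (ContinuousAt.mul ?_ ?_) ?_
    · simp only [smears, push, update_self, update_of_ne, ne_eq, reduceCtorEq, not_false_eq_true,
        cons_append, psum_cons]
      have h1 := m.hf.differentiable_smearC.continuous
      have h2 := m.hg.differentiable_smearC.continuous; exact Continuous.continuousAt (by fun_prop)
    · simp only [bze]
      exact ContinuousAt.comp (f := fun z => z - π * I) (g := fun w => onList m.b (β ++ ξ ++ w :: (η ++ π')))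
        (m.hb.holo _ (by simp at hlβ ⊢; omega) pX).continuousAt_insert (by fun_prop)
    · refine (differentiableAt_list_prod (fun y z => m.S (y - z)) _ fun y hy => ?_).continuousAt
      exact (m.strip.diff _ (by simp [hHi y hy, hxi]; linarith) (by simp [hHi y hy, hxi]; linarith)).comp (f := fun z => y - z)
        x (by fun_prop)
  have hlim := ((hGc.tendsto.mono_left nhdsWithin_le_nhds).mul hkin).const_mul c
  refine (hlim.congr' ?_).trans (le_of_eq (congrArg 𝓝 ?_))
  · filter_upwards [hev] with z hz
    rw [W, hz, hc, hG, vecs]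
    simp only [push_of_ne, ne_eq, reduceCtorEq, not_false_eq_true, hth, append_assoc, cons_append, id]
    ring
  -- Crossing symmetry: for a creation argument `y - iπ` the factor `S(x - y + iπ)` of the residue
  -- equals `S(y - x)`.
  · have hcross : ∀ M : List ℂ, (∀ y ∈ M, y.im = 2 * m.s) → ((M.reverse.map fun y => y - π * I).map fun z =>
        m.S (x - z)).prod = (M.map fun y => m.S (y - x)).prod := fun M hM => by
      rw [map_map, map_reverse, prod_reverse]; refine congrArg _ (map_congr_left fun y hy => ?_)
      rw [comp_apply, ← m.strip.cross (y - x) (by simp [hM y hy, hxi]; linarith)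
        (by simp [hM y hy, hxi]; linarith)]
      congr 1; ring
    have hPK : (K.map fun z => m.S (x - z)).prod = ((C .H).map fun y => m.S (x - y)).prod *
        ((C .L).map fun y => m.S (x - y)).prod * ((C .et).map fun y => m.S (x - y)).prod *
        (D.map fun y => m.S (y - x)).prod * (A.map fun y => m.S (y - x)).prod := by
      simp only [hK, map_append, prod_append, hcross A fun y hy => hAD y (by simp [hy]), hα,
        hcross D fun y hy => hAD y (by simp [hy])]
      rw [map_reverse, prod_reverse]; ring
    have iA := m.strip.prod_inv x A fun y hy => by simp [hAD y (by simp [hy]), hxi]; linarith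
    have iD := m.strip.prod_inv x D fun y hy => by simp [hAD y (by simp [hy]), hxi]; linarith
    have iH := m.strip.prod_inv x (C .H) fun y hy => by
      rw [sub_im, hHi y hy, hxi, abs_lt]; constructor <;> linarith
    have eξ : (ξ.map fun y => m.S (x - π * I - y)).prod = ((C .L).map fun y => m.S (x - y)).prod := by
      rw [hξ, map_map, map_reverse, prod_reverse]; simp [comp_def]
    have eη : (η.map fun y => m.S (x - π * I - y)).prod = ((C .H).map fun y => m.S (x - y)).prod := by
      rw [hη, map_map]; simp [comp_def]
    rw [eξ] at mQ; rw [eη] at mP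
    have sm : ∀ b, b = .P ∨ b = .Q → m.smears (push b x C') = m.smears (push .H x C) := by
      rintro b (rfl | rfl) <;> simp only [smears, push, hC', hth, update_self, update_of_ne, ne_eq,
        reduceCtorEq, not_false_eq_true, cons_append, psum_cons, psum_append] <;> congr 2 <;> abel
    have wP : m.W true 𝟎 𝟎 (push .P x C') = m.smears (push .H x C) * onList m.a K *
        onList m.b ((β ++ ξ) ++ (η ++ (x - π * I) :: π')) * sProd m.S (C .Q) (C .et) *
        (conjFn m.φ ((C .P).reverse ++ x :: (A ++ (D ++ (C .Q ++ C .nu)))) * m.ψ (C .eB ++ (C .et ++ C .nu))) := by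
      rw [W, aKe _ (Or.inl rfl), bPe, sm _ (Or.inl rfl), vecs]; simp [push, hC']
    have wQ : m.W true 𝟎 𝟎 (push .Q x C') = m.smears (push .H x C) * onList m.a K *
        onList m.b (β ++ (x - π * I) :: (ξ ++ (η ++ π'))) *
        (((C .et).map fun y => m.S (x - y)).prod * sProd m.S (C .Q) (C .et)) *
        (conjFn m.φ ((C .P).reverse ++ (A ++ (D ++ x :: (C .Q ++ C .nu)))) * m.ψ (C .eB ++ (C .et ++ C .nu))) := by
      rw [W, aKe _ (Or.inr rfl), bQe, sm _ (Or.inr rfl), vecs]; simp [push, hC', sProd]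
    rw [wP, wQ, hPK, hc, hG, mQ]; simp only [bze]; rw [mP, vA, vD]
    -- What remains is an identity between scalars that follows from `S(x - y) S(y - x) = 1` for `y`
    -- in `A`, `D` and `H`.
    generalize (A.map fun y => m.S (x - y)).prod = pA at *
    generalize (A.map fun y => m.S (y - x)).prod = pA' at *
    generalize (D.map fun y => m.S (x - y)).prod = pD at *
    generalize (D.map fun y => m.S (y - x)).prod = pD' at *
    generalize ((C .H).map fun y => m.S (x - y)).prod = pH' at *
    generalize ((C .H).map fun y => m.S (y - x)).prod = pH at *
    generalize ((C .L).map fun y => m.S (x - y)).prod = pL at *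
    generalize ((C .et).map fun y => m.S (x - y)).prod = pE at *
    generalize onList m.b ((β ++ ξ) ++ (η ++ (x - π * I) :: π')) = bP
    generalize conjFn m.φ ((C .P).reverse ++ (A ++ (D ++ x :: (C .Q ++ C .nu)))) = φQ
    generalize onList m.a K = aK; generalize m.smears (push .H x C) = sm
    generalize sProd m.S (C .Q) (C .et) = sQ; generalize m.ψ (C .eB ++ (C .et ++ C .nu)) = ψ
    linear_combination (-I * sm * aK * sQ * ψ * bP * φQ) * ((pA * pD - pL * pH' * pE) * iH -
      pL * pH' * pE * pH * pH' * (iA + pA * pA' * iD))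

end Model

/-! ### Raising one contracted variable past the creators of the first field. -/

theorem integral_cons_right {n : ℕ} {f : (Fin (n + 1) → ℝ) → ℂ} (hf : Integrable f) :
    (Integrable fun t : Fin n → ℝ => ∫ x : ℝ, f (Fin.cons x t)) ∧
    ∫ t, f t = ∫ t : Fin n → ℝ, ∫ x : ℝ, f (Fin.cons x t) := by
  have h := integrable_insertNth 0 hf; rw [← integral_insertNth_prod 0]
  simp only [Fin.insertNth_zero'] at h ⊢; exact ⟨h.integral_prod_right, integral_prod_symm _ h⟩

/-- Coincidences lie in proper subspaces. Off this null set the creators of the first field are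
distinct, so the poles met by the contracted variable are distinct and simple. -/
theorem ae_injective (n : ℕ) : ∀ᵐ t : Fin n → ℝ, Injective t := by
  have h : ∀ i j : Fin n, i ≠ j → ∀ᵐ t : Fin n → ℝ, t i ≠ t j := fun i j hij => by
    have h1 := Measure.addHaar_submodule (volume : Measure (Fin n → ℝ))
      (LinearMap.ker (LinearMap.proj (R := ℝ) (φ := fun _ : Fin n => ℝ) i - LinearMap.proj j)) (fun h => by
        have h2 : (Pi.single i 1 : Fin n → ℝ) ∈
            LinearMap.ker (LinearMap.proj (R := ℝ) (φ := fun _ : Fin n => ℝ) i - LinearMap.proj j) := h ▸ trivial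
        simp [hij.symm] at h2)
    rw [ae_iff]; convert h1 using 2; ext t; simp [sub_eq_zero]
  have h' : ∀ᵐ t : Fin n → ℝ, ∀ i j : Fin n, i ≠ j → t i ≠ t j :=
    ae_all_iff.2 fun i => ae_all_iff.2 fun j => by
      by_cases hij : i = j
      · exact ae_of_all _ fun _ h => absurd hij h
      · filter_upwards [h i j hij] with t ht _ using ht
  filter_upwards [h'] with t ht i j hij
  by_contra hne; exact ht i j hne hij

theorem config_nodup {X : Type} (b : Role) : ∀ (ω : List Role) (t : Fin ω.length → X), Injective t →
    (config ω t b).Nodup ∧ ∀ x ∈ config ω t b, ∃ i, t i = x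
  | [], _, _ => by simp [config]
  | c :: ω, t, ht => by
    obtain ⟨h1, h2⟩ := config_nodup b ω (fun i => t i.succ) fun i j h => Fin.succ_injective _ (ht h)
    rw [config]
    by_cases hc : b = c
    · subst hc; rw [push_same]; refine ⟨List.nodup_cons.2 ⟨fun h => ?_, h1⟩, fun x hx => ?_⟩
      · obtain ⟨i, hi⟩ := h2 _ h; exact Fin.succ_ne_zero i (ht hi)
      · rcases mem_cons.1 hx with rfl | hx
        · exact ⟨0, rfl⟩
        · obtain ⟨i, hi⟩ := h2 x hx; exact ⟨i.succ, hi⟩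
    · rw [push_of_ne hc]; exact ⟨h1, fun x hx => by obtain ⟨i, hi⟩ := h2 x hx; exact ⟨i.succ, hi⟩⟩

/-- Give the role `b` to the variable at the position `p` of the role `th`. -/
def moveTh (b : Role) (p : ℕ) (C : Config ℝ) : Config ℝ :=
  push b ((C .th).getD p 0) (update C .th ((C .th).eraseIdx p))

theorem rint_moveTh {b : Role} {ω : List Role} {p : ℕ} (hp : p < ω.count .th) {G : Config ℝ → ℂ}
    (hG : Integrable fun t => G (config (b :: ω.erase .th) t)) :
    (Integrable fun t => G (moveTh b p (config ω t))) ∧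
      rint ω (fun C => G (moveTh b p C)) = rint (b :: ω.erase .th) G := by
  have hperm := List.perm_cons_erase (count_pos_iff.1 (by omega : 0 < ω.count .th))
  have hc : p ≤ (ω.erase .th).count .th := by rw [count_erase_self]; omega
  have e : ∀ t : Fin ((ω.erase .th).length + 1) → ℝ,
      moveTh b p (ins .th p (t 0) (config (ω.erase .th) fun i => t i.succ)) = config (b :: ω.erase .th) t := fun t => by
    set C := config (ω.erase .th) fun i => t i.succ
    obtain ⟨e1, -, e3⟩ := getD_insert ((C .th).take p) ((C .th).drop p) (t 0) (p := p) (by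
      rw [List.length_take, config_length]; omega)
    rw [moveTh, ins_same, e1, e3, take_append_drop, ins, update_idem, update_eq_self]; rfl
  constructor
  · rw [integrable_perm (F := fun C => G (moveTh b p C)) hperm,
      integrable_cons_ins (F := fun C => G (moveTh b p C)) hc]
    simp only [e]; exact hG
  · rw [rint_perm hperm, rint_cons_ins hc]; simp only [e]; rfl

namespace Model

variable {m : Model}

theorem lift_moveTh {b : Role} (hb : b = .P ∨ b = .Q) {p : ℕ} {C : Config ℝ} (hp : p < (C .th).length) :
    lift (m.levels m.s) (moveTh b p C) = push b ((lift (m.levels m.s) C .th).getD p 0)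
      (update (lift (m.levels m.s) C) .th ((lift (m.levels m.s) C .th).eraseIdx p)) := by
  rw [moveTh, lift_push]; congr 1
  · have : m.levels m.s b = m.levels m.s .th := by rcases hb with rfl | rfl <;> rfl
    rw [this]; simp [lift, List.getD_eq_getElem?_getD, hp]
  · funext c
    by_cases hc : c = .th
    · subst hc; simp [lift, List.eraseIdx_map]
    · simp [lift, update_of_ne hc]

/-- The residue theorem for the strip between the heights `s` and `3s`. The poles of the integrand
as a function of the contracted variable are the variables `th` at height `2s`, and `2πi` times the
factor `-i` of the residue gives `2π`. -/
theorem integral_cross_th (hr : RightOf m.f m.g) {ω : List Role} (hN : ω.length + 1 ≤ m.N) {t : Fin ω.length → ℝ}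
    (ht : Injective t) :
    (∫ x : ℝ, m.W true 𝟎 𝟎 (lift (m.levels m.s) (push .L x (config ω t)))) -
      (∫ x : ℝ, m.W true 𝟎 𝟎 (lift (m.levels m.s) (push .H x (config ω t)))) =
    2 * π * ∑ p ∈ range (ω.count .th),
      (m.W true 𝟎 𝟎 (lift (m.levels m.s) (moveTh .P p (config ω t))) -
        m.W true 𝟎 𝟎 (lift (m.levels m.s) (moveTh .Q p (config ω t)))) := by
  obtain ⟨hs, hs1, hδ, hpi⟩ := m.s_facts; set C := config ω t with hC
  set D := lift (m.levels m.s) C with hD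
  have hDi : ∀ b, ∀ z ∈ D b, z.im = m.levels m.s b := fun b z hz => mem_lift_im hz
  have hDl : ∑ b, (D b).length = ω.length := by simp only [hD, hC, lift, length_map, length_config]
  have hnd : (D .th).Nodup := by
    refine List.Nodup.map (fun x y h => ?_) (config_nodup .th ω t ht).1
    simpa using congrArg re h
  have hlen : (D .th).length = ω.count .th := by simp [hD, hC, lift, config_length]
  set V : ℂ → ℂ := fun z => m.W true 𝟎 𝟎 (push .H z D) with hV
  -- The position of the pole in its list is recovered by `idxOf`, unambiguously because the list
  -- has no repetitions.
  set R : ℂ → ℂ := fun z => -I * (m.W true 𝟎 𝟎 (push .P z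
      (update D .th ((D .th).eraseIdx ((D .th).idxOf z)))) - m.W true 𝟎 𝟎 (push .Q z
      (update D .th ((D .th).eraseIdx ((D .th).idxOf z))))) with hR
  have key := integral_cross (l1 := m.s) (l2 := 3 * m.s) (by linarith) (D .th).toFinset R (fun p hp => by
      rw [hDi .th p (by simpa using hp)]; simp only [levels]; constructor <;> linarith) V (by linarith)
    (fun z h1 h2 hz => ?_) (fun p hp => ?_) ?_
  · rw [show (fun x : ℝ => m.W true 𝟎 𝟎 (lift (m.levels m.s) (push .L x C))) =
      fun x : ℝ => V (x + m.s * I) from funext fun x => by rw [lift_push, W_push_eq]; rfl,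
      show (fun x : ℝ => m.W true 𝟎 𝟎 (lift (m.levels m.s) (push .H x C))) =
      fun x : ℝ => V (x + (3 * m.s : ℝ) * I) from funext fun x => by rw [lift_push]; rfl, key,
      List.sum_toFinset _ hnd, ← Fin.sum_univ_fun_getElem, ← hlen, Finset.sum_range, mul_assoc, mul_sum]
    congr 1; refine sum_congr rfl fun p _ => ?_
    have hp : (p : ℕ) < (C .th).length := by simpa [hD, lift] using p.2
    rw [lift_moveTh (Or.inl rfl) hp, lift_moveTh (Or.inr rfl) hp, hR]
    simp only [← hD, hnd.idxOf_getElem, List.getD_eq_getElem _ _ p.2]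
    linear_combination -(m.W true 𝟎 𝟎 (push .P (D .th)[(p : ℕ)] (update D .th ((D .th).eraseIdx p))) -
      m.W true 𝟎 𝟎 (push .Q (D .th)[(p : ℕ)] (update D .th ((D .th).eraseIdx p)))) * I_mul_I
  · have h := m.differentiableAt_W true (.H :: ω) (Fin.cons z fun i => (t i : ℂ) + m.levels m.s (ω.get i) * I)
      𝟎 𝟎
    have e : ∀ z : ℂ, config (.H :: ω) (Fin.cons z fun i => (t i : ℂ) + m.levels m.s (ω.get i) * I) = push .H z D :=
      fun z => by rw [hD, hC, lift_config]; rfl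
    rw [e] at h
    have h' := (h (adm_push hr (fun _ _ h => h.regRel m.sin_s_pos) hDi (by omega) h1 h2 fun x hx => ?_)).comp
      (f := fun z : ℂ => ((Fin.cons z fun i => (t i : ℂ) + m.levels m.s (ω.get i) * I : Fin (ω.length + 1) → ℂ),
        𝟎, 𝟎)) z (DifferentiableAt.prodMk (differentiableAt_pi.2 fun i => by
          cases i using Fin.cases <;> simp) (by fun_prop))
    · refine h'.congr_of_eventuallyEq (.of_forall fun w => ?_)
      exact congrArg (m.W true 𝟎 𝟎) (e w).symm
    · exact regRel_sub_pi (hDi .th x hx) h1 h2 (by rintro rfl; exact hz (by simpa using hx))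
  · have hp' : p ∈ D .th := by simpa using hp
    have hi := List.idxOf_lt_length_of_mem hp'
    have hsp : D .th = (D .th).take ((D .th).idxOf p) ++ p :: (D .th).drop ((D .th).idxOf p + 1) := by
      conv_lhs => rw [← take_append_drop ((D .th).idxOf p) (D .th), List.drop_eq_getElem_cons hi,
        List.getElem_idxOf]
    have := m.residue hr hDi (by omega) hsp (fun y hy => ?_)
    · rwa [← List.eraseIdx_eq_take_drop_succ] at this
    · rintro rfl; rw [hsp] at hnd; rw [List.nodup_middle] at hnd; exact (List.nodup_cons.1 hnd).1 hy
  -- Between the levels the heights no longer keep `z` away from the poles. Beyond `|Re z| = M + 2`,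
  -- however, the relevant pole factors are at least `sinh 1 ≥ 1`, so the general bound on the
  -- integrand applies.
  · obtain ⟨M, hM⟩ := ((D .th).toFinset.image fun x => |x.re|).exists_le
    obtain ⟨K, hK0, hK⟩ := m.norm_W_le m.sin_s_pos
    refine ⟨K, M + 2, fun z h1 h2 h3 => (hK true 0 0 _ (adm_push hr (fun _ _ => id) hDi (by omega) h1 h2 fun x hx => ?_)).trans ?_⟩
    · have hx' := hDi .th x hx; simp only [levels] at hx'
      refine ⟨⟨by simp; linarith, by simp; linarith⟩, ?_⟩
      rw [cosh_half_add_pi, norm_mul, norm_I, mul_one]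
      refine (Real.sin_le_one _).trans (le_trans ?_ (abs_sinh_re_le _))
      have h4 := hM |x.re| (Finset.mem_image_of_mem _ (by simpa using hx))
      have h5 : 1 ≤ |((z - x) / 2).re| := by
        have : ((z - x) / 2).re = (z.re - x.re) / 2 := by simp
        rw [this, abs_div, abs_two, le_div_iff₀ two_pos]; have := abs_sub_abs_le_abs_sub z.re x.re
        linarith
      rw [abs_sinh]; exact h5.trans (Real.self_le_sinh_iff.2 (abs_nonneg _))
    · rw [absSum_push]; have : 0 ≤ absSum D := by rw [hD, hC, absSum_config]; positivity
      gcongr; linarith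

/-- The change of the order of the contracted variables and the created particles. -/
theorem wint_flip (hr : RightOf m.f m.g) {ω : List Role} (hN : ω.length + 1 ≤ m.N) :
    wint (.H :: ω) (m.levels m.s) (m.W true 𝟎 𝟎) +
      ω.count .th * wint (.P :: ω.erase .th) (m.levels m.s) (m.W true 𝟎 𝟎) =
    wint (.L :: ω) (m.levels m.s) (m.W true 𝟎 𝟎) +
      ω.count .th * wint (.Q :: ω.erase .th) (m.levels m.s) (m.W true 𝟎 𝟎) := by
  have hi : ∀ ω' : List Role, ω'.length ≤ m.N →
      Integrable fun t => m.W true 𝟎 𝟎 (lift (m.levels m.s) (config ω' t)) := fun ω' h =>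
    integrable_W m.sin_s_pos fun t => adm_cross_levels hr
      (fun b z hz => mem_lift_im hz) (by simpa only [lift, length_map, length_config] using h)
  set G : Config ℝ → ℂ := fun C => m.W true 𝟎 𝟎 (lift (m.levels m.s) C) with hG
  have hlen : ∀ b, (b :: ω.erase .th).length ≤ m.N := fun b => by
    have := (List.erase_sublist (a := Role.th) (l := ω)).length_le; simp only [length_cons]; omega
  have hp : ∀ b, ∀ p ∈ range (ω.count .th), (Integrable fun t => G (moveTh b p (config ω t))) ∧
      rint ω (fun C => G (moveTh b p C)) = rint (b :: ω.erase .th) G := fun b p hp =>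
    rint_moveTh (mem_range.1 hp) (hi _ (hlen b))
  have h1 : ∀ b, (Integrable fun t : Fin ω.length → ℝ => ∫ x : ℝ, G (push b x (config ω t))) ∧
      rint (b :: ω) G = ((2 * π : ℂ) ^ ω.length)⁻¹ * ((2 * π : ℂ)⁻¹ *
        ∫ t : Fin ω.length → ℝ, ∫ x : ℝ, G (push b x (config ω t))) := fun b => by
    have h := integral_cons_right (f := fun t => G (config (b :: ω) t)) (hi (b :: ω) (by simpa using hN))
    have e : ∀ (t : Fin ω.length → ℝ) (x : ℝ), config (b :: ω) (Fin.cons x t) = push b x (config ω t) := fun t x => rfl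
    simp only [e] at h; refine ⟨h.1, ?_⟩; rw [← mul_assoc, ← mul_inv, ← pow_succ]
    exact congrArg _ h.2
  have hae : (fun t : Fin ω.length → ℝ => (∫ x : ℝ, G (push .L x (config ω t))) - ∫ x : ℝ, G (push .H x (config ω t)))
      =ᵐ[volume] fun t => 2 * π * ∑ p ∈ range (ω.count .th),
        (G (moveTh .P p (config ω t)) - G (moveTh .Q p (config ω t))) := by
    filter_upwards [ae_injective ω.length] with t ht using integral_cross_th hr hN ht
  have h2 := integral_congr_ae hae
  rw [integral_sub (h1 .L).1 (h1 .H).1, integral_const_mul, integral_finsetSum _ fun p h =>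
    Integrable.sub' (hp .P p h).1 (hp .Q p h).1]
    at h2
  have h3 : ((2 * π : ℂ) ^ ω.length)⁻¹ * ∑ p ∈ range (ω.count .th), ∫ t : Fin ω.length → ℝ,
      (G (moveTh .P p (config ω t)) - G (moveTh .Q p (config ω t))) =
      ω.count .th * rint (.P :: ω.erase .th) G - ω.count .th * rint (.Q :: ω.erase .th) G := by
    rw [mul_sum]
    refine (sum_congr rfl (g := fun _ => rint (.P :: ω.erase .th) G - rint (.Q :: ω.erase .th) G)
      fun p h => ?_).trans (by simp [mul_sub])
    rw [integral_sub (hp .P p h).1 (hp .Q p h).1, mul_sub]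
    exact congrArg₂ _ (hp .P p h).2 (hp .Q p h).2
  have h4 : (2 * π : ℂ) ≠ 0 := by simp [Real.pi_ne_zero]
  change rint _ G + _ * rint _ G = rint _ G + _ * rint _ G; rw [(h1 .H).2, (h1 .L).2]
  linear_combination -h3 - ((2 * π : ℂ) ^ ω.length)⁻¹ * (2 * π : ℂ)⁻¹ * h2 -
    ((2 * π : ℂ) ^ ω.length)⁻¹ * (∑ p ∈ range (ω.count .th), ∫ t : Fin ω.length → ℝ,
      (G (moveTh .P p (config ω t)) - G (moveTh .Q p (config ω t)))) * inv_mul_cancel₀ h4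

end Model

/-! ### Combinatorics of the exchange of levels. -/

/-- For the polynomial with coefficients `f` the hypothesis says that `∂_h + ∂_p` and `∂_l + ∂_q`
agree in total degree `t`. With `Y i j` the sum of the coefficients of degree `i` in the first pair
and `j` in the second, Euler's identity makes `i! j! Y i j` constant along `i + j = t`; compare the
two ends. -/
theorem euler_exchange (f : ℕ → ℕ → ℕ → ℕ → ℂ) (t : ℕ) (hf : ∀ h p l q, h + p + l + q + 1 = t →
      (h + 1 : ℂ) * f (h + 1) p l q + (p + 1 : ℂ) * f h (p + 1) l q =
        (l + 1 : ℂ) * f h p (l + 1) q + (q + 1 : ℂ) * f h p l (q + 1)) :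
    ∑ x ∈ antidiagonal t, f 0 0 x.1 x.2 = ∑ x ∈ antidiagonal t, f x.1 x.2 0 0 := by
  set Y : ℕ → ℕ → ℂ := fun i j => ∑ x ∈ antidiagonal i,
    ∑ y ∈ antidiagonal j, f x.1 x.2 y.1 y.2 with hY
  have h1 : ∀ i j, i + j + 1 = t → (i + 1 : ℂ) * Y (i + 1) j = (j + 1 : ℂ) * Y i (j + 1) := by
    intro i j hij; have e1 := euler_antidiagonal (fun h p => ∑ y ∈ antidiagonal j, f h p y.1 y.2) i
    have e2 : (j + 1 : ℂ) * Y i (j + 1) = ∑ x ∈ antidiagonal i,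
        ∑ y ∈ antidiagonal j,
          ((y.1 + 1 : ℂ) * f x.1 x.2 (y.1 + 1) y.2 + (y.2 + 1 : ℂ) * f x.1 x.2 y.1 (y.2 + 1)) := by
      rw [hY, mul_sum]; exact sum_congr rfl fun x _ => (euler_antidiagonal (f x.1 x.2) j).symm
    rw [e2, hY, ← e1]; refine sum_congr rfl fun x hx => ?_
    rw [mul_sum, mul_sum, ← sum_add_distrib]; refine sum_congr rfl fun y hy => hf _ _ _ _ ?_
    have := mem_antidiagonal.1 hx; have := mem_antidiagonal.1 hy; omega
  have h2 : ∀ i j, i + j = t → (i.factorial * j.factorial : ℂ) * Y i j = t.factorial * Y 0 t := by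
    intro i
    induction i with
    | zero => intro j hj; simp [← hj]
    | succ i ih =>
      intro j hj; rw [← ih (j + 1) (by omega), factorial_succ, factorial_succ]; push_cast
      linear_combination (i.factorial * j.factorial : ℂ) * h1 i j (by omega)
  have h3 := h2 t 0 rfl; rw [Nat.factorial_zero, cast_one, mul_one] at h3
  simpa [hY] using (mul_left_cancel₀ (factorial_ne t) h3).symm

/-- The numbers of variables when `K` particles are created by the first field, of which `p` and `q` are created by
the second field instead. -/
def countsHL (K e k n h p l q : ℕ) : Role → ℕ
  | .th => K - p - q
  | .et => e
  | .P => p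
  | .H => h
  | .L => l
  | .Q => q
  | .eB => k
  | .nu => n

namespace Model

variable {m : Model}

/-- This is `wint_flip` divided by the factorials. The multiplicity, the number of remaining
variables `th`, is absorbed by their factorial; it vanishes for `p + q = K`, where no creator of the
first field is left. -/
theorem T_flip (hr : RightOf m.f m.g) {K e k n h p l q : ℕ} (hpq : p + q ≤ K)
    (hN : K - p - q + e + p + h + l + q + k + n + 1 ≤ m.N) :
    (h + 1 : ℂ) * m.T (m.levels m.s) true 0 0 (countsHL K e k n (h + 1) p l q) +
      (if p + q < K then (p + 1 : ℂ) * m.T (m.levels m.s) true 0 0 (countsHL K e k n h (p + 1) l q) else 0) =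
    (l + 1 : ℂ) * m.T (m.levels m.s) true 0 0 (countsHL K e k n h p (l + 1) q) +
      (if p + q < K then (q + 1 : ℂ) * m.T (m.levels m.s) true 0 0 (countsHL K e k n h p l (q + 1)) else 0) := by
  have hw := wint_flip hr (ω := word (countsHL K e k n h p l q)) (by
    rw [length_word, sum_role]; simpa [countsHL] using hN)
  rw [count_word] at hw
  have h1 : ∀ b v, (∀ c, (b :: word (countsHL K e k n h p l q)).count c = v c) →
      wint (b :: word (countsHL K e k n h p l q)) (m.levels m.s) (m.W true 𝟎 𝟎) =
      wint (word v) (m.levels m.s) (m.W true 𝟎 𝟎) := fun b v hv => wint_perm (perm_word hv) _ _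
  rw [h1 .H (countsHL K e k n (h + 1) p l q) fun c => by cases c <;> simp [count_word, countsHL],
    h1 .L (countsHL K e k n h p (l + 1) q) fun c => by cases c <;> simp [count_word, countsHL]] at hw
  have := factorial_ne h; have := factorial_ne p; have := factorial_ne l; have := factorial_ne q
  have := factorial_ne e; have := factorial_ne k; have := factorial_ne n; have := factorial_ne (K - p - q)
  have := Nat.cast_add_one_ne_zero (R := ℂ) h; have := Nat.cast_add_one_ne_zero (R := ℂ) p
  have := Nat.cast_add_one_ne_zero (R := ℂ) l; have := Nat.cast_add_one_ne_zero (R := ℂ) q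
  by_cases hK : p + q < K
  · obtain ⟨r, hr'⟩ : ∃ r, K - p - q = r + 1 := ⟨K - p - q - 1, by omega⟩
    have h2 : ∀ b v, (∀ c, (b :: (word (countsHL K e k n h p l q)).erase .th).count c = v c) →
        wint (b :: (word (countsHL K e k n h p l q)).erase .th) (m.levels m.s) (m.W true 𝟎 𝟎) =
        wint (word v) (m.levels m.s) (m.W true 𝟎 𝟎) := fun b v hv => wint_perm (perm_word hv) _ _
    rw [h2 .P (countsHL K e k n h (p + 1) l q) fun c => by
        cases c <;> simp [count_erase, count_word, countsHL]; omega,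
      h2 .Q (countsHL K e k n h p l (q + 1)) fun c => by
        cases c <;> simp [count_erase, count_word, countsHL]; omega] at hw
    have := factorial_ne r; have := Nat.cast_add_one_ne_zero (R := ℂ) r; rw [if_pos hK, if_pos hK]
    simp only [T, prod_role, countsHL, hr', show K - (p + 1) - q = r by omega, show K - p - (q + 1) = r by omega,
      factorial_succ] at hw ⊢
    push_cast at hw ⊢; field_simp; linear_combination hw
  · rw [if_neg hK, if_neg hK]
    simp only [T, prod_role, countsHL, show K - p - q = 0 by omega, factorial_succ] at hw ⊢
    push_cast at hw ⊢; field_simp; linear_combination hw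

end Model

/-- The numbers of variables that contribute to the sum of all products of terms of the first field with the term of
order `k` of the second one. -/
def countsL (n0 k : ℕ) : Finset (Role → ℕ) :=
  (Fintype.piFinset fun _ => range (n0 + k + 1)).filter fun v => v .P = 0 ∧ v .H = 0 ∧
    v .L + v .Q + v .eB = k ∧ v .th + v .Q + v .nu ≤ n0 ∧ v .eB + v .et + v .nu ≤ n0

theorem mem_countsL {n0 k : ℕ} {v : Role → ℕ} : v ∈ countsL n0 k ↔ v .P = 0 ∧ v .H = 0 ∧
    v .L + v .Q + v .eB = k ∧ v .th + v .Q + v .nu ≤ n0 ∧ v .eB + v .et + v .nu ≤ n0 := by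
  simp only [countsL, mem_filter, Fintype.mem_piFinset, mem_range, and_iff_right_iff_imp]
  rintro h b
  cases b <;> omega

/-- The same after the change of the order of the contractions. -/
def countsH (n0 k : ℕ) : Finset (Role → ℕ) :=
  (Fintype.piFinset fun _ => range (n0 + k + 1)).filter fun v => v .L = 0 ∧ v .Q = 0 ∧
    v .H + v .P + v .eB = k ∧ v .th + v .P + v .nu ≤ n0 ∧ v .eB + v .et + v .nu ≤ n0

theorem mem_countsH {n0 k : ℕ} {v : Role → ℕ} : v ∈ countsH n0 k ↔ v .L = 0 ∧ v .Q = 0 ∧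
    v .H + v .P + v .eB = k ∧ v .th + v .P + v .nu ≤ n0 ∧ v .eB + v .et + v .nu ≤ n0 := by
  simp only [countsH, mem_filter, Fintype.mem_piFinset, mem_range, and_iff_right_iff_imp]
  rintro h b
  cases b <;> omega

/-- The numbers `K = th + P + Q`, `et`, `eB` and `nu` are unchanged by an exchange of levels. For
fixed values of these the claim is `euler_exchange`, with total degree `k0 - eB`. -/
theorem sum_countsL_eq_sum_countsH (F : (Role → ℕ) → ℂ) (n0 k0 : ℕ) (hF : ∀ K e k n h p l q, p + q ≤ K →
      h + p + l + q + k + 1 = k0 → K + n ≤ n0 → e + k + n ≤ n0 →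
      (h + 1 : ℂ) * F (countsHL K e k n (h + 1) p l q) +
        (if p + q < K then (p + 1 : ℂ) * F (countsHL K e k n h (p + 1) l q) else 0) =
      (l + 1 : ℂ) * F (countsHL K e k n h p (l + 1) q) +
        (if p + q < K then (q + 1 : ℂ) * F (countsHL K e k n h p l (q + 1)) else 0)) :
    ∑ v ∈ countsL n0 k0, F v = ∑ v ∈ countsH n0 k0, F v := by
  set Y : Finset (ℕ × ℕ × ℕ × ℕ) := (range (n0 + 1) ×ˢ range (n0 + 1) ×ˢ range (k0 + 1) ×ˢ
    range (n0 + 1)).filter fun y => y.1 + y.2.2.2 ≤ n0 ∧ y.2.1 + y.2.2.1 + y.2.2.2 ≤ n0 with hY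
  have key : ∀ y ∈ Y, ∑ x ∈ antidiagonal (k0 - y.2.2.1),
      (if 0 + x.2 ≤ y.1 then F (countsHL y.1 y.2.1 y.2.2.1 y.2.2.2 0 0 x.1 x.2) else 0) =
      ∑ x ∈ antidiagonal (k0 - y.2.2.1),
      (if x.2 + 0 ≤ y.1 then F (countsHL y.1 y.2.1 y.2.2.1 y.2.2.2 x.1 x.2 0 0) else 0) := fun y hy => by
    refine euler_exchange (fun h p l q => if p + q ≤ y.1 then F (countsHL y.1 y.2.1 y.2.2.1 y.2.2.2 h p l q) else 0) _
      fun h p l q ht => ?_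
    simp only [hY, mem_filter, mem_product, mem_range] at hy
    by_cases hpq : p + q ≤ y.1
    · have := hF y.1 y.2.1 y.2.2.1 y.2.2.2 h p l q hpq (by omega) (by omega) (by omega)
      simp only [hpq, if_true, mul_ite, mul_zero, show p + 1 + q = p + q + 1 by ring, ← add_assoc, Nat.succ_le_iff]
      simpa only [Nat.lt_iff_add_one_le] using this
    · rw [if_neg hpq, if_neg (by omega), if_neg hpq, if_neg (by omega)]; simp
  have e : (∑ v ∈ countsL n0 k0, F v = ∑ y ∈ Y, ∑ x ∈ antidiagonal (k0 - y.2.2.1),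
      (if 0 + x.2 ≤ y.1 then F (countsHL y.1 y.2.1 y.2.2.1 y.2.2.2 0 0 x.1 x.2) else 0)) ∧
      ∑ v ∈ countsH n0 k0, F v = ∑ y ∈ Y, ∑ x ∈ antidiagonal (k0 - y.2.2.1),
      (if x.2 + 0 ≤ y.1 then F (countsHL y.1 y.2.1 y.2.2.1 y.2.2.2 x.1 x.2 0 0) else 0) := by
    rw [sum_sigma', sum_sigma', ← sum_filter, ← sum_filter]
    refine ⟨sum_nbij' (fun v => ⟨(v .th + v .Q, v .et, v .eB, v .nu), (v .L, v .Q)⟩)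
      (fun x => countsHL x.1.1 x.1.2.1 x.1.2.2.1 x.1.2.2.2 0 0 x.2.1 x.2.2) ?_ ?_ ?_ ?_ ?_,
      sum_nbij' (fun v => ⟨(v .th + v .P, v .et, v .eB, v .nu), (v .H, v .P)⟩)
      (fun x => countsHL x.1.1 x.1.2.1 x.1.2.2.1 x.1.2.2.2 x.2.1 x.2.2 0 0) ?_ ?_ ?_ ?_ ?_⟩
    iterate 2
      · intro v hv; simp only [mem_countsL, mem_countsH] at hv
        simp only [hY, mem_filter, mem_sigma, mem_product, mem_range, mem_antidiagonal]; omega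
      · rintro ⟨⟨K, e, k, n⟩, l, q⟩ hx
        simp only [hY, mem_filter, mem_sigma, mem_product, mem_range, mem_antidiagonal] at hx
        simp only [mem_countsL, mem_countsH, countsHL, true_and]; omega
      · intro v hv; simp only [mem_countsL, mem_countsH] at hv; funext b
        cases b <;> simp [countsHL] <;> omega
      · rintro ⟨⟨K, e, k, n⟩, l, q⟩ hx; simp only [mem_filter] at hx; simp [countsHL]; omega
      · intro v hv; simp only [mem_countsL, mem_countsH] at hv; congr 1; funext b
        cases b <;> simp [countsHL] <;> omega
  rw [e.1, e.2, sum_congr rfl key]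

namespace Model

variable {m : Model}

theorem sum_T_flip (hr : RightOf m.f m.g) {n0 k : ℕ} (hN : 2 * n0 + k ≤ m.N) :
    ∑ v ∈ countsL n0 k, m.T (m.levels m.s) true 0 0 v = ∑ v ∈ countsH n0 k, m.T (m.levels m.s) true 0 0 v :=
  sum_countsL_eq_sum_countsH _ n0 k fun _ _ _ _ _ _ _ _ h1 h2 h3 h4 => T_flip hr h1 (by omega)

/-- Terms with too many particles in the right vector vanish. -/
theorem T_eq_zero {Φ Ψ : FockFn} {n0 : ℕ} (h : m.Represents Φ Ψ n0) {lev : Role → ℝ} {k : Bool} {e1 e2 : ℝ} {v : Role → ℕ}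
    (hv : n0 < v .eB + v .et + v .nu) : m.T lev k e1 e2 v = 0 := by
  have h0 : ∀ t, m.W k e1 e2 (lift lev (config (word v) t)) = 0 := fun t => by
    rw [W, vecs, h.right_zero, mul_zero, mul_zero]
    simp only [lift, length_append, length_map, config_length, count_word]; omega
  simp [T, wint, h0]

/-- The right vector restricts `eB + et + nu` to `n0`, the left one `th + Q + nu`, and `L ≤ k`.
Hence only orders `j = th + et + L ≤ 2 n0 + k` contribute, and summing over them removes the
constraint on `j`. -/
theorem sum_countsAB_eq {Φ Ψ : FockFn} {n0 : ℕ} (h : m.Represents Φ Ψ n0) (ρ : ℝ) (k : ℕ) :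
    ∑ j ∈ range (2 * n0 + k + 1), ∑ v ∈ countsAB n0 j k, m.T (m.levels ρ) true 0 0 v =
      ∑ v ∈ countsL n0 k, m.T (m.levels ρ) true 0 0 v := by
  rw [← Finset.sum_fiberwise_of_maps_to (s := countsL n0 k) (t := range (2 * n0 + k + 1))
    (g := fun v => v .th + v .et + v .L) fun v hv => by rw [mem_countsL] at hv; rw [mem_range]; omega]
  refine sum_congr rfl fun j _ => (Finset.sum_subset (fun v hv => ?_) fun v hv hv' => T_eq_zero h ?_).symm
  · rw [mem_filter, mem_countsL] at hv; rw [mem_countsAB]; omega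
  · rw [mem_countsAB] at hv; rw [mem_filter, mem_countsL] at hv'; omega

end Model

/-! ### Adjoint fields -/

/-- The arguments of the adjoint coefficients. -/
def starList (L : List ℂ) : List ℂ := L.reverse.map fun z => conj z - π * I

/-- The coefficients of the adjoint field. -/
def starCoef (a : Coefficients) : Coefficients := fun _ ζ => conj (onList a (starList (ofFn ζ)))

theorem onList_starCoef (a : Coefficients) (L : List ℂ) :
    onList (starCoef a) L = conj (onList a (starList L)) := by rw [onList, starCoef, ofFn_get]

theorem starList_append (L M : List ℂ) : starList (L ++ M) = starList M ++ starList L := by simp [starList]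

theorem starList_cons (x : ℂ) (L : List ℂ) : starList (x :: L) = starList L ++ [conj x - π * I] := by
  simp [starList]

theorem starList_pairwise {R : ℂ → ℂ → Prop} (hR : ∀ z w, R z w → R (conj w - π * I)
    (conj z - π * I)) {L : List ℂ} (h : L.Pairwise R) : (starList L).Pairwise R := by
  rw [starList, pairwise_map, List.pairwise_reverse]; exact h.imp fun h => hR _ _ h

theorem cosh_conj_half (z : ℂ) : cosh (conj z / 2) = conj (cosh (z / 2)) := by
  rw [← cosh_conj, map_div₀, conj_ofNat]

theorem tubeRel_conj {δ : ℝ} {z w : ℂ} (h : TubeRel δ z w) :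
    TubeRel δ (conj w - π * I) (conj z - π * I) := by
  have h1 := h.1; have h2 := h.2; simp only [sub_im] at h1 h2; constructor <;> simp <;> linarith

theorem cosh_conj_sub (z w : ℂ) : cosh ((conj w - π * I - (conj z - π * I)) / 2) =
    conj (cosh ((z - w) / 2)) := by rw [← cosh_conj_half, ← cosh_neg, map_sub]; congr 1; ring

theorem regRel_conj {δ : ℝ} {z w : ℂ} (h : RegRel δ z w) :
    RegRel δ (conj w - π * I) (conj z - π * I) :=
  ⟨tubeRel_conj h.1, by rw [cosh_conj_sub]; exact (map_ne_zero _).2 h.2⟩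

/-- Conjugation reverses the order of heights and reversal of the list restores it, so tube and pole
factors are preserved. The exchange relation needs hermitian analyticity of `S`. In the residue the
roles of `u` and `v` are interchanged, and crossing symmetry is needed as well. -/
theorem CoefData.star {S : ℂ → ℂ} {a : Coefficients} {δ B : ℝ} {N : ℕ} (hS : StripS S δ B) (h : CoefData S a δ N) :
    CoefData S (starCoef a) δ N := by
  refine ⟨fun L hL hp => ?_, fun γ hγ => ?_, fun L1 L2 x y hn h1 h2 => ?_, fun L x hn h1 h2 l u v hu hv hne => ?_⟩
  · have e : onList (starCoef a) = conjFn fun M => onList a (M.reverse.map fun z => z - π * I) := by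
      funext M; rw [onList_starCoef, conjFn, starList, ← map_reverse, map_map]; rfl
    rw [e]; refine HoloAt.conjFn fun n ζ hζ => ?_
    have e2 : ∀ ζ' : Fin n → ℂ, (ofFn ζ').reverse.map (fun z => z - π * I) =
        (finRange n).reverse.map fun i => ζ' i - π * I := fun ζ' => by simp [ofFn_eq_map, comp_def]
    have e3 : (finRange n).reverse.map (fun i => ζ i - π * I) = starList L := by
      rw [← e2, ← hζ, ← map_reverse, map_map]; rfl
    simp only [e2]
    refine HoloAt.comp _ (fun i (ζ' : Fin n → ℂ) => ζ' i - π * I) ?_ fun i _ => by fun_prop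
    rw [e3]
    exact h.holo _ (by simpa [starList] using hL) (starList_pairwise (fun _ _ => regRel_conj) hp)
  · obtain ⟨C, r, h0, h1, h2⟩ := h.bound γ hγ; refine ⟨C, r, h0, h1, fun L hL hp => ?_⟩
    have := h2 (starList L) (by simpa [starList] using hL) (starList_pairwise (fun z w h =>
      ⟨tubeRel_conj h.1, by rw [cosh_conj_sub, norm_conj]; exact h.2⟩) hp)
    rw [onList_starCoef, norm_conj]; simpa [starList, comp_def, List.sum_reverse] using this
  · have g1 := h.exch (starList L2) (starList L1) (conj y - π * I) (conj x - π * I)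
      (by simp [starList] at hn ⊢; omega) (by simpa [starList] using starList_pairwise (fun _ _ => regRel_conj) h1)
      (by simpa [starList] using starList_pairwise (fun _ _ => regRel_conj) h2)
    have hxy : RegRel δ x y := by
      simp only [pairwise_append, pairwise_cons] at h1; exact h1.2.1.1 y (by simp)
    have hh := hS.herm (conj (y - x)) (by have := hxy.1.1; simp at this ⊢; linarith)
      (by have := hxy.1.2; simp at this ⊢; linarith)
    rw [conj_conj, neg_sub] at hh; rw [onList_starCoef, onList_starCoef, hh, ← map_mul]; congr 1
    simpa [starList] using g1
  · have g1 := h.kin (starList L) (conj x) (by simpa [starList] using hn)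
      (starList_pairwise (fun _ _ => regRel_conj) h1) (fun z hz => ?_) l (fun w => conj (v w))
      (fun w => conj (u w)) ((continuous_conj.tendsto _).comp hv) ((continuous_conj.tendsto _).comp hu)
      (hne.mono fun w hw h => hw (star_injective h).symm)
    · have g2 := ((continuous_conj.tendsto _).comp g1).neg
      refine (g2.congr fun w => ?_).trans (le_of_eq (congrArg 𝓝 ?_))
      · rw [onList_starCoef, cons_append, starList_cons, starList_append]
        simp only [comp_apply, map_mul, map_sub, conj_conj, starList, List.reverse_singleton, map_cons,
          map_nil, nil_append, conj_ofReal, conj_I, cons_append]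
        rw [← neg_mul, neg_sub, show conj (v w) - ↑π * -I - ↑π * I = conj (v w) by ring]
      · have e : conj ((starList L).map fun z => S (conj x - z)).prod =
            (L.map fun z => S (x - z)).prod := by
          rw [map_list_prod, starList, map_map, map_map, map_reverse, prod_reverse]
          refine congrArg _ (map_congr_left fun z hz => ?_)
          have t := (h2 z hz).1; have t1 := t.1; have t2 := t.2; simp only [sub_im] at t1 t2
          simp only [comp_apply]
          rw [← hS.herm _ (by simp; linarith) (by simp; linarith), ← hS.cross (x - z) (by simp; linarith)
            (by simp; linarith)]
          congr 1; simp; ring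
        rw [map_mul, map_mul, map_neg, conj_I, map_sub, map_one, e, onList_starCoef]; ring
    · simp only [starList, mem_map, mem_reverse] at hz; obtain ⟨z, hz, rfl⟩ := hz
      obtain ⟨t, c1, c2⟩ := h2 z hz; have t1 := t.1; have t2 := t.2; simp only [sub_im] at t1 t2
      refine ⟨⟨by simp; linarith, by simp; linarith⟩, ?_, ?_⟩
      · rw [show conj x - (conj z - π * I) =
          conj (-(z - (x - π * I))) by simp; ring, cosh_conj_half, neg_div, cosh_neg]
        exact (map_ne_zero _).2 c2
      · rw [cosh_conj_sub]; exact (map_ne_zero _).2 c1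

theorem conj_smearC (f : ℝ × ℝ → ℂ) (P : ℂ × ℂ) : conj (smearC (fun x => conj (f x)) P) =
    smearC f (-conj P.1, -conj P.2) := by
  rw [smearC, smearC, ← integral_conj]; congr 1; funext x; rw [map_mul, conj_conj, ← exp_conj]
  congr 2; simp; ring

theorem psum_map_conj (μ : ℝ) (L : List ℂ) :
    psum μ (L.map conj) = (conj (psum μ L).1, conj (psum μ L).2) := by
  simp [psum, map_list_sum, cosh_conj, sinh_conj, comp_def]

theorem IsTestFunction.conj {f : ℝ × ℝ → ℂ} (hf : IsTestFunction f) : IsTestFunction fun x => conj (f x) :=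
  ⟨conjCLE.contDiff.comp hf.1, hf.2.comp_left (map_zero _)⟩

theorem RightOf.conj {f g : ℝ × ℝ → ℂ} (h : RightOf f g) :
    RightOf (fun x => conj (f x)) fun x => conj (g x) := by
  have e : ∀ f : ℝ × ℝ → ℂ, tsupport (fun x => conj (f x)) = tsupport f := fun f => by
    rw [tsupport, tsupport]; congr 1; ext x; simp
  intro x hx y hy; rw [e] at hx hy; exact h x hx y hy

/-- The model with the adjoint fields. -/
def Model.star (m : Model) : Model :=
  { m with
    a := starCoef m.a
    b := starCoef m.b
    f := fun x => conj (m.f x)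
    g := fun x => conj (m.g x)
    φ := m.ψ
    ψ := m.φ
    ha := m.ha.star m.strip
    hb := m.hb.star m.strip
    hf := m.hf.conj
    hg := m.hg.conj
    hφ := m.hψ
    hψ := m.hφ }

/-- The model with the two fields exchanged. -/
def Model.swap (m : Model) : Model :=
  { m with a := m.b, b := m.a, f := m.g, g := m.f, ha := m.hb, hb := m.ha, hf := m.hg, hg := m.hf }

/-- The exchange of roles under the adjoint. -/
def adjRole : Role → Role
  | .th => .eB
  | .eB => .th
  | .et => .Q
  | .Q => .et
  | b => b

/-- The exchange of roles under the adjoint, for contractions in the other order. -/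
def crossRole : Role → Role
  | .th => .et
  | .et => .th
  | .P => .eB
  | .eB => .P
  | b => b

theorem rint_role {σ : Role → Role} (hσ : Involutive σ) (ω : List Role) (F : Config ℝ → ℂ) :
    rint (ω.map σ) F = rint ω fun C => F fun b => C (σ b) := by
  have key : ∀ (ω : List Role) (t : Fin ω.length → ℝ),
      config (ω.map σ) (fun i => t (i.cast (by simp))) = fun b => config ω t (σ b) := by
    intro ω
    induction ω with
    | nil => intro t; rfl
    | cons c ω ih =>
      intro t; have := ih fun i => t i.succ
      change push (σ c) (t 0) (config (ω.map σ) fun i => t ((i.cast (by simp)).succ)) = _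
      rw [this]; funext b; rw [config]
      by_cases hb : σ b = c
      · subst hb; rw [hσ b, push_same, push_same]
      · rw [push_of_ne hb, push_of_ne fun h => hb (by rw [h, hσ])]
  rw [rint, rint, ← integral_comp_equiv (finCongr (by simp : (ω.map σ).length = ω.length))]; congr 1
  · rw [length_map]
  · congr 1; funext t; rw [← key]; rfl

theorem conj_sProd {S : ℂ → ℂ} {δ B : ℝ} (hS : StripS S δ B) {L M : List ℂ} (h : ∀ q ∈ L, ∀ e ∈ M, |(q - e).im| < δ) :
    conj (sProd S L M) = sProd S (M.map conj) (L.map conj) := by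
  have hpi := pi_pos
  induction L with
  | nil => simp [sProd, comp_def]
  | cons q L ih =>
    rw [← singleton_append, sProd_append_left, map_mul, ih fun q' hq' => h q' (by simp [hq']), map_append,
      sProd_append_right, List.map_singleton, sProd_singleton_left, sProd_singleton_right, map_list_prod, map_map,
      map_map]
    refine congrArg (· * _) (congrArg _ (map_congr_left fun y hy => ?_))
    have := abs_lt.1 (h q (by simp) y hy); simp only [comp_apply]
    rw [← hS.herm _ (by linarith) (by linarith)]; congr 1; simp

namespace Model

variable {m : Model}

/-- The adjoint of `A* B*` is `B A`, so the field `A` now stands second. Creators `th` of `A*` are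
annihilators `eB` of `A` there, and the uncontracted annihilators `et` of `A*` are creators `Q` of
`A`; the contracted variables stay contracted. -/
theorem conj_W_star {e1 e2 : ℝ} {C : Config ℂ} (hs : ∀ q ∈ C .Q, ∀ e ∈ C .et, |(q - e).im| < m.δ) (hP : C .P = [])
    (hH : C .H = []) : conj (m.star.W true e1 e2 C) =
      m.swap.W true e2 e1 fun b => (C (adjRole b)).map conj := by
  have r1 : ∀ (e : ℝ) (x : ℂ), conj (x - e * I) - π * I = conj x - π * I + e * I :=
    fun e x => by simp; ring
  have r2 : ∀ (e : ℝ) (x : ℂ), conj (x - π * I + e * I) - π * I = conj x - e * I :=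
    fun e x => by simp; ring
  set D : Config ℂ := fun b => (C (adjRole b)).map conj with hD
  have hDP : D .P = [] := by simp [hD, adjRole, hP]
  have hDH : D .H = [] := by simp [hD, adjRole, hH]
  have ea : starList (symEval e1 (aSym true C)) = symEval e1 (bSym D) := by
    simp only [symEval_aSym_true, symEval_bSym, starList, hD, adjRole, hP, hH, nil_append, append_nil,
      List.reverse_append, map_append, map_map, map_reverse, List.reverse_reverse, reverse_nil,
      map_nil, comp_def, r1, r2]
  have eb : starList (symEval e2 (bSym C)) = symEval e2 (aSym true D) := by
    simp only [symEval_aSym_true, symEval_bSym, starList, hD, adjRole, hP, hH, nil_append, append_nil,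
      List.reverse_append, map_append, map_map, map_reverse, List.reverse_reverse, reverse_nil,
      map_nil, comp_def, r1, r2]
  have es : conj (m.star.smears C) = m.swap.smears D := by
    rw [smears, smears, map_mul, mul_comm]; change conj (smearC (fun x => conj (m.g x)) _) *
      conj (smearC (fun x => conj (m.f x)) _) = smearC m.g _ * smearC m.f _
    simp only [conj_smearC, hD, hP, hH, adjRole, nil_append, psum_map_conj]
    congr 2 <;> ext <;> simp [star, swap, psum_map_conj] <;> ring
  have ev : conj (m.star.vecs C) = m.swap.vecs D := by
    simp [vecs, star, swap, conjFn, hD, hP, adjRole, mul_comm, comp_def]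
  rw [W, W, map_mul, map_mul, map_mul, map_mul, es, ev]
  change _ * conj (onList (starCoef m.a) _) * conj (onList (starCoef m.b) _) *
    conj (sProd m.S _ _) * _ = _ * onList m.b _ * onList m.a _ * sProd m.S (D .Q) (D .et) * _
  rw [onList_starCoef, onList_starCoef, conj_conj, conj_conj, ea, eb, conj_sProd m.strip hs]
  simp only [hD, adjRole]; ring

end Model

/-! ### Matrix elements of the adjoint fields -/

theorem conj_rint (ω : List Role) (F : Config ℝ → ℂ) : conj (rint ω F) = rint ω fun C => conj (F C) := by
  rw [rint, rint, map_mul, ← integral_conj, map_inv₀, map_pow, map_mul, conj_ofNat, conj_ofReal]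

theorem rint_congr {ω : List Role} {F G : Config ℝ → ℂ} (h : ∀ t, F (config ω t) = G (config ω t)) :
    rint ω F = rint ω G := by simp only [rint, h]

theorem rint_word_comp {σ : Role → Role} (hσ : Involutive σ) (v : Role → ℕ) (F : Config ℝ → ℂ) :
    rint (word fun b => v (σ b)) F = rint (word v) fun C => F fun b => C (σ b) := by
  rw [← rint_role hσ]; refine rint_perm (List.perm_iff_count.2 fun b => ?_) F
  rw [count_word, ← hσ b, List.count_map_of_injective _ _ hσ.injective, count_word, hσ b]

theorem adjRole_involutive : Involutive adjRole := fun b => by cases b <;> rfl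

theorem crossRole_involutive : Involutive crossRole := fun b => by cases b <;> rfl

namespace Model

variable {m : Model}

theorem conj_T_star (m : Model) {e1 e2 : ℝ} {v : Role → ℕ} (hP : v .P = 0) (hH : v .H = 0) :
    conj (m.star.T (fun _ => 0) true e1 e2 v) = m.swap.T (fun _ => 0) true e2 e1 fun b => v (adjRole b) := by
  rw [T, T, wint_eq_rint, wint_eq_rint, map_mul, conj_rint, rint_word_comp adjRole_involutive]
  have hp : ∏ b, ((v (adjRole b)).factorial : ℂ) = ∏ b, ((v b).factorial : ℂ) :=
    Equiv.prod_comp adjRole_involutive.toPerm fun b => ((v b).factorial : ℂ)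
  rw [hp]; congr 1
  · simp
  · refine rint_congr fun t => ?_
    rw [conj_W_star (fun q hq e he => ?_) (lift_nil hP t) (lift_nil hH t)]
    · congr 1; funext b; simp [lift]
    · rw [sub_im, mem_lift_im hq, mem_lift_im he, sub_self, abs_zero]; exact m.strip.pos

theorem Represents.star {Φ Ψ : FockFn} {n0 : ℕ} (h : m.Represents Φ Ψ n0) : m.star.Represents Ψ Φ n0 :=
  ⟨h.right, h.left, h.right_zero, h.left_zero⟩

theorem Represents.swap {Φ Ψ : FockFn} {n0 : ℕ} (h : m.Represents Φ Ψ n0) : m.swap.Represents Φ Ψ n0 :=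
  ⟨h.left, h.right, h.left_zero, h.right_zero⟩

/-- The relation between an operator product and its adjoint is checked term by term on the Wick
expansions of both sides, so that no operator adjoints have to be discussed. Each expansion
restricts the particle number of its left vector only; discarding vanishing terms restricts both and
makes the index sets correspond. -/
theorem pairing_swap {Φ Ψ : FockFn} {n0 : ℕ} (h : m.Represents Φ Ψ n0) {e1 e2 : ℝ} (h10 : 0 < e1) (h11 : e1 ≤ m.s)
    (h20 : 0 < e2) (h21 : e2 ≤ m.s) {j k : ℕ} (hN : n0 + j + k ≤ m.N) :
    pairing Φ (fieldTerm m.μ m.S m.b k m.g e2 (fieldTerm m.μ m.S m.a j m.f e1 Ψ)) =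
      conj (pairing Ψ (fieldTerm m.μ m.S m.star.a j m.star.f e1 (fieldTerm m.μ m.S m.star.b k m.star.g e2 Φ))) := by
  have h1 := pairing_eq_sum h.swap (j := k) (k := j) h20 h21 h10 h11 (by change n0 + k + j ≤ m.N; omega)
  have h2 := pairing_eq_sum h.star (j := j) (k := k) h10 h11 h20 h21 hN
  refine h1.trans (Eq.trans ?_ (congrArg conj h2).symm)
  have e : ∀ (m : Model) {Φ Ψ : FockFn} (_ : m.Represents Φ Ψ n0) (e1 e2 : ℝ) (j k : ℕ),
      ∑ v ∈ countsAB n0 j k, m.T (fun _ => 0) true e1 e2 v =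
        ∑ v ∈ (countsAB n0 j k).filter fun v => v .eB + v .et + v .nu ≤ n0, m.T (fun _ => 0) true e1 e2 v :=
    fun m Φ Ψ h e1 e2 j k => (Finset.sum_filter_of_ne fun v _ hv => by
      by_contra hc; exact hv (T_eq_zero h (not_le.1 hc))).symm
  rw [e _ h.swap, e _ h.star, map_sum]
  refine sum_nbij' (fun v b => v (adjRole b)) (fun v b => v (adjRole b)) ?_ ?_ ?_ ?_ ?_
  iterate 2
    intro v hv; rw [mem_filter, mem_countsAB] at hv ⊢; simp only [adjRole]; omega
  iterate 2 exact fun v _ => funext fun b => congrArg v (adjRole_involutive b)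
  intro v hv; rw [mem_filter, mem_countsAB] at hv
  rw [conj_T_star m (by exact hv.1.1) (by exact hv.1.2.1)]; congr 1
  exact funext fun b => congrArg v (adjRole_involutive b).symm

theorem hasProductElement_swap {Φ Ψ : FockFn} {n0 : ℕ} (h : m.Represents Φ Ψ n0) {ρ : ℝ} (hρ0 : 0 ≤ ρ) (hρ1 : ρ ≤ m.s)
    (hρ : ρ = 0 ∨ RightOf m.f m.g) {j k : ℕ} (hN : n0 + j + k ≤ m.N) :
    HasProductElement m.μ m.S m.b m.a m.g m.f Φ Ψ k j
      (conj (∑ v ∈ countsAB n0 j k, m.star.T (m.levels ρ) true 0 0 v)) := by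
  have h1 := (continuous_conj.tendsto _).comp ((hasProductElement h.star hρ0 hρ1 (hρ.imp id RightOf.conj) hN).comp
    tendsto_prod_swap)
  refine h1.congr' ?_; have h2 : ∀ᶠ e : ℝ in 𝓝[>] 0, 0 < e ∧ e ≤ m.s := Ioc_mem_nhdsGT m.s_pos
  filter_upwards [h2.prod_mk h2] with e he
  exact (pairing_swap h he.2.1 he.2.2 he.1.1 he.1.2 hN).symm

/-! ### Crossing -/

theorem psum_add_pi (μ : ℝ) (L : List ℂ) : psum μ (L.map fun z => z + π * I) = -psum μ L := by
  induction L with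
  | nil => simp [psum_nil]
  | cons z L ih =>
    rw [map_cons, psum_cons, psum_cons, ih, neg_add, cosh_add, sinh_add, cosh_mul_I,
      sinh_mul_I, cos_pi, sin_pi]
    simp

/-- Under `starList` the arguments of `a` become the conjugates of `th`, followed by those of `et`
and `H` lowered by `iπ`. Rotation brings the latter to the front, raised by `iπ`: this is the
alternative order of `aSym` for the crossed roles, with `conj z + iπ` in place of each contracted
`z`. In `b` the shift of the contracted variables cancels the `-iπ` of creation arguments. -/
theorem W_false_eq_conj (hR : Rotates m.a m.δ m.N) {C D : Config ℂ}
    (ha : (symEval 𝟎 (aSym true C)).Pairwise (RegRel m.δ)) (hlen : ∑ b, (C b).length ≤ m.N)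
    (him : ∀ b, ∀ z ∈ C b, |z.im| < m.δ / 2) (hCL : C .L = []) (hCQ : C .Q = []) (hDL : D .L = []) (hDQ : D .Q = [])
    (hth : D .th = (C .et).map conj) (het : D .et = (C .th).map conj)
    (hH : D .H = (C .H).reverse.map fun z => conj z + π * I) (hP : D .P = (C .eB).reverse.map conj)
    (heB : D .eB = (C .P).reverse.map conj) (hnu : D .nu = (C .nu).map conj) :
    m.W false 𝟎 𝟎 D = conj (m.star.W true 𝟎 𝟎 C) := by
  rw [sum_role] at hlen; have hpi : ∀ z : ℂ, conj (z - π * I) - π * I = conj z := fun z => by simp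
  have ea : onList m.a (starList (symEval 𝟎 (aSym true C))) =
      onList m.a (symEval 𝟎 (aSym false D)) := by
    have e : starList (symEval 𝟎 (aSym true C)) =
        (C .th).map conj ++ ((C .et).reverse.map conj ++ (C .H).map conj).map fun z => z - π * I := by
      simp [symEval_aSym_true, starList, hCL, comp_def]
    have hp := starList_pairwise (fun _ _ => regRel_conj) ha
    rw [e] at hp ⊢; rw [hR _ _ (by simp; omega) _ _ hp]
    · simp [symEval_aSym_false, hDL, hth, het, hH, comp_def]
    all_goals
      intro z hz; simp only [mem_append, mem_map, mem_reverse] at hz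
    · rcases hz with ⟨w, hw, rfl⟩ | ⟨w, hw, rfl⟩ <;> simpa using him _ w hw
    · obtain ⟨w, hw, rfl⟩ := hz; simpa using him _ w hw
  have eb : starList (symEval 𝟎 (bSym C)) = symEval 𝟎 (bSym D) := by
    simp [symEval_bSym, starList, hCL, hCQ, hDL, hDQ, heB, hP, hH, comp_def]
  have es : m.smears D = conj (m.star.smears C) := by
    rw [smears, smears, map_mul]
    change _ = conj (smearC (fun x => conj (m.f x)) _) * conj (smearC (fun x => conj (m.g x)) _)
    have hHs : psum m.μ ((C .H).reverse.map fun z => conj z + π * I) =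
        (-conj (psum m.μ (C .H)).1, -conj (psum m.μ (C .H)).2) := by
      have := psum_add_pi m.μ ((C .H).map conj); rw [psum_perm m.μ ((reverse_perm (C .H)).map _)]
      simpa [psum_map_conj, comp_def] using this
    have hrev : ∀ L : List ℂ, psum m.μ (L.reverse.map conj) = (conj (psum m.μ L).1, conj (psum m.μ L).2) := fun L => by
      rw [psum_perm m.μ ((reverse_perm L).map _), psum_map_conj]
    simp only [conj_smearC, hCL, hCQ, hDL, hDQ, hH, hth, het, hP, heB, append_nil, psum_map_conj, hHs, hrev]
    congr 2 <;> ext <;> simp [star] <;> ring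
  have ev : m.vecs D = conj (m.star.vecs C) := by
    simp [vecs, star, conjFn, hth, het, hP, heB, hnu, hCQ, hDQ, mul_comm, comp_def]
  rw [W, W, map_mul, map_mul, map_mul, map_mul, es, ev]
  change _ = _ * conj (onList (starCoef m.a) _) * conj (onList (starCoef m.b) _) * conj (sProd m.S _ _) * _
  rw [onList_starCoef, onList_starCoef, conj_conj, conj_conj, ea, eb, hCQ, hDQ]; simp [sProd]

theorem W_true_eq_false (hR : Rotates m.a m.δ m.N) {C : Config ℂ}
    (ha : (symEval 𝟎 (aSym true C)).Pairwise (RegRel m.δ)) (hlen : ∑ b, (C b).length ≤ m.N)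
    (him : ∀ b, ∀ z ∈ C b, |z.im| < m.δ / 2) :
    m.W true 𝟎 𝟎 C = m.W false 𝟎 𝟎 C := by
  rw [sum_role] at hlen; have e : symEval 𝟎 (aSym true C) =
      ((C .H).reverse ++ (C .L ++ C .et)) ++ (C .th).reverse.map fun z => z - π * I := by
    simp [symEval_aSym_true]
  rw [e] at ha
  rw [W, W, e, hR _ _ (by simp; omega) (fun z hz => him .th z (by simpa using hz)) (fun z hz => ?_) ha, symEval_aSym_false]
  simp only [mem_append, mem_reverse] at hz; rcases hz with hz | hz | hz <;> exact him _ z hz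

/-- The levels of the variables after the crossing of the contracted ones. -/
def crossLevels (m : Model) : Role → ℝ
  | .H => π - 3 * m.s
  | .th => m.s
  | .P => m.s
  | .et => -(2 * m.s)
  | .eB => -(2 * m.s)
  | b => m.levels m.s b

/-- In the alternative order the contracted variables move in the gap between the annihilators `et`
and the arguments `th + iπ`, where the pole distance is kept. Creators and annihilators descend
together by `s`, which preserves their mutual gap and leads to the mirror image of the standard
levels. -/
theorem adm_crossLevels (hr : RightOf m.f m.g) {y : ℝ} (hy0 : 0 ≤ y) (hy1 : y ≤ 1) {C : Config ℂ}
    (hC : ∀ b, ∀ z ∈ C b, z.im = m.levels m.s b + y * (m.crossLevels b - m.levels m.s b)) (hL : C .L = [])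
    (hQ : C .Q = []) (hlen : ∑ b, (C b).length ≤ m.N) :
    m.Adm (CoshRel m.δ (Real.sin (m.s / 2))) false 𝟎 𝟎 C := by
  obtain ⟨hs, hs1, hδ, hpi⟩ := m.s_facts; have h1 : 0 ≤ y * m.s := by positivity
  have h2 : y * m.s ≤ m.s := by nlinarith
  have h3 : 0 ≤ y * (π - 5 * m.s) := mul_nonneg hy0 (by linarith)
  have h4 : y * (π - 5 * m.s) ≤ π - 5 * m.s := mul_le_of_le_one_left (by linarith) hy1
  have hH : ∀ z ∈ C .H, z.im = 3 * m.s + y * (π - 3 * m.s - 3 * m.s) := hC .H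
  have hth : ∀ z ∈ C .th, z.im = 2 * m.s + y * (m.s - 2 * m.s) := hC .th
  have hP : ∀ z ∈ C .P, z.im = 2 * m.s + y * (m.s - 2 * m.s) := hC .P
  have het : ∀ z ∈ C .et, z.im = -m.s + y * (-(2 * m.s) - -m.s) := hC .et
  have heB : ∀ z ∈ C .eB, z.im = -m.s + y * (-(2 * m.s) - -m.s) := hC .eB
  refine ⟨hlen, pairwise_aSym_false ?_ ?_ ?_ ?_ ?_ ?_, ?_, by simp [hQ], ?_, ?_⟩
  rotate_left 6
  rw [symEval_bSym, hL, hQ, reverse_nil, nil_append, nil_append, map_append, pairwise_append,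
    pairwise_append]
  refine ⟨pairwise_map_of_all _ ?_, ⟨pairwise_map_of_all _ ?_, pairwise_map_of_all _ ?_, ?_⟩, ?_⟩
  rotate_right 6
  iterate 11
    · try simp only [hL, nil_append]
      intro x hx z hz
      try rcases mem_append.1 hz with hz | hz
      all_goals try (obtain ⟨x, h, rfl⟩ := mem_map.1 hx; replace hx := h)
      all_goals try (obtain ⟨z, h, rfl⟩ := mem_map.1 hz; replace hz := h)
      all_goals
        first | have := hH x hx | have := hth x hx | have := het x hx | have := heB x hx | have := hP x hx
        first | have := hH z hz | have := hth z hz | have := het z hz | have := heB z hz | have := hP z hz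
        first
        | apply coshRel_of_le <;> simp <;> linarith
        | apply coshRel_of_ge <;> simp <;> linarith
  · intro r g1 g2 z hz; rw [abs_lt, hC r z hz]
    cases r <;> simp only [levels, crossLevels] at g1 ⊢ <;> first | exact absurd rfl g1 | constructor <;> linarith
  · rw [hL, append_nil]; refine Or.inr ⟨hr, 3 * m.s + y * (π - 3 * m.s - 3 * m.s), fun z hz => ?_⟩
    rw [hH z hz]; exact ⟨by linarith, by linarith, by simp⟩

theorem abs_im_lt_of_mem_lift {E : Config ℝ} {b : Role} {z : ℂ} (hz : z ∈ lift (m.levels m.s) E b) :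
    |z.im| < m.δ / 2 := by
  have hs := m.s_pos; have hδ := m.δ_eq; rw [mem_lift_im hz, abs_lt]
  cases b <;> simp only [levels] <;> constructor <;> linarith

theorem W_crossLevels (hR : Rotates m.a m.δ m.N) (hr : RightOf m.f m.g) {E : Config ℝ} (hL : E .L = []) (hQ : E .Q = [])
    (hlen : ∑ b, (E b).length ≤ m.N) :
    m.W false 𝟎 𝟎 (lift m.crossLevels (revRole .eB (revRole .P (revRole .H E)))) =
      conj (m.star.W true 𝟎 𝟎 (lift (m.levels m.s) fun b => E (crossRole b))) := by
  have hlen' : ∑ b, (lift (m.levels m.s) (fun b => E (crossRole b)) b).length ≤ m.N := by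
    have := Equiv.sum_comp crossRole_involutive.toPerm fun b => (E b).length
    simp only [lift, length_map]; exact this.trans_le hlen
  have ha := (adm_cross_levels (m := m.star) hr.conj (C := lift (m.levels m.s) fun b => E (crossRole b))
    (fun b z hz => mem_lift_im hz) hlen').reg m.sin_s_pos |>.a
  refine W_false_eq_conj hR ha hlen' (fun b z => abs_im_lt_of_mem_lift) ?_ ?_ ?_ ?_ ?_ ?_ ?_ ?_ ?_ ?_ <;>
    simp [lift, revRole, crossRole, levels, crossLevels, hL, hQ, conj_ofNat, comp_def]
  intro z _; ring

/-- Rotation of the creators of `a`, the shift of the contracted variables to `π - 3s`, and the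
reversal of the variables `H`, `P` and `eB` lead to the mirror configuration. Crossing exchanges
`th` with `et` and `P` with `eB`. -/
theorem T_eq_conj (hR : Rotates m.a m.δ m.N) (hr : RightOf m.f m.g) {v : Role → ℕ} (hL : v .L = 0) (hQ : v .Q = 0)
    (hN : ∑ b, v b ≤ m.N) : m.T (m.levels m.s) true 0 0 v =
      conj (m.star.T (m.levels m.s) true 0 0 fun b => v (crossRole b)) := by
  have hsin : 0 < Real.sin (m.s / 2) := m.sin_s_pos
  have h1 : wint (word v) (m.levels m.s) (m.W true 𝟎 𝟎) =
      wint (word v) (m.levels m.s) (m.W false 𝟎 𝟎) := rint_congr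
    (F := fun C => m.W true 𝟎 𝟎 (lift (m.levels m.s) C))
    (G := fun C => m.W false 𝟎 𝟎 (lift (m.levels m.s) C)) fun t => W_true_eq_false hR
      ((adm_cross_levels hr (fun b z hz => mem_lift_im hz) (lift_len hN t)).reg hsin).a (lift_len hN t)
      fun b z => abs_im_lt_of_mem_lift
  have h2 : wint (word v) (m.levels m.s) (m.W false 𝟎 𝟎) =
      wint (word v) m.crossLevels (m.W false 𝟎 𝟎) :=
    wint_shift hsin fun y hy0 hy1 t => adm_crossLevels hr hy0 hy1 (fun b z hz => mem_lift_im hz)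
      (lift_nil hL t) (lift_nil hQ t) (lift_len hN t)
  have h3 : ∀ F : Config ℝ → ℂ, rint (word v) F =
      rint (word v) fun E => F (revRole .eB (revRole .P (revRole .H E))) := fun F =>
    ((rint_rev .H (word v) fun E => F (revRole .eB (revRole .P E))).trans
      ((rint_rev .P (word v) fun E => F (revRole .eB E)).trans (rint_rev .eB (word v) F))).symm
  have hp : ∏ b, ((v (crossRole b)).factorial : ℂ) = ∏ b, ((v b).factorial : ℂ) :=
    Equiv.prod_comp crossRole_involutive.toPerm fun b => ((v b).factorial : ℂ)
  have h4 : conj (∏ b, ((v b).factorial : ℂ))⁻¹ = (∏ b, ((v b).factorial : ℂ))⁻¹ := by simp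
  rw [T, T, h1, h2, map_mul, hp, h4, wint_eq_rint, wint_eq_rint, conj_rint, rint_word_comp crossRole_involutive, h3]
  have hnil : ∀ {b : Role} (t : Fin (word v).length → ℝ), v b = 0 → config (word v) t b = [] := fun t h =>
    map_eq_nil_iff.1 (lift_nil (lev := m.levels m.s) h t)
  exact congrArg _ (rint_congr fun t => W_crossLevels hR hr (hnil t hL) (hnil t hQ) (by rwa [length_config, length_word]))

theorem mem_countsH_cross {n0 k : ℕ} {v : Role → ℕ} (h : v ∈ countsH n0 k) : (fun b => v (crossRole b)) ∈ countsH n0 k := by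
  rw [mem_countsH] at h ⊢; simp only [crossRole]; omega

/-- Exchange of levels for the given fields, crossing term by term, and exchange of levels in the
opposite direction for the adjoint fields. -/
theorem sum_T_cross (hR : Rotates m.a m.δ m.N) (hr : RightOf m.f m.g) {n0 k : ℕ} (hN : 2 * n0 + k ≤ m.N) :
    ∑ v ∈ countsL n0 k, m.T (m.levels m.s) true 0 0 v = conj (∑ v ∈ countsL n0 k, m.star.T (m.levels m.s) true 0 0 v) := by
  rw [sum_T_flip hr hN]
  refine Eq.trans ?_ (congrArg conj (sum_T_flip (m := m.star) hr.conj hN).symm); rw [map_sum]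
  refine sum_nbij' (fun v b => v (crossRole b)) (fun v b => v (crossRole b)) (fun v => mem_countsH_cross)
    (fun v => mem_countsH_cross) (fun v _ => funext fun b => congrArg v (crossRole_involutive b))
    (fun v _ => funext fun b => congrArg v (crossRole_involutive b)) fun v hv => ?_
  rw [mem_countsH] at hv; exact T_eq_conj hR hr (by omega) (by omega) (by rw [sum_role]; omega)

end Model

/-! ### Locality -/

section

variable {μ : ℝ} {S : ℂ → ℂ} {a b : Coefficients} {f g : ℝ × ℝ → ℂ} {Φ Ψ : FockFn}

/-- The bound `n0` on the particle numbers is fixed before `N` and the test functions. The order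
`N`, on which the widths of the analyticity domains depend, can therefore be chosen after `n0`, `j`
and `k`. -/
theorem exists_model (hμ : 0 < μ) (hS : IsScatteringFunction S) (ha : IsLocalCoefficients S a)
    (hb : IsLocalCoefficients S b) (hΦ : IsTestVector S Φ) (hΨ : IsTestVector S Ψ) :
    ∃ n0 : ℕ, ∀ N : ℕ, ∀ f g : ℝ × ℝ → ℂ, IsTestFunction f → IsTestFunction g → ∃ m : Model, m.μ = μ ∧ m.S = S ∧
      m.a = a ∧ m.b = b ∧ m.f = f ∧ m.g = g ∧ N ≤ m.N ∧ Rotates m.a m.δ m.N ∧ m.Represents Φ Ψ n0 := by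
  obtain ⟨δ0, B, hs⟩ := hS.exists_stripS
  obtain ⟨κ1, N1, φ, hκ1, hφ, hφr, -⟩ := hΦ.exists_vecData hs
  obtain ⟨κ2, N2, ψ, hκ2, hψ, hψr, -⟩ := hΨ.exists_vecData hs
  refine ⟨max N1 N2, fun N f g hf hg => ?_⟩
  obtain ⟨δ1, h1, hδ1, hca, hra⟩ := exists_coefData hs ha (max N (max N1 N2))
  obtain ⟨δ2, h2, -, hcb, -⟩ := exists_coefData hs hb (max N (max N1 N2))
  obtain ⟨δ, hδ, g1, g2, g3, g₄⟩ : ∃ δ, 0 < δ ∧ δ ≤ δ1 ∧ δ ≤ δ2 ∧ δ / 2 ≤ κ1 ∧ δ / 2 ≤ κ2 :=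
    ⟨min (min δ1 δ2) (min κ1 κ2), lt_min (lt_min h1 h2) (lt_min hκ1 hκ2), (min_le_left _ _).trans (min_le_left _ _),
      (min_le_left _ _).trans (min_le_right _ _),
      (half_le_self (lt_min (lt_min h1 h2) (lt_min hκ1 hκ2)).le).trans ((min_le_right _ _).trans (min_le_left _ _)),
      (half_le_self (lt_min (lt_min h1 h2) (lt_min hκ1 hκ2)).le).trans ((min_le_right _ _).trans (min_le_right _ _))⟩
  exact ⟨⟨μ, S, a, b, f, g, φ, ψ, δ, B, max N (max N1 N2), hμ, hs.mono hδ (g1.trans hδ1), hca.mono g1, hcb.mono g2, hf, hg,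
      hφ.mono g3 (by omega), hψ.mono g₄ (by omega)⟩, rfl, rfl, rfl, rfl, rfl, rfl, le_max_left _ _, hra.mono g1,
    hφr, hψr, fun L hL => hφ.zero L (by omega), fun L hL => hψ.zero L (by omega)⟩

theorem exists_hasProductElement (hμ : 0 < μ) (hS : IsScatteringFunction S) (ha : IsLocalCoefficients S a)
    (hb : IsLocalCoefficients S b) (hf : IsTestFunction f) (hg : IsTestFunction g) (hΦ : IsTestVector S Φ)
    (hΨ : IsTestVector S Ψ) (j k : ℕ) : ∃ z, HasProductElement μ S a b f g Φ Ψ j k z := by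
  obtain ⟨n0, h⟩ := exists_model hμ hS ha hb hΦ hΨ
  obtain ⟨m, rfl, rfl, rfl, rfl, rfl, rfl, hN, -, hm⟩ := h (n0 + j + k) f g hf hg
  exact ⟨_, Model.hasProductElement hm le_rfl m.s_pos.le (Or.inl rfl) hN⟩

/-- Locality as an identity of formal series, with finitely many nonzero terms. -/
theorem tsum_productElement (hμ : 0 < μ) (hS : IsScatteringFunction S) (ha : IsLocalCoefficients S a)
    (hb : IsLocalCoefficients S b) (hf : IsTestFunction f) (hg : IsTestFunction g) (hΦ : IsTestVector S Φ)
    (hΨ : IsTestVector S Ψ) (hr : RightOf f g) (k : ℕ) : ∑' j : ℕ, productElement μ S a b f g Φ Ψ j k =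
      ∑' j : ℕ, productElement μ S b a g f Φ Ψ k j := by
  obtain ⟨n0, h⟩ := exists_model hμ hS ha hb hΦ hΨ
  -- For such `j` every configuration has more than `n0` particles in the right vector. No single
  -- model covers all `j`, so a separate one is taken for each.
  have h0 : ∀ j ∉ range (2 * n0 + k + 1), productElement μ S a b f g Φ Ψ j k = 0 ∧
      productElement μ S b a g f Φ Ψ k j = 0 := by
    intro j hj; obtain ⟨m, rfl, rfl, rfl, rfl, rfl, rfl, hN, -, hm⟩ := h (n0 + j + k) f g hf hg
    rw [mem_range] at hj
    have hv : ∀ v ∈ countsAB n0 j k, n0 < v .eB + v .et + v .nu := fun v hv => by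
      rw [mem_countsAB] at hv; omega
    rw [(Model.hasProductElement hm le_rfl m.s_pos.le (Or.inl rfl) hN).eq,
      (Model.hasProductElement_swap hm le_rfl m.s_pos.le (Or.inl rfl) hN).eq,
      sum_eq_zero fun v h => Model.T_eq_zero hm (hv v h),
      sum_eq_zero fun v h => Model.T_eq_zero hm.star (hv v h), map_zero]
    exact ⟨rfl, rfl⟩
  rw [tsum_eq_sum fun j hj => (h0 j hj).1, tsum_eq_sum fun j hj => (h0 j hj).2]
  clear h0
  -- The remaining orders `j ≤ 2 n0 + k` are finitely many and share one model, as is necessary for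
  -- exchanging terms between them.
  obtain ⟨m, rfl, rfl, rfl, rfl, rfl, rfl, hN, hR, hm⟩ := h (n0 + (2 * n0 + k) + k) f g hf hg
  have e := Model.sum_T_cross hR hr (n0 := n0) (k := k) (by omega)
  rw [← Model.sum_countsAB_eq hm] at e; refine Eq.trans (sum_congr rfl fun j hj => ?_) (e.trans ?_)
  · rw [mem_range] at hj
    exact (Model.hasProductElement hm m.s_pos.le le_rfl (Or.inr hr) (by omega)).eq
  · refine (congrArg conj (Model.sum_countsAB_eq hm.star m.s k).symm).trans ?_; rw [map_sum]
    refine sum_congr rfl fun j hj => ?_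
    rw [mem_range] at hj
    exact (Model.hasProductElement_swap hm m.s_pos.le le_rfl (Or.inr hr) (by omega)).eq.symm

/-! ### Linearity in the test functions -/

theorem smearC_sum {ι : Type} (s : Finset ι) {F : ι → ℝ × ℝ → ℂ} (hF : ∀ i, IsTestFunction (F i)) (P : ℂ × ℂ) :
    smearC (fun x => ∑ i ∈ s, F i x) P = ∑ i ∈ s, smearC (F i) P := by
  simp only [smearC, sum_mul]; refine integral_finsetSum _ fun i _ => ?_
  exact Continuous.integrable_of_hasCompactSupport ((hF i).1.continuous.mul (by fun_prop)) (hF i).2.mul_right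

/-- The model with other test functions. -/
def Model.withTest (m : Model) {f g : ℝ × ℝ → ℂ} (hf : IsTestFunction f) (hg : IsTestFunction g) : Model :=
  { m with f := f, g := g, hf := hf, hg := hg }

theorem Model.T_sum (m : Model) {ι κ : Type} (s : Finset ι) (t : Finset κ) {F : ι → ℝ × ℝ → ℂ} {G : κ → ℝ × ℝ → ℂ}
    (hF : ∀ i, IsTestFunction (F i)) (hG : ∀ i, IsTestFunction (G i)) (hf : m.f = fun x => ∑ i ∈ s, F i x)
    (hg : m.g = fun x => ∑ i ∈ t, G i x) {v : Role → ℕ} (hH : v .H = 0) (hN : ∑ b, v b ≤ m.N) :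
    m.T (m.levels 0) true 0 0 v = ∑ i ∈ s, ∑ l ∈ t, (m.withTest (hF i) (hG l)).T (m.levels 0) true 0 0 v := by
  have hInt : ∀ i l, Integrable fun u => (m.withTest (hF i) (hG l)).W true 𝟎 𝟎
      (lift (m.levels 0) (config (word v) u)) := fun i l => by
    refine integrable_W (m := m.withTest (hF i) (hG l)) m.sin_s_pos fun u => ?_
    exact adm_levels (m.withTest (hF i) (hG l)) le_rfl m.s_pos.le (Or.inl rfl) zero_le_one le_rfl m.s_pos le_rfl
      m.s_pos.le le_rfl m.s_pos.le (by change m.s ≤ 2 * 0 + 1 * m.s; linarith)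
      (by change m.s ≤ 2 * 0 + 1 * m.s; linarith) (fun b z hz => by rw [mem_lift_im hz, one_mul]; rfl) (lift_nil hH u)
      (lift_len (m := m) hN u)
  have hW : ∀ C, m.W true 𝟎 𝟎 C =
      ∑ i ∈ s, ∑ l ∈ t, (m.withTest (hF i) (hG l)).W true 𝟎 𝟎 C := fun C => by
    simp only [W, smears]; rw [hf, hg, smearC_sum s hF, smearC_sum t hG, Finset.sum_mul_sum]
    simp only [sum_mul]; rfl
  simp only [T, wint, hW]
  rw [integral_finsetSum _ fun i _ => integrable_finsetSum _ fun l _ => hInt i l]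
  simp only [mul_sum]; refine sum_congr rfl fun i _ => ?_
  rw [integral_finsetSum _ fun l _ => hInt i l]
  simp only [mul_sum]

/-- The contraction level `0` is admissible for all test functions, so one choice of domains and
levels represents the matrix elements of all pieces, and these are integrals linear in each test
function. -/
theorem productElement_sum (hμ : 0 < μ) (hS : IsScatteringFunction S) (ha : IsLocalCoefficients S a)
    (hb : IsLocalCoefficients S b) {ι κ : Type} (s : Finset ι) (t : Finset κ) {F : ι → ℝ × ℝ → ℂ} {G : κ → ℝ × ℝ → ℂ}
    (hF : ∀ i, IsTestFunction (F i)) (hG : ∀ i, IsTestFunction (G i)) (hf : IsTestFunction f) (hg : IsTestFunction g)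
    (ef : f = fun x => ∑ i ∈ s, F i x) (eg : g = fun x => ∑ i ∈ t, G i x) (hΦ : IsTestVector S Φ)
    (hΨ : IsTestVector S Ψ) (j k : ℕ) : productElement μ S a b f g Φ Ψ j k =
      ∑ i ∈ s, ∑ l ∈ t, productElement μ S a b (F i) (G l) Φ Ψ j k := by
  obtain ⟨n0, h⟩ := exists_model hμ hS ha hb hΦ hΨ
  obtain ⟨m, rfl, rfl, rfl, rfl, rfl, rfl, hN, -, hm⟩ := h (n0 + j + k) f g hf hg
  have e : ∀ i l, productElement m.μ m.S m.a m.b (F i) (G l) Φ Ψ j k =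
      ∑ v ∈ countsAB n0 j k, (m.withTest (hF i) (hG l)).T (m.levels 0) true 0 0 v := fun i l =>
    (Model.hasProductElement (m := m.withTest (hF i) (hG l)) (Φ := Φ) (Ψ := Ψ) ⟨hm.left, hm.right, hm.left_zero,
      hm.right_zero⟩ le_rfl m.s_pos.le (Or.inl rfl) hN).eq
  rw [(Model.hasProductElement hm le_rfl m.s_pos.le (Or.inl rfl) hN).eq]; simp only [e]
  rw [sum_congr rfl fun v hv => m.T_sum s t hF hG ef eg (v := v) ?_ ?_, sum_comm]
  · exact sum_congr rfl fun i _ => sum_comm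
  all_goals rw [mem_countsAB] at hv
  · exact hv.2.1
  · rw [sum_role]; omega

end

/-! ### Localization of the test functions -/

theorem IsTestFunction.exists_decomposition {f : ℝ × ℝ → ℂ} (hf : IsTestFunction f) {r : ℝ} (hr : 0 < r) :
    ∃ (t : Finset (ℝ × ℝ)) (F : t → ℝ × ℝ → ℂ), (∀ i, IsTestFunction (F i)) ∧
      (∀ i, tsupport (F i) ⊆ tsupport f) ∧ (∀ i, ∀ x ∈ tsupport (F i), ∀ y ∈ tsupport (F i), dist x y < r) ∧
      f = fun x => ∑ i, F i x := by
  obtain ⟨t, -, ht⟩ := hf.2.isCompact.elim_nhds_subcover (fun x => Metric.ball x (r / 2)) fun x _ =>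
    Metric.ball_mem_nhds x (half_pos hr)
  obtain ⟨ρ, hρ⟩ := SmoothPartitionOfUnity.exists_isSubordinate (modelWithCornersSelf ℝ (ℝ × ℝ)) (isClosed_tsupport f)
    (fun i : t => Metric.ball (i : ℝ × ℝ) (r / 2)) (fun _ => Metric.isOpen_ball) fun x hx => by
      simpa using ht hx
  have hsub : ∀ i, tsupport (fun x => (ρ i x : ℂ) * f x) ⊆ tsupport (ρ i) ∩ tsupport f := fun i => by
    refine fun x hx => ⟨?_, tsupport_mul_subset_right hx⟩
    have := tsupport_mul_subset_left hx; refine closure_mono (fun y hy => ?_) this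
    simpa using hy
  refine ⟨t, fun i x => (ρ i x : ℂ) * f x, fun i => ⟨?_, hf.2.mul_left⟩, fun i x hx => (hsub i hx).2,
    fun i x hx y hy => ?_, ?_⟩
  · exact (ofRealCLM.contDiff.comp (ρ i).contMDiff.contDiff).mul hf.1
  · have h1 := hρ i (hsub i hx).1; have h2 := hρ i (hsub i hy).1; rw [Metric.mem_ball] at h1 h2
    linarith [dist_triangle_right x y (i : ℝ × ℝ)]
  · funext x; rw [← sum_mul]
    by_cases hx : x ∈ tsupport f
    · have := ρ.sum_eq_one hx; rw [finsum_eq_sum_of_fintype] at this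
      rw [← ofReal_sum, this, ofReal_one, one_mul]
    · rw [image_eq_zero_of_notMem_tsupport hx, mul_zero]

/-- In two dimensions spacelike separation means right or left separation, two open conditions that
cover the compact product of the supports. The radius is a Lebesgue number of this cover. -/
theorem SpacelikeSeparated.exists_radius {f g : ℝ × ℝ → ℂ} (hf : IsTestFunction f) (hg : IsTestFunction g)
    (h : SpacelikeSeparated f g) : ∃ r > 0, ∀ F G : ℝ × ℝ → ℂ, tsupport F ⊆ tsupport f → tsupport G ⊆ tsupport g →
      (∀ x ∈ tsupport F, ∀ y ∈ tsupport F, dist x y < r) → (∀ x ∈ tsupport G, ∀ y ∈ tsupport G, dist x y < r) →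
      RightOf F G ∨ RightOf G F := by
  obtain ⟨r, hr, hb⟩ := lebesgue_number_lemma_of_metric (hf.2.isCompact.prod hg.2.isCompact)
    (c := fun b : Bool => {p : (ℝ × ℝ) × ℝ × ℝ | |p.1.1 - p.2.1| < if b then p.1.2 - p.2.2 else p.2.2 - p.1.2})
    (fun b => by cases b <;> exact isOpen_lt (by fun_prop) (by simp; fun_prop)) (fun p hp => by
      have := h p.1 hp.1 p.2 hp.2
      have h1 : |p.1.1 - p.2.1| < |p.1.2 - p.2.2| := sq_lt_sq.1 (by linarith); rw [mem_iUnion]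
      rcases lt_abs.1 h1 with h2 | h2
      · exact ⟨true, h2⟩
      · exact ⟨false, by simpa using h2⟩)
  refine ⟨r, hr, fun F G hF hG h1 h2 => ?_⟩
  rcases (tsupport F).eq_empty_or_nonempty with h0 | ⟨x0, hx0⟩
  · exact Or.inl fun x hx => by simp [h0] at hx
  rcases (tsupport G).eq_empty_or_nonempty with h0 | ⟨y0, hy0⟩
  · exact Or.inl fun x hx y hy => by simp [h0] at hy
  obtain ⟨b, hb⟩ := hb (x0, y0) ⟨hF hx0, hG hy0⟩
  have key : ∀ x ∈ tsupport F, ∀ y ∈ tsupport G, |x.1 - y.1| < if b then x.2 - y.2 else y.2 - x.2 := fun x hx y hy =>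
    hb (show (x, y) ∈ _ from by
      rw [Metric.mem_ball, Prod.dist_eq]; exact max_lt (h1 x hx x0 hx0) (h2 y hy y0 hy0))
  cases b
  · exact Or.inr fun y hy x hx => by simpa [abs_sub_comm] using key x hx y hy
  · exact Or.inl fun x hx y hy => by simpa using key x hx y hy

theorem SpacelikeSeparated.mono {f g F G : ℝ × ℝ → ℂ} (h : SpacelikeSeparated f g) (hF : tsupport F ⊆ tsupport f)
    (hG : tsupport G ⊆ tsupport g) : SpacelikeSeparated F G := fun x hx y hy => h x (hF hx) y (hG hy)

/-- Summability is assumed for all spacelike separated test functions, hence also for the pieces of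
a fine decomposition. For each pair of pieces one lies to the right of the other, which decides
whether the sum over `j` or the sum over `k` is done first; absolute convergence permits either. -/
theorem tsum_tsum_productElement {μ : ℝ} (hμ : 0 < μ) {S : ℂ → ℂ} (hS : IsScatteringFunction S) {a b : Coefficients}
    (ha : IsLocalCoefficients S a) (hb : IsLocalCoefficients S b) {Φ Ψ : FockFn} (hΦ : IsTestVector S Φ)
    (hΨ : IsTestVector S Ψ)
    (hsum : ∀ f g : ℝ × ℝ → ℂ, IsTestFunction f → IsTestFunction g → SpacelikeSeparated f g →
      Summable (fun q : ℕ × ℕ => productElement μ S a b f g Φ Ψ q.1 q.2) ∧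
        Summable (fun q : ℕ × ℕ => productElement μ S b a g f Φ Ψ q.2 q.1))
    {f g : ℝ × ℝ → ℂ} (hf : IsTestFunction f) (hg : IsTestFunction g) (hfg : SpacelikeSeparated f g) :
    ∑' q : ℕ × ℕ, productElement μ S a b f g Φ Ψ q.1 q.2 = ∑' q : ℕ × ℕ, productElement μ S b a g f Φ Ψ q.2 q.1 := by
  obtain ⟨r, hr, hsep⟩ := hfg.exists_radius hf hg
  obtain ⟨t, F, hF, hFf, hFr, ef⟩ := hf.exists_decomposition hr
  obtain ⟨u, G, hG, hGg, hGr, eg⟩ := hg.exists_decomposition hr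
  have hs := fun i l => hsum _ _ (hF i) (hG l) (hfg.mono (hFf i) (hGg l))
  simp only [productElement_sum hμ hS ha hb _ _ hF hG hf hg ef eg hΦ hΨ,
    productElement_sum hμ hS hb ha _ _ hG hF hg hf eg ef hΦ hΨ]
  rw [Summable.tsum_finsetSum fun i _ => summable_sum fun l _ => (hs i l).1,
    Summable.tsum_finsetSum fun l _ => summable_sum fun i _ => (hs i l).2]
  simp only [Summable.tsum_finsetSum fun l _ => (hs _ l).1, Summable.tsum_finsetSum fun i _ => (hs i _).2]
  rw [sum_comm]; refine sum_congr rfl fun l _ => sum_congr rfl fun i _ => ?_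
  obtain ⟨h1, h2⟩ := hs i l; rcases hsep _ _ (hFf i) (hGg l) (hFr i) (hGr l) with h | h
  · refine ((Equiv.prodComm ℕ ℕ).tsum_eq _).symm.trans (Eq.trans ?_ ((Equiv.prodComm ℕ ℕ).tsum_eq _))
    refine ((Equiv.prodComm ℕ ℕ).summable_iff.2 h1).tsum_prod.trans (Eq.trans (tsum_congr fun k => ?_)
      ((Equiv.prodComm ℕ ℕ).summable_iff.2 h2).tsum_prod.symm)
    exact tsum_productElement hμ hS ha hb (hF i) (hG l) hΦ hΨ h k
  · rw [h1.tsum_prod, h2.tsum_prod]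
    exact tsum_congr fun j => (tsum_productElement hμ hS hb ha (hG l) (hF i) hΦ hΨ h j).symm

end ZF

end

theorem theorem3 (μ : ℝ) (hμ : 0 < μ) (S : ℂ → ℂ) (hS : ZF.IsScatteringFunction S)
    (a b : ZF.Coefficients) (ha : ZF.IsLocalCoefficients S a) (hb : ZF.IsLocalCoefficients S b) :
    -- the products of the terms of the two series are well defined, in both orders
    (∀ f g : ℝ × ℝ → ℂ, ZF.IsTestFunction f → ZF.IsTestFunction g →
      ∀ Φ Ψ : ZF.FockFn, ZF.IsTestVector S Φ → ZF.IsTestVector S Ψ → ∀ j k : ℕ,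
        (∃ z, ZF.HasProductElement μ S a b f g Φ Ψ j k z) ∧
        (∃ z, ZF.HasProductElement μ S b a g f Φ Ψ k j z)) ∧
    -- at spacelike separation, `A(f)` and `B(g)` commute as formal series, without any assumption
    -- on convergence (only finitely many terms of the sums below are nonzero)
    (∀ f g : ℝ × ℝ → ℂ, ZF.IsTestFunction f → ZF.IsTestFunction g →
      ∀ Φ Ψ : ZF.FockFn, ZF.IsTestVector S Φ → ZF.IsTestVector S Ψ →
        (ZF.RightOf f g → ∀ k : ℕ, ∑' j : ℕ, ZF.productElement μ S a b f g Φ Ψ j k =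
          ∑' j : ℕ, ZF.productElement μ S b a g f Φ Ψ k j) ∧
        (ZF.RightOf g f → ∀ j : ℕ, ∑' k : ℕ, ZF.productElement μ S a b f g Φ Ψ j k =
          ∑' k : ℕ, ZF.productElement μ S b a g f Φ Ψ k j)) ∧
    -- if the double series for `A(f) B(g)` and `B(g) A(f)` converge at spacelike separation,
    -- then their sums agree
    ((∀ f g : ℝ × ℝ → ℂ, ZF.IsTestFunction f → ZF.IsTestFunction g → ZF.SpacelikeSeparated f g →
        ∀ Φ Ψ : ZF.FockFn, ZF.IsTestVector S Φ → ZF.IsTestVector S Ψ →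
          Summable (fun q : ℕ × ℕ => ZF.productElement μ S a b f g Φ Ψ q.1 q.2) ∧
          Summable (fun q : ℕ × ℕ => ZF.productElement μ S b a g f Φ Ψ q.2 q.1)) →
      ∀ f g : ℝ × ℝ → ℂ, ZF.IsTestFunction f → ZF.IsTestFunction g → ZF.SpacelikeSeparated f g →
        ∀ Φ Ψ : ZF.FockFn, ZF.IsTestVector S Φ → ZF.IsTestVector S Ψ →
          ∑' q : ℕ × ℕ, ZF.productElement μ S a b f g Φ Ψ q.1 q.2 =
            ∑' q : ℕ × ℕ, ZF.productElement μ S b a g f Φ Ψ q.2 q.1) := by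
  exact ⟨fun f g hf hg Φ Ψ hΦ hΨ j k => ⟨ZF.exists_hasProductElement hμ hS ha hb hf hg hΦ hΨ j k,
      ZF.exists_hasProductElement hμ hS hb ha hg hf hΦ hΨ k j⟩,
    fun f g hf hg Φ Ψ hΦ hΨ => ⟨fun hr k => ZF.tsum_productElement hμ hS ha hb hf hg hΦ hΨ hr k,
      fun hr j => (ZF.tsum_productElement hμ hS hb ha hg hf hΦ hΨ hr j).symm⟩,
    fun hsum f g hf hg hfg Φ Ψ hΦ hΨ => ZF.tsum_tsum_productElement hμ hS ha hb hΦ hΨ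
      (fun f g hf hg hfg => hsum f g hf hg hfg Φ Ψ hΦ hΨ) hf hg hfg⟩
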